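/- **Formulas.** MELL formulas: $A,B ::= X \mid X^\perp \mid \mathbf 1 \mid \bot \mid A\otimes B \mid A ⅋ B \mid {!}A \mid {?}A$ ($X$ in a countably infinite set), with the involutive negation $(\cdot)^\perp$ given by De Morgan duality. **Quasi-proof-structures.** A *module* is a finite directed graph whose vertices (*cells*) are labeled by $\mathtt{ax},\mathtt{cut},\mathbf 1,\bot,\otimes,⅋,?,!,✠$ and whose edges are labeled by formulas; every edge has a source, and edges without target are the *conclusions*. Conclusions are totally ordered, and so are the two inputs of each $\otimes$- or $⅋$-cell. Cells: $\mathtt{ax}$ has no input and two outputs of dual types (not necessarily atomic); $\mathtt{cut}$ has two inputs of dual types and no output; $\mathbf 1$ (resp. $\bot$) has no input and one output of type $\mathbf 1$ (resp. $\bot$); $\otimes$ (resp. $⅋$) has inputs of types $A,B$ and one output of type $A\otimes B$ (resp. $A⅋B$); $?$ (resp. $!$) has any number of inputs, all of one type $A$, and one output of type $?A$ (resp. $!A$); $✠$ has no input and any number of outputs of any types. A *quasi-proof-structure* is a module with a finite forest of rooted trees (the *box-forest*, with edges directed towards the roots) and a graph morphism $\mathsf{box}$ from the module to the reflexive-transitive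 closure of the forest, such that: conclusions are outputs of cells sent to roots; the conclusions over each root are consecutive; an edge from $v'$ to $v$ with $\mathsf{box}(v')\ne\mathsf{box}(v)$ has $v$ of type $!$ or $?$; $\mathsf{box}$ induces a partial bijection from the inputs of $!$-cells to the edges of the forest; every root is the image of at least one cell. Its *type* is the list, root by root, of the lists of types of its conclusions; the part over a root is a *component*. It is a *proof-structure* if it has one root or is empty; $\varepsilon$ is the empty one. It is *MELL* if every $!$-cell has exactly one input, the partial bijection is a total bijection, and each $✠$-cell $v$ satisfies $\mathsf{box}^{-1}(\mathsf{box}(v))=\{v\}$ with $\mathsf{box}(v)$ not a root. It is *DiLL$_0^✠$* if its forest consists of roots only, and *DiLL$_0$* if moreover it has no $✠$-cell. Everything is considered up to isomorphism. **Taylor expansion.** For a quasi-proof-structure $R$ with box-forest $\mathcal F$, a thick subforest of $\mathcal F$ is a finite forest of rooted trees $\tau$ with a graph morphism $h:\tau\to\mathcal F$ that is bijective on roots; $\mathcal T(R)$ is the set of all DiLL$_0^✠$ quasi-proof-structures obtained as the pullback of $\mathsf{box}$ and $h$ (between the reflexive-transitive closures), retaining only the roots of $\tau$. **Elementary paths.**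 They act on lists $\Gamma$ of lists of formulas. In one list of $\Gamma$, the other ones being kept ($\Delta,\Delta'$ arbitrary lists of formulas): $\mathtt{exc}:\ (\Delta,A,B,\Delta')\to(\Delta,B,A,\Delta')$; $\mathtt{mix}:\ (\Delta,A,B,\Delta')\to(\Delta,A\,;\,B,\Delta')$; $\mathtt{cut}:\ (\Delta)\to(\Delta,A,A^\perp)$; $\otimes:\ (\Delta,A\otimes B)\to(\Delta,A,B)$; $⅋:\ (\Delta,A⅋B)\to(\Delta,A,B)$; $\mathsf{contr}:\ (\Delta,?A)\to(\Delta,?A,?A)$; $\mathsf{der}:\ (\Delta,?A)\to(\Delta,A)$; $\mathsf{Box}:\ (?\Delta,!A)\to(?\Delta,A)$; and the steps $\mathtt{ax},\mathbf 1,\bot,\mathsf{weak},✠$ which delete a list of the form $(A,A^\perp)$, $(\mathbf 1)$, $(\bot)$, $(?A)$, $(\Delta,A)$ respectively. A *path* is an arrow of the category freely generated by these. **Action on DiLL$_0^✠$ quasi-proof-structures.** An elementary path $a:\Gamma\to\Gamma'$ relates a DiLL$_0^✠$ quasi-proof-structure $\rho$ of type $\Gamma$ to a set of ones of type $\Gamma'$,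 by acting on the component concerned and keeping the others. Call *daimon component* a component made of one $✠$-cell each of whose outputs is either a conclusion or the only input of a $?$-cell whose output is a conclusion. The set is a singleton, except in the last case of $\mathsf{Box}$. - $\mathtt{exc}$ exchanges two conclusions. - $\mathtt{mix}$ splits a component that is the disjoint union of two, one for each of the two lists of conclusions; it also splits a daimon component into two daimon components, each conclusion keeping its $?$-cell if it has one. - $\mathtt{ax},\mathbf 1,\bot,\mathsf{weak},✠$ delete a component consisting of a single input-free cell, which is either of the type of the step ($?$ for $\mathsf{weak}$) or a $✠$-cell. - $\mathtt{cut}$ deletes a $\mathtt{cut}$-cell, whose inputs become the new conclusions; on a daimon component, it adds two outputs of the $✠$-cell as new conclusions. - $\otimes$ (resp. $⅋$) deletes the $\otimes$-cell (resp. $⅋$-cell) at the last conclusion; in a daimon component, it replaces the last output (a conclusion) by two. - $\mathsf{der}$ deletes the $?$-cell at the last conclusion if it has exactly one input; in a daimon component it replaces the last output $?A$ by $A$. - $\mathsf{contr}$ splits the $?$-cell at the last conclusion, with $h+k$ inputs ($h,k\ge 0$), into two $?$-cells with $h$ and $k$ inputs; in a daimon component, it replaces the last conclusion $?A$ (with or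 without its $?$-cell) by two conclusions $?A$, each being the output of a $?$-cell whose only input, of type $A$, is an output of the $✠$-cell. - $\mathsf{Box}$ replaces the last output $!A$ of a daimon component by $A$; it replaces a component made only of input-free $?$-cells and of one input-free $!$-cell (last conclusion) by one $✠$-cell all of whose outputs are conclusions; if the last conclusion is the output of a $!$-cell with $n>0$ inputs, the others are outputs of $?$-cells, and the remaining cells fall into $n$ parts $\rho_1,\dots,\rho_n$, pairwise not connected, each containing the source of one input of the $!$-cell, then it gives the set of the $n$ quasi-proof-structures whose component consists of $\rho_j$ and the $?$-cells of the conclusions, with only their inputs coming from $\rho_j$, and whose last conclusion is the input of the $!$-cell coming from $\rho_j$. For sets $\Pi,\Pi'$ of DiLL$_0^✠$ quasi-proof-structures of types $\Gamma,\Gamma'$, let $\Pi\to_a\Pi'$ if $\Pi'=\bigcup_{\rho\in\Pi}S_\rho$ for some sets $S_\rho$ with $a$ relating $\rho$ to $S_\rho$; paths act by composition of relations. $\Pi$ is *glueable* if $\Pi\to_\xi\{\varepsilon\}$ for some path $\xi$. **Theorem (glueability criterion with $\eta$).** Let $\Pi$ be a nonempty set of DiLL$_0$ proof-structures, not necessarily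 with atomic axioms. Then $\Pi$ is glueable if and only if $\Pi\subseteq\mathcal T(R)$ for some MELL proof-structure $R$ (not necessarily with atomic axioms). -/

import Mathlib

namespace Glue

/-! ## Formulas -/

/-- MELL formulas over a countably infinite set of propositional variables. -/
inductive Formula : Type
  | var (x : ℕ)
  | nvar (x : ℕ)
  | one
  | bot
  | tensor (A B : Formula)
  | par (A B : Formula)
  | bang (A : Formula)
  | wn (A : Formula)

/-- Linear negation. -/
def Formula.dual : Formula → Formula
  | .var x => .nvar x
  | .nvar x => .var x
  | .one => .bot
  | .bot => .one
  | .tensor A B => .par A.dual B.dual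
  | .par A B => .tensor A.dual B.dual
  | .bang A => .wn A.dual
  | .wn A => .bang A.dual

/-! ## Modules without input tails -/

/-- Types of cells; a `daimon` cell may have any number of outputs. -/
inductive Cell : Type
  | ax | cut | one | bot | tensor | par | wn | bang | daimon

/-- The data of one component of a quasi-proof-structure: a directed graph whose vertices carry a
cell type and whose edges carry a formula. Every edge has a source (there are no input tails); an
edge without target is an output tail. The order on the two inputs of a tensor or par cell is given
by saying which one is the left one (`left` is irrelevant on all other edges), the order on the
output tails by listing them in `concl`. -/
structure Net where
  V : Type
  E : Type
  label : V → Cell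
  ty : E → Formula
  src : E → V
  tgt : E → Option V
  left : E → Prop
  concl : List E

/-- The list of the types of the conclusions. -/
def Net.type (N : Net) : List Formula := N.concl.map N.ty

/-- The edge `e` is the only output of `v`. -/
def Net.IsOut (N : Net) (v : N.V) (e : N.E) : Prop := ∀ g, N.src g = v ↔ g = e

/-- The cell `v` has exactly two inputs, `e` and `f`. -/
def Net.IsPairIn (N : Net) (v : N.V) (e f : N.E) : Prop :=
  e ≠ f ∧ ∀ g, N.tgt g = some v ↔ (g = e ∨ g = f)

def Net.NoIn (N : Net) (v : N.V) : Prop := ∀ g, N.tgt g ≠ some v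

/-- The typing condition on the inputs and outputs of a cell. The outputs of an `ax` cell carry dual
formulas, not necessarily atomic ones. -/
def Net.CellOK (N : Net) (v : N.V) : Prop :=
  match N.label v with
  | .ax => N.NoIn v ∧ ∃ e f, e ≠ f ∧ (∀ g, N.src g = v ↔ (g = e ∨ g = f)) ∧
      N.ty e = (N.ty f).dual
  | .cut => (∀ g, N.src g ≠ v) ∧ ∃ e f, N.IsPairIn v e f ∧ N.ty e = (N.ty f).dual
  | .one => N.NoIn v ∧ ∃ e, N.IsOut v e ∧ N.ty e = .one
  | .bot => N.NoIn v ∧ ∃ e, N.IsOut v e ∧ N.ty e = .bot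
  | .tensor => ∃ e f o, N.IsPairIn v e f ∧ N.left e ∧ ¬ N.left f ∧ N.IsOut v o ∧
      N.ty o = .tensor (N.ty e) (N.ty f)
  | .par => ∃ e f o, N.IsPairIn v e f ∧ N.left e ∧ ¬ N.left f ∧ N.IsOut v o ∧
      N.ty o = .par (N.ty e) (N.ty f)
  | .wn => ∃ o A, N.IsOut v o ∧ N.ty o = .wn A ∧ ∀ g, N.tgt g = some v → N.ty g = A
  | .bang => ∃ o A, N.IsOut v o ∧ N.ty o = .bang A ∧ ∀ g, N.tgt g = some v → N.ty g = A
  | .daimon => N.NoIn v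

/-- Well-formedness: a finite, nonempty graph, listing its output tails without repetition, all of
whose cells obey the typing conditions. -/
structure Net.WF (N : Net) : Prop where
  finite_V : Finite N.V
  finite_E : Finite N.E
  nonempty : Nonempty N.V
  concl_nodup : N.concl.Nodup
  mem_concl : ∀ e, e ∈ N.concl ↔ N.tgt e = none
  cell_ok : ∀ v, N.CellOK v

/-- `Sub N' N KV KE c`: up to isomorphism, `N'` is the subgraph of `N` on the set `KV` of vertices
and the set `KE` of edges, with list of conclusions `c`; an edge of `KE` whose target is not in `KV`
becomes an output tail. -/
def Sub (N' N : Net) (KV : Set N.V) (KE : Set N.E) (c : List N.E) : Prop :=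
  ∃ (p : N'.V → N.V) (q : N'.E → N.E),
    Function.Injective p ∧ Function.Injective q ∧ Set.range p = KV ∧ Set.range q = KE ∧
    (∀ v, N'.label v = N.label (p v)) ∧
    (∀ e, N'.ty e = N.ty (q e)) ∧
    (∀ e, p (N'.src e) = N.src (q e)) ∧
    (∀ e v, N'.tgt e = some v ↔ N.tgt (q e) = some (p v)) ∧
    (∀ e v, N'.tgt e = some v → (N'.label v = .tensor ∨ N'.label v = .par) →
      (N'.left e ↔ N.left (q e))) ∧
    N'.concl.map q = c

/-- Isomorphism of modules with ordered conclusions. -/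
def Iso (N' N : Net) : Prop := Sub N' N Set.univ Set.univ N.concl

/-! ## Quasi-proof-structures

A quasi-proof-structure is presented as the list of its components, one for each root of its
box-forest (the box-function, being a morphism of graphs, cuts the module into these components). -/

/-- A finite rooted tree, with edges directed towards the root. -/
structure RTree where
  Node : Type
  finite : Finite Node
  root : Node
  parent : Node → Option Node
  parent_eq_none : ∀ x, parent x = none ↔ x = root
  reach_root : ∀ x, Relation.ReflTransGen (fun a b => parent a = some b) x root

/-- The edges of the reflexive-transitive closure of a tree. -/
def RTree.Reach (T : RTree) (x y : T.Node) : Prop :=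
  Relation.ReflTransGen (fun a b => T.parent a = some b) x y

/-- A component of a quasi-proof-structure: a module, a box-tree, and a box-function, which is a
morphism from the module to the reflexive-transitive closure of the tree (output tails are sent to
the output tail of the root). An edge of the tree is named by its upper end. -/
structure BoxNet extends Net where
  wf : toNet.WF
  tree : RTree
  box : V → tree.Node
  box_edge : ∀ e v, tgt e = some v → tree.Reach (box (src e)) (box v)
  box_tail : ∀ e, tgt e = none → box (src e) = tree.root
  border : ∀ e v, tgt e = some v → box (src e) ≠ box v → label v = .bang ∨ label v = .wn
  door_inj : ∀ e f v w, tgt e = some v → tgt f = some w → label v = .bang → label w = .bang →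
    tree.parent (box (src e)) = some (box v) → tree.parent (box (src f)) = some (box w) →
    box (src e) = box (src f) → e = f

/-- The component belongs to MELL with daimons: every `bang` cell has exactly one input, and the
box-function induces a (total) bijection from the inputs of the `bang` cells to the edges of the
box-tree. -/
def BoxNet.IsMELLDaimon (R : BoxNet) : Prop :=
  (∀ v, R.label v = .bang → ∃! e, R.tgt e = some v) ∧
  (∀ e v, R.tgt e = some v → R.label v = .bang →
    R.tree.parent (R.box (R.src e)) = some (R.box v)) ∧
  (∀ x, x ≠ R.tree.root → ∃ e v, R.tgt e = some v ∧ R.label v = .bang ∧ R.box (R.src e) = x)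

/-- The component belongs to MELL: moreover each daimon fills alone a box. -/
def BoxNet.IsMELL (R : BoxNet) : Prop :=
  R.IsMELLDaimon ∧ ∀ v, R.label v = .daimon →
    (∀ w, R.box w = R.box v → w = v) ∧ R.box v ≠ R.tree.root

/-- A MELL proof-structure: a MELL quasi-proof-structure which is empty or has one root. -/
def IsMELLProofStructure (R : List BoxNet) : Prop :=
  R.length ≤ 1 ∧ ∀ c ∈ R, c.IsMELL

/-- Quasi-proof-structures whose box-forest consists of roots only: lists of modules. -/
abbrev Poly := List Net

/-- The empty quasi-proof-structure. -/
abbrev emptyPS : Poly := []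

/-- The set of quasi-proof-structures of type `G` in differential linear logic with daimons. -/
def qDiLL (G : List (List Formula)) : Set Poly :=
  {r | (∀ c ∈ r, c.WF) ∧ r.map Net.type = G}

/-- A resource proof-structure: empty or with one root, and without daimons. -/
def IsDiLLProofStructure (r : Poly) : Prop :=
  r.length ≤ 1 ∧ ∀ c ∈ r, c.WF ∧ ∀ v, c.label v ≠ .daimon

/-! ## The Taylor expansion -/

/-- Thick subtrees of `T`: trees with a morphism of graphs to `T` sending the root to the root. -/
structure Thick (T : RTree) where
  tree : RTree
  h : tree.Node → T.Node
  h_root : h tree.root = T.root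
  h_parent : ∀ x y, tree.parent x = some y → T.parent (h x) = some (h y)

/-- The expansion of `R` along a thick subtree: the pullback of the box-function along the morphism
of reflexive-transitive closures. An edge of the closure of the thick subtree is given by its two
ends; a conclusion is paired with the output tail of the root. -/
def BoxNet.expansion (R : BoxNet) (t : Thick R.tree) : Net where
  V := {p : R.V × t.tree.Node // R.box p.1 = t.h p.2}
  E := {p : R.E × t.tree.Node × t.tree.Node //
    R.box (R.src p.1) = t.h p.2.1 ∧ t.tree.Reach p.2.1 p.2.2 ∧
    (R.tgt p.1 = none → p.2.2 = t.tree.root) ∧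
    (∀ v, R.tgt p.1 = some v → R.box v = t.h p.2.2)}
  label p := R.label p.1.1
  ty p := R.ty p.1.1
  src p := ⟨(R.src p.1.1, p.1.2.1), p.2.1⟩
  tgt p := match hp : R.tgt p.1.1 with
    | none => none
    | some v => some ⟨(v, p.1.2.2), p.2.2.2.2 v hp⟩
  left p := R.left p.1.1
  concl := R.concl.pmap
    (fun e he => ⟨(e, t.tree.root, t.tree.root),
      ⟨(R.box_tail e he).trans t.h_root.symm, Relation.ReflTransGen.refl, fun _ => rfl,
        fun v hv => by simp [he] at hv⟩⟩)
    (fun e he => (R.wf.mem_concl e).1 he)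

/-- The Taylor expansion of a quasi-proof-structure, as a set closed under isomorphism: a thick
subforest is a choice of one thick subtree for each root. -/
def Taylor (R : List BoxNet) : Set Poly :=
  {r | List.Forall₂ (fun N c => ∃ t : Thick c.tree, Iso N (c.expansion t)) r R}

/-! ## Paths -/

/-- The elementary steps, as they act on one list of formulas: it is replaced by zero, one or two
lists. -/
inductive LocalPath : List Formula → List (List Formula) → Type
  | exc (D : List Formula) (A B : Formula) (D' : List Formula) :
      LocalPath (D ++ A :: B :: D') [D ++ B :: A :: D']
  | mix (D : List Formula) (A B : Formula) (D' : List Formula) :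
      LocalPath (D ++ A :: B :: D') [D ++ [A], B :: D']
  | ax (A : Formula) : LocalPath [A, A.dual] []
  | cut (D : List Formula) (A : Formula) : LocalPath D [D ++ [A, A.dual]]
  | daimon (D : List Formula) (A : Formula) : LocalPath (D ++ [A]) []
  | one : LocalPath [.one] []
  | bot : LocalPath [.bot] []
  | tensor (D : List Formula) (A B : Formula) : LocalPath (D ++ [.tensor A B]) [D ++ [A, B]]
  | par (D : List Formula) (A B : Formula) : LocalPath (D ++ [.par A B]) [D ++ [A, B]]
  | contr (D : List Formula) (A : Formula) : LocalPath (D ++ [.wn A]) [D ++ [.wn A, .wn A]]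
  | der (D : List Formula) (A : Formula) : LocalPath (D ++ [.wn A]) [D ++ [A]]
  | weak (A : Formula) : LocalPath [.wn A] []
  | box (D : List Formula) (A : Formula) :
      LocalPath (D.map .wn ++ [.bang A]) [D.map .wn ++ [A]]

/-- The elementary paths: a step performed in one of the lists of a list of lists of formulas. -/
inductive ElemPath : List (List Formula) → List (List Formula) → Type
  | ctx {D : List Formula} {X : List (List Formula)} (L M : List (List Formula))
      (a : LocalPath D X) : ElemPath (L ++ [D] ++ M) (L ++ X ++ M)

/-- Paths are the arrows of the category freely generated by the elementary paths. -/
instance : Quiver (List (List Formula)) := ⟨ElemPath⟩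

/-! ## Action of paths on sets of quasi-proof-structures -/

/-- A component which consists of one cell, of type `l`, without inputs. -/
def Net.IsHypothesis (N : Net) (l : Cell) : Prop :=
  (∃ v, N.label v = l ∧ ∀ w, w = v) ∧ ∀ e, N.tgt e = none

/-- A component made of cells of types `wn` and `bang` without inputs (when it has a type of the
form `?A₁, …, ?Aₘ, !A`, it thus has one `wn` cell above each of the first `m` conclusions, and one
`bang` cell above the last one). -/
def Net.IsEmptyBox (N : Net) : Prop :=
  (∀ v, N.label v = .wn ∨ N.label v = .bang) ∧ ∀ e, N.tgt e = none

/-- The result of splitting the `wn` cell with output `e`: a new `wn` cell, with a new conclusion,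
takes the inputs in `S`; the old cell keeps the other ones. -/
noncomputable def Net.split (N : Net) (e : N.E) (S : Set N.E) : Net where
  V := Option N.V
  E := Option N.E
  label v := v.elim .wn N.label
  ty f := f.elim (N.ty e) N.ty
  src f := f.map N.src
  tgt f := f.elim none fun g =>
    open Classical in if g ∈ S then some none else (N.tgt g).map some
  left f := f.elim False N.left
  concl := N.concl.map some ++ [none]

/-- An output of a daimon, of type `top`, which is either a conclusion (`viaWn = false`), or the only
input of a `wn` cell whose output is a conclusion (`viaWn = true`). -/
structure DaimonOut where
  top : Formula
  viaWn : Bool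

/-- The type of the corresponding conclusion. -/
def DaimonOut.type (x : DaimonOut) : Formula := if x.viaWn then .wn x.top else x.top

/-- The component made of a daimon with the prescribed outputs, and of the `wn` cells below it. -/
def daimonNet (l : List DaimonOut) : Net where
  V := Option {i : Fin l.length // l[i].viaWn = true}
  E := Fin l.length ⊕ {i : Fin l.length // l[i].viaWn = true}
  label v := v.elim .daimon fun _ => .wn
  ty := Sum.elim (fun i => l[i].top) (fun i => .wn l[i.1].top)
  src := Sum.elim (fun _ => none) some
  tgt := Sum.elim (fun i => if h : l[i].viaWn = true then some (some ⟨i, h⟩) else none)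
    (fun _ => none)
  left _ := False
  concl := (List.finRange l.length).map fun i =>
    if h : l[i].viaWn = true then Sum.inr ⟨i, h⟩ else Sum.inl i

/-- A cell which has no conclusion among its outputs. -/
def Net.Inner (N : Net) (v : N.V) : Prop := ∀ c ∈ N.concl, N.src c ≠ v

/-- `LocalAct a N T`: the step `a` rewrites the component `N` to the set `T`, each element of which
is a list of components put in the place of `N`. The names ending in `D` are the rules for components
that are filled by a daimon. -/
inductive LocalAct : {D : List Formula} → {X : List (List Formula)} → LocalPath D X →
    Net → Set Poly → Prop
  | exc {D A B D'} {N N' : Net} (C : List N.E) (e f : N.E) (C' : List N.E)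
      (hc : N.concl = C ++ e :: f :: C') (hC : C.length = D.length)
      (h : Sub N' N Set.univ Set.univ (C ++ f :: e :: C')) :
      LocalAct (.exc D A B D') N {[N']}
  | mix {D A B D'} {N N₁ N₂ : Net} (S : Set N.V) (C₁ C₂ : List N.E)
      (hS : ∀ e v, N.tgt e = some v → (N.src e ∈ S ↔ v ∈ S))
      (hc : N.concl = C₁ ++ C₂) (h1 : ∀ e ∈ C₁, N.src e ∈ S) (h2 : ∀ e ∈ C₂, N.src e ∉ S)
      (hN1 : Sub N₁ N S {e | N.src e ∈ S} C₁) (hN2 : Sub N₂ N Sᶜ {e | N.src e ∉ S} C₂) :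
      LocalAct (.mix D A B D') N {[N₁, N₂]}
  | mixD {D A B D'} {N N₁ N₂ : Net} (l₁ l₂ : List DaimonOut) (h : Iso N (daimonNet (l₁ ++ l₂)))
      (h1 : Iso N₁ (daimonNet l₁)) (h2 : Iso N₂ (daimonNet l₂)) :
      LocalAct (.mix D A B D') N {[N₁, N₂]}
  | ax {A} {N : Net} (h : N.IsHypothesis .ax ∨ N.IsHypothesis .daimon) :
      LocalAct (.ax A) N {[]}
  | one {N : Net} (h : N.IsHypothesis .one ∨ N.IsHypothesis .daimon) : LocalAct .one N {[]}
  | bot {N : Net} (h : N.IsHypothesis .bot ∨ N.IsHypothesis .daimon) : LocalAct .bot N {[]}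
  | weak {A} {N : Net} (h : N.IsHypothesis .wn ∨ N.IsHypothesis .daimon) :
      LocalAct (.weak A) N {[]}
  | daimon {D A} {N : Net} (h : N.IsHypothesis .daimon) : LocalAct (.daimon D A) N {[]}
  | cut {D A} {N N' : Net} (v : N.V) (e f : N.E) (hv : N.label v = .cut) (hi : N.IsPairIn v e f)
      (h : Sub N' N {v}ᶜ Set.univ (N.concl ++ [e, f])) :
      LocalAct (.cut D A) N {[N']}
  | cutD {D A} {N N' : Net} (l : List DaimonOut) (h : Iso N (daimonNet l))
      (h' : Iso N' (daimonNet (l ++ [⟨A, false⟩, ⟨A.dual, false⟩]))) :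
      LocalAct (.cut D A) N {[N']}
  | tensor {D A B} {N N' : Net} (C : List N.E) (o e f : N.E) (hc : N.concl = C ++ [o])
      (hv : N.label (N.src o) = .tensor) (hi : N.IsPairIn (N.src o) e f) (he : N.left e)
      (h : Sub N' N {N.src o}ᶜ {o}ᶜ (C ++ [e, f])) :
      LocalAct (.tensor D A B) N {[N']}
  | tensorD {D A B} {N N' : Net} (l : List DaimonOut)
      (h : Iso N (daimonNet (l ++ [⟨.tensor A B, false⟩])))
      (h' : Iso N' (daimonNet (l ++ [⟨A, false⟩, ⟨B, false⟩]))) :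
      LocalAct (.tensor D A B) N {[N']}
  | par {D A B} {N N' : Net} (C : List N.E) (o e f : N.E) (hc : N.concl = C ++ [o])
      (hv : N.label (N.src o) = .par) (hi : N.IsPairIn (N.src o) e f) (he : N.left e)
      (h : Sub N' N {N.src o}ᶜ {o}ᶜ (C ++ [e, f])) :
      LocalAct (.par D A B) N {[N']}
  | parD {D A B} {N N' : Net} (l : List DaimonOut)
      (h : Iso N (daimonNet (l ++ [⟨.par A B, false⟩])))
      (h' : Iso N' (daimonNet (l ++ [⟨A, false⟩, ⟨B, false⟩]))) :
      LocalAct (.par D A B) N {[N']}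
  | contr {D A} {N N' : Net} (C : List N.E) (o : N.E) (S : Set N.E) (hc : N.concl = C ++ [o])
      (hv : N.label (N.src o) = .wn) (hS : ∀ e ∈ S, N.tgt e = some (N.src o))
      (h : Iso N' (N.split o S)) :
      LocalAct (.contr D A) N {[N']}
  | contrD {D A} {N N' : Net} (l : List DaimonOut) (x : DaimonOut) (hx : x.type = .wn A)
      (h : Iso N (daimonNet (l ++ [x])))
      (h' : Iso N' (daimonNet (l ++ [⟨A, true⟩, ⟨A, true⟩]))) :
      LocalAct (.contr D A) N {[N']}
  | der {D A} {N N' : Net} (C : List N.E) (o e : N.E) (hc : N.concl = C ++ [o])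
      (hv : N.label (N.src o) = .wn) (hi : ∀ g, N.tgt g = some (N.src o) ↔ g = e)
      (h : Sub N' N {N.src o}ᶜ {o}ᶜ (C ++ [e])) :
      LocalAct (.der D A) N {[N']}
  | derD {D A} {N N' : Net} (l : List DaimonOut) (h : Iso N (daimonNet (l ++ [⟨.wn A, false⟩])))
      (h' : Iso N' (daimonNet (l ++ [⟨A, false⟩]))) :
      LocalAct (.der D A) N {[N']}
  | boxD {D A} {N N' : Net} (l : List DaimonOut) (h : Iso N (daimonNet (l ++ [⟨.bang A, false⟩])))
      (h' : Iso N' (daimonNet (l ++ [⟨A, false⟩]))) :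
      LocalAct (.box D A) N {[N']}
  | boxEmpty {D A} {N N' : Net} (h : N.IsEmptyBox) (h' : N'.IsHypothesis .daimon) :
      LocalAct (.box D A) N {[N']}
  /-- The nonempty box: apart from the `bang` cell of the last conclusion and the `wn` cells of the
  other ones, the cells fall into `n` parts, not connected with each other, each of which contains
  the source of one input `f j` of the `bang` cell. The `j`-th result consists of the `j`-th part,
  of one copy of the `wn` cells, and has `f j` as its last conclusion. -/
  | box {D A} {N : Net} {n : ℕ} (hn : 0 < n) (N' : Fin n → Net) (C : List N.E) (o : N.E)
      (f : Fin n → N.E) (k : N.V → Fin n) (hc : N.concl = C ++ [o])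
      (hv : N.label (N.src o) = .bang) (hC : ∀ c ∈ C, N.label (N.src c) = .wn)
      (hf : ∀ g, N.tgt g = some (N.src o) ↔ ∃ j, g = f j) (hfk : ∀ j, k (N.src (f j)) = j)
      (hk : ∀ e v, N.tgt e = some v → N.Inner v → k (N.src e) = k v)
      (h : ∀ j, Sub (N' j) N
        ({v | N.Inner v ∧ k v = j} ∪ {v | ∃ c ∈ C, N.src c = v})
        ({e | N.Inner (N.src e) ∧ k (N.src e) = j} ∪ {e | e ∈ C})
        (C ++ [f j])) :
      LocalAct (.box D A) N (Set.range fun j => [N' j])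

/-- The action of an elementary path on one quasi-proof-structure: the step acts on the component in
the prescribed position, the other components are kept. -/
inductive ElemAct : {G G' : List (List Formula)} → ElemPath G G' → Poly → Set Poly → Prop
  | ctx {D : List Formula} {X : List (List Formula)} {a : LocalPath D X}
      {L M : List (List Formula)} {l m : Poly} {N : Net} {T : Set Poly}
      (hl : l.map Net.type = L) (hm : m.map Net.type = M) (h : LocalAct a N T) :
      ElemAct (.ctx L M a) (l ++ [N] ++ m) ((fun c => l ++ c ++ m) '' T)

/-- The action of an elementary path on sets of quasi-proof-structures. -/
def SetAct {G G' : List (List Formula)} (a : ElemPath G G') (P P' : Set Poly) : Prop :=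
  P ⊆ qDiLL G ∧ P' ⊆ qDiLL G' ∧
    ∃ F : Poly → Set Poly, (∀ r ∈ P, ElemAct a r (F r)) ∧ P' = ⋃ r ∈ P, F r

/-- The action of a path, by composition of relations. -/
def PathAct {G : List (List Formula)} : {G' : List (List Formula)} → Quiver.Path G G' →
    Set Poly → Set Poly → Prop
  | _, .nil, P, P' => P ⊆ qDiLL G ∧ P' = P
  | _, .cons p a, P, P' => ∃ Q, PathAct p P Q ∧ SetAct a Q P'

/-- A set of quasi-proof-structures is glueable if some path rewrites it to the singleton of the
empty quasi-proof-structure. -/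
def Glueable (P : Set Poly) : Prop :=
  ∃ (G : List (List Formula)) (p : Quiver.Path G []), PathAct p P {emptyPS}

end Glue

namespace Glue

/-! Both directions rest on `Exp N R`, which presents a net `N` as an expansion of a structure `R`
by explicit maps on cells and edges. In a thick subtree the root has a single copy, so a cell of the
root of `R` has exactly one copy in `N`. A step that only touches the root therefore commutes with
expansion, whether it is read forwards or backwards.

Suppose that `P` is glueable. The structure `R` is obtained by reading the path from its end. Every
step is inverted on structures: deletion of a cell becomes addition of a cell at the root, `mix`
becomes gluing at the roots, `contr` becomes the merging of two `wn` cells, and `box` becomes the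
closing of a box. The structure so built depends on the step and on the structures that follow it,
never on the net being rewritten (`exists_inverts`), and this is why a single `R` serves the whole
set.

Daimons are handled by claiming nothing about them. The invariant `ExpandsTo` concerns daimon-free
components only, and a position that no such component can occupy holds `none`. A daimon-free
component turns into one with a daimon in one case only, that of an empty box. An empty box is an
expansion, with zero copies, of any box of the right type whose auxiliary conclusions are outputs of
`wn` cells. If nothing better is known, a box filled by a daimon will do (`BoxNet.exists_box`). This
is where daimons enter `R`.

Suppose conversely that `P` is contained in the expansion of `R`. The path dismantles `R` from its
root, applying the same step to all members of the set. The members met on the way are of two sorts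
(`BoxNet.Admits`): daimon-free expansions of the current structure, and components filled by a
daimon, which come from boxes taken zero times. A daimon follows every step dictated by `R`,
provided that it is a bare cell at the moment when `R` is a single cell to be deleted. The flags of
`DaimonForm` ensure this: a daimon may reach a conclusion through a `wn` cell only where the
structure has a `wn` cell with inputs, and such a cell is never the one deleted by `weak`.

`Good` is phrased with a continuation: a strategy for the remaining components extends to one with
this component in front. So a structure that `mix` has split is treated one part after the other.
The strategy itself is an induction on `BoxNet.size` (`BoxNet.Inv.isGood`). As long as an edge of
the root is not a conclusion, some cut, tensor, par or `wn` cell of the root can be removed or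
contracted. Otherwise the structure is saturated: isolated cells are separated and deleted, `wn`
cells with several inputs are split, and the structure is cut into pieces until one box is left.
Opening it turns each expansion into the set of its copies, which are expansions of the content of
the box, or into a daimon if there is no copy. If a daimon lies directly in the box, a daimon-free
member has no copy of it, so every member becomes a daimon and `goodForm` concludes.

Axioms need not be atomic for any of this: the `ax` step deletes an axiom of any type, on both
sides, and no axiom is ever expanded. -/

theorem Formula.dual_dual (A : Formula) : A.dual.dual = A := by
  induction A <;> simp_all [Formula.dual]

/-! ## Rooted trees -/

namespace RTree

theorem parent_root (T : RTree) : T.parent T.root = none := (T.parent_eq_none _).2 rfl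

theorem reach_refl (T : RTree) (x : T.Node) : T.Reach x x := Relation.ReflTransGen.refl

theorem Reach.trans {T : RTree} {x y z : T.Node} (h : T.Reach x y) (h' : T.Reach y z) :
    T.Reach x z := Relation.ReflTransGen.trans h h'

/-- Iterating `parent` from a node yields `none` after finitely many steps, one more than the
distance to the root. The least such number, minus one, is the depth. All uniqueness arguments on
trees below are comparisons of depths. -/
theorem exists_depth (T : RTree) : ∃ d : T.Node → ℕ, d T.root = 0 ∧
    ∀ x y, T.parent x = some y → d x = d y + 1 := by
  have key : ∀ x, ∃ n : ℕ, (fun z : Option T.Node => z.bind T.parent)^[n] (some x) = none := by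
    intro x
    have := T.reach_root x
    induction this using Relation.ReflTransGen.head_induction_on with
    | refl => exact ⟨1, by simp [T.parent_root]⟩
    | head h _ ih =>
      obtain ⟨n, hn⟩ := ih
      exact ⟨n + 1, by simpa [Function.iterate_succ_apply, h] using hn⟩
  classical
  refine ⟨fun x => Nat.find (key x) - 1, ?_, ?_⟩
  · have h0 : Nat.find (key T.root) ≤ 1 := Nat.find_min' _ (by simp [T.parent_root])
    exact Nat.sub_eq_zero_of_le h0
  · intro x y hxy
    have hy : Nat.find (key y) ≠ 0 := fun h => by
      have := Nat.find_spec (key y); rw [h] at this; simp at this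
    have hx : Nat.find (key x) = Nat.find (key y) + 1 := by
      rw [Nat.find_eq_iff]
      refine ⟨?_, ?_⟩
      · have := Nat.find_spec (key y)
        simpa [Function.iterate_succ_apply, hxy] using this
      · intro n hn
        cases n with
        | zero => simp
        | succ n =>
          have := Nat.find_min (key y) (show n < _ by omega)
          simpa [Function.iterate_succ_apply, hxy] using this
    simp only []
    omega

/-- The distance of a node to the root. -/
noncomputable def depth (T : RTree) : T.Node → ℕ := T.exists_depth.choose

theorem depth_root (T : RTree) : T.depth T.root = 0 := T.exists_depth.choose_spec.1

theorem depth_parent {T : RTree} {x y : T.Node} (h : T.parent x = some y) :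
    T.depth x = T.depth y + 1 := T.exists_depth.choose_spec.2 x y h

theorem exists_parent {T : RTree} {x : T.Node} (h : x ≠ T.root) : ∃ y, T.parent x = some y :=
  Option.ne_none_iff_exists'.1 fun hn => h ((T.parent_eq_none x).1 hn)

theorem depth_eq_zero {T : RTree} {x : T.Node} : T.depth x = 0 ↔ x = T.root := by
  refine ⟨fun h => ?_, fun h => h ▸ T.depth_root⟩
  by_contra hx
  obtain ⟨y, hy⟩ := exists_parent hx
  have := depth_parent hy
  omega

theorem Reach.depth_le {T : RTree} {x y : T.Node} (h : T.Reach x y) : T.depth y ≤ T.depth x := by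
  induction h with
  | refl => exact le_rfl
  | tail _ h ih => have := depth_parent h; omega

theorem Reach.total {T : RTree} {x y z : T.Node} (h : T.Reach x y) (h' : T.Reach x z) :
    T.Reach y z ∨ T.Reach z y :=
  Relation.ReflTransGen.total_of_right_unique
    (fun a b c (h : _ = _) (h' : _ = _) => by rw [h] at h'; exact Option.some.inj h') h h'

theorem Reach.eq_of_depth {T : RTree} {x y : T.Node} (h : T.Reach x y)
    (hd : T.depth x ≤ T.depth y) : x = y := by
  rcases Relation.ReflTransGen.cases_head h with h | ⟨z, hz, hzy⟩
  · exact h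
  · have h1 := depth_parent hz
    have h2 := Reach.depth_le hzy
    omega

/-- The nodes below `x` form a chain on which the depth is injective. In a thick subtree this
singles out the copy of a box in which a given cell lies. -/
theorem Reach.unique {T : RTree} {x y z : T.Node} (h : T.Reach x y) (h' : T.Reach x z)
    (hd : T.depth y = T.depth z) : y = z := by
  rcases h.total h' with h | h
  · exact h.eq_of_depth hd.le
  · exact (h.eq_of_depth hd.ge).symm

theorem Reach.antisymm {T : RTree} {x y : T.Node} (h : T.Reach x y) (h' : T.Reach y x) : x = y :=
  h.eq_of_depth h'.depth_le

theorem reach_root_iff {T : RTree} {x : T.Node} : T.Reach T.root x ↔ x = T.root :=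
  ⟨fun h => (h.antisymm (T.reach_root x)).symm, fun h => h ▸ T.reach_refl _⟩

theorem Reach.of_parent {T : RTree} {x y : T.Node} (h : T.parent x = some y) : T.Reach x y :=
  Relation.ReflTransGen.single h

theorem Reach.cases_parent {T : RTree} {x y : T.Node} (h : T.Reach x y) :
    x = y ∨ ∃ z, T.parent x = some z ∧ T.Reach z y :=
  Relation.ReflTransGen.cases_head h

/-- A node other than the root is above a child of the root. -/
theorem exists_child {T : RTree} {x : T.Node} (h : x ≠ T.root) :
    ∃ y, T.Reach x y ∧ T.parent y = some T.root := by
  rcases Relation.ReflTransGen.cases_tail (T.reach_root x) with h' | ⟨y, h1, h2⟩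
  · exact absurd h'.symm h
  · exact ⟨y, h1, h2⟩

/-- The subtree above the node `b`. -/
noncomputable def sub (T : RTree) (b : T.Node) : RTree where
  Node := {x // T.Reach x b}
  finite := by have := T.finite; infer_instance
  root := ⟨b, T.reach_refl b⟩
  parent x := open Classical in
    if h : x.1 = b then none else
      some ⟨(x.2.cases_parent.resolve_left h).choose,
        (x.2.cases_parent.resolve_left h).choose_spec.2⟩
  parent_eq_none x := by
    by_cases h : x.1 = b <;> simp [h, Subtype.ext_iff]
  reach_root x := by
    obtain ⟨x, hx⟩ := x
    induction hx using Relation.ReflTransGen.head_induction_on with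
    | refl => exact Relation.ReflTransGen.refl
    | @head x y h h' ih =>
      by_cases hb : x = b
      · subst hb; exact Relation.ReflTransGen.refl
      · refine Relation.ReflTransGen.head ?_ ih
        have hc := (Reach.cases_parent (Relation.ReflTransGen.head h h')).resolve_left hb
        have h2 := hc.choose_spec.1
        simp only [hb, dite_false, Option.some.injEq]
        exact Subtype.ext (Option.some.inj (h2.symm.trans h))

theorem sub_parent {T : RTree} {b : T.Node} (x y : (T.sub b).Node) :
    (T.sub b).parent x = some y ↔ x.1 ≠ b ∧ T.parent x.1 = some y.1 := by
  by_cases h : x.1 = b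
  · simp [sub, h]
  · have h2 := (x.2.cases_parent.resolve_left h).choose_spec.1
    simp only [sub, h, dite_false, ne_eq, not_false_eq_true, true_and]
    refine ⟨fun h' => ?_, fun h' => ?_⟩
    · exact h2.trans (congrArg some (congrArg Subtype.val (Option.some.inj h')))
    · exact congrArg some (Subtype.ext (Option.some.inj (h2.symm.trans h')))

theorem sub_reach {T : RTree} {b : T.Node} (x y : (T.sub b).Node) :
    (T.sub b).Reach x y ↔ T.Reach x.1 y.1 := by
  refine ⟨fun h => ?_, fun h => ?_⟩
  · induction h with
    | refl => exact T.reach_refl _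
    | tail _ h ih => exact ih.trans (Reach.of_parent ((sub_parent _ _).1 h).2)
  · obtain ⟨x, hx⟩ := x
    change T.Reach x y.1 at h
    induction h using Relation.ReflTransGen.head_induction_on with
    | refl => exact Relation.ReflTransGen.refl
    | @head x z h h' ih =>
      have hz : T.Reach z b := Reach.trans h' y.2
      refine Reach.trans (Reach.of_parent (T := T.sub b) (y := ⟨z, hz⟩) ((sub_parent _ _).2 ⟨?_, h⟩)) (ih hz)
      intro hx'
      have h1 := depth_parent h
      have h2 := hz.depth_le
      rw [show x = b from hx'] at h1
      omega

/-- The tree with one node. -/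
def single : RTree where
  Node := Unit
  finite := inferInstance
  root := ()
  parent _ := none
  parent_eq_none x := by simp
  reach_root x := Relation.ReflTransGen.refl

/-- The tree obtained by gluing two trees at their roots. -/
noncomputable def wedge (T U : RTree) : RTree where
  -- Pairs with one coordinate at the root identify the two roots without a quotient.
  Node := {x : T.Node × U.Node // x.1 = T.root ∨ x.2 = U.root}
  finite := by have := T.finite; have := U.finite; infer_instance
  root := ⟨(T.root, U.root), Or.inl rfl⟩
  parent x := match T.parent x.1.1, U.parent x.1.2 with
    | some y, _ => some ⟨(y, U.root), Or.inr rfl⟩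
    | none, some y => some ⟨(T.root, y), Or.inl rfl⟩
    | none, none => none
  parent_eq_none := by
    rintro ⟨⟨x, y⟩, h⟩
    rw [Subtype.ext_iff, Prod.ext_iff]
    simp only
    rw [← T.parent_eq_none, ← U.parent_eq_none]
    cases T.parent x <;> cases U.parent y <;> simp
  reach_root := by
    have h1 : ∀ x : T.Node, Relation.ReflTransGen (fun a b : {x : T.Node × U.Node //
        x.1 = T.root ∨ x.2 = U.root} => (match T.parent a.1.1, U.parent a.1.2 with
          | some y, _ => some (⟨(y, U.root), Or.inr rfl⟩ : {x : T.Node × U.Node //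
            x.1 = T.root ∨ x.2 = U.root})
          | none, some y => some ⟨(T.root, y), Or.inl rfl⟩
          | none, none => none) = some b)
        ⟨(x, U.root), Or.inr rfl⟩ ⟨(T.root, U.root), Or.inl rfl⟩ := by
      intro x
      have := T.reach_root x
      induction this using Relation.ReflTransGen.head_induction_on with
      | refl => exact Relation.ReflTransGen.refl
      | head h _ ih => exact Relation.ReflTransGen.head (by simp [h]) ih
    have h2 : ∀ x : U.Node, Relation.ReflTransGen (fun a b : {x : T.Node × U.Node //
        x.1 = T.root ∨ x.2 = U.root} => (match T.parent a.1.1, U.parent a.1.2 with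
          | some y, _ => some (⟨(y, U.root), Or.inr rfl⟩ : {x : T.Node × U.Node //
            x.1 = T.root ∨ x.2 = U.root})
          | none, some y => some ⟨(T.root, y), Or.inl rfl⟩
          | none, none => none) = some b)
        ⟨(T.root, x), Or.inl rfl⟩ ⟨(T.root, U.root), Or.inl rfl⟩ := by
      intro x
      have := U.reach_root x
      induction this using Relation.ReflTransGen.head_induction_on with
      | refl => exact Relation.ReflTransGen.refl
      | head h _ ih => exact Relation.ReflTransGen.head (by simp [h, T.parent_root]) ih
    rintro ⟨⟨x, y⟩, h | h⟩
    · simp only at h; subst h; exact h2 y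
    · simp only at h; subst h; exact h1 x

/-- The inclusion of the first tree into the tree glued from two. -/
def inl {T U : RTree} (x : T.Node) : (T.wedge U).Node := ⟨(x, U.root), Or.inr rfl⟩

/-- The inclusion of the second tree into the tree glued from two. -/
def inr {T U : RTree} (x : U.Node) : (T.wedge U).Node := ⟨(T.root, x), Or.inl rfl⟩

theorem inl_inj {T U : RTree} {x y : T.Node} : (inl x : (T.wedge U).Node) = inl y ↔ x = y := by
  exact Subtype.ext_iff.trans (by simp [inl])

theorem inr_inj {T U : RTree} {x y : U.Node} : (inr x : (T.wedge U).Node) = inr y ↔ x = y := by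
  exact Subtype.ext_iff.trans (by simp [inr])

theorem inl_eq_inr {T U : RTree} {x : T.Node} {y : U.Node} :
    (inl x : (T.wedge U).Node) = inr y ↔ x = T.root ∧ y = U.root := by
  exact Subtype.ext_iff.trans (by simp [inl, inr, eq_comm])

theorem wedge_cases {T U : RTree} (x : (T.wedge U).Node) : (∃ y, x = inl y) ∨ ∃ y, x = inr y := by
  obtain ⟨⟨x, y⟩, h | h⟩ := x
  · simp only at h; subst h; exact Or.inr ⟨y, rfl⟩
  · simp only at h; subst h; exact Or.inl ⟨x, rfl⟩

theorem parent_inl {T U : RTree} (x : T.Node) :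
    (T.wedge U).parent (inl x) = (T.parent x).map inl := by
  rw [show (T.wedge U).parent (inl x) = (match T.parent x, U.parent U.root with
    | some y, _ => some ⟨(y, U.root), Or.inr rfl⟩
    | none, some y => some ⟨(T.root, y), Or.inl rfl⟩
    | none, none => none) from rfl, U.parent_root]
  cases T.parent x <;> rfl

theorem parent_inr {T U : RTree} (x : U.Node) :
    (T.wedge U).parent (inr x) = (U.parent x).map inr := by
  rw [show (T.wedge U).parent (inr x) = (match T.parent T.root, U.parent x with
    | some y, _ => some ⟨(y, U.root), Or.inr rfl⟩
    | none, some y => some ⟨(T.root, y), Or.inl rfl⟩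
    | none, none => none) from rfl, T.parent_root]
  cases U.parent x <;> rfl

theorem reach_inl {T U : RTree} {x y : T.Node} (h : T.Reach x y) :
    (T.wedge U).Reach (inl x) (inl y) := by
  induction h with
  | refl => exact reach_refl _ _
  | tail _ h ih => exact ih.trans (Reach.of_parent (by rw [parent_inl, h]; rfl))

theorem reach_inr {T U : RTree} {x y : U.Node} (h : U.Reach x y) :
    (T.wedge U).Reach (inr x) (inr y) := by
  induction h with
  | refl => exact reach_refl _ _
  | tail _ h ih => exact ih.trans (Reach.of_parent (by rw [parent_inr, h]; rfl))

/-- The tree with a new root, below the roots of a finite family of trees. -/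
def graft {ι : Type} [Finite ι] (T : ι → RTree) : RTree where
  Node := Option (Σ i, (T i).Node)
  finite := by have := fun i => (T i).finite; infer_instance
  root := none
  parent x := x.bind fun y => some (((T y.1).parent y.2).map fun z => ⟨y.1, z⟩)
  parent_eq_none x := by cases x <;> simp
  reach_root x := by
    rcases x with _ | ⟨i, x⟩
    · exact Relation.ReflTransGen.refl
    · have := (T i).reach_root x
      induction this using Relation.ReflTransGen.head_induction_on with
      | refl => exact Relation.ReflTransGen.single (by simp [(T i).parent_root])
      | head h _ ih => exact Relation.ReflTransGen.head (by simp [h]) ih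

theorem graft_parent {ι : Type} [Finite ι] (T : ι → RTree) (i : ι) (x : (T i).Node) :
    (graft T).parent (some ⟨i, x⟩) = some (((T i).parent x).map fun z => ⟨i, z⟩) := rfl

theorem graft_parent_some {ι : Type} [Finite ι] (T : ι → RTree) (i : ι) (x y : (T i).Node) :
    (graft T).parent (some ⟨i, x⟩) = some (some ⟨i, y⟩) ↔ (T i).parent x = some y := by
  cases h : (T i).parent x <;> simp [graft, h]

theorem graft_parent_none {ι : Type} [Finite ι] (T : ι → RTree) (i : ι) (x : (T i).Node) :
    (graft T).parent (some ⟨i, x⟩) = some none ↔ x = (T i).root := by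
  rw [← (T i).parent_eq_none]
  cases h : (T i).parent x <;> simp [graft, h]

theorem graft_reach {ι : Type} [Finite ι] (T : ι → RTree) (i : ι) {x y : (T i).Node}
    (h : (T i).Reach x y) : (graft T).Reach (some ⟨i, x⟩) (some ⟨i, y⟩) := by
  induction h with
  | refl => exact reach_refl _ _
  | tail _ h ih => exact ih.trans (Reach.of_parent ((graft_parent_some _ _ _ _).2 h))

end RTree

/-! ## Thick subtrees -/

namespace Thick

variable {T : RTree} (t : Thick T)

/-- A morphism preserves parents and sends the root to the root, so it cannot shorten the way down.
As a consequence the root has one preimage, and `h` is injective on the nodes below a given one. -/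
theorem depth_h (x : t.tree.Node) : T.depth (t.h x) = t.tree.depth x := by
  have := t.tree.reach_root x
  induction this using Relation.ReflTransGen.head_induction_on with
  | refl => rw [t.h_root, T.depth_root, t.tree.depth_root]
  | head h _ ih => rw [RTree.depth_parent h, RTree.depth_parent (t.h_parent _ _ h), ih]

theorem h_eq_root {x : t.tree.Node} : t.h x = T.root ↔ x = t.tree.root := by
  rw [← RTree.depth_eq_zero, depth_h, RTree.depth_eq_zero]

theorem reach_h {x y : t.tree.Node} (h : t.tree.Reach x y) : T.Reach (t.h x) (t.h y) := by
  induction h with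
  | refl => exact T.reach_refl _
  | tail _ h ih => exact ih.trans (RTree.Reach.of_parent (t.h_parent _ _ h))

/-- Descents in `T` lift along `h`, one parent at a time. With `reach_unique` this says that the
copy of the source of an edge determines the copy of its target. -/
theorem exists_reach (x : t.tree.Node) {z : T.Node} (h : T.Reach (t.h x) z) :
    ∃ y, t.tree.Reach x y ∧ t.h y = z := by
  have := t.tree.reach_root x
  induction this using Relation.ReflTransGen.head_induction_on with
  | refl =>
    rw [t.h_root] at h
    exact ⟨_, t.tree.reach_refl _, by rw [t.h_root, RTree.reach_root_iff.1 h]⟩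
  | @head x y hxy _ ih =>
    rcases h.cases_parent with h' | ⟨w, hw, hwz⟩
    · exact ⟨x, t.tree.reach_refl _, h'⟩
    · rw [t.h_parent _ _ hxy] at hw
      obtain rfl := Option.some.inj hw
      obtain ⟨u, hu, rfl⟩ := ih hwz
      exact ⟨u, (RTree.Reach.of_parent hxy).trans hu, rfl⟩

theorem reach_unique {x y z : t.tree.Node} (h : t.tree.Reach x y) (h' : t.tree.Reach x z)
    (he : t.h y = t.h z) : y = z :=
  h.unique h' (by rw [← t.depth_h, he, t.depth_h])

theorem parent_of_h {x y : t.tree.Node} (h : t.tree.Reach x y)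
    (hp : T.parent (t.h x) = some (t.h y)) : t.tree.parent x = some y := by
  rcases h.cases_parent with rfl | ⟨z, hz, hzy⟩
  · have := RTree.depth_parent hp; omega
  · have h1 := RTree.depth_parent hp
    have h2 := RTree.depth_parent hz
    rw [t.depth_h, t.depth_h] at h1
    rw [hz, hzy.eq_of_depth (by omega)]

end Thick

/-! ## Transfer of the typing conditions -/

namespace Net

theorem IsOut.ex {N : Net} {v : N.V} {e : N.E} (h : N.IsOut v e) : N.src e = v := (h e).2 rfl

/-- If `r` relates bijectively the outputs and the inputs of two cells with the same label, then the
typing condition passes from the second one to the first one. -/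
theorem CellOK.transfer {N M : Net} {v : N.V} {w : M.V} (r : N.E → M.E → Prop)
    (hl : N.label v = M.label w) (hr : ∀ g k k', r g k → r g k' → k = k')
    (hty : ∀ g g', r g g' → N.ty g = M.ty g')
    (hout : ∀ g, N.src g = v → ∃ g', r g g' ∧ M.src g' = w)
    (hout' : ∀ g', M.src g' = w → ∃! g, r g g' ∧ N.src g = v)
    (hin : ∀ g, N.tgt g = some v → ∃ g', r g g' ∧ M.tgt g' = some w)
    -- Nothing is asked about the number of inputs of a `wn` or `bang` cell: expansion, splitting
    -- and merging change it, and typing does not depend on it.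
    (hin' : M.label w ≠ .wn → M.label w ≠ .bang →
      ∀ g', M.tgt g' = some w → ∃! g, r g g' ∧ N.tgt g = some v)
    (hleft : ∀ g g', r g g' → N.tgt g = some v → (N.label v = .tensor ∨ N.label v = .par) →
      (N.left g ↔ M.left g'))
    (h : M.CellOK w) : N.CellOK v := by
  have noin : M.NoIn w → N.NoIn v := fun h g hg => by
    obtain ⟨g', _, h'⟩ := hin g hg
    exact h g' h'
  have isOut : ∀ {o}, M.IsOut w o → ∃ o', N.IsOut v o' ∧ N.ty o' = M.ty o := by
    intro o ho
    obtain ⟨o', ⟨h1, h2⟩, h3⟩ := hout' o ho.ex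
    refine ⟨o', fun g => ⟨fun hg => h3 g ⟨?_, hg⟩, fun hg => hg ▸ h2⟩, hty _ _ h1⟩
    obtain ⟨g', h4, h5⟩ := hout g hg
    exact (ho g').1 h5 ▸ h4
  have pairIn : M.label w ≠ .wn → M.label w ≠ .bang → ∀ {e f}, M.IsPairIn w e f →
      ∃ e' f', r e' e ∧ r f' f ∧ N.IsPairIn v e' f' := by
    intro h1 h2 e f hef
    obtain ⟨e', ⟨h3, h4⟩, h5⟩ := hin' h1 h2 e ((hef.2 e).2 (Or.inl rfl))
    obtain ⟨f', ⟨h6, h7⟩, h8⟩ := hin' h1 h2 f ((hef.2 f).2 (Or.inr rfl))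
    refine ⟨e', f', h3, h6, fun h => hef.1 (hr _ _ _ h3 (h ▸ h6)), fun g => ⟨fun hg => ?_, ?_⟩⟩
    · obtain ⟨g', h9, h10⟩ := hin g hg
      rcases (hef.2 g').1 h10 with rfl | rfl
      · exact Or.inl (h5 g ⟨h9, hg⟩)
      · exact Or.inr (h8 g ⟨h9, hg⟩)
    · rintro (rfl | rfl) <;> assumption
  unfold CellOK at h ⊢
  rw [hl]
  cases hw : M.label w <;> simp only [hw] at h ⊢
  case ax =>
    obtain ⟨h1, e, f, hef, h2, h3⟩ := h
    obtain ⟨e', ⟨h4, h5⟩, h6⟩ := hout' e ((h2 e).2 (Or.inl rfl))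
    obtain ⟨f', ⟨h7, h8⟩, h9⟩ := hout' f ((h2 f).2 (Or.inr rfl))
    refine ⟨noin h1, e', f', fun h => hef (hr _ _ _ h4 (h ▸ h7)), fun g => ⟨fun hg => ?_, ?_⟩, ?_⟩
    · obtain ⟨g', h10, h11⟩ := hout g hg
      rcases (h2 g').1 h11 with rfl | rfl
      · exact Or.inl (h6 g ⟨h10, hg⟩)
      · exact Or.inr (h9 g ⟨h10, hg⟩)
    · rintro (rfl | rfl) <;> assumption
    · rw [hty _ _ h4, hty _ _ h7, h3]
  case cut =>
    obtain ⟨h1, e, f, hef, h2⟩ := h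
    obtain ⟨e', f', h3, h4, h5⟩ := pairIn (by simp [hw]) (by simp [hw]) hef
    refine ⟨fun g hg => ?_, e', f', h5, by rw [hty _ _ h3, hty _ _ h4, h2]⟩
    obtain ⟨g', _, h6⟩ := hout g hg
    exact h1 g' h6
  case one =>
    obtain ⟨h1, o, h2, h3⟩ := h
    obtain ⟨o', h4, h5⟩ := isOut h2
    exact ⟨noin h1, o', h4, h5.trans h3⟩
  case bot =>
    obtain ⟨h1, o, h2, h3⟩ := h
    obtain ⟨o', h4, h5⟩ := isOut h2
    exact ⟨noin h1, o', h4, h5.trans h3⟩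
  case daimon => exact noin h
  case tensor =>
    obtain ⟨e, f, o, h1, h2, h3, h4, h5⟩ := h
    obtain ⟨o', h6, h7⟩ := isOut h4
    obtain ⟨e', f', h8, h9, h10⟩ := pairIn (by simp [hw]) (by simp [hw]) h1
    have hlab : N.label v = .tensor ∨ N.label v = .par := by simp [hl, hw]
    exact ⟨e', f', o', h10, (hleft _ _ h8 ((h10.2 _).2 (Or.inl rfl)) hlab).2 h2,
      fun h => h3 ((hleft _ _ h9 ((h10.2 _).2 (Or.inr rfl)) hlab).1 h), h6,
      by rw [h7, h5, hty _ _ h8, hty _ _ h9]⟩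
  case par =>
    obtain ⟨e, f, o, h1, h2, h3, h4, h5⟩ := h
    obtain ⟨o', h6, h7⟩ := isOut h4
    obtain ⟨e', f', h8, h9, h10⟩ := pairIn (by simp [hw]) (by simp [hw]) h1
    have hlab : N.label v = .tensor ∨ N.label v = .par := by simp [hl, hw]
    exact ⟨e', f', o', h10, (hleft _ _ h8 ((h10.2 _).2 (Or.inl rfl)) hlab).2 h2,
      fun h => h3 ((hleft _ _ h9 ((h10.2 _).2 (Or.inr rfl)) hlab).1 h), h6,
      by rw [h7, h5, hty _ _ h8, hty _ _ h9]⟩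
  case wn =>
    obtain ⟨o, A, h1, h2, h3⟩ := h
    obtain ⟨o', h4, h5⟩ := isOut h1
    refine ⟨o', A, h4, h5.trans h2, fun g hg => ?_⟩
    obtain ⟨g', h6, h7⟩ := hin g hg
    rw [hty _ _ h6, h3 g' h7]
  case bang =>
    obtain ⟨o, A, h1, h2, h3⟩ := h
    obtain ⟨o', h4, h5⟩ := isOut h1
    refine ⟨o', A, h4, h5.trans h2, fun g hg => ?_⟩
    obtain ⟨g', h6, h7⟩ := hin g hg
    rw [hty _ _ h6, h3 g' h7]

/-- No cell is a daimon. -/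
def DaimonFree (N : Net) : Prop := ∀ v, N.label v ≠ .daimon

/-! ## Isomorphisms -/

end Net

theorem Iso.refl (N : Net) : Iso N N :=
  ⟨id, id, Function.injective_id, Function.injective_id, by simp, by simp, fun _ => rfl,
    fun _ => rfl, fun _ => rfl, fun _ _ => Iff.rfl, fun _ _ _ _ => Iff.rfl, by simp⟩

theorem Iso.trans {N M L : Net} (h : Iso N M) (h' : Iso M L) : Iso N L := by
  obtain ⟨p, q, hp, hq, rp, rq, hl, ht, hs, hg, hf, hc⟩ := h
  obtain ⟨p', q', hp', hq', rp', rq', hl', ht', hs', hg', hf', hc'⟩ := h'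
  refine ⟨p' ∘ p, q' ∘ q, hp'.comp hp, hq'.comp hq, ?_, ?_, ?_, ?_, ?_, ?_, ?_, ?_⟩
  · rw [Set.range_comp, rp, Set.image_univ, rp']
  · rw [Set.range_comp, rq, Set.image_univ, rq']
  · intro v; rw [hl, hl']; rfl
  · intro v; rw [ht, ht']; rfl
  · intro v; simp [hs', hs]
  · intro e v; rw [hg, hg']; rfl
  · intro e v h1 h2
    rw [hf e v h1 h2, hf' _ (p v) ((hg e v).1 h1) (by rw [← hl]; exact h2)]; rfl
  · rw [← List.map_map, hc, hc']

theorem Iso.symm {N M : Net} (h : Iso N M) : Iso M N := by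
  obtain ⟨p, q, hp, hq, rp, rq, hl, ht, hs, hg, hf, hc⟩ := h
  have bp : Function.Bijective p := ⟨hp, Set.range_eq_univ.1 rp⟩
  have bq : Function.Bijective q := ⟨hq, Set.range_eq_univ.1 rq⟩
  obtain ⟨p', lp, rp'⟩ := Function.bijective_iff_has_inverse.1 bp
  obtain ⟨q', lq, rq'⟩ := Function.bijective_iff_has_inverse.1 bq
  have hg' : ∀ e v, M.tgt e = some v ↔ N.tgt (q' e) = some (p' v) := fun e v => by
    rw [hg, rp', rq']
  refine ⟨p', q', rp'.injective, rq'.injective, Set.range_eq_univ.2 lp.surjective,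
    Set.range_eq_univ.2 lq.surjective, fun v => by rw [hl, rp'], fun v => by rw [ht, rq'],
    fun v => ?_, hg', fun e v h1 h2 => ?_, ?_⟩
  · apply hp; rw [hs, rp', rq']
  · rw [hf (q' e) (p' v) ((hg' e v).1 h1) (by rw [hl, rp']; exact h2), rq']
  · rw [← hc, List.map_map]; simp [Function.comp_def, lq _]

theorem Iso.type_eq {N M : Net} (h : Iso N M) : N.type = M.type := by
  obtain ⟨p, q, hp, hq, rp, rq, hl, ht, hs, hg, hf, hc⟩ := h
  simp [Net.type, ← hc, ht, Function.comp_def]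

theorem Sub.daimonFree {N' N : Net} {KV KE c} (h : Sub N' N KV KE c) (hN : N.DaimonFree) :
    N'.DaimonFree := by
  obtain ⟨p, q, hp, hq, rp, rq, hl, _⟩ := h
  intro v; rw [hl]; exact hN _

theorem Iso.wf {N M : Net} (h : Iso N M) (hM : M.WF) : N.WF := by
  obtain ⟨p, q, hp, hq, rp, rq, hl, ht, hs, hg, hf, hc⟩ := h
  have sp := Set.range_eq_univ.1 rp
  have sq := Set.range_eq_univ.1 rq
  have := hM.finite_V
  have := hM.finite_E
  refine ⟨Finite.of_injective p hp, Finite.of_injective q hq, ?_, ?_, ?_, fun v => ?_⟩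
  · obtain ⟨v⟩ := hM.nonempty
    exact ⟨(sp v).choose⟩
  · exact List.Nodup.of_map q (hc ▸ hM.concl_nodup)
  · intro e
    rw [← List.mem_map_of_injective hq, hc, hM.mem_concl, Option.eq_none_iff_forall_ne_some,
      Option.eq_none_iff_forall_ne_some]
    refine ⟨fun h v hv => h _ ((hg e v).1 hv), fun h v hv => ?_⟩
    obtain ⟨w, rfl⟩ := sp v
    exact h w ((hg e w).2 hv)
  · refine Net.CellOK.transfer (M := M) (w := p v) (fun e f => q e = f) (hl v) ?_ ?_ ?_ ?_ ?_ ?_ ?_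
      (hM.cell_ok _)
    · rintro g _ _ rfl rfl; rfl
    · rintro g _ rfl; exact ht g
    · rintro g rfl; exact ⟨_, rfl, (hs g).symm⟩
    · intro g h
      obtain ⟨e, rfl⟩ := sq g
      exact ⟨e, ⟨rfl, hp (by rw [hs, h])⟩, fun f hf => hq hf.1⟩
    · intro g h; exact ⟨_, rfl, (hg _ _).1 h⟩
    · intro _ _ g h
      obtain ⟨e, rfl⟩ := sq g
      exact ⟨e, ⟨rfl, (hg _ _).2 h⟩, fun f hf => hq hf.1⟩
    · rintro g _ rfl h1 h2; exact hf g v h1 h2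

/-! ## Expansions -/

/-- `Exp N R`: the net `N` is, up to isomorphism, the expansion of `R` along a thick subtree. -/
structure Exp (N : Net) (R : BoxNet) where
  t : Thick R.tree
  p : N.V → R.V
  b : N.V → t.tree.Node
  q : N.E → R.E
  box_p : ∀ v, R.box (p v) = t.h (b v)
  inj : ∀ v w, p v = p w → b v = b w → v = w
  surj : ∀ v x, R.box v = t.h x → ∃ w, p w = v ∧ b w = x
  src_q : ∀ e, R.src (q e) = p (N.src e)
  -- An edge of the pullback is recorded by its image and its source only. The copy of its target is
  -- forced: it lies in the unique node below the copy of the source that is sent to the right box.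
  injE : ∀ e f, q e = q f → N.src e = N.src f → e = f
  surjE : ∀ e w, R.src e = p w → ∃ f, q f = e ∧ N.src f = w
  tgt_q : ∀ e v, N.tgt e = some v →
    R.tgt (q e) = some (p v) ∧ t.tree.Reach (b (N.src e)) (b v)
  tgt_some : ∀ e u, R.tgt (q e) = some u → ∃ v, N.tgt e = some v
  label_p : ∀ v, N.label v = R.label (p v)
  ty_q : ∀ e, N.ty e = R.ty (q e)
  left_q : ∀ e v, N.tgt e = some v → (N.label v = .tensor ∨ N.label v = .par) →
    (N.left e ↔ R.left (q e))
  concl_q : N.concl.map q = R.concl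

theorem BoxNet.expansion_tgt (R : BoxNet) (t : Thick R.tree) (e : (R.expansion t).E)
    (v : (R.expansion t).V) :
    (R.expansion t).tgt e = some v ↔ R.tgt e.1.1 = some v.1.1 ∧ e.1.2.2 = v.1.2 := by
  obtain ⟨⟨e, x, y⟩, h1, h2, h3, h4⟩ := e
  obtain ⟨⟨v, z⟩, hv⟩ := v
  unfold BoxNet.expansion
  simp only
  split
  · rename_i h
    simp [h]
  · rename_i w h
    simp only [Option.some.injEq, h]
    exact Subtype.ext_iff.trans Prod.ext_iff

theorem Exp.of_iso {N : Net} {R : BoxNet} (t : Thick R.tree) (h : Iso N (R.expansion t)) :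
    Nonempty (Exp N R) := by
  obtain ⟨p, q, hp, hq, rp, rq, hl, ht, hs, hg, hf, hc⟩ := h
  have sp := Set.range_eq_univ.1 rp
  have sq := Set.range_eq_univ.1 rq
  refine ⟨⟨t, fun v => (p v).1.1, fun v => (p v).1.2, fun e => (q e).1.1, fun v => (p v).2, ?_, ?_,
    ?_, ?_, ?_, ?_, ?_, hl, ht, ?_, ?_⟩⟩
  · intro v w h1 h2
    exact hp (Subtype.ext (Prod.ext h1 h2))
  · intro v x h
    obtain ⟨w, hw⟩ := sp ⟨(v, x), h⟩
    exact ⟨w, by simp [hw], by simp [hw]⟩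
  · intro e; rw [hs]; rfl
  · intro e f h1 h2
    refine hq (Subtype.ext (Prod.ext h1 ?_))
    have h3 : (q e).1.2.1 = (q f).1.2.1 :=
      congrArg (fun x : (R.expansion t).V => x.1.2) ((hs e).symm.trans ((congrArg p h2).trans (hs f)))
    refine Prod.ext h3 ?_
    rcases h4 : R.tgt (q e).1.1 with _ | v
    · have h5 := h4
      rw [show (q e).1.1 = (q f).1.1 from h1] at h5
      rw [(q e).2.2.2.1 h4, (q f).2.2.2.1 h5]
    · have h5 := h4
      rw [show (q e).1.1 = (q f).1.1 from h1] at h5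
      refine t.reach_unique (q e).2.2.1 (h3 ▸ (q f).2.2.1) ?_
      rw [← (q e).2.2.2.2 v h4, ← (q f).2.2.2.2 v h5]
  · intro e w h
    have h0 : R.box (R.src e) = t.h (p w).1.2 := by rw [h]; exact (p w).2
    -- The lower end of the lifted edge: the root for a conclusion, otherwise the lift of the box of
    -- the target along the thick subtree.
    have : ∃ y, t.tree.Reach (p w).1.2 y ∧ (R.tgt e = none → y = t.tree.root) ∧
        ∀ v, R.tgt e = some v → R.box v = t.h y := by
      rcases he : R.tgt e with _ | v
      · exact ⟨_, t.tree.reach_root _, fun _ => rfl, by simp⟩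
      · have := R.box_edge e v he
        rw [h0] at this
        obtain ⟨y, h1, h2⟩ := t.exists_reach _ this
        exact ⟨y, h1, by simp, fun u hu => by rw [← Option.some.inj hu, h2]⟩
    obtain ⟨y, h1, h2, h3⟩ := this
    obtain ⟨f, hf⟩ := sq ⟨(e, (p w).1.2, y), h0, h1, h2, h3⟩
    refine ⟨f, by simp [hf], hp ?_⟩
    rw [hs, hf]
    exact Subtype.ext (Prod.ext h rfl)
  · intro e v h
    obtain ⟨h1, h2⟩ := (R.expansion_tgt t _ _).1 ((hg e v).1 h)
    refine ⟨h1, ?_⟩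
    rw [← h2, hs]
    exact (q e).2.2.1
  · intro e u h
    obtain ⟨v, hv⟩ := sp ⟨(u, (q e).1.2.2), (q e).2.2.2.2 u h⟩
    exact ⟨v, (hg e v).2 ((R.expansion_tgt t _ _).2 ⟨by rw [hv]; exact h, by rw [hv]⟩)⟩
  · exact hf
  · have := congrArg (List.map fun e : (R.expansion t).E => e.1.1) hc
    simp only [List.map_map] at this
    refine (List.map_congr_left fun _ _ => rfl).trans (this.trans ?_)
    simp [BoxNet.expansion, List.map_pmap]

namespace Exp

variable {N : Net} {R : BoxNet} (E : Exp N R)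

theorem root_iff (v : N.V) : R.box (E.p v) = R.tree.root ↔ E.b v = E.t.tree.root := by
  rw [E.box_p, E.t.h_eq_root]

theorem tgt_none (e : N.E) : N.tgt e = none ↔ R.tgt (E.q e) = none := by
  refine ⟨fun h => ?_, fun h => ?_⟩
  · rcases h' : R.tgt (E.q e) with _ | u
    · rfl
    · obtain ⟨v, hv⟩ := E.tgt_some e u h'
      simp [h] at hv
  · rcases h' : N.tgt e with _ | u
    · rfl
    · have := (E.tgt_q e u h').1
      simp [h] at this

/-- An edge whose ends are in the same box: its copies join cells in the same copy of the box. -/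
theorem tgt_iff_of_box {e : N.E} {v : N.V} (h : R.tgt (E.q e) = some (E.p v))
    (hb : E.t.tree.Reach (E.b (N.src e)) (E.b v)) : N.tgt e = some v := by
  obtain ⟨w, hw⟩ := E.tgt_some e _ h
  obtain ⟨h1, h2⟩ := E.tgt_q e w hw
  rw [h] at h1
  have h3 := Option.some.inj h1
  rw [hw, Option.some.injEq]
  exact E.inj _ _ h3.symm (E.t.reach_unique h2 hb (by rw [← E.box_p, ← E.box_p, h3]))

theorem type_eq (E : Exp N R) : N.type = R.toNet.type := by
  rw [Net.type, Net.type, ← E.concl_q, List.map_map]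
  exact List.map_congr_left fun e _ => E.ty_q e

theorem root_of_mem {e : N.E} (h : N.tgt e = none) : E.b (N.src e) = E.t.tree.root := by
  rw [← E.root_iff, ← E.src_q]
  exact R.box_tail _ ((E.tgt_none e).1 h)

/-- The root of a thick subtree is the only node over the root, so the cells of the root are not
duplicated. This lets a step at the root act alike on a structure and on its expansions. -/
theorem inj_root {v w : N.V} (h : E.p v = E.p w) (hv : R.box (E.p v) = R.tree.root) : v = w :=
  E.inj _ _ h (by rw [(E.root_iff v).1 hv, (E.root_iff w).1 (h ▸ hv)])

theorem q_inj {e f : N.E} (h : E.q e = E.q f) (he : R.tgt (E.q e) = none) : e = f := by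
  refine E.injE _ _ h (E.inj_root ?_ ?_)
  · rw [← E.src_q, ← E.src_q, h]
  · rw [← E.src_q]; exact R.box_tail _ he

theorem surj_root {v : R.V} (hv : R.box v = R.tree.root) :
    ∃ w, E.p w = v ∧ E.b w = E.t.tree.root := E.surj _ _ (by rw [hv, E.t.h_root])

/-- Only `bang` and `wn` cells receive edges from another box. For the other cells the input lies in
the same box, hence has a copy in the same copy of that box. -/
theorem exists_input {g : R.E} {v : N.V} (hg : R.tgt g = some (E.p v))
    (h1 : R.label (E.p v) ≠ .wn) (h2 : R.label (E.p v) ≠ .bang) :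
    ∃ f, E.q f = g ∧ N.tgt f = some v ∧ E.b (N.src f) = E.b v := by
  have h3 : R.box (R.src g) = R.box (E.p v) := by
    by_contra h
    rcases R.border _ _ hg h with h | h <;> contradiction
  obtain ⟨w, hw, hb⟩ := E.surj (R.src g) (E.b v) (by rw [h3, E.box_p])
  obtain ⟨f, rfl, rfl⟩ := E.surjE g w hw.symm
  exact ⟨f, rfl, E.tgt_iff_of_box hg (by rw [hb]; exact RTree.reach_refl _ _), hb⟩

theorem cellOK (E : Exp N R) (v : N.V) : N.CellOK v := by
  refine Net.CellOK.transfer (M := R.toNet) (w := E.p v) (fun e f => E.q e = f) (E.label_p v)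
    ?_ ?_ ?_ ?_ ?_ ?_ ?_ (R.wf.cell_ok _)
  · rintro g _ _ rfl rfl; rfl
  · rintro g _ rfl; exact E.ty_q g
  · rintro g rfl; exact ⟨_, rfl, E.src_q g⟩
  · intro g h
    obtain ⟨f, rfl, rfl⟩ := E.surjE g v h
    exact ⟨f, ⟨rfl, rfl⟩, fun e he => E.injE _ _ he.1 he.2⟩
  · intro g h; exact ⟨_, rfl, (E.tgt_q _ _ h).1⟩
  · intro h1 h2 g hg
    have key : ∀ e, E.q e = g → N.tgt e = some v → E.b (N.src e) = E.b v := by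
      rintro e rfl he
      refine E.t.reach_unique (RTree.reach_refl _ _) (E.tgt_q e v he).2 ?_
      rw [← E.box_p, ← E.box_p, ← E.src_q]
      by_contra h
      rcases R.border _ _ hg h with h | h <;> contradiction
    obtain ⟨f, rfl, hf, hb⟩ := E.exists_input hg h1 h2
    refine ⟨f, ⟨rfl, hf⟩, fun e he => E.injE _ _ he.1 (E.inj _ _ ?_ ?_)⟩
    · rw [← E.src_q, he.1, E.src_q]
    · rw [key e he.1 he.2, hb]
  · rintro g _ rfl h1 h2; exact E.left_q g v h1 h2

/-- A cell in a box may have no copy at all, so a cell of the root is needed for the expansion to be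
nonempty. -/
theorem wf (E : Exp N R) (hR : ∃ v, R.box v = R.tree.root) : N.WF := by
  have := R.wf.finite_V
  have := R.wf.finite_E
  have := E.t.tree.finite
  have fV : Finite N.V := Finite.of_injective (fun v => (E.p v, E.b v)) fun v w h =>
    E.inj _ _ (congrArg Prod.fst h) (congrArg Prod.snd h)
  refine ⟨fV, Finite.of_injective (fun e => (E.q e, N.src e)) fun v w h =>
    E.injE _ _ (congrArg Prod.fst h) (congrArg Prod.snd h), ?_, ?_, fun e => ?_, E.cellOK⟩
  · obtain ⟨v, hv⟩ := hR
    obtain ⟨w, _⟩ := E.surj_root hv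
    exact ⟨w⟩
  · exact List.Nodup.of_map E.q (E.concl_q ▸ R.wf.concl_nodup)
  · refine ⟨fun h => ?_, fun h => ?_⟩
    · rw [E.tgt_none, ← R.wf.mem_concl, ← E.concl_q]
      exact List.mem_map_of_mem h
    · have h1 := (E.tgt_none e).1 h
      rw [← R.wf.mem_concl, ← E.concl_q] at h1
      obtain ⟨f, hf, hfe⟩ := List.mem_map.1 h1
      have h2 : R.tgt (E.q f) = none := hfe ▸ (E.tgt_none e).1 h
      rwa [← E.q_inj hfe h2]

theorem to_iso : Iso N (R.expansion E.t) := by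
  have key : ∀ e, ∃ y, E.t.tree.Reach (E.b (N.src e)) y ∧
      (R.tgt (E.q e) = none → y = E.t.tree.root) ∧
      (∀ v, R.tgt (E.q e) = some v → R.box v = E.t.h y) ∧
      ∀ v, N.tgt e = some v → y = E.b v := by
    intro e
    rcases he : N.tgt e with _ | v
    · refine ⟨_, E.t.tree.reach_root _, fun _ => rfl, ?_, by simp⟩
      intro v hv
      rw [(E.tgt_none e).1 he] at hv
      cases hv
    · obtain ⟨h1, h2⟩ := E.tgt_q e v he
      refine ⟨_, h2, by simp [h1], ?_, ?_⟩
      · intro u hu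
        rw [h1] at hu
        rw [← Option.some.inj hu, E.box_p]
      · intro u hu
        rw [Option.some.inj hu]
  choose y y1 y2 y3 y4 using key
  have hbox : ∀ e, R.box (R.src (E.q e)) = E.t.h (E.b (N.src e)) := fun e => by
    rw [E.src_q, E.box_p]
  have hg : ∀ e v, N.tgt e = some v ↔ R.tgt (E.q e) = some (E.p v) ∧ y e = E.b v := by
    refine fun e v => ⟨fun h => ⟨(E.tgt_q e v h).1, y4 e v h⟩, fun h => ?_⟩
    exact E.tgt_iff_of_box h.1 (h.2 ▸ y1 e)
  let P : N.V → (R.expansion E.t).V := fun v => ⟨(E.p v, E.b v), E.box_p v⟩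
  let Q : N.E → (R.expansion E.t).E := fun e =>
    ⟨(E.q e, E.b (N.src e), y e), hbox e, y1 e, y2 e, y3 e⟩
  refine ⟨P, Q, ?_, ?_, ?_, ?_, E.label_p, E.ty_q, ?_, ?_, ?_, ?_⟩
  · intro v w h
    have h' := congrArg Subtype.val h
    exact E.inj _ _ (congrArg Prod.fst h') (congrArg Prod.snd h')
  · intro e f h
    have h' := congrArg Subtype.val h
    have h1 : E.q e = E.q f := congrArg Prod.fst h'
    refine E.injE _ _ h1 (E.inj _ _ ?_ (congrArg (fun z => z.2.1) h'))
    rw [← E.src_q, ← E.src_q, h1]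
  · refine Set.eq_univ_of_forall ?_
    rintro ⟨⟨v, x⟩, h⟩
    obtain ⟨w, rfl, rfl⟩ := E.surj v x h
    exact ⟨w, rfl⟩
  · refine Set.eq_univ_of_forall ?_
    rintro ⟨⟨e, x, z⟩, h1, h2, h3, h4⟩
    obtain ⟨w, hw, rfl⟩ := E.surj _ x h1
    obtain ⟨f, rfl, rfl⟩ := E.surjE e w hw.symm
    refine ⟨f, Subtype.ext (Prod.ext rfl (Prod.ext rfl ?_))⟩
    change y f = z
    rcases hf : R.tgt (E.q f) with _ | v
    · exact (y2 f hf).trans (h3 hf).symm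
    · exact E.t.reach_unique (y1 f) h2 (by rw [← y3 f v hf, ← h4 v hf])
  · intro e; exact Subtype.ext (Prod.ext (E.src_q e).symm rfl)
  · intro e v
    rw [hg]
    exact (R.expansion_tgt E.t (Q e) (P v)).symm
  · exact E.left_q
  · refine (List.map_injective_iff (f := fun z : (R.expansion E.t).E => z.1)).2
      (fun _ _ h => Subtype.ext h) ?_
    rw [List.map_map]
    have : (R.expansion E.t).concl.map (fun z : (R.expansion E.t).E => z.1) =
        R.concl.map fun e => (e, E.t.tree.root, E.t.tree.root) := by
      simp [BoxNet.expansion, List.map_pmap]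
    rw [this, ← E.concl_q, List.map_map]
    refine List.map_congr_left fun e he => ?_
    have h : R.tgt (E.q e) = none := by
      rw [← R.wf.mem_concl, ← E.concl_q]; exact List.mem_map_of_mem he
    exact Prod.ext rfl (Prod.ext (E.root_of_mem ((E.tgt_none e).2 h)) (y2 e h))

/-- This is the passage between the definition of the Taylor expansion and the coordinates in which
all constructions are made. -/
theorem iff_iso : Nonempty (Exp N R) ↔ ∃ t, Iso N (R.expansion t) :=
  ⟨fun ⟨E⟩ => ⟨E.t, E.to_iso⟩, fun ⟨t, h⟩ => Exp.of_iso t h⟩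

end Exp
theorem Exp.congr_iso {N M : Net} {R : BoxNet} (h : Iso N M) (E : Nonempty (Exp M R)) :
    Nonempty (Exp N R) := by
  rw [Exp.iff_iso] at E ⊢
  obtain ⟨t, ht⟩ := E
  exact ⟨t, h.trans ht⟩

/-- Two copies of the same subgraph are isomorphic. -/
theorem Sub.iso {N' N'' N : Net} {K KE c} (h : Sub N' N K KE c) (h' : Sub N'' N K KE c) :
    Iso N' N'' := by
  obtain ⟨p, q, hp, hq, rp, rq, hl, ht, hs, hg, hf, hc⟩ := h
  obtain ⟨p', q', hp', hq', rp', rq', hl', ht', hs', hg', hf', hc'⟩ := h'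
  have kp : ∀ v, ∃ w, p' w = p v := fun v => by
    have : p v ∈ Set.range p' := rp' ▸ rp ▸ ⟨v, rfl⟩
    exact this
  have kp' : ∀ v, ∃ w, p w = p' v := fun v => by
    have : p' v ∈ Set.range p := rp ▸ rp' ▸ ⟨v, rfl⟩
    exact this
  have kq : ∀ v, ∃ w, q' w = q v := fun v => by
    have : q v ∈ Set.range q' := rq' ▸ rq ▸ ⟨v, rfl⟩
    exact this
  have kq' : ∀ v, ∃ w, q w = q' v := fun v => by
    have : q' v ∈ Set.range q := rq ▸ rq' ▸ ⟨v, rfl⟩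
    exact this
  choose P hP using kp
  choose Q hQ using kq
  have hg'' : ∀ e v, N'.tgt e = some v ↔ N''.tgt (Q e) = some (P v) := fun e v => by
    rw [hg, hg', hP, hQ]
  refine ⟨P, Q, fun v w h => ?_, fun v w h => ?_, ?_, ?_, fun v => ?_, fun v => ?_, fun e => ?_, hg'',
    fun e v h1 h2 => ?_, ?_⟩
  · apply hp; rw [← hP, ← hP, h]
  · apply hq; rw [← hQ, ← hQ, h]
  · refine Set.eq_univ_of_forall fun w => ?_
    obtain ⟨v, hv⟩ := kp' w
    exact ⟨v, hp' (by rw [hP, hv])⟩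
  · refine Set.eq_univ_of_forall fun w => ?_
    obtain ⟨v, hv⟩ := kq' w
    exact ⟨v, hq' (by rw [hQ, hv])⟩
  · rw [hl, hl', hP]
  · rw [ht, ht', hQ]
  · apply hp'; rw [hP, hs, hs', hQ]
  · rw [hf e v h1 h2, hf' (Q e) (P v) ((hg'' e v).1 h1) (by rw [hl', hP, ← hl]; exact h2), hQ]
  · refine (List.map_injective_iff.2 hq') ?_
    rw [List.map_map, hc', ← hc]
    exact List.map_congr_left fun e _ => hQ e

/-! ### Subgraphs and reordered conclusions -/

namespace Net

/-- The subgraph on the set `K` of cells and on their outputs, with conclusions `c`. -/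
noncomputable def restrict (N : Net) (K : Set N.V) (c : List N.E) (hc : ∀ e ∈ c, N.src e ∈ K) :
    Net where
  V := {v // v ∈ K}
  E := {e // N.src e ∈ K}
  label v := N.label v.1
  ty e := N.ty e.1
  src e := ⟨N.src e.1, e.2⟩
  tgt e := (N.tgt e.1).bind fun v => open Classical in if h : v ∈ K then some ⟨v, h⟩ else none
  left e := N.left e.1
  concl := c.pmap Subtype.mk hc

section
variable {N : Net} {K : Set N.V} {c : List N.E} {hc : ∀ e ∈ c, N.src e ∈ K}

theorem restrict_tgt (e : (N.restrict K c hc).E) (v : (N.restrict K c hc).V) :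
    (N.restrict K c hc).tgt e = some v ↔ N.tgt e.1 = some v.1 := by
  refine Option.bind_eq_some_iff.trans ⟨?_, fun h => ⟨v.1, h, ?_⟩⟩
  · rintro ⟨w, h1, h2⟩
    split at h2
    · rw [h1, ← Option.some.inj h2]
    · cases h2
  · exact dif_pos v.2

theorem restrict_concl : (N.restrict K c hc).concl.map Subtype.val = c := by
  simp [restrict, List.map_pmap]

theorem mem_restrict_concl (e : (N.restrict K c hc).E) :
    e ∈ (N.restrict K c hc).concl ↔ e.1 ∈ c := by
  have h := List.mem_map_of_injective (f := fun e : (N.restrict K c hc).E => e.1)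
    (fun _ _ h => Subtype.ext h) (a := e) (l := (N.restrict K c hc).concl)
  rw [← h]
  exact iff_of_eq (congrArg (e.1 ∈ ·) restrict_concl)

theorem sub_restrict : Sub (N.restrict K c hc) N K {e | N.src e ∈ K} c :=
  ⟨Subtype.val, Subtype.val, Subtype.val_injective, Subtype.val_injective, Subtype.range_val,
    Subtype.range_val, fun _ => rfl, fun _ => rfl, fun _ => rfl, restrict_tgt,
    fun _ _ _ _ => Iff.rfl, restrict_concl⟩

end

/-- Conditions under which a subgraph is well-formed. -/
structure Restrictable (N : Net) (K : Set N.V) (c : List N.E) : Prop where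
  src_mem : ∀ e ∈ c, N.src e ∈ K
  nonempty : K.Nonempty
  nodup : c.Nodup
  mem_iff : ∀ e, N.src e ∈ K → (e ∈ c ↔ ∀ v, N.tgt e = some v → v ∉ K)
  up : ∀ e v, N.tgt e = some v → v ∈ K → N.src e ∈ K

theorem Restrictable.wf {N : Net} {K : Set N.V} {c : List N.E} (h : N.Restrictable K c)
    (hN : N.WF) : (N.restrict K c h.src_mem).WF := by
  have := hN.finite_V
  have := hN.finite_E
  refine ⟨(inferInstance : Finite {v // v ∈ K}), (inferInstance : Finite {e // N.src e ∈ K}),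
    h.nonempty.to_subtype, h.nodup.pmap fun _ _ _ _ h => congrArg Subtype.val h, fun e => ?_,
    fun v => ?_⟩
  · rw [mem_restrict_concl, h.mem_iff _ e.2, Option.eq_none_iff_forall_ne_some]
    refine ⟨fun h1 v hv => h1 v.1 ((restrict_tgt _ _).1 hv) v.2, fun h1 v hv hK => ?_⟩
    exact h1 ⟨v, hK⟩ ((restrict_tgt _ _).2 hv)
  · refine CellOK.transfer (M := N) (w := v.1) (fun e f => e.1 = f) rfl ?_ ?_ ?_ ?_ ?_ ?_ ?_
      (hN.cell_ok _)
    · rintro g _ _ rfl rfl; rfl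
    · rintro g _ rfl; rfl
    · rintro g rfl; exact ⟨_, rfl, rfl⟩
    · intro g hg
      exact ⟨⟨g, hg ▸ v.2⟩, ⟨rfl, Subtype.ext hg⟩, fun f hf => Subtype.ext hf.1⟩
    · intro g hg; exact ⟨_, rfl, (restrict_tgt _ _).1 hg⟩
    · intro _ _ g hg
      exact ⟨⟨g, h.up g v.1 hg v.2⟩, ⟨rfl, (restrict_tgt _ _).2 hg⟩, fun f hf => Subtype.ext hf.1⟩
    · rintro g _ rfl _ _; exact Iff.rfl

/-- The same graph with another list of conclusions. -/
def reconcl (N : Net) (c : List N.E) : Net := { N with concl := c }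

theorem sub_reconcl (N : Net) (c : List N.E) : Sub (N.reconcl c) N Set.univ Set.univ c :=
  ⟨id, id, Function.injective_id, Function.injective_id, Set.range_id, Set.range_id,
    fun _ => rfl, fun _ => rfl, fun _ => rfl, fun _ _ => Iff.rfl, fun _ _ _ _ => Iff.rfl,
    List.map_id _⟩

end Net

namespace BoxNet

/-- The same structure with another order on the conclusions. -/
def reconcl (R : BoxNet) (c : List R.E) (h : c.Perm R.concl) : BoxNet where
  toNet := R.toNet.reconcl c
  wf :=
    { finite_V := R.wf.finite_V
      finite_E := R.wf.finite_E
      nonempty := R.wf.nonempty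
      concl_nodup := h.nodup_iff.2 R.wf.concl_nodup
      mem_concl := fun e => h.mem_iff.trans (R.wf.mem_concl e)
      cell_ok := R.wf.cell_ok }
  tree := R.tree
  box := R.box
  box_edge := R.box_edge
  box_tail := R.box_tail
  border := R.border
  door_inj := R.door_inj

/-- The restriction of a structure to a set of cells closed under taking premises. -/
noncomputable def restrict (R : BoxNet) (K : Set R.V) (c : List R.E) (h : R.toNet.Restrictable K c)
    (hroot : ∀ e ∈ c, R.box (R.src e) = R.tree.root) : BoxNet where
  toNet := R.toNet.restrict K c h.src_mem
  wf := h.wf R.wf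
  tree := R.tree
  box v := R.box v.1
  box_edge e v hv := R.box_edge e.1 v.1 ((Net.restrict_tgt _ _).1 hv)
  box_tail e he := by
    refine hroot e.1 ?_
    rwa [← (h.wf R.wf).mem_concl, Net.mem_restrict_concl] at he
  border e v hv := R.border e.1 v.1 ((Net.restrict_tgt _ _).1 hv)
  door_inj e f v w he hf hv hw h1 h2 h3 := Subtype.ext (R.door_inj e.1 f.1 v.1 w.1
    ((Net.restrict_tgt _ _).1 he) ((Net.restrict_tgt _ _).1 hf) hv hw h1 h2 h3)

end BoxNet

namespace Exp

variable {N : Net} {R : BoxNet}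

/-- Expansions commute with the permutation of conclusions. -/
def reconcl (E : Exp N R) (c : List R.E) (h : c.Perm R.concl) (cN : List N.E)
    (hcN : cN.map E.q = c) : Exp (N.reconcl cN) (R.reconcl c h) where
  t := E.t
  p := E.p
  b := E.b
  q := E.q
  box_p := E.box_p
  inj := E.inj
  surj := E.surj
  src_q := E.src_q
  injE := E.injE
  surjE := E.surjE
  tgt_q := E.tgt_q
  tgt_some := E.tgt_some
  label_p := E.label_p
  ty_q := E.ty_q
  left_q := E.left_q
  concl_q := hcN

/-- Expansions commute with the restriction to a set of cells. -/
noncomputable def restrict (E : Exp N R) (K : Set R.V) (c : List R.E)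
    (h : R.toNet.Restrictable K c) (hroot : ∀ e ∈ c, R.box (R.src e) = R.tree.root)
    (cN : List N.E) (hcN : cN.map E.q = c) (hs : ∀ e ∈ cN, N.src e ∈ E.p ⁻¹' K) :
    Exp (N.restrict (E.p ⁻¹' K) cN hs) (R.restrict K c h hroot) where
  t := E.t
  p v := ⟨E.p v.1, v.2⟩
  b v := E.b v.1
  q e := ⟨E.q e.1, (E.src_q e.1).symm ▸ e.2⟩
  box_p v := E.box_p v.1
  inj v w h1 h2 := Subtype.ext (E.inj _ _ (congrArg Subtype.val h1) h2)
  surj := by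
    rintro ⟨v, hv⟩ x hx
    obtain ⟨w, rfl, rfl⟩ := E.surj v x hx
    exact ⟨⟨w, hv⟩, rfl, rfl⟩
  src_q e := Subtype.ext (E.src_q e.1)
  injE e f h1 h2 := Subtype.ext (E.injE _ _ (congrArg Subtype.val h1) (congrArg Subtype.val h2))
  surjE := by
    rintro ⟨e, he⟩ w hw
    obtain ⟨f, rfl, hf⟩ := E.surjE e w.1 (congrArg Subtype.val hw)
    exact ⟨⟨f, hf.symm ▸ w.2⟩, rfl, Subtype.ext hf⟩
  tgt_q e v hv := by
    obtain ⟨h1, h2⟩ := E.tgt_q e.1 v.1 ((Net.restrict_tgt _ _).1 hv)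
    exact ⟨(Net.restrict_tgt _ _).2 h1, h2⟩
  tgt_some e u hu := by
    have hu' := (Net.restrict_tgt _ _).1 hu
    obtain ⟨v, hv⟩ := E.tgt_some e.1 _ hu'
    have := (E.tgt_q _ _ hv).1
    rw [hu'] at this
    exact ⟨⟨v, show E.p v ∈ K from Option.some.inj this ▸ u.2⟩, (Net.restrict_tgt _ _).2 hv⟩
  label_p v := E.label_p v.1
  ty_q e := E.ty_q e.1
  left_q e v hv := E.left_q e.1 v.1 ((Net.restrict_tgt _ _).1 hv)
  concl_q := by
    refine List.map_injective_iff.2 Subtype.val_injective ?_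
    refine Eq.trans ?_ (Net.restrict_concl (N := R.toNet) (hc := h.src_mem)).symm
    refine (List.map_map ..).trans (Eq.trans ?_ hcN)
    refine (List.map_map (f := Subtype.val) (g := E.q)).symm.trans ?_
    exact congrArg _ Net.restrict_concl

end Exp

/-! ## The structures met while rewriting a MELL proof-structure -/

/-- The part of the MELL conditions which is kept by all rewriting steps: the box-tree may contain
nodes which are not used. -/
structure BoxNet.Inv (R : BoxNet) : Prop where
  bang : ∀ v, R.label v = .bang → ∃ e, ∀ g, R.tgt g = some v ↔ g = e
  bang_parent : ∀ e v, R.tgt e = some v → R.label v = .bang →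
    R.tree.parent (R.box (R.src e)) = some (R.box v)
  door : ∀ w x, R.tree.Reach (R.box w) x → x ≠ R.tree.root →
    ∃ e v, R.tgt e = some v ∧ R.label v = .bang ∧ R.box (R.src e) = x
  daimon : ∀ v, R.label v = .daimon → R.box v ≠ R.tree.root

namespace BoxNet.Inv

variable {R : BoxNet}

theorem of_isMELL (h : R.IsMELL) : R.Inv where
  bang v hv := by
    obtain ⟨e, h1, h2⟩ := h.1.1 v hv
    exact ⟨e, fun g => ⟨h2 g, fun h => h ▸ h1⟩⟩
  bang_parent := h.1.2.1
  door w x _ hx := h.1.2.2 x hx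
  daimon v hv := (h.2 v hv).2

theorem exists_root_door (h : R.Inv) {w : R.V} (hw : R.box w ≠ R.tree.root) :
    ∃ e v, R.tgt e = some v ∧ R.label v = .bang ∧ R.box v = R.tree.root ∧
      R.tree.Reach (R.box w) (R.box (R.src e)) := by
  obtain ⟨x, h1, h2⟩ := RTree.exists_child hw
  obtain ⟨e, v, h3, h4, rfl⟩ := h.door w x h1 (by rintro rfl; simp [R.tree.parent_root] at h2)
  refine ⟨e, v, h3, h4, ?_, h1⟩
  have := h.bang_parent e v h3 h4
  rw [h2] at this
  exact (Option.some.inj this).symm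

/-- A cell in a box forces, for the outermost box around it, a `bang` cell at the root. Hence every
expansion of such a structure is nonempty and well-formed. -/
theorem exists_root (h : R.Inv) : ∃ v, R.box v = R.tree.root := by
  obtain ⟨w⟩ := R.wf.nonempty
  by_cases hw : R.box w = R.tree.root
  · exact ⟨w, hw⟩
  · obtain ⟨_, v, _, _, hv, _⟩ := h.exists_root_door hw
    exact ⟨v, hv⟩

theorem reconcl (h : R.Inv) (c : List R.E) (hc : c.Perm R.concl) : (R.reconcl c hc).Inv :=
  ⟨h.bang, h.bang_parent, h.door, h.daimon⟩

/-- The box-tree is kept unchanged. Since only the nodes at or below the box of some cell need a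
door, it is enough that `K` contains, with a cell, the `bang` cells of all the boxes around it. -/
theorem restrict (h : R.Inv) {K : Set R.V} {c : List R.E} (hK : R.toNet.Restrictable K c)
    (hroot : ∀ e ∈ c, R.box (R.src e) = R.tree.root)
    (hdoor : ∀ w ∈ K, ∀ e v, R.tgt e = some v → R.label v = .bang →
      R.tree.Reach (R.box w) (R.box (R.src e)) → v ∈ K) : (R.restrict K c hK hroot).Inv where
  bang v hv := by
    obtain ⟨e, he⟩ := h.bang v.1 hv
    refine ⟨⟨e, hK.up e v.1 ((he e).2 rfl) v.2⟩, fun g => ?_⟩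
    exact (Net.restrict_tgt g v).trans ((he g.1).trans ⟨fun h => Subtype.ext h, fun h => h ▸ rfl⟩)
  bang_parent e v hv := h.bang_parent e.1 v.1 ((Net.restrict_tgt _ _).1 hv)
  door w x hx hne := by
    obtain ⟨e, v, h1, h2, h3⟩ := h.door w.1 x hx hne
    have hv : v ∈ K := hdoor w.1 w.2 e v h1 h2 (by rw [h3]; exact hx)
    exact ⟨⟨e, hK.up e v h1 hv⟩, ⟨v, hv⟩, (Net.restrict_tgt _ _).2 h1, h2, h3⟩
  daimon v hv := h.daimon v.1 hv

end BoxNet.Inv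

/-! ## Adding a cell below some conclusions -/

/-- In `Net.addCell` the left input is the head of the list of inputs; this transports that mark
along an expansion, which is injective on conclusions. -/
theorem _root_.List.head?_pmap_eq_some_iff {α β : Type*} {P : α → Prop} {f : ∀ a, P a → β}
    {l : List α} {H : ∀ a ∈ l, P a} {a : α} {ha : P a}
    (hinj : ∀ i ∈ l, ∀ hi : P i, f i hi = f a ha → i = a) :
    l.head? = some a ↔ (l.pmap f H).head? = some (f a ha) := by
  cases l with
  | nil => simp
  | cons i l =>
    simp only [List.head?_cons, List.pmap_cons, Option.some.injEq]
    exact ⟨fun h => by subst h; rfl, hinj i List.mem_cons_self _⟩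

namespace Net

/-- The net `N` with a new cell of type `l`, with inputs the conclusions in `I` (the first one of
which is the left one), outputs indexed by `O`, and the conclusions in `c`. -/
noncomputable def addCell (N : Net) (l : Cell) (I : List N.E) {O : Type} (tyO : O → Formula)
    (c : List (N.E ⊕ O)) : Net where
  V := Option N.V
  E := N.E ⊕ O
  label v := v.elim l N.label
  ty := Sum.elim N.ty tyO
  src := Sum.elim (fun e => some (N.src e)) fun _ => none
  tgt := Sum.elim (fun e => open Classical in if e ∈ I then some none else (N.tgt e).map some)
    fun _ => none
  left := Sum.elim
    (fun e => open Classical in if e ∈ I then I.head? = some e else N.left e) fun _ => False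
  concl := c

section
variable {N : Net} {l : Cell} {I : List N.E} {O : Type} {tyO : O → Formula} {c : List (N.E ⊕ O)}

theorem addCell_tgt_none (g : N.E ⊕ O) :
    (N.addCell l I tyO c).tgt g = some none ↔ ∃ e ∈ I, g = Sum.inl e := by
  rcases g with g | g
  · by_cases h : g ∈ I
    · simp [addCell, h]
    · simp [addCell, h]
  · simp [addCell]

theorem addCell_tgt_pair {e f : N.E} (g : N.E ⊕ O) :
    (N.addCell l [e, f] tyO c).tgt g = some none ↔ g = Sum.inl e ∨ g = Sum.inl f :=
  (addCell_tgt_none g).trans (by simp)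

theorem addCell_tgt_some (hI : ∀ e ∈ I, N.tgt e = none) (g : N.E ⊕ O) (v : N.V) :
    (N.addCell l I tyO c).tgt g = some (some v) ↔ ∃ e, g = Sum.inl e ∧ N.tgt e = some v := by
  rcases g with g | g
  · by_cases h : g ∈ I
    · simp [addCell, h, hI g h]
    · simp [addCell, h]
  · simp [addCell]

theorem addCell_tgt_inl {e : N.E} (h : e ∉ I) :
    (N.addCell l I tyO c).tgt (Sum.inl e) = (N.tgt e).map some := by
  simp [addCell, h]

theorem addCell_cellOK (hN : N.WF) (hI : ∀ e ∈ I, N.tgt e = none) (v : N.V) :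
    (N.addCell l I tyO c).CellOK (some v) := by
  refine CellOK.transfer (M := N) (w := v) (fun e f => e = Sum.inl f) rfl ?_ ?_ ?_ ?_ ?_ ?_ ?_
    (hN.cell_ok _)
  · rintro _ _ _ rfl h; exact Sum.inl_injective h
  · rintro _ g rfl; rfl
  · rintro (g | g) h
    · exact ⟨g, rfl, Option.some.inj h⟩
    · cases h
  · intro g hg
    exact ⟨Sum.inl g, ⟨rfl, congrArg some hg⟩, fun f hf => hf.1⟩
  · intro g hg; exact (addCell_tgt_some hI _ _).1 hg
  · intro _ _ g hg
    exact ⟨Sum.inl g, ⟨rfl, (addCell_tgt_some hI _ _).2 ⟨g, rfl, hg⟩⟩, fun f hf => hf.1⟩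
  · rintro _ g rfl h _
    have : g ∉ I := fun hg => by
      rw [(addCell_tgt_none _).2 ⟨g, hg, rfl⟩] at h
      cases h
    simp [addCell, this]

end

end Net

/-- The conditions on the conclusions of the structure with a new cell. -/
structure Net.Addable (N : Net) (l : Cell) (I : List N.E) {O : Type} (tyO : O → Formula)
    (C : List N.E) (os : List O) : Prop where
  fin : Finite O
  concl : N.concl = C ++ I
  nodup : os.Nodup
  mem : ∀ o, o ∈ os
  cell : (N.addCell l I tyO (C.map Sum.inl ++ os.map Sum.inr)).CellOK none

theorem Net.Addable.wf {N : Net} {l : Cell} {I : List N.E} {O : Type} {tyO : O → Formula}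
    {C : List N.E} {os : List O} (h : N.Addable l I tyO C os) (hN : N.WF) :
    (N.addCell l I tyO (C.map Sum.inl ++ os.map Sum.inr)).WF := by
  have := hN.finite_V
  have := hN.finite_E
  have := h.fin
  have hnd := h.concl ▸ hN.concl_nodup
  have hmem : ∀ e, N.tgt e = none ↔ e ∈ C ∨ e ∈ I := fun e => by
    rw [← hN.mem_concl, h.concl, List.mem_append]
  refine ⟨(inferInstance : Finite (Option N.V)), (inferInstance : Finite (N.E ⊕ O)),
    ⟨(none : Option N.V)⟩, ?_, ?_, ?_⟩
  · refine List.Nodup.append (hnd.of_append_left.map Sum.inl_injective)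
      (h.nodup.map Sum.inr_injective) ?_
    intro x h1 h2
    obtain ⟨_, _, rfl⟩ := List.mem_map.1 h1
    obtain ⟨_, _, h3⟩ := List.mem_map.1 h2
    cases h3
  · change ∀ e, e ∈ C.map Sum.inl ++ os.map Sum.inr ↔ _
    rintro (e | o)
    · by_cases he : e ∈ I
      · have : e ∉ C := fun h' => (List.nodup_append.1 hnd).2.2 e h' e he rfl
        simp [Net.addCell, he, this]
      · simp [Net.addCell, he, hmem]
    · simp [Net.addCell, h.mem]
  · intro v
    rcases v with _ | v
    · exact h.cell
    · exact Net.addCell_cellOK hN (fun e he => (hmem e).2 (Or.inr he)) v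

namespace BoxNet

/-- The structure `R` with a new cell at the root. -/
noncomputable def addCell (R : BoxNet) {l : Cell} {I : List R.E} {O : Type} {tyO : O → Formula}
    {C : List R.E} {os : List O} (h : R.toNet.Addable l I tyO C os) (hl : l ≠ .bang) : BoxNet where
  toNet := R.toNet.addCell l I tyO (C.map Sum.inl ++ os.map Sum.inr)
  wf := h.wf R.wf
  tree := R.tree
  box v := v.elim R.tree.root R.box
  box_edge e v hv := by
    have hI : ∀ e ∈ I, R.tgt e = none := fun e he => by
      rw [← R.wf.mem_concl, h.concl]; exact List.mem_append_right _ he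
    rcases v with _ | v
    · exact R.tree.reach_root _
    · obtain ⟨e, rfl, he⟩ := (Net.addCell_tgt_some hI _ _).1 hv
      exact R.box_edge e v he
  box_tail e he := by
    rcases e with e | o
    · by_cases hI : e ∈ I
      · rw [(Net.addCell_tgt_none _).2 ⟨e, hI, rfl⟩] at he
        cases he
      · rw [Net.addCell_tgt_inl hI] at he
        exact R.box_tail e (Option.map_eq_none_iff.1 he)
    · rfl
  border e v hv hb := by
    have hI : ∀ e ∈ I, R.tgt e = none := fun e he => by
      rw [← R.wf.mem_concl, h.concl]; exact List.mem_append_right _ he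
    rcases v with _ | v
    · obtain ⟨e, he, rfl⟩ := (Net.addCell_tgt_none _).1 hv
      exact absurd (R.box_tail e (hI e he)) hb
    · obtain ⟨e, rfl, he⟩ := (Net.addCell_tgt_some hI _ _).1 hv
      exact R.border e v he hb
  door_inj e f v w hv hw hlv hlw h1 h2 h3 := by
    have hI : ∀ e ∈ I, R.tgt e = none := fun e he => by
      rw [← R.wf.mem_concl, h.concl]; exact List.mem_append_right _ he
    rcases v with _ | v
    · exact absurd hlv hl
    rcases w with _ | w
    · exact absurd hlw hl
    obtain ⟨e, rfl, he⟩ := (Net.addCell_tgt_some hI _ _).1 hv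
    obtain ⟨f, rfl, hf⟩ := (Net.addCell_tgt_some hI _ _).1 hw
    exact congrArg _ (R.door_inj e f v w he hf hlv hlw h1 h2 h3)

/-- The new cell lies at the root and is neither a `bang` nor a `daimon`. So the bijection between
doors and edges of the tree is unaffected, and no daimon, being in a box, gets company. -/
theorem IsMELL.addCell {R : BoxNet} (hR : R.IsMELL) {l : Cell} {I : List R.E} {O : Type}
    {tyO : O → Formula} {C : List R.E} {os : List O} (h : R.toNet.Addable l I tyO C os)
    (hl : l ≠ .bang) (hl' : l ≠ .daimon) : (R.addCell h hl).IsMELL := by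
  have hI : ∀ e ∈ I, R.tgt e = none := fun e he => by
    rw [← R.wf.mem_concl, h.concl]; exact List.mem_append_right _ he
  refine ⟨⟨fun v hv => ?_, fun e v he hv => ?_, fun x hx => ?_⟩, fun v hv => ?_⟩
  · rcases v with _ | v
    · exact absurd hv hl
    obtain ⟨e, he, hu⟩ := hR.1.1 v hv
    refine ⟨Sum.inl e, (Net.addCell_tgt_some hI _ _).2 ⟨e, rfl, he⟩, fun f hf => ?_⟩
    obtain ⟨g, rfl, hg⟩ := (Net.addCell_tgt_some hI _ _).1 hf
    exact congrArg _ (hu g hg)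
  · rcases v with _ | v
    · exact absurd hv hl
    obtain ⟨g, rfl, hg⟩ := (Net.addCell_tgt_some hI _ _).1 he
    exact hR.1.2.1 g v hg hv
  · obtain ⟨e, v, he, hv, hb⟩ := hR.1.2.2 x hx
    exact ⟨Sum.inl e, some v, (Net.addCell_tgt_some hI _ _).2 ⟨e, rfl, he⟩, hv, hb⟩
  · rcases v with _ | v
    · exact absurd hv hl'
    obtain ⟨h1, h2⟩ := hR.2 v hv
    refine ⟨fun w hw => ?_, h2⟩
    rcases w with _ | w
    · exact absurd hw.symm h2
    · exact congrArg some (h1 w hw)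

end BoxNet

/-- If removing a cell from `N` yields an expansion of `R`, then `N` is an expansion of `R` with a
cell added. -/
theorem Exp.addCell {N : Net} {w : N.V} {C I : List N.E} {O : Type} {os : List O} (out : O → N.E)
    {hs : ∀ e ∈ C ++ I, N.src e ∈ ({w}ᶜ : Set N.V)}
    {R : BoxNet} (E : Exp (N.restrict {w}ᶜ (C ++ I) hs) R) {tyO : O → Formula} {C' I' : List R.E}
    (h : R.toNet.Addable (N.label w) I' tyO C' os) (hl : N.label w ≠ .bang)
    (hlen : C.length = C'.length)
    (hc : N.concl = C ++ os.map out)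
    (hin : ∀ e, N.tgt e = some w ↔ e ∈ I)
    (hout : ∀ e, N.src e = w ↔ ∃ o, out o = e)
    (houtI : ∀ o, N.tgt (out o) = none)
    (hinj : Function.Injective out)
    (hty : ∀ o, N.ty (out o) = tyO o)
    (hleft : N.label w = .tensor ∨ N.label w = .par → ∀ e ∈ I, N.left e ↔ I.head? = some e) :
    Nonempty (Exp N (R.addCell h hl)) := by
  classical
  have hI : ∀ e ∈ I', R.tgt e = none := fun e he => by
    rw [← R.wf.mem_concl, h.concl]; exact List.mem_append_right _ he
  let p : N.V → Option R.V := fun v => if hv : v = w then none else some (E.p ⟨v, hv⟩)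
  let b : N.V → E.t.tree.Node := fun v => if hv : v = w then E.t.tree.root else E.b ⟨v, hv⟩
  let q : N.E → R.E ⊕ O := fun e =>
    if he : N.src e = w then Sum.inr ((hout e).1 he).choose else Sum.inl (E.q ⟨e, he⟩)
  have pw : p w = none := dif_pos rfl
  have bw : b w = E.t.tree.root := dif_pos rfl
  have pv : ∀ v (hv : v ≠ w), p v = some (E.p ⟨v, hv⟩) := fun v hv => dif_neg hv
  have bv : ∀ v (hv : v ≠ w), b v = E.b ⟨v, hv⟩ := fun v hv => dif_neg hv
  have qo : ∀ o, q (out o) = Sum.inr o := fun o => by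
    have h1 : N.src (out o) = w := (hout _).2 ⟨o, rfl⟩
    have h2 := ((hout _).1 h1).choose_spec
    exact (dif_pos h1).trans (congrArg Sum.inr (hinj h2))
  have qe : ∀ e (he : N.src e ≠ w), q e = Sum.inl (E.q ⟨e, he⟩) := fun e he => dif_neg he
  have ecases : ∀ e, (∃ o, e = out o) ∨ N.src e ≠ w := fun e => by
    by_cases he : N.src e = w
    · obtain ⟨o, rfl⟩ := (hout e).1 he; exact Or.inl ⟨o, rfl⟩
    · exact Or.inr he
  have srco : ∀ o, N.src (out o) = w := fun o => (hout _).2 ⟨o, rfl⟩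
  -- the images of the conclusions
  have hmap : (C ++ I).pmap (fun e he => E.q ⟨e, he⟩) hs = C' ++ I' := by
    rw [← h.concl, ← E.concl_q]
    simp [Net.restrict, List.map_pmap]
  rw [List.pmap_append] at hmap
  obtain ⟨hmC, hmI⟩ := List.append_inj hmap (by simp [hlen])
  -- Conclusions come from the root and have a single preimage, so the inputs of the added cell
  -- correspond to the inputs of `w` and to nothing else.
  have hEI : ∀ e (he : N.src e ≠ w), E.q ⟨e, he⟩ ∈ I' ↔ e ∈ I := by
    intro e he
    rw [← hmI, List.mem_pmap]
    constructor
    · rintro ⟨f, hf, hfe⟩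
      have h1 : f ∈ C ++ I := List.mem_append_right _ hf
      have h2 : (⟨f, hs f h1⟩ : (N.restrict {w}ᶜ (C ++ I) hs).E) ∈
        (N.restrict {w}ᶜ (C ++ I) hs).concl := (Net.mem_restrict_concl _).2 h1
      have h3 : R.tgt (E.q ⟨f, hs f h1⟩) = none := by
        rw [← R.wf.mem_concl, ← E.concl_q]; exact List.mem_map_of_mem h2
      have h4 : f = e := congrArg Subtype.val (E.q_inj hfe h3)
      exact h4 ▸ hf
    · intro hf; exact ⟨e, hf, rfl⟩
  have hIw : ∀ e ∈ I, N.src e ≠ w := fun e he => hs e (List.mem_append_right _ he)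
  have tgtv : ∀ e (he : N.src e ≠ w) v (hv : v ≠ w), N.tgt e = some v →
      (N.restrict {w}ᶜ (C ++ I) hs).tgt ⟨e, he⟩ = some ⟨v, hv⟩ := fun e he v hv h' =>
    (Net.restrict_tgt _ _).2 h'
  refine ⟨⟨E.t, p, b, q, ?_, ?_, ?_, ?_, ?_, ?_, ?_, ?_, ?_, ?_, ?_, ?_⟩⟩
  · intro v
    by_cases hv : v = w
    · subst hv; rw [pw, bw]; exact E.t.h_root.symm
    · rw [pv v hv, bv v hv]; exact E.box_p _
  · intro v v' h1 h2
    by_cases hv : v = w <;> by_cases hv' : v' = w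
    · rw [hv, hv']
    · subst hv; rw [pw, pv v' hv'] at h1; cases h1
    · subst hv'; rw [pw, pv v hv] at h1; cases h1
    · rw [pv v hv, pv v' hv'] at h1
      rw [bv v hv, bv v' hv'] at h2
      exact congrArg Subtype.val (E.inj _ _ (Option.some.inj h1) h2)
  · rintro (_ | v) x hx
    · exact ⟨w, pw, bw.trans (E.t.h_eq_root.1 hx.symm).symm⟩
    · obtain ⟨u, hu1, hu2⟩ := E.surj v x hx
      exact ⟨u.1, (pv u.1 u.2).trans (congrArg some hu1), (bv u.1 u.2).trans hu2⟩
  · intro e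
    rcases ecases e with ⟨o, rfl⟩ | he
    · rw [qo, srco, pw]; rfl
    · rw [qe e he, pv _ he]; exact congrArg some (E.src_q _)
  · intro e f h1 h2
    rcases ecases e with ⟨o, rfl⟩ | he <;> rcases ecases f with ⟨o', rfl⟩ | hf
    · rw [qo, qo] at h1; rw [Sum.inr_injective h1]
    · exact absurd (h2.symm.trans (srco o)) hf
    · exact absurd (h2.trans (srco o')) he
    · rw [qe e he, qe f hf] at h1
      exact congrArg Subtype.val (E.injE _ _ (Sum.inl_injective h1) (Subtype.ext h2))
  · rintro (e | o) v hv
    · by_cases hvw : v = w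
      · subst hvw; rw [pw] at hv; cases hv
      · rw [pv v hvw] at hv
        obtain ⟨f, hf1, hf2⟩ := E.surjE e ⟨v, hvw⟩ (Option.some.inj hv)
        exact ⟨f.1, (qe f.1 f.2).trans (congrArg Sum.inl hf1), congrArg Subtype.val hf2⟩
    · by_cases hvw : v = w
      · exact ⟨out o, qo o, (srco o).trans hvw.symm⟩
      · rw [pv v hvw] at hv; cases hv
  · intro e v hv
    rcases ecases e with ⟨o, rfl⟩ | he
    · rw [houtI] at hv; cases hv
    · rw [qe e he, bv _ he]
      by_cases hvw : v = w
      · subst hvw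
        rw [pw, bw]
        exact ⟨(Net.addCell_tgt_none _).2 ⟨_, (hEI e he).2 ((hin e).1 hv), rfl⟩,
          E.t.tree.reach_root _⟩
      · obtain ⟨h1, h2⟩ := E.tgt_q _ _ (tgtv e he v hvw hv)
        rw [pv v hvw, bv v hvw]
        exact ⟨(Net.addCell_tgt_some hI _ _).2 ⟨_, rfl, h1⟩, h2⟩
  · rintro e (_ | u) hu
    · obtain ⟨g, hg, hge⟩ := (Net.addCell_tgt_none _).1 hu
      rcases ecases e with ⟨o, rfl⟩ | he
      · rw [qo] at hge; cases hge
      · rw [qe e he] at hge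
        obtain rfl := Sum.inl_injective hge
        exact ⟨w, (hin e).2 ((hEI e he).1 hg)⟩
    · obtain ⟨g, hge, hg⟩ := (Net.addCell_tgt_some hI _ _).1 hu
      rcases ecases e with ⟨o, rfl⟩ | he
      · rw [qo] at hge; cases hge
      · rw [qe e he] at hge
        obtain rfl := Sum.inl_injective hge
        obtain ⟨v, hv⟩ := E.tgt_some _ _ hg
        exact ⟨v.1, (Net.restrict_tgt _ _).1 hv⟩
  · intro v
    by_cases hv : v = w
    · subst hv; rw [pw]; rfl
    · rw [pv v hv]; exact E.label_p ⟨v, hv⟩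
  · intro e
    rcases ecases e with ⟨o, rfl⟩ | he
    · rw [qo]; exact hty o
    · rw [qe e he]; exact E.ty_q ⟨e, he⟩
  · intro e v hv hlab
    rcases ecases e with ⟨o, rfl⟩ | he
    · rw [houtI] at hv; cases hv
    · rw [qe e he]
      by_cases hvw : v = w
      · subst hvw
        have h1 := (hin e).1 hv
        have h2 := (hEI e he).2 h1
        have h3 : (R.addCell h hl).left (Sum.inl (E.q ⟨e, he⟩)) ↔
            I'.head? = some (E.q ⟨e, he⟩) := by
          change (if _ then _ else _) ↔ _
          rw [if_pos h2]
        rw [h3, hleft hlab e h1]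
        rw [← hmI]
        exact List.head?_pmap_eq_some_iff (fun i _ hi h4 => congrArg Subtype.val
          (E.q_inj (e := ⟨i, hi⟩) (f := ⟨e, he⟩) h4 (h4 ▸ hI _ h2)))
      · have h1 := E.left_q _ _ (tgtv e he v hvw hv) hlab
        have h2 : E.q ⟨e, he⟩ ∉ I' := fun h' => by
          rw [hEI, ← hin, hv] at h'
          exact hvw (Option.some.inj h')
        refine h1.trans ?_
        change _ ↔ (if _ then _ else _)
        rw [if_neg h2]
  · change N.concl.map q = C'.map Sum.inl ++ os.map Sum.inr
    rw [hc, List.map_append, List.map_map, ← hmC, List.map_pmap]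
    congr 1
    · rw [← List.pmap_eq_map (p := fun e => N.src e ∈ ({w}ᶜ : Set N.V))
        (H := fun e he => hs e (List.mem_append_left _ he))]
      exact List.pmap_congr_left _ fun e _ he _ => qe e he
    · exact List.map_congr_left fun o _ => qo o

/-! ## Structures without boxes -/

theorem exists_bijective_map {α β : Type*} {l : List α} {m : List β} (hl : l.Nodup)
    (hm : m.Nodup) (hl' : ∀ a, a ∈ l) (hm' : ∀ b, b ∈ m) (h : l.length = m.length) :
    ∃ q : α → β, Function.Bijective q ∧ l.map q = m := by
  classical
  let e := (hl.getEquivOfForallMemList l hl').symm.trans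
    ((finCongr h).trans (hm.getEquivOfForallMemList m hm'))
  refine ⟨e, e.bijective, List.ext_getElem (by simpa using h) fun i h1 h2 => ?_⟩
  have h3 : i < l.length := by simpa using h1
  have h4 : (hl.getEquivOfForallMemList l hl').symm l[i] = ⟨i, h3⟩ := by
    rw [Equiv.symm_apply_eq]; rfl
  rw [List.getElem_map]
  simp only [e, Equiv.trans_apply, h4]
  rfl

/-- Components made of one cell without inputs are determined by their types. -/
theorem Net.IsHypothesis.iso {N M : Net} {l : Cell} (hN : N.WF) (hM : M.WF)
    (h : N.IsHypothesis l) (h' : M.IsHypothesis l) (ht : N.type = M.type) : Iso N M := by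
  obtain ⟨⟨v, hv, hvu⟩, hE⟩ := h
  obtain ⟨⟨w, hw, hwu⟩, hF⟩ := h'
  have hlen : N.concl.length = M.concl.length := by
    simpa [Net.type] using congrArg List.length ht
  obtain ⟨q, hq, hqc⟩ := exists_bijective_map hN.concl_nodup hM.concl_nodup
    (fun e => (hN.mem_concl e).2 (hE e)) (fun e => (hM.mem_concl e).2 (hF e)) hlen
  refine ⟨fun _ => w, q, fun a b _ => (hvu a).trans (hvu b).symm, hq.injective,
    Set.eq_univ_of_forall fun u => ⟨v, (hwu u).symm⟩, Set.range_eq_univ.2 hq.surjective,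
    fun u => by rw [hvu u, hv, hw], fun e => ?_, fun e => (hwu _).symm,
    fun e u => by simp [hE, hF], fun e u h => by simp [hE] at h, hqc⟩
  have h1 : List.map N.ty N.concl = List.map (fun e => M.ty (q e)) N.concl := by
    rw [← Net.type, ht, Net.type, ← hqc, List.map_map]; rfl
  exact List.map_inj_left.1 h1 e ((hN.mem_concl e).2 (hE e))

/-- A net, seen as a structure without boxes. -/
def BoxNet.flat (M : Net) (hM : M.WF) : BoxNet where
  toNet := M
  wf := hM
  tree := RTree.single
  box _ := ()
  box_edge _ _ _ := RTree.reach_refl _ _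
  box_tail _ _ := rfl
  border _ _ _ h := absurd rfl h
  door_inj e f v w _ _ _ _ h := by cases h

theorem BoxNet.flat_isMELL {M : Net} {hM : M.WF} (h : ∀ v, M.label v ≠ .bang)
    (h' : M.DaimonFree) : (flat M hM).IsMELL :=
  ⟨⟨fun v hv => absurd hv (h v), fun _ v _ hv => absurd hv (h v), fun _ hx => absurd rfl hx⟩,
    fun v hv => absurd hv (h' v)⟩

/-- A net is an expansion of itself. -/
def Exp.flat {M : Net} (hM : M.WF) : Exp M (BoxNet.flat M hM) where
  t := { tree := RTree.single, h := id, h_root := rfl, h_parent := fun _ _ h => by cases h }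
  p := id
  b _ := ()
  q := id
  box_p _ := rfl
  inj _ _ h _ := h
  surj v _ _ := ⟨v, rfl, rfl⟩
  src_q _ := rfl
  injE _ _ h _ := h
  surjE e _ h := ⟨e, rfl, h⟩
  tgt_q _ _ h := ⟨h, RTree.reach_refl _ _⟩
  tgt_some _ u h := ⟨u, h⟩
  label_p _ := rfl
  ty_q _ := rfl
  left_q _ _ _ _ := Iff.rfl
  concl_q := List.map_id _

/-! ## Inverting single steps -/

/-- `r` is empty or a MELL structure of type `G`. -/
def IsMELLOfType (r : Option BoxNet) (G : List Formula) : Prop :=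
  ∀ R, r = some R → R.IsMELL ∧ R.toNet.type = G

/-- If `N` is without daimon, then it is an expansion of `r`. -/
def ExpandsTo (N : Net) (r : Option BoxNet) : Prop :=
  N.DaimonFree → ∃ R, r = some R ∧ Nonempty (Exp N R)

/-- A single cell without inputs is determined by its label and its list of types. If one such net
of type `D` exists, it serves, as a structure without boxes, for all of them; if none exists, `none`
is vacuously right. -/
theorem exists_hypothesis (l : Cell) (hl : l ≠ .bang) (hl' : l ≠ .daimon) (D : List Formula) :
    ∃ r, IsMELLOfType r D ∧
      ∀ N : Net, N.WF → N.type = D → N.IsHypothesis l → ExpandsTo N r := by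
  by_cases h : ∃ M : Net, M.WF ∧ M.type = D ∧ M.IsHypothesis l
  · obtain ⟨M, hM, hMD, hMl⟩ := h
    have hlab : ∀ v, M.label v = l := fun v => by
      obtain ⟨⟨w, hw, hwu⟩, _⟩ := hMl
      rw [hwu v, hw]
    refine ⟨some (BoxNet.flat M hM), ?_, fun N hN hND hNl _ => ⟨_, rfl, ?_⟩⟩
    · rintro _ ⟨⟩
      exact ⟨BoxNet.flat_isMELL (fun v => by rw [hlab]; exact hl)
        fun v => by rw [hlab]; exact hl', hMD⟩
    · exact Exp.congr_iso (hNl.iso hN hM hMl (hND.trans hMD.symm)) ⟨Exp.flat hM⟩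
  · exact ⟨none, fun R hR => (by cases hR), fun N hN hND hNl => absurd ⟨N, hN, hND, hNl⟩ h⟩

theorem Sub.mem {N' N : Net} {K KE c} (h : Sub N' N K KE c) : ∀ e ∈ c, e ∈ KE := by
  obtain ⟨p, q, _, _, _, rq, _, _, _, _, _, hc⟩ := h
  intro e he
  rw [← hc] at he
  obtain ⟨f, _, rfl⟩ := List.mem_map.1 he
  rw [← rq]; exact ⟨f, rfl⟩

/-- Deleting a cell keeps exactly the outputs of the other cells, so the result of the step can be
traded for the standard restriction. -/
theorem Sub.iso_restrict {N' N : Net} {K KE c} (h : Sub N' N K KE c)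
    (hK : ∀ e, e ∈ KE ↔ N.src e ∈ K) : ∃ hs, Iso N' (N.restrict K c hs) := by
  obtain rfl : KE = {e | N.src e ∈ K} := Set.ext hK
  exact ⟨h.mem, h.iso Net.sub_restrict⟩

theorem Exp.congr_iso' {N M : Net} {R : BoxNet} (h : Iso N M) (E : Nonempty (Exp N R)) :
    Nonempty (Exp M R) := Exp.congr_iso h.symm E

namespace BoxNet

variable {R : BoxNet}

theorem exists_concl_append {G H : List Formula} (h : R.toNet.type = G ++ H) :
    ∃ C I, R.concl = C ++ I ∧ C.map R.ty = G ∧ I.map R.ty = H :=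
  List.map_eq_append_iff.1 h

/-- Inverting the deletion of a tensor or par cell. -/
theorem exists_binary (hR : R.IsMELL) (l : Cell) (op : Formula → Formula → Formula)
    (hl : l = .tensor ∧ op = .tensor ∨ l = .par ∧ op = .par) {D : List Formula} {A B : Formula}
    (hD : R.toNet.type = D ++ [A, B]) :
    ∃ R' : BoxNet, R'.IsMELL ∧ R'.toNet.type = D ++ [op A B] ∧
      ∀ (N N' : Net) (C : List N.E) (o e f : N.E), N.WF → N.concl = C ++ [o] →
        N.label (N.src o) = l → N.IsPairIn (N.src o) e f → N.left e →
        Sub N' N {N.src o}ᶜ {o}ᶜ (C ++ [e, f]) → Nonempty (Exp N' R) → Nonempty (Exp N R') := by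
  obtain ⟨C', I', hC', hCD, hI'⟩ := exists_concl_append hD
  obtain ⟨e', I1, rfl, he', hI1⟩ := List.map_eq_cons_iff.1 hI'
  obtain ⟨f', I2, rfl, hf', hI2⟩ := List.map_eq_cons_iff.1 hI1
  obtain rfl := List.map_eq_nil_iff.1 hI2
  have hne : e' ≠ f' := by
    have := R.wf.concl_nodup
    rw [hC', List.nodup_append] at this
    simpa using this.2.1
  have hl1 : l ≠ .bang := by rcases hl with ⟨rfl, _⟩ | ⟨rfl, _⟩ <;> simp
  have hl2 : l ≠ .daimon := by rcases hl with ⟨rfl, _⟩ | ⟨rfl, _⟩ <;> simp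
  have hA : R.toNet.Addable l [e', f'] (fun _ : Unit => op A B) C' [()] := by
    refine ⟨inferInstance, hC', by simp, by simp, ?_⟩
    have h1 : (R.toNet.addCell l [e', f'] (fun _ : Unit => op A B)
        (C'.map Sum.inl ++ [()].map Sum.inr)).IsPairIn none (Sum.inl e') (Sum.inl f') :=
      ⟨fun h => hne (Sum.inl_injective h), fun g =>
        Net.addCell_tgt_pair g⟩
    have h2 : (R.toNet.addCell l [e', f'] (fun _ : Unit => op A B)
        (C'.map Sum.inl ++ [()].map Sum.inr)).IsOut none (Sum.inr ()) := by
      rintro (g | g) <;> simp [Net.addCell]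
    have h3 : (R.toNet.addCell l [e', f'] (fun _ : Unit => op A B)
        (C'.map Sum.inl ++ [()].map Sum.inr)).left (Sum.inl e') := by simp [Net.addCell]
    have h4 : ¬ (R.toNet.addCell l [e', f'] (fun _ : Unit => op A B)
        (C'.map Sum.inl ++ [()].map Sum.inr)).left (Sum.inl f') := by simp [Net.addCell, hne]
    rcases hl with ⟨rfl, rfl⟩ | ⟨rfl, rfl⟩
    · refine ⟨_, _, _, h1, h3, h4, h2, ?_⟩
      simp [Net.addCell, he', hf']
    · refine ⟨_, _, _, h1, h3, h4, h2, ?_⟩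
      simp [Net.addCell, he', hf']
  refine ⟨R.addCell hA hl1, hR.addCell hA hl1 hl2, ?_, ?_⟩
  · rw [← hCD]
    simp [Net.type, addCell, Net.addCell]
  · intro N N' C o e f hN hc hv hi he hsub hE
    have hok := hN.cell_ok (N.src o)
    have hpair : ∃ e f o', N.IsPairIn (N.src o) e f ∧ N.left e ∧ ¬ N.left f ∧
        N.IsOut (N.src o) o' ∧ N.ty o' = op (N.ty e) (N.ty f) := by
      unfold Net.CellOK at hok
      rcases hl with ⟨rfl, rfl⟩ | ⟨rfl, rfl⟩ <;> rw [hv] at hok <;> exact hok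
    obtain ⟨e0, f0, o', hi0, he0, hf0, ho', hty⟩ := hpair
    obtain rfl : o = o' := (ho' o).1 rfl
    -- The left mark distinguishes the two inputs, so those named by the step are those named by the
    -- typing condition, in the same order.
    have hee : e = e0 := by
      rcases (hi0.2 e).1 ((hi.2 e).2 (Or.inl rfl)) with h | h
      · exact h
      · exact absurd (h ▸ he) hf0
    have hff : f = f0 := by
      rcases (hi0.2 f).1 ((hi.2 f).2 (Or.inr rfl)) with h | h
      · exact absurd (hee.trans h.symm) hi.1
      · exact h
    subst hee hff
    obtain ⟨hs, hiso⟩ := hsub.iso_restrict (fun g => (not_congr (ho' g)).symm)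
    obtain ⟨E⟩ := Exp.congr_iso' hiso hE
    have hcE := E.concl_q
    have hlen : C.length = C'.length := by
      have := congrArg List.length hcE
      simpa [Net.restrict, hC'] using this
    have hmap : (C ++ [e, f]).pmap (fun e he => E.q ⟨e, he⟩) hs = C' ++ [e', f'] := by
      rw [← hC', ← E.concl_q]
      simp [Net.restrict, List.map_pmap]
    rw [List.pmap_append] at hmap
    obtain ⟨_, hmI⟩ := List.append_inj hmap (by simp [hlen])
    simp only [List.pmap_cons, List.pmap_nil, List.cons.injEq, and_true] at hmI
    subst hv
    have hto : N.tgt o = none := (hN.mem_concl o).1 (by rw [hc]; simp)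
    refine Exp.addCell (fun _ : Unit => o) E hA hl1 hlen (by rw [hc]; rfl)
      (fun g => (hi.2 g).trans (by simp)) (fun g => (ho' g).trans (by simp [eq_comm]))
      (fun _ => hto) (fun _ _ _ => rfl) (fun _ => ?_) (fun _ g hg => ?_)
    · rw [hty, ← he', ← hf', ← hmI.1, ← hmI.2]
      exact congrArg₂ op (E.ty_q ⟨e, _⟩) (E.ty_q ⟨f, _⟩)
    · simp only [List.mem_cons, List.not_mem_nil, or_false] at hg
      rcases hg with rfl | rfl
      · simp [he]
      · simp [hf0, hi.1]

/-- Inverting the deletion of a unary `wn` cell. -/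
theorem exists_der (hR : R.IsMELL) {D : List Formula} {A : Formula}
    (hD : R.toNet.type = D ++ [A]) :
    ∃ R' : BoxNet, R'.IsMELL ∧ R'.toNet.type = D ++ [.wn A] ∧
      ∀ (N N' : Net) (C : List N.E) (o e : N.E), N.WF → N.concl = C ++ [o] →
        N.label (N.src o) = .wn → (∀ g, N.tgt g = some (N.src o) ↔ g = e) →
        Sub N' N {N.src o}ᶜ {o}ᶜ (C ++ [e]) → Nonempty (Exp N' R) → Nonempty (Exp N R') := by
  obtain ⟨C', I', hC', hCD, hI'⟩ := exists_concl_append hD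
  obtain ⟨e', I1, rfl, he', hI1⟩ := List.map_eq_cons_iff.1 hI'
  obtain rfl := List.map_eq_nil_iff.1 hI1
  have hA : R.toNet.Addable .wn [e'] (fun _ : Unit => .wn A) C' [()] := by
    refine ⟨inferInstance, hC', by simp, by simp, Sum.inr (), A, ?_, rfl, ?_⟩
    · rintro (g | g) <;> simp [Net.addCell]
    · intro g hg
      obtain ⟨g', h1, rfl⟩ := (Net.addCell_tgt_none _).1 hg
      rw [List.mem_singleton.1 h1]; exact he'
  refine ⟨R.addCell hA (by simp), hR.addCell hA (by simp) (by simp), ?_, ?_⟩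
  · rw [← hCD]
    simp [Net.type, addCell, Net.addCell]
  · intro N N' C o e hN hc hv hi hsub hE
    have hok := hN.cell_ok (N.src o)
    unfold Net.CellOK at hok
    rw [hv] at hok
    obtain ⟨o', A', ho', hty, hin⟩ := hok
    obtain rfl : o = o' := (ho' o).1 rfl
    obtain ⟨hs, hiso⟩ := hsub.iso_restrict (fun g => (not_congr (ho' g)).symm)
    obtain ⟨E⟩ := Exp.congr_iso' hiso hE
    have hcE := E.concl_q
    have hlen : C.length = C'.length := by
      have := congrArg List.length hcE
      simpa [Net.restrict, hC'] using this
    have hmap : (C ++ [e]).pmap (fun e he => E.q ⟨e, he⟩) hs = C' ++ [e'] := by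
      rw [← hC', ← E.concl_q]
      simp [Net.restrict, List.map_pmap]
    rw [List.pmap_append] at hmap
    obtain ⟨_, hmI⟩ := List.append_inj hmap (by simp [hlen])
    simp only [List.pmap_cons, List.pmap_nil, List.cons.injEq, and_true] at hmI
    have hto : N.tgt o = none := (hN.mem_concl o).1 (by rw [hc]; simp)
    rw [← hv] at hA
    have key := Exp.addCell (fun _ : Unit => o) E hA (by simp [hv]) hlen (by rw [hc]; rfl)
      (fun g => (hi g).trans (by simp)) (fun g => (ho' g).trans (by simp [eq_comm]))
      (fun _ => hto) (fun _ _ _ => rfl) (fun _ => ?_) (fun h => by simp [hv] at h)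
    · simp only [hv] at key
      exact key
    · rw [hty, ← he', ← hmI, ← hin e ((hi e).2 rfl)]
      exact congrArg _ (E.ty_q ⟨e, _⟩)

/-- Inverting the deletion of a cut. -/
theorem exists_cut (hR : R.IsMELL) {D : List Formula} {A : Formula}
    (hD : R.toNet.type = D ++ [A, A.dual]) :
    ∃ R' : BoxNet, R'.IsMELL ∧ R'.toNet.type = D ∧
      ∀ (N N' : Net) (v : N.V) (e f : N.E), N.WF →
        N.label v = .cut → N.IsPairIn v e f →
        Sub N' N {v}ᶜ Set.univ (N.concl ++ [e, f]) → Nonempty (Exp N' R) →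
        Nonempty (Exp N R') := by
  obtain ⟨C', I', hC', hCD, hI'⟩ := exists_concl_append hD
  obtain ⟨e', I1, rfl, he', hI1⟩ := List.map_eq_cons_iff.1 hI'
  obtain ⟨f', I2, rfl, hf', hI2⟩ := List.map_eq_cons_iff.1 hI1
  obtain rfl := List.map_eq_nil_iff.1 hI2
  have hne : e' ≠ f' := by
    have := R.wf.concl_nodup
    rw [hC', List.nodup_append] at this
    simpa using this.2.1
  have hA : R.toNet.Addable .cut [e', f'] (fun x : Empty => x.elim) C' [] := by
    -- The conclusions have types `A, A.dual`, whereas `CellOK` wants the first input to be dual to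
    -- the second; hence the inputs are listed in the opposite order.
    refine ⟨inferInstance, hC', by simp, by simp, ?_, Sum.inl f', Sum.inl e', ⟨?_, ?_⟩, ?_⟩
    · rintro (g | g) <;> simp [Net.addCell]
      cases g
    · exact fun h => hne (Sum.inl_injective h).symm
    · exact fun g => (Net.addCell_tgt_pair g).trans or_comm
    · exact hf'.trans (congrArg _ he'.symm)
  refine ⟨R.addCell hA (by simp), hR.addCell hA (by simp) (by simp), ?_, ?_⟩
  · rw [← hCD]
    simp [Net.type, addCell, Net.addCell]
  · intro N N' v e f hN hv hi hsub hE
    have hok := hN.cell_ok v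
    unfold Net.CellOK at hok
    rw [hv] at hok
    obtain ⟨hno, _⟩ := hok
    obtain ⟨hs, hiso⟩ := hsub.iso_restrict (fun g => iff_of_true trivial (hno g))
    obtain ⟨E⟩ := Exp.congr_iso' hiso hE
    have hcE := E.concl_q
    have hlen : N.concl.length = C'.length := by
      have := congrArg List.length hcE
      simpa [Net.restrict, hC'] using this
    rw [← hv] at hA
    have key := Exp.addCell (fun x : Empty => x.elim) E hA (by simp [hv]) hlen (by simp)
      (fun g => (hi.2 g).trans (by simp)) (fun g => iff_of_false (hno g) (by simp))
      (fun x => x.elim) (fun x => x.elim) (fun x => x.elim) (fun h => by simp [hv] at h)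
    simp only [hv] at key
    exact key

/-- Inverting an exchange. -/
theorem exists_exc (hR : R.IsMELL) {D D' : List Formula} {A B : Formula}
    (hD : R.toNet.type = D ++ B :: A :: D') :
    ∃ R' : BoxNet, R'.IsMELL ∧ R'.toNet.type = D ++ A :: B :: D' ∧
      ∀ (N N' : Net) (C : List N.E) (e f : N.E) (C' : List N.E), N.concl = C ++ e :: f :: C' →
        C.length = D.length → Sub N' N Set.univ Set.univ (C ++ f :: e :: C') →
        Nonempty (Exp N' R) → Nonempty (Exp N R') := by
  obtain ⟨K, I, hK, hKD, hI⟩ := exists_concl_append hD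
  obtain ⟨f', I1, rfl, hf', hI1⟩ := List.map_eq_cons_iff.1 hI
  obtain ⟨e', I2, rfl, he', hI2⟩ := List.map_eq_cons_iff.1 hI1
  have hp : (K ++ e' :: f' :: I2).Perm R.concl := by
    rw [hK]; exact (List.Perm.swap _ _ _).append_left _
  refine ⟨R.reconcl _ hp, hR, ?_, ?_⟩
  · rw [← hKD, ← hI2, ← he', ← hf']
    simp [Net.type, reconcl, Net.reconcl]
  · intro N N' C e f C' hc hC hsub hE
    obtain ⟨E⟩ := Exp.congr_iso' (hsub.iso (N.sub_reconcl _)) hE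
    refine ⟨E.reconcl _ hp N.concl ?_⟩
    let q : N.E → R.E := E.q
    change N.concl.map q = _
    have h1 : (C ++ f :: e :: C').map q = K ++ f' :: e' :: I2 := E.concl_q.trans hK
    rw [List.map_append] at h1
    obtain ⟨h2, h3⟩ := List.append_inj h1 (by rw [List.length_map, hC, ← hKD, List.length_map])
    simp only [List.map_cons, List.cons.injEq] at h3
    rw [hc, List.map_append, h2]
    exact congrArg _ (congrArg₂ _ h3.2.1 (congrArg₂ _ h3.1 h3.2.2))

end BoxNet

/-! ## Gluing two structures at their roots -/

/-- The disjoint union of two nets. -/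
def Net.union (N M : Net) : Net where
  V := N.V ⊕ M.V
  E := N.E ⊕ M.E
  label := Sum.elim N.label M.label
  ty := Sum.elim N.ty M.ty
  src := Sum.map N.src M.src
  tgt := Sum.elim (fun e => (N.tgt e).map Sum.inl) fun e => (M.tgt e).map Sum.inr
  left := Sum.elim N.left M.left
  concl := N.concl.map Sum.inl ++ M.concl.map Sum.inr

namespace Net

section
variable {N M : Net}

theorem union_tgt_inl (g : N.E ⊕ M.E) (v : N.V) :
    (N.union M).tgt g = some (Sum.inl v) ↔ ∃ e, g = Sum.inl e ∧ N.tgt e = some v := by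
  rcases g with g | g <;> simp [union]

theorem union_tgt_inr (g : N.E ⊕ M.E) (v : M.V) :
    (N.union M).tgt g = some (Sum.inr v) ↔ ∃ e, g = Sum.inr e ∧ M.tgt e = some v := by
  rcases g with g | g <;> simp [union]

theorem WF.union (hN : N.WF) (hM : M.WF) : (N.union M).WF := by
  have := hN.finite_V
  have := hN.finite_E
  have := hM.finite_V
  have := hM.finite_E
  refine ⟨(inferInstance : Finite (N.V ⊕ M.V)), (inferInstance : Finite (N.E ⊕ M.E)),
    hN.nonempty.map Sum.inl, ?_, ?_, ?_⟩
  · refine List.Nodup.append (hN.concl_nodup.map Sum.inl_injective)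
      (hM.concl_nodup.map Sum.inr_injective) ?_
    intro x h1 h2
    obtain ⟨_, _, rfl⟩ := List.mem_map.1 h1
    obtain ⟨_, _, h3⟩ := List.mem_map.1 h2
    cases h3
  · suffices h : ∀ e : N.E ⊕ M.E, e ∈ N.concl.map Sum.inl ++ M.concl.map Sum.inr ↔
        (N.union M).tgt e = none from h
    rintro (e | e)
    · simp [Net.union, hN.mem_concl]
    · simp [Net.union, hM.mem_concl]
  · rintro (v | v)
    · refine CellOK.transfer (M := N) (w := v) (fun e f => e = Sum.inl f) rfl ?_ ?_ ?_ ?_ ?_ ?_ ?_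
        (hN.cell_ok _)
      · rintro _ _ _ rfl h; exact Sum.inl_injective h
      · rintro _ g rfl; rfl
      · rintro (g | g) h
        · exact ⟨g, rfl, Sum.inl_injective h⟩
        · cases h
      · intro g hg
        exact ⟨Sum.inl g, ⟨rfl, congrArg Sum.inl hg⟩, fun f hf => hf.1⟩
      · intro g hg; exact (union_tgt_inl _ _).1 hg
      · intro _ _ g hg
        exact ⟨Sum.inl g, ⟨rfl, (union_tgt_inl _ _).2 ⟨g, rfl, hg⟩⟩, fun f hf => hf.1⟩
      · rintro _ g rfl h _; rfl
    · refine CellOK.transfer (M := M) (w := v) (fun e f => e = Sum.inr f) rfl ?_ ?_ ?_ ?_ ?_ ?_ ?_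
        (hM.cell_ok _)
      · rintro _ _ _ rfl h; exact Sum.inr_injective h
      · rintro _ g rfl; rfl
      · rintro (g | g) h
        · cases h
        · exact ⟨g, rfl, Sum.inr_injective h⟩
      · intro g hg
        exact ⟨Sum.inr g, ⟨rfl, congrArg Sum.inr hg⟩, fun f hf => hf.1⟩
      · intro g hg; exact (union_tgt_inr _ _).1 hg
      · intro _ _ g hg
        exact ⟨Sum.inr g, ⟨rfl, (union_tgt_inr _ _).2 ⟨g, rfl, hg⟩⟩, fun f hf => hf.1⟩
      · rintro _ g rfl h _; rfl

end

end Net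

namespace BoxNet

/-- The union of two structures, which share their roots. -/
noncomputable def union (R S : BoxNet) : BoxNet where
  toNet := R.toNet.union S.toNet
  wf := R.wf.union S.wf
  tree := R.tree.wedge S.tree
  box := Sum.elim (fun v => RTree.inl (R.box v)) fun v => RTree.inr (S.box v)
  box_edge e v hv := by
    rcases v with v | v
    · obtain ⟨e, rfl, he⟩ := (Net.union_tgt_inl _ _).1 hv
      exact RTree.reach_inl (R.box_edge e v he)
    · obtain ⟨e, rfl, he⟩ := (Net.union_tgt_inr _ _).1 hv
      exact RTree.reach_inr (S.box_edge e v he)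
  box_tail e he := by
    rcases e with e | e
    · exact congrArg RTree.inl (R.box_tail e (Option.map_eq_none_iff.1 he))
    · exact congrArg RTree.inr (S.box_tail e (Option.map_eq_none_iff.1 he))
  border e v hv hb := by
    rcases v with v | v
    · obtain ⟨e, rfl, he⟩ := (Net.union_tgt_inl _ _).1 hv
      exact R.border e v he fun h => hb (congrArg RTree.inl h)
    · obtain ⟨e, rfl, he⟩ := (Net.union_tgt_inr _ _).1 hv
      exact S.border e v he fun h => hb (congrArg RTree.inr h)
  door_inj e f v w hv hw hlv hlw h1 h2 h3 := by
    rcases v with v | v <;> rcases w with w | w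
    · obtain ⟨e, rfl, he⟩ := (Net.union_tgt_inl _ _).1 hv
      obtain ⟨f, rfl, hf⟩ := (Net.union_tgt_inl _ _).1 hw
      have h1' := (RTree.parent_inl _).symm.trans h1
      have h2' := (RTree.parent_inl _).symm.trans h2
      obtain ⟨x, hx, hx'⟩ := Option.map_eq_some_iff.1 h1'
      obtain ⟨y, hy, hy'⟩ := Option.map_eq_some_iff.1 h2'
      rw [RTree.inl_inj.1 hx'] at hx
      rw [RTree.inl_inj.1 hy'] at hy
      exact congrArg Sum.inl (R.door_inj e f v w he hf hlv hlw hx hy (RTree.inl_inj.1 h3))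
    · obtain ⟨e, rfl, he⟩ := (Net.union_tgt_inl _ _).1 hv
      obtain ⟨f, rfl, hf⟩ := (Net.union_tgt_inr _ _).1 hw
      have h4 := (RTree.inl_eq_inr.1 h3).1
      have h1' := (RTree.parent_inl _).symm.trans h1
      rw [h4, R.tree.parent_root] at h1'
      cases h1'
    · obtain ⟨e, rfl, he⟩ := (Net.union_tgt_inr _ _).1 hv
      obtain ⟨f, rfl, hf⟩ := (Net.union_tgt_inl _ _).1 hw
      have h4 := (RTree.inl_eq_inr.1 h3.symm).1
      have h2' := (RTree.parent_inl _).symm.trans h2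
      rw [h4, R.tree.parent_root] at h2'
      cases h2'
    · obtain ⟨e, rfl, he⟩ := (Net.union_tgt_inr _ _).1 hv
      obtain ⟨f, rfl, hf⟩ := (Net.union_tgt_inr _ _).1 hw
      have h1' := (RTree.parent_inr _).symm.trans h1
      have h2' := (RTree.parent_inr _).symm.trans h2
      obtain ⟨x, hx, hx'⟩ := Option.map_eq_some_iff.1 h1'
      obtain ⟨y, hy, hy'⟩ := Option.map_eq_some_iff.1 h2'
      rw [RTree.inr_inj.1 hx'] at hx
      rw [RTree.inr_inj.1 hy'] at hy
      exact congrArg Sum.inr (S.door_inj e f v w he hf hlv hlw hx hy (RTree.inr_inj.1 h3))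

theorem IsMELL.union {R S : BoxNet} (hR : R.IsMELL) (hS : S.IsMELL) : (R.union S).IsMELL := by
  refine ⟨⟨?_, ?_, ?_⟩, ?_⟩
  · rintro (v | v) hv
    · obtain ⟨e, he, hu⟩ := hR.1.1 v hv
      refine ⟨Sum.inl e, (Net.union_tgt_inl _ _).2 ⟨e, rfl, he⟩, fun f hf => ?_⟩
      obtain ⟨g, rfl, hg⟩ := (Net.union_tgt_inl _ _).1 hf
      exact congrArg _ (hu g hg)
    · obtain ⟨e, he, hu⟩ := hS.1.1 v hv
      refine ⟨Sum.inr e, (Net.union_tgt_inr _ _).2 ⟨e, rfl, he⟩, fun f hf => ?_⟩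
      obtain ⟨g, rfl, hg⟩ := (Net.union_tgt_inr _ _).1 hf
      exact congrArg _ (hu g hg)
  · rintro e (v | v) he hv
    · obtain ⟨g, rfl, hg⟩ := (Net.union_tgt_inl _ _).1 he
      exact (RTree.parent_inl _).trans (congrArg _ (hR.1.2.1 g v hg hv))
    · obtain ⟨g, rfl, hg⟩ := (Net.union_tgt_inr _ _).1 he
      exact (RTree.parent_inr _).trans (congrArg _ (hS.1.2.1 g v hg hv))
  · intro x hx
    rcases RTree.wedge_cases x with ⟨y, rfl⟩ | ⟨y, rfl⟩
    · obtain ⟨e, v, he, hv, hb⟩ := hR.1.2.2 y fun h => hx (congrArg RTree.inl h)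
      exact ⟨Sum.inl e, Sum.inl v, (Net.union_tgt_inl _ _).2 ⟨e, rfl, he⟩, hv,
        congrArg RTree.inl hb⟩
    · obtain ⟨e, v, he, hv, hb⟩ := hS.1.2.2 y fun h => hx (congrArg RTree.inr h)
      exact ⟨Sum.inr e, Sum.inr v, (Net.union_tgt_inr _ _).2 ⟨e, rfl, he⟩, hv,
        congrArg RTree.inr hb⟩
  · rintro (v | v) hv
    · obtain ⟨h1, h2⟩ := hR.2 v hv
      refine ⟨?_, fun h => h2 (RTree.inl_inj.1 h)⟩
      rintro (w | w) hw
      · exact congrArg _ (h1 w (RTree.inl_inj.1 hw))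
      · exact absurd (RTree.inl_eq_inr.1 hw.symm).1 h2
    · obtain ⟨h1, h2⟩ := hS.2 v hv
      refine ⟨?_, fun h => h2 (RTree.inr_inj.1 h)⟩
      rintro (w | w) hw
      · exact absurd (RTree.inl_eq_inr.1 hw).2 h2
      · exact congrArg _ (h1 w (RTree.inr_inj.1 hw))

end BoxNet

/-- The thick subtree glued from two thick subtrees. -/
noncomputable def Thick.wedge {T U : RTree} (t : Thick T) (u : Thick U) : Thick (T.wedge U) where
  tree := t.tree.wedge u.tree
  h x := ⟨(t.h x.1.1, u.h x.1.2), x.2.imp (fun h => by rw [h, t.h_root])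
    fun h => by rw [h, u.h_root]⟩
  h_root := Subtype.ext (Prod.ext t.h_root u.h_root)
  h_parent x y hxy := by
    have hl : ∀ x : t.tree.Node, (⟨(t.h x, u.h u.tree.root), Or.inr u.h_root⟩ :
        {x : T.Node × U.Node // x.1 = T.root ∨ x.2 = U.root}) = RTree.inl (t.h x) := fun x =>
      Subtype.ext (Prod.ext rfl u.h_root)
    have hr : ∀ x : u.tree.Node, (⟨(t.h t.tree.root, u.h x), Or.inl t.h_root⟩ :
        {x : T.Node × U.Node // x.1 = T.root ∨ x.2 = U.root}) = RTree.inr (u.h x) := fun x =>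
      Subtype.ext (Prod.ext t.h_root rfl)
    rcases RTree.wedge_cases x with ⟨x, rfl⟩ | ⟨x, rfl⟩
    · rw [RTree.parent_inl, Option.map_eq_some_iff] at hxy
      obtain ⟨z, hz, rfl⟩ := hxy
      exact (congrArg _ (hl x)).trans ((RTree.parent_inl _).trans
        ((congrArg _ (t.h_parent _ _ hz)).trans (congrArg some (hl z).symm)))
    · rw [RTree.parent_inr, Option.map_eq_some_iff] at hxy
      obtain ⟨z, hz, rfl⟩ := hxy
      exact (congrArg _ (hr x)).trans ((RTree.parent_inr _).trans
        ((congrArg _ (u.h_parent _ _ hz)).trans (congrArg some (hr z).symm)))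

theorem Thick.wedge_inl {T U : RTree} (t : Thick T) (u : Thick U) (x : t.tree.Node) :
    (t.wedge u).h (RTree.inl x) = RTree.inl (t.h x) :=
  Subtype.ext (Prod.ext rfl u.h_root)

theorem Thick.wedge_inr {T U : RTree} (t : Thick T) (u : Thick U) (x : u.tree.Node) :
    (t.wedge u).h (RTree.inr x) = RTree.inr (u.h x) :=
  Subtype.ext (Prod.ext t.h_root rfl)

/-- If both parts of a net are expansions, then the net is an expansion of the union. -/
theorem Exp.union {N : Net} {S : Set N.V} {C₁ C₂ : List N.E}
    {hs₁ : ∀ e ∈ C₁, N.src e ∈ S} {hs₂ : ∀ e ∈ C₂, N.src e ∈ Sᶜ} {R₁ R₂ : BoxNet}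
    (E₁ : Exp (N.restrict S C₁ hs₁) R₁) (E₂ : Exp (N.restrict Sᶜ C₂ hs₂) R₂)
    (hS : ∀ e v, N.tgt e = some v → (N.src e ∈ S ↔ v ∈ S)) (hc : N.concl = C₁ ++ C₂) :
    Nonempty (Exp N (R₁.union R₂)) := by
  classical
  let p : N.V → R₁.V ⊕ R₂.V := fun v =>
    if h : v ∈ S then Sum.inl (E₁.p ⟨v, h⟩) else Sum.inr (E₂.p ⟨v, h⟩)
  let b : N.V → (E₁.t.tree.wedge E₂.t.tree).Node := fun v =>
    if h : v ∈ S then RTree.inl (E₁.b ⟨v, h⟩) else RTree.inr (E₂.b ⟨v, h⟩)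
  let q : N.E → R₁.E ⊕ R₂.E := fun e =>
    if h : N.src e ∈ S then Sum.inl (E₁.q ⟨e, h⟩) else Sum.inr (E₂.q ⟨e, h⟩)
  have p1 : ∀ v (h : v ∈ S), p v = Sum.inl (E₁.p ⟨v, h⟩) := fun v h => dif_pos h
  have p2 : ∀ v (h : v ∉ S), p v = Sum.inr (E₂.p ⟨v, h⟩) := fun v h => dif_neg h
  have b1 : ∀ v (h : v ∈ S), b v = RTree.inl (E₁.b ⟨v, h⟩) := fun v h => dif_pos h
  have b2 : ∀ v (h : v ∉ S), b v = RTree.inr (E₂.b ⟨v, h⟩) := fun v h => dif_neg h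
  have q1 : ∀ e (h : N.src e ∈ S), q e = Sum.inl (E₁.q ⟨e, h⟩) := fun v h => dif_pos h
  have q2 : ∀ e (h : N.src e ∉ S), q e = Sum.inr (E₂.q ⟨e, h⟩) := fun v h => dif_neg h
  have t1 : ∀ e (he : N.src e ∈ S) v (hv : v ∈ S), N.tgt e = some v →
      (N.restrict S C₁ hs₁).tgt ⟨e, he⟩ = some ⟨v, hv⟩ := fun e he v hv h' =>
    (Net.restrict_tgt _ _).2 h'
  have t2 : ∀ e (he : N.src e ∈ Sᶜ) v (hv : v ∈ Sᶜ), N.tgt e = some v →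
      (N.restrict Sᶜ C₂ hs₂).tgt ⟨e, he⟩ = some ⟨v, hv⟩ := fun e he v hv h' =>
    (Net.restrict_tgt _ _).2 h'
  refine ⟨⟨E₁.t.wedge E₂.t, p, b, q, ?_, ?_, ?_, ?_, ?_, ?_, ?_, ?_, ?_, ?_, ?_, ?_⟩⟩
  · intro v
    by_cases h : v ∈ S
    · rw [p1 v h, b1 v h, Thick.wedge_inl]; exact congrArg RTree.inl (E₁.box_p _)
    · rw [p2 v h, b2 v h, Thick.wedge_inr]; exact congrArg RTree.inr (E₂.box_p _)
  · intro v w hp hb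
    by_cases h : v ∈ S <;> by_cases h' : w ∈ S
    · rw [p1 v h, p1 w h'] at hp
      rw [b1 v h, b1 w h'] at hb
      exact congrArg Subtype.val (E₁.inj _ _ (Sum.inl_injective hp) (RTree.inl_inj.1 hb))
    · rw [p1 v h, p2 w h'] at hp; cases hp
    · rw [p2 v h, p1 w h'] at hp; cases hp
    · rw [p2 v h, p2 w h'] at hp
      rw [b2 v h, b2 w h'] at hb
      exact congrArg Subtype.val (E₂.inj _ _ (Sum.inr_injective hp) (RTree.inr_inj.1 hb))
  · rintro (v | v) x hx
    -- A node of the second tree can lie over a node of the first one only if both are the root, and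
    -- the root belongs to the first tree as well.
    · have : ∃ y, x = RTree.inl y ∧ R₁.box v = E₁.t.h y := by
        rcases RTree.wedge_cases x with ⟨y, rfl⟩ | ⟨y, rfl⟩
        · rw [Thick.wedge_inl] at hx; exact ⟨y, rfl, RTree.inl_inj.1 hx⟩
        · rw [Thick.wedge_inr] at hx
          obtain ⟨h1, h2⟩ := RTree.inl_eq_inr.1 hx
          rw [E₂.t.h_eq_root] at h2
          exact ⟨E₁.t.tree.root, by rw [h2]; rfl, by rw [h1, E₁.t.h_root]⟩
      obtain ⟨y, rfl, hy⟩ := this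
      obtain ⟨w, hw1, hw2⟩ := E₁.surj v y hy
      exact ⟨w.1, (p1 w.1 w.2).trans (congrArg _ hw1), (b1 w.1 w.2).trans (congrArg _ hw2)⟩
    · have : ∃ y, x = RTree.inr y ∧ R₂.box v = E₂.t.h y := by
        rcases RTree.wedge_cases x with ⟨y, rfl⟩ | ⟨y, rfl⟩
        · rw [Thick.wedge_inl] at hx
          obtain ⟨h1, h2⟩ := RTree.inl_eq_inr.1 hx.symm
          rw [E₁.t.h_eq_root] at h1
          exact ⟨E₂.t.tree.root, by rw [h1]; rfl, by rw [h2, E₂.t.h_root]⟩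
        · rw [Thick.wedge_inr] at hx; exact ⟨y, rfl, RTree.inr_inj.1 hx⟩
      obtain ⟨y, rfl, hy⟩ := this
      obtain ⟨w, hw1, hw2⟩ := E₂.surj v y hy
      exact ⟨w.1, (p2 w.1 w.2).trans (congrArg _ hw1), (b2 w.1 w.2).trans (congrArg _ hw2)⟩
  · intro e
    by_cases h : N.src e ∈ S
    · rw [q1 e h, p1 _ h]; exact congrArg Sum.inl (E₁.src_q _)
    · rw [q2 e h, p2 _ h]; exact congrArg Sum.inr (E₂.src_q _)
  · intro e f h1 h2
    by_cases h : N.src e ∈ S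
    · rw [q1 e h, q1 f (h2 ▸ h)] at h1
      exact congrArg Subtype.val (E₁.injE _ _ (Sum.inl_injective h1) (Subtype.ext h2))
    · rw [q2 e h, q2 f (h2 ▸ h)] at h1
      exact congrArg Subtype.val (E₂.injE _ _ (Sum.inr_injective h1) (Subtype.ext h2))
  · intro e w hw
    by_cases h : w ∈ S
    · rw [p1 w h] at hw
      rcases e with e | e
      · obtain ⟨f, hf1, hf2⟩ := E₁.surjE e ⟨w, h⟩ (Sum.inl_injective hw)
        exact ⟨f.1, (q1 f.1 f.2).trans (congrArg _ hf1), congrArg Subtype.val hf2⟩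
      · cases hw
    · rw [p2 w h] at hw
      rcases e with e | e
      · cases hw
      · obtain ⟨f, hf1, hf2⟩ := E₂.surjE e ⟨w, h⟩ (Sum.inr_injective hw)
        exact ⟨f.1, (q2 f.1 f.2).trans (congrArg _ hf1), congrArg Subtype.val hf2⟩
  · intro e v hv
    by_cases h : N.src e ∈ S
    · have h' := (hS e v hv).1 h
      rw [q1 e h, p1 v h', b1 v h', b1 _ h]
      obtain ⟨h1, h2⟩ := E₁.tgt_q _ _ (t1 e h v h' hv)
      exact ⟨(Net.union_tgt_inl _ _).2 ⟨_, rfl, h1⟩, RTree.reach_inl h2⟩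
    · have h' := fun hh => h ((hS e v hv).2 hh)
      rw [q2 e h, p2 v h', b2 v h', b2 _ h]
      obtain ⟨h1, h2⟩ := E₂.tgt_q _ _ (t2 e h v h' hv)
      exact ⟨(Net.union_tgt_inr _ _).2 ⟨_, rfl, h1⟩, RTree.reach_inr h2⟩
  · intro e u hu
    by_cases h : N.src e ∈ S
    · rw [q1 e h] at hu
      obtain ⟨u', hu', _⟩ := Option.map_eq_some_iff.1 hu
      obtain ⟨v, hv⟩ := E₁.tgt_some _ _ hu'
      exact ⟨v.1, (Net.restrict_tgt _ _).1 hv⟩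
    · rw [q2 e h] at hu
      obtain ⟨u', hu', _⟩ := Option.map_eq_some_iff.1 hu
      obtain ⟨v, hv⟩ := E₂.tgt_some _ _ hu'
      exact ⟨v.1, (Net.restrict_tgt _ _).1 hv⟩
  · intro v
    by_cases h : v ∈ S
    · rw [p1 v h]; exact E₁.label_p ⟨v, h⟩
    · rw [p2 v h]; exact E₂.label_p ⟨v, h⟩
  · intro e
    by_cases h : N.src e ∈ S
    · rw [q1 e h]; exact E₁.ty_q ⟨e, h⟩
    · rw [q2 e h]; exact E₂.ty_q ⟨e, h⟩
  · intro e v hv hl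
    by_cases h : N.src e ∈ S
    · rw [q1 e h]
      exact E₁.left_q _ _ (t1 e h v ((hS e v hv).1 h) hv) hl
    · rw [q2 e h]
      exact E₂.left_q _ _ (t2 e h v (fun hh => h ((hS e v hv).2 hh)) hv) hl
  · suffices h : N.concl.map q = R₁.concl.map Sum.inl ++ R₂.concl.map Sum.inr from h
    rw [hc, List.map_append, ← E₁.concl_q, ← E₂.concl_q, ← List.pmap_eq_map (H := hs₁),
      ← List.pmap_eq_map (H := hs₂)]
    simp only [Net.restrict, List.map_pmap]
    congr 1
    · exact List.pmap_congr_left _ fun e _ h _ => q1 e h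
    · exact List.pmap_congr_left _ fun e _ h _ => q2 e h

/-! ## Merging two `wn` cells -/

namespace Net

theorem CellOK.wn {N : Net} {v : N.V} (h : N.CellOK v) (hv : N.label v = .wn) :
    ∃ o A, N.IsOut v o ∧ N.ty o = .wn A ∧ ∀ g, N.tgt g = some v → N.ty g = A := by
  unfold CellOK at h
  rwa [hv] at h

/-- The condition for merging the cells `v` and `w`, where `f` is the output of `w`. -/
structure Mergeable (N : Net) (C : List N.E) (e f : N.E) : Prop where
  concl : N.concl = C ++ [e, f]
  left : N.label (N.src e) = .wn
  right : N.label (N.src f) = .wn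
  ty : N.ty e = N.ty f

theorem WF.isOut_wn {N : Net} (hN : N.WF) {g : N.E} (hg : N.label (N.src g) = .wn) :
    N.IsOut (N.src g) g := by
  obtain ⟨o, _, ho, _⟩ := (hN.cell_ok (N.src g)).wn hg
  obtain rfl := (ho g).1 rfl
  exact ho

theorem Mergeable.ne {N : Net} {C : List N.E} {e f : N.E} (h : N.Mergeable C e f) (hN : N.WF) :
    N.src e ≠ N.src f := fun he => by
  have h1 := (hN.isOut_wn h.right e).1 he
  have h2 := h.concl ▸ hN.concl_nodup
  rw [List.nodup_append] at h2
  simp [h1] at h2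

theorem Mergeable.tgt_right {N : Net} {C : List N.E} {e f : N.E} (h : N.Mergeable C e f)
    (hN : N.WF) : N.tgt f = none := by
  rw [← hN.mem_concl, h.concl]; simp

end Net

namespace Net.Mergeable

variable {N : Net} {C : List N.E} {e f : N.E}

/-- The cell which replaces `v` when the source of `f` is identified with the source of `e`. -/
noncomputable def redirect (h : N.Mergeable C e f) (hN : N.WF) (v : N.V) :
    {v // v ≠ N.src f} :=
  open Classical in if hv : v = N.src f then ⟨N.src e, h.ne hN⟩ else ⟨v, hv⟩

theorem redirect_eq (h : N.Mergeable C e f) (hN : N.WF) {v : N.V} (hv : v ≠ N.src f) :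
    h.redirect hN v = ⟨v, hv⟩ := dif_neg hv

theorem redirect_src (h : N.Mergeable C e f) (hN : N.WF) :
    h.redirect hN (N.src f) = ⟨N.src e, h.ne hN⟩ := dif_pos rfl

theorem label_redirect (h : N.Mergeable C e f) (hN : N.WF) (v : N.V) :
    N.label (h.redirect hN v).1 = N.label v := by
  by_cases hv : v = N.src f
  · subst hv; rw [redirect_src, h.left, h.right]
  · rw [redirect_eq h hN hv]

theorem eq_of_redirect (h : N.Mergeable C e f) (hN : N.WF) {v : N.V} {w : {v // v ≠ N.src f}}
    (hw : N.label w.1 ≠ .wn) (hv : h.redirect hN v = w) : v = w.1 := by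
  by_cases hvf : v = N.src f
  · subst hv; rw [hvf, redirect_src] at hw; exact absurd h.left hw
  · rw [← hv, redirect_eq h hN hvf]

/-- The result of merging the `wn` cells with outputs `e` and `f`. -/
noncomputable def net (h : N.Mergeable C e f) (hN : N.WF) : Net where
  V := {v // v ≠ N.src f}
  E := {g // g ≠ f}
  label v := N.label v.1
  ty g := N.ty g.1
  src g := ⟨N.src g.1, fun hg => g.2 ((hN.isOut_wn h.right g.1).1 hg)⟩
  tgt g := (N.tgt g.1).map (h.redirect hN)
  left g := N.left g.1
  concl := (C ++ [e]).pmap Subtype.mk (by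
    have h2 := h.concl ▸ hN.concl_nodup
    rintro g hg rfl
    rw [show C ++ [e, g] = (C ++ [e]) ++ [g] by simp] at h2
    exact (List.nodup_append.1 h2).2.2 g hg g (by simp) rfl)

theorem net_concl (h : N.Mergeable C e f) (hN : N.WF) :
    (h.net hN).concl.map Subtype.val = C ++ [e] := by
  simp [net, List.map_pmap]

theorem net_tgt (h : N.Mergeable C e f) (hN : N.WF) (g : {g // g ≠ f}) (v : {v // v ≠ N.src f}) :
    (h.net hN).tgt g = some v ↔ ∃ w, N.tgt g.1 = some w ∧ h.redirect hN w = v :=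
  Option.map_eq_some_iff

theorem net_wf (h : N.Mergeable C e f) (hN : N.WF) : (h.net hN).WF := by
  have := hN.finite_V
  have := hN.finite_E
  have hnd := h.concl ▸ hN.concl_nodup
  rw [show C ++ [e, f] = (C ++ [e]) ++ [f] by simp] at hnd
  have hmem : ∀ g, g ≠ f → (g ∈ C ++ [e] ↔ N.tgt g = none) := fun g hg => by
    rw [← hN.mem_concl, h.concl]; simp [hg]
  have hkey : ∀ g : (h.net hN).E, g ∈ (h.net hN).concl ↔ g.1 ∈ C ++ [e] := fun g => by
    have h1 := List.mem_map_of_injective (f := fun g : (h.net hN).E => g.1)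
      (fun _ _ h => Subtype.ext h) (a := g) (l := (h.net hN).concl)
    rw [← h1]
    exact iff_of_eq (congrArg (g.1 ∈ ·) (h.net_concl hN))
  refine ⟨(inferInstance : Finite {v // v ≠ N.src f}), (inferInstance : Finite {g // g ≠ f}),
    ⟨(⟨N.src e, h.ne hN⟩ : {v // v ≠ N.src f})⟩,
    hnd.of_append_left.pmap fun _ _ _ _ h => congrArg Subtype.val h, fun g => ?_, fun v => ?_⟩
  · rw [hkey, hmem _ g.2]; exact Option.map_eq_none_iff.symm
  · by_cases hv : v.1 = N.src e
    · obtain ⟨o, A, ho, hA, hin⟩ := (hN.cell_ok (N.src e)).wn h.left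
      obtain ⟨o', A', ho', hA', hin'⟩ := (hN.cell_ok (N.src f)).wn h.right
      obtain rfl := (ho e).1 rfl
      obtain rfl := (ho' f).1 rfl
      have hAA : A' = A := by
        have := h.ty
        rw [hA, hA'] at this
        exact (Formula.wn.inj this).symm
      have hef : e ≠ f := fun hh => h.ne hN (congrArg _ hh)
      have hl : (h.net hN).label v = .wn := (congrArg N.label hv).trans h.left
      unfold CellOK
      rw [hl]
      refine ⟨⟨e, hef⟩, A, fun g => ?_, hA, fun g hg => ?_⟩
      · exact (Subtype.ext_iff.trans (by rw [hv]; exact ho g.1)).trans Subtype.ext_iff.symm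
      · obtain ⟨w, hw, hwv⟩ := (h.net_tgt hN _ _).1 hg
        by_cases hwf : w = N.src f
        · exact (hin' _ (hwf ▸ hw)).trans hAA
        · rw [h.redirect_eq hN hwf] at hwv
          exact hin _ (by rw [hw, ← hv, ← hwv])
    · have hr : ∀ w, h.redirect hN w = v ↔ w = v.1 := fun w => by
        refine ⟨fun hw => ?_, fun hw => by subst hw; exact h.redirect_eq hN v.2⟩
        by_cases hwf : w = N.src f
        · rw [hwf, h.redirect_src] at hw; exact absurd (congrArg Subtype.val hw).symm hv
        · rw [h.redirect_eq hN hwf] at hw; exact congrArg Subtype.val hw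
      have ht : ∀ g : {g // g ≠ f}, (h.net hN).tgt g = some v ↔ N.tgt g.1 = some v.1 := fun g =>
        (h.net_tgt hN g v).trans
          ⟨fun ⟨w, h1, h2⟩ => ((hr w).1 h2) ▸ h1, fun h1 => ⟨v.1, h1, (hr _).2 rfl⟩⟩
      refine CellOK.transfer (M := N) (w := v.1) (fun e f => e.1 = f) rfl ?_ ?_ ?_ ?_ ?_ ?_ ?_
        (hN.cell_ok _)
      · rintro g _ _ rfl rfl; rfl
      · rintro g _ rfl; rfl
      · rintro g rfl; exact ⟨_, rfl, rfl⟩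
      · intro g hg
        exact ⟨⟨g, fun hgf => v.2 (by rw [← hg, hgf])⟩, ⟨rfl, Subtype.ext hg⟩,
          fun f hf => Subtype.ext hf.1⟩
      · intro g hg; exact ⟨_, rfl, (ht _).1 hg⟩
      · intro _ _ g hg
        refine ⟨⟨g, fun hgf => ?_⟩, ⟨rfl, (ht _).2 hg⟩, fun f hf => Subtype.ext hf.1⟩
        rw [hgf, h.tgt_right hN] at hg; cases hg
      · rintro g _ rfl _ _; exact Iff.rfl

end Net.Mergeable

namespace BoxNet

variable {R : BoxNet} {C : List R.E} {e f : R.E}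

theorem box_redirect (h : R.toNet.Mergeable C e f) (v : R.V) :
    R.box (h.redirect R.wf v).1 = R.box v := by
  by_cases hv : v = R.src f
  · have he : R.tgt e = none := by rw [← R.wf.mem_concl, h.concl]; simp
    subst hv
    rw [h.redirect_src, R.box_tail _ he, R.box_tail _ (h.tgt_right R.wf)]
  · rw [h.redirect_eq R.wf hv]

/-- The result of merging two `wn` cells at the root. -/
noncomputable def merge (h : R.toNet.Mergeable C e f) : BoxNet where
  toNet := h.net R.wf
  wf := h.net_wf R.wf
  tree := R.tree
  box v := R.box v.1
  box_edge g v hv := by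
    obtain ⟨w, hw, rfl⟩ := (h.net_tgt R.wf _ _).1 hv
    rw [box_redirect]; exact R.box_edge _ _ hw
  box_tail g hg := R.box_tail g.1 (Option.map_eq_none_iff.1 hg)
  border g v hv hb := by
    obtain ⟨w, hw, rfl⟩ := (h.net_tgt R.wf _ _).1 hv
    rw [box_redirect] at hb
    have := R.border _ _ hw hb
    rwa [← h.label_redirect R.wf w] at this
  door_inj g k v w hv hw hlv hlw h1 h2 h3 := by
    obtain ⟨v', hv', rfl⟩ := (h.net_tgt R.wf _ _).1 hv
    obtain ⟨w', hw', rfl⟩ := (h.net_tgt R.wf _ _).1 hw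
    rw [box_redirect] at h1 h2
    exact Subtype.ext (R.door_inj _ _ v' w' hv' hw' ((h.label_redirect R.wf v').symm.trans hlv)
      ((h.label_redirect R.wf w').symm.trans hlw) h1 h2 h3)

theorem IsMELL.merge (hR : R.IsMELL) (h : R.toNet.Mergeable C e f) : (R.merge h).IsMELL := by
  have hne : ∀ g v, R.tgt g = some v → g ≠ f := by
    rintro g v hg rfl
    rw [h.tgt_right R.wf] at hg; cases hg
  refine ⟨⟨fun v hv => ?_, fun g v hg hv => ?_, fun x hx => ?_⟩, fun v hv => ?_⟩
  · obtain ⟨g, hg, hu⟩ := hR.1.1 v.1 hv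
    refine ⟨⟨g, hne _ _ hg⟩, (h.net_tgt R.wf _ _).2 ⟨v.1, hg, h.redirect_eq R.wf v.2⟩,
      fun k hk => ?_⟩
    obtain ⟨w, hw, hwv⟩ := (h.net_tgt R.wf _ _).1 hk
    have hv' : R.label v.1 ≠ .wn := fun hh => by
      have := hh.symm.trans hv; cases this
    rw [h.eq_of_redirect R.wf hv' hwv] at hw
    exact Subtype.ext (hu _ hw)
  · obtain ⟨w, hw, rfl⟩ := (h.net_tgt R.wf _ _).1 hg
    change R.tree.parent (R.box (R.src g.1)) = some (R.box (h.redirect R.wf w).1)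
    rw [box_redirect]
    exact hR.1.2.1 _ w hw ((h.label_redirect R.wf w).symm.trans hv)
  · obtain ⟨g, v, hg, hv, hb⟩ := hR.1.2.2 x hx
    exact ⟨⟨g, hne _ _ hg⟩, h.redirect R.wf v, (h.net_tgt R.wf _ _).2 ⟨v, hg, rfl⟩,
      (h.label_redirect R.wf v).trans hv, hb⟩
  · obtain ⟨h1, h2⟩ := hR.2 v.1 hv
    exact ⟨fun w hw => Subtype.ext (h1 w.1 hw), h2⟩

end BoxNet

section
variable {N : Net} {o : N.E} {S : Set N.E}

theorem Net.split_tgt_none (g : N.E) :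
    (N.split o S).tgt (some g) = some none ↔ g ∈ S := by
  by_cases h : g ∈ S <;> simp [Net.split, h]

theorem Net.split_tgt_some (g : N.E) (v : N.V) :
    (N.split o S).tgt (some g) = some (some v) ↔ g ∉ S ∧ N.tgt g = some v := by
  by_cases h : g ∈ S <;> simp [Net.split, h]

end

/-- If splitting a `wn` cell of `N` yields an expansion of `R`, then `N` is an expansion of the
structure obtained by merging two `wn` cells of `R`. -/
theorem Exp.merge {N : Net} {C : List N.E} {o : N.E} {S : Set N.E} {R : BoxNet}
    (E : Exp (N.split o S) R) {C' : List R.E} {e f : R.E} (h : R.toNet.Mergeable C' e f)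
    (hlen : C.length = C'.length)
    (hc : N.concl = C ++ [o]) (hv : N.label (N.src o) = .wn)
    (hS : ∀ e ∈ S, N.tgt e = some (N.src o)) : Nonempty (Exp N (R.merge h)) := by
  let qs : Option N.E → R.E := E.q
  let ps : Option N.V → R.V := E.p
  let bs : Option N.V → E.t.tree.Node := E.b
  have hconcl : (C.map some ++ [some o, none]).map qs = C' ++ [e, f] := by
    rw [← h.concl, ← E.concl_q]
    change _ = List.map qs (N.concl.map some ++ [none])
    rw [hc]
    simp
  rw [List.map_append] at hconcl
  obtain ⟨hC, ho⟩ := List.append_inj hconcl (by simp [hlen])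
  simp only [List.map_cons, List.map_nil, List.cons.injEq, and_true] at ho
  obtain ⟨ho, hn⟩ := ho
  have hf : R.tgt f = none := h.tgt_right R.wf
  have he : R.tgt e = none := by rw [← R.wf.mem_concl, h.concl]; simp
  have hpn : R.src f = ps none := by rw [← hn]; exact E.src_q none
  have hpo : R.src e = ps (some (N.src o)) := by rw [← ho]; exact E.src_q (some o)
  -- The source of `f` is the image of the new `wn` cell; being at the root, it has no other
  -- preimage.
  have hne : ∀ v : N.V, ps (some v) ≠ R.src f := fun v hvf => by
    have h2 := hvf.trans hpn
    have h3 : R.box (ps (some v)) = R.tree.root := by rw [hvf, R.box_tail _ hf]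
    have h4 : (some v : Option N.V) = none := E.inj_root (v := some v) (w := none) h2 h3
    cases h4
  have hqne : ∀ g : N.E, qs (some g) ≠ f := fun g hg => by
    have h4 : (some g : Option N.E) = none :=
      E.q_inj (e := some g) (f := none) (hg.trans hn.symm)
        ((congrArg R.tgt hg).trans hf)
    cases h4
  have hbn : bs none = E.t.tree.root := by
    refine (E.root_iff none).1 ?_
    change R.box (ps none) = _
    rw [← hpn, R.box_tail _ hf]
  have hbo : bs (some (N.src o)) = E.t.tree.root := by
    refine (E.root_iff (some (N.src o))).1 ?_
    change R.box (ps (some (N.src o))) = _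
    rw [← hpo, R.box_tail _ he]
  have hnS : ∀ g v, N.tgt g = some v → N.label v ≠ .wn → g ∉ S := fun g v hg hl hgS => by
    rw [hS g hgS, Option.some.injEq] at hg
    rw [← hg] at hl
    exact hl hv
  refine ⟨⟨E.t, fun v => ⟨ps (some v), hne v⟩, fun v => bs (some v),
    fun g => ⟨qs (some g), hqne g⟩, fun v => E.box_p (some v), ?_, ?_, ?_, ?_, ?_, ?_, ?_,
    fun v => E.label_p (some v), fun g => E.ty_q (some g), ?_, ?_⟩⟩
  · intro v w h1 h2
    exact Option.some.inj (E.inj (some v) (some w) (congrArg Subtype.val h1) h2)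
  · rintro ⟨v, hvf⟩ x hx
    obtain ⟨w, hw1, hw2⟩ := E.surj v x hx
    rcases w with _ | w
    · exact absurd (hw1.symm.trans hpn.symm) hvf
    · exact ⟨w, Subtype.ext hw1, hw2⟩
  · intro g; exact Subtype.ext (E.src_q (some g))
  · intro g k h1 h2
    exact Option.some.inj (E.injE (some g) (some k) (congrArg Subtype.val h1)
      (congrArg some h2))
  · rintro ⟨g, hg⟩ w hw
    obtain ⟨k, hk1, hk2⟩ := E.surjE g (some w) (congrArg Subtype.val hw)
    rcases k with _ | k
    · cases hk2
    · exact ⟨k, Subtype.ext hk1, Option.some.inj hk2⟩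
  · intro g v hg
    refine (and_congr_left' (h.net_tgt R.wf ⟨qs (some g), hqne g⟩ ⟨ps (some v), hne v⟩)).2 ?_
    by_cases hgS : g ∈ S
    · rw [hS g hgS, Option.some.injEq] at hg
      subst hg
      obtain ⟨h1, _⟩ := E.tgt_q (some g) none ((Net.split_tgt_none g).2 hgS)
      refine ⟨⟨ps none, h1, ?_⟩, ?_⟩
      · rw [← hpn, h.redirect_src]; exact Subtype.ext hpo
      · rw [hbo]; exact E.t.tree.reach_root _
    · obtain ⟨h1, h2⟩ := E.tgt_q (some g) (some v) ((Net.split_tgt_some g v).2 ⟨hgS, hg⟩)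
      exact ⟨⟨_, h1, h.redirect_eq R.wf (hne v)⟩, h2⟩
  · intro g u hu
    obtain ⟨w, hw, _⟩ := (h.net_tgt R.wf _ _).1 hu
    obtain ⟨v, hv⟩ := E.tgt_some (some g) _ hw
    rcases v with _ | v
    · exact ⟨_, hS g ((Net.split_tgt_none g).1 hv)⟩
    · exact ⟨v, ((Net.split_tgt_some g v).1 hv).2⟩
  · intro g v hg hl
    have hgS : g ∉ S := hnS g v hg (by rcases hl with hl | hl <;> simp [hl])
    exact E.left_q (some g) (some v) ((Net.split_tgt_some g v).2 ⟨hgS, hg⟩) hl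
  · refine (List.map_injective_iff (f := fun g : (R.merge h).E => g.1)).2
      (fun _ _ h => Subtype.ext h) ?_
    refine Eq.trans ?_ (h.net_concl R.wf).symm
    suffices hh : N.concl.map (fun g => qs (some g)) = C' ++ [e] from (List.map_map ..).trans hh
    rw [hc, ← hC, ← ho]
    simp [Function.comp_def]

/-! ### Inverting contraction and mix -/

namespace BoxNet

/-- Inverting a contraction. -/
theorem exists_contr {R : BoxNet} (hR : R.IsMELL) {D : List Formula} {A : Formula}
    (hD : R.toNet.type = D ++ [.wn A, .wn A]) :
    ∃ r : Option BoxNet, IsMELLOfType r (D ++ [.wn A]) ∧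
      ∀ (N N' : Net) (C : List N.E) (o : N.E) (S : Set N.E), N.type = D ++ [.wn A] →
        N.concl = C ++ [o] → N.label (N.src o) = .wn → (∀ e ∈ S, N.tgt e = some (N.src o)) →
        Iso N' (N.split o S) → Nonempty (Exp N' R) → ∃ R', r = some R' ∧ Nonempty (Exp N R') := by
  obtain ⟨C', I', hC', hCD, hI'⟩ := exists_concl_append hD
  obtain ⟨e, I1, rfl, he, hI1⟩ := List.map_eq_cons_iff.1 hI'
  obtain ⟨f, I2, rfl, hf, hI2⟩ := List.map_eq_cons_iff.1 hI1
  obtain rfl := List.map_eq_nil_iff.1 hI2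
  -- Expansions preserve labels, and the last two conclusions of a split net are outputs of `wn`
  -- cells. If this fails in `R`, for instance because a type `?A` comes from an axiom, no net can
  -- arise and `none` is correct.
  by_cases hl : R.label (R.src e) = .wn ∧ R.label (R.src f) = .wn
  · have h : R.toNet.Mergeable C' e f := ⟨hC', hl.1, hl.2, he.trans hf.symm⟩
    refine ⟨some (R.merge h), ?_, ?_⟩
    · rintro _ ⟨⟩
      refine ⟨hR.merge h, ?_⟩
      have h1 : (h.net R.wf).type = ((h.net R.wf).concl.map Subtype.val).map R.ty :=
        (List.map_map (f := fun g : {g // g ≠ f} => g.1) (g := R.ty)).symm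
      exact h1.trans (by rw [h.net_concl, List.map_append, hCD]; simp [he])
    · intro N N' C o S hN hc hv hS hiso hE
      obtain ⟨E⟩ := Exp.congr_iso' hiso hE
      refine ⟨_, rfl, E.merge h ?_ hc hv hS⟩
      have := congrArg List.length hN
      rw [Net.type, hc, ← hCD] at this
      simpa using this
  · refine ⟨none, fun R hR => (by cases hR), ?_⟩
    intro N N' C o S hN hc hv hS hiso hE
    exfalso
    obtain ⟨E⟩ := Exp.congr_iso' hiso hE
    let qs : Option N.E → R.E := E.q
    have hlen : C.length = C'.length := by
      have := congrArg List.length hN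
      rw [Net.type, hc, ← hCD] at this
      simpa using this
    have hconcl : (C.map some ++ [some o, none]).map qs = C' ++ [e, f] := by
      rw [← hC', ← E.concl_q]
      change _ = List.map qs (N.concl.map some ++ [none])
      rw [hc]
      simp
    rw [List.map_append] at hconcl
    obtain ⟨hC, ho⟩ := List.append_inj hconcl (by simp [hlen])
    simp only [List.map_cons, List.map_nil, List.cons.injEq, and_true] at ho
    refine hl ⟨?_, ?_⟩
    · rw [← ho.1]
      refine (congrArg R.label (E.src_q (some o))).trans ((E.label_p _).symm.trans hv)
    · rw [← ho.2]
      exact (congrArg R.label (E.src_q none)).trans (E.label_p none).symm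

/-- Inverting the splitting of a component. -/
theorem exists_mix {R₁ R₂ : BoxNet} (h₁ : R₁.IsMELL) (h₂ : R₂.IsMELL) :
    ∃ R : BoxNet, R.IsMELL ∧ R.toNet.type = R₁.toNet.type ++ R₂.toNet.type ∧
      ∀ (N N₁ N₂ : Net) (S : Set N.V) (C₁ C₂ : List N.E),
        (∀ e v, N.tgt e = some v → (N.src e ∈ S ↔ v ∈ S)) → N.concl = C₁ ++ C₂ →
        Sub N₁ N S {e | N.src e ∈ S} C₁ → Sub N₂ N Sᶜ {e | N.src e ∉ S} C₂ →
        Nonempty (Exp N₁ R₁) → Nonempty (Exp N₂ R₂) → Nonempty (Exp N R) := by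
  refine ⟨R₁.union R₂, h₁.union h₂, ?_, ?_⟩
  · change List.map (Sum.elim R₁.ty R₂.ty) (R₁.concl.map Sum.inl ++ R₂.concl.map Sum.inr) = _
    simp [Net.type]
  · intro N N₁ N₂ S C₁ C₂ hS hc hs₁ hs₂ hE₁ hE₂
    obtain ⟨_, hi₁⟩ := hs₁.iso_restrict (fun _ => Iff.rfl)
    obtain ⟨_, hi₂⟩ := hs₂.iso_restrict (fun _ => Iff.rfl)
    obtain ⟨E₁⟩ := Exp.congr_iso' hi₁ hE₁
    obtain ⟨E₂⟩ := Exp.congr_iso' hi₂ hE₂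
    exact E₁.union E₂ hS hc

end BoxNet

/-! ## Closing a box -/

/-- All conclusions but the last one, `a`, are outputs of `wn` cells. -/
structure Net.Boxable (N : Net) (C : List N.E) (a : N.E) : Prop where
  concl : N.concl = C ++ [a]
  wn : ∀ c ∈ C, N.label (N.src c) = .wn

namespace Net

theorem CellOK.bang {N : Net} {v : N.V} (h : N.CellOK v) (hv : N.label v = .bang) :
    ∃ o A, N.IsOut v o ∧ N.ty o = .bang A ∧ ∀ g, N.tgt g = some v → N.ty g = A := by
  unfold CellOK at h
  rwa [hv] at h

theorem WF.isOut_bang {N : Net} (hN : N.WF) {g : N.E} (hg : N.label (N.src g) = .bang) :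
    N.IsOut (N.src g) g := by
  obtain ⟨o, _, ho, _⟩ := (hN.cell_ok (N.src g)).bang hg
  obtain rfl := (ho g).1 rfl
  exact ho

namespace Boxable

variable {N : Net} {C : List N.E} {a : N.E}

theorem not_mem (h : N.Boxable C a) (hN : N.WF) : a ∉ C := fun ha => by
  have := h.concl ▸ hN.concl_nodup
  exact (List.nodup_append.1 this).2.2 a ha a (by simp) rfl

theorem addable (h : N.Boxable C a) :
    N.Addable .bang [a] (fun _ : Unit => .bang (N.ty a)) C [()] := by
  refine ⟨inferInstance, h.concl, by simp, by simp, Sum.inr (), N.ty a, ?_, rfl, ?_⟩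
  · rintro (g | g) <;> simp [Net.addCell]
  · intro g hg
    obtain ⟨g', h1, rfl⟩ := (Net.addCell_tgt_none _).1 hg
    rw [List.mem_singleton.1 h1]; rfl

theorem tgt_of_mem (h : N.Boxable C a) (hN : N.WF) {c : N.E} (hc : c ∈ C) : N.tgt c = none := by
  rw [← hN.mem_concl, h.concl]; exact List.mem_append_left _ hc

theorem tgt_last (h : N.Boxable C a) (hN : N.WF) : N.tgt a = none := by
  rw [← hN.mem_concl, h.concl]; simp

theorem mem_of_src (h : N.Boxable C a) (hN : N.WF) {g c : N.E} (hc : c ∈ C)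
    (hg : N.src g = N.src c) : g = c := (hN.isOut_wn (h.wn c hc) g).1 hg

end Boxable

end Net

namespace BoxNet

variable {R : BoxNet} {C : List R.E} {a : R.E}

/-- The box of a cell, once the box is closed. -/
noncomputable def closeBox (R : BoxNet) (C : List R.E) (v : R.V) :
    Option (Σ _ : Unit, R.tree.Node) :=
  open Classical in if ∃ c ∈ C, R.src c = v then none else some ⟨(), R.box v⟩

theorem closeBox_door {v : R.V} (h : ∃ c ∈ C, R.src c = v) : R.closeBox C v = none := if_pos h

theorem closeBox_inner {v : R.V} (h : ¬ ∃ c ∈ C, R.src c = v) :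
    R.closeBox C v = some ⟨(), R.box v⟩ := if_neg h

theorem closeBox_eq_some {v : R.V} {y : R.tree.Node} :
    R.closeBox C v = some ⟨(), y⟩ ↔ (¬ ∃ c ∈ C, R.src c = v) ∧ R.box v = y := by
  by_cases h : ∃ c ∈ C, R.src c = v
  · simp [closeBox_door h, h]
  · simp [closeBox_inner h, h]

theorem not_door_last (h : R.toNet.Boxable C a) : ¬ ∃ c ∈ C, R.src c = R.src a := by
  rintro ⟨c, hc, hca⟩
  exact h.not_mem R.wf (h.mem_of_src R.wf hc hca.symm ▸ hc)

theorem not_door_src (h : R.toNet.Boxable C a) {e : R.E} {v : R.V} (he : R.tgt e = some v) :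
    ¬ ∃ c ∈ C, R.src c = R.src e := by
  rintro ⟨c, hc, hca⟩
  rw [h.mem_of_src R.wf hc hca.symm, h.tgt_of_mem R.wf hc] at he
  cases he

theorem not_door_label (h : R.toNet.Boxable C a) {v : R.V} (hv : R.label v ≠ .wn) :
    ¬ ∃ c ∈ C, R.src c = v := by
  rintro ⟨c, hc, rfl⟩
  exact hv (h.wn c hc)

theorem tgt_mem_last (h : R.toNet.Boxable C a) : ∀ e ∈ [a], R.tgt e = none := fun e he => by
  rw [List.mem_singleton.1 he, h.tgt_last R.wf]

theorem box_last (h : R.toNet.Boxable C a) : R.box (R.src a) = R.tree.root :=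
  R.box_tail _ (h.tgt_last R.wf)

/-- The structure obtained by putting `R` in a box. -/
noncomputable def close (R : BoxNet) {C : List R.E} {a : R.E} (h : R.toNet.Boxable C a) :
    BoxNet where
  toNet := R.toNet.addCell .bang [a] (fun _ : Unit => .bang (R.ty a))
    (C.map Sum.inl ++ [()].map Sum.inr)
  wf := h.addable.wf R.wf
  -- The old root becomes the new box, above a new root. The new root receives the `bang` cell and,
  -- through `closeBox`, the `wn` cells of the other conclusions, so that the edges into these cross
  -- the border of the box.
  tree := RTree.graft fun _ : Unit => R.tree
  box v := v.elim none (R.closeBox C)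
  box_edge e v hv := by
    rcases v with _ | v
    · exact RTree.reach_root _ _
    · obtain ⟨e, rfl, he⟩ := (Net.addCell_tgt_some (tgt_mem_last h) _ _).1 hv
      change (RTree.graft fun _ : Unit => R.tree).Reach (R.closeBox C (R.src e)) (R.closeBox C v)
      rw [closeBox_inner (not_door_src h he)]
      by_cases hd : ∃ c ∈ C, R.src c = v
      · rw [closeBox_door hd]; exact RTree.reach_root _ _
      · rw [closeBox_inner hd]
        exact RTree.graft_reach (fun _ : Unit => R.tree) () (R.box_edge e v he)
  box_tail e he := by
    rcases e with e | o
    · change R.closeBox C (R.src e) = none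
      by_cases hI : e = a
      · rw [(Net.addCell_tgt_none _).2 ⟨e, List.mem_singleton.2 hI, rfl⟩] at he
        cases he
      · rw [Net.addCell_tgt_inl (by simpa using hI)] at he
        have h1 := Option.map_eq_none_iff.1 he
        rw [← R.wf.mem_concl, h.concl, List.mem_append, List.mem_singleton, or_iff_left hI] at h1
        exact closeBox_door ⟨e, h1, rfl⟩
    · rfl
  border e v hv hb := by
    rcases v with _ | v
    · exact Or.inl rfl
    · obtain ⟨e, rfl, he⟩ := (Net.addCell_tgt_some (tgt_mem_last h) _ _).1 hv
      by_cases hd : ∃ c ∈ C, R.src c = v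
      · obtain ⟨c, hc, rfl⟩ := hd
        exact Or.inr (h.wn c hc)
      · refine R.border e v he fun hb' => hb ?_
        change R.closeBox C (R.src e) = R.closeBox C v
        rw [closeBox_inner hd, closeBox_inner (not_door_src h he), hb']
  door_inj e f v w hv hw hlv hlw h1 h2 h3 := by
    rcases v with _ | v <;> rcases w with _ | w
    · obtain ⟨e, he, rfl⟩ := (Net.addCell_tgt_none _).1 hv
      obtain ⟨f, hf, rfl⟩ := (Net.addCell_tgt_none _).1 hw
      rw [List.mem_singleton.1 he, List.mem_singleton.1 hf]
    · obtain ⟨e, he, rfl⟩ := (Net.addCell_tgt_none _).1 hv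
      obtain ⟨f, rfl, hf⟩ := (Net.addCell_tgt_some (tgt_mem_last h) _ _).1 hw
      change R.closeBox C (R.src e) = R.closeBox C (R.src f) at h3
      have h2' : (RTree.graft fun _ : Unit => R.tree).parent (R.closeBox C (R.src f)) =
        some (R.closeBox C w) := h2
      rw [List.mem_singleton.1 he, closeBox_inner (not_door_last h)] at h3
      rw [← h3, box_last h,
        (RTree.graft_parent_none (fun _ : Unit => R.tree) () R.tree.root).2 rfl,
        closeBox_inner (not_door_label h fun hh => by simp [show R.label w = .bang from hlw] at hh)]
        at h2'
      cases h2'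
    · obtain ⟨e, rfl, he⟩ := (Net.addCell_tgt_some (tgt_mem_last h) _ _).1 hv
      obtain ⟨f, hf, rfl⟩ := (Net.addCell_tgt_none _).1 hw
      change R.closeBox C (R.src e) = R.closeBox C (R.src f) at h3
      have h1' : (RTree.graft fun _ : Unit => R.tree).parent (R.closeBox C (R.src e)) =
        some (R.closeBox C v) := h1
      rw [List.mem_singleton.1 hf, closeBox_inner (not_door_last h)] at h3
      rw [h3, box_last h,
        (RTree.graft_parent_none (fun _ : Unit => R.tree) () R.tree.root).2 rfl,
        closeBox_inner (not_door_label h fun hh => by simp [show R.label v = .bang from hlv] at hh)]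
        at h1'
      cases h1'
    · obtain ⟨e, rfl, he⟩ := (Net.addCell_tgt_some (tgt_mem_last h) _ _).1 hv
      obtain ⟨f, rfl, hf⟩ := (Net.addCell_tgt_some (tgt_mem_last h) _ _).1 hw
      change R.closeBox C (R.src e) = R.closeBox C (R.src f) at h3
      have h1' : (RTree.graft fun _ : Unit => R.tree).parent (R.closeBox C (R.src e)) =
        some (R.closeBox C v) := h1
      have h2' : (RTree.graft fun _ : Unit => R.tree).parent (R.closeBox C (R.src f)) =
        some (R.closeBox C w) := h2
      have hv' := not_door_label h (v := v) fun hh => by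
        simp [show R.label v = .bang from hlv] at hh
      have hw' := not_door_label h (v := w) fun hh => by
        simp [show R.label w = .bang from hlw] at hh
      rw [closeBox_inner (not_door_src h he), closeBox_inner (not_door_src h hf)] at h3
      rw [closeBox_inner (not_door_src h he), closeBox_inner hv', RTree.graft_parent_some] at h1'
      rw [closeBox_inner (not_door_src h hf), closeBox_inner hw', RTree.graft_parent_some] at h2'
      simp only [Option.some.injEq, Sigma.mk.injEq, heq_eq_eq, true_and] at h3
      exact congrArg _ (R.door_inj e f v w he hf hlv hlw h1' h2' h3)

/-- The edge `a` becomes the door of the new box and the other doors are unchanged. A daimon at the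
root of `R` is allowed here: once boxed it is no longer at the root, and it is alone if all other
cells of its level are `wn` cells sent to the border. -/
theorem IsMELLDaimon.close (hR : R.IsMELLDaimon) (h : R.toNet.Boxable C a)
    (hd : ∀ v, R.label v = .daimon → ∀ w, R.box w = R.box v → (¬ ∃ c ∈ C, R.src c = w) → w = v) :
    (R.close h).IsMELL := by
  refine ⟨⟨fun v hv => ?_, fun e v he hv => ?_, fun x hx => ?_⟩, fun v hv => ?_⟩
  · rcases v with _ | v
    · refine ⟨Sum.inl a, (Net.addCell_tgt_none _).2 ⟨a, by simp, rfl⟩, fun f hf => ?_⟩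
      obtain ⟨g, hg, rfl⟩ := (Net.addCell_tgt_none _).1 hf
      rw [List.mem_singleton.1 hg]
    · obtain ⟨e, he, hu⟩ := hR.1 v hv
      refine ⟨Sum.inl e, (Net.addCell_tgt_some (tgt_mem_last h) _ _).2 ⟨e, rfl, he⟩,
        fun f hf => ?_⟩
      obtain ⟨g, rfl, hg⟩ := (Net.addCell_tgt_some (tgt_mem_last h) _ _).1 hf
      exact congrArg _ (hu g hg)
  · rcases v with _ | v
    · obtain ⟨g, hg, rfl⟩ := (Net.addCell_tgt_none _).1 he
      change (RTree.graft fun _ : Unit => R.tree).parent (R.closeBox C (R.src g)) = some none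
      rw [List.mem_singleton.1 hg, closeBox_inner (not_door_last h), RTree.graft_parent_none,
        box_last h]
    · obtain ⟨g, rfl, hg⟩ := (Net.addCell_tgt_some (tgt_mem_last h) _ _).1 he
      change (RTree.graft fun _ : Unit => R.tree).parent (R.closeBox C (R.src g)) =
        some (R.closeBox C v)
      rw [closeBox_inner (not_door_src h hg), closeBox_inner (not_door_label h fun hh => by
        simp [show R.label v = .bang from hv] at hh), RTree.graft_parent_some]
      exact hR.2.1 g v hg hv
  · rcases x with _ | ⟨⟨⟩, y⟩
    · exact absurd rfl hx
    · by_cases hy : y = R.tree.root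
      · refine ⟨Sum.inl a, none, (Net.addCell_tgt_none _).2 ⟨a, by simp, rfl⟩, rfl, ?_⟩
        exact closeBox_eq_some.2 ⟨not_door_last h, by rw [hy, box_last h]⟩
      · obtain ⟨e, v, he, hv, hb⟩ := hR.2.2 y hy
        exact ⟨Sum.inl e, some v, (Net.addCell_tgt_some (tgt_mem_last h) _ _).2 ⟨e, rfl, he⟩, hv,
          closeBox_eq_some.2 ⟨not_door_src h he, hb⟩⟩
  · rcases v with _ | v
    · cases hv
    have hv' := not_door_label h (v := v) fun hh => by
      simp [show R.label v = .daimon from hv] at hh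
    have hb : (R.close h).box (some v) = some ⟨(), R.box v⟩ := closeBox_inner hv'
    refine ⟨fun w hw => ?_, fun h' => ?_⟩
    · rw [hb] at hw
      rcases w with _ | w
      · cases hw
      · obtain ⟨h1, h2⟩ := closeBox_eq_some.1 hw
        exact congrArg some (hd v hv w h2 h1)
    · rw [hb] at h'; cases h'

end BoxNet

/-- A choice of images of the elements of a list. -/
theorem exists_map_eq {α β : Type*} [Nonempty β] {l : List α} (hl : l.Nodup) {m : List β}
    (h : l.length = m.length) : ∃ f : α → β, l.map f = m := by
  classical
  induction l generalizing m with
  | nil =>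
    rw [List.length_nil, eq_comm, List.length_eq_zero_iff] at h
    exact ⟨fun _ => Classical.arbitrary β, h.symm⟩
  | cons a l ih =>
    obtain _ | ⟨b, m⟩ := m
    · cases h
    · obtain ⟨f, rfl⟩ := ih hl.of_cons (Nat.succ_injective h)
      refine ⟨Function.update f a b, ?_⟩
      rw [List.map_cons, Function.update_self]
      congr 1
      refine List.map_congr_left fun x hx => Function.update_of_ne ?_ _ _
      rintro rfl
      exact (List.nodup_cons.1 hl).1 hx

/-- The thick subtree made of one root and of thick subtrees above it. -/
noncomputable def Thick.graft {T : RTree} {n : ℕ} (t : Fin n → Thick T) :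
    Thick (RTree.graft fun _ : Unit => T) where
  tree := RTree.graft fun j => (t j).tree
  h x := x.map fun y => ⟨(), (t y.1).h y.2⟩
  h_root := rfl
  h_parent x y hxy := by
    rcases x with _ | ⟨j, x⟩
    · cases hxy
    · rcases y with _ | ⟨i, y⟩
      · obtain rfl := (RTree.graft_parent_none (fun j => (t j).tree) j x).1 hxy
        refine (RTree.graft_parent_none (fun _ : Unit => T) () _).2 ((t j).h_root)
      · obtain rfl : j = i := by
          obtain ⟨_, _, h⟩ := Option.map_eq_some_iff.1
            (Option.some.inj ((RTree.graft_parent (fun j => (t j).tree) j x).symm.trans hxy))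
          exact congrArg Sigma.fst h
        replace hxy := (RTree.graft_parent_some (fun j => (t j).tree) _ _ _).1 hxy
        exact (RTree.graft_parent_some (fun _ : Unit => T) () _ _).2 ((t j).h_parent _ _ hxy)

/-- The cells of the `j`-th copy of the content of a box, and the `wn` cells at its border. -/
def Net.copy (N : Net) {n : ℕ} (C : List N.E) (k : ∀ v, N.Inner v → Fin n) (j : Fin n) :
    Set N.V := {v | ∃ h : N.Inner v, k v h = j} ∪ {v | ∃ c ∈ C, N.src c = v}

/-- If all the copies of the content of a box are expansions of `R`, then the net is an expansion
of `R` put in a box. -/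
theorem Exp.close {N : Net} {n : ℕ} {C : List N.E} {o : N.E} {f : Fin n → N.E}
    {k : ∀ v, N.Inner v → Fin n} (hN : N.WF) (hc : N.concl = C ++ [o])
    (hv : N.label (N.src o) = .bang) (hC : ∀ c ∈ C, N.label (N.src c) = .wn)
    (hf : ∀ g, N.tgt g = some (N.src o) ↔ ∃ j, g = f j) (hfk : ∀ j h, k (N.src (f j)) h = j)
    (hk : ∀ e v (_ : N.tgt e = some v) (hv : N.Inner v) (he : N.Inner (N.src e)),
      k (N.src e) he = k v hv)
    {R : BoxNet} {C' : List R.E} {a : R.E} (h : R.toNet.Boxable C' a)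
    {hs : ∀ j, ∀ e ∈ C ++ [f j], N.src e ∈ N.copy C k j}
    (E : ∀ j, Exp (N.restrict (N.copy C k j) (C ++ [f j]) (hs j)) R)
    (hty : C.map N.ty = C'.map R.ty) (hto : N.ty o = .bang (R.ty a)) :
    Nonempty (Exp N (R.close h)) := by
  classical
  have hlen : C.length = C'.length := by simpa using congrArg List.length hty
  have hnd := hc ▸ hN.concl_nodup
  have hndC : C.Nodup := hnd.of_append_left
  have hoC : o ∉ C := fun ho => (List.nodup_append.1 hnd).2.2 o ho o (by simp) rfl
  have hndC' : C'.Nodup := (h.concl ▸ R.wf.concl_nodup : (C' ++ [a]).Nodup).of_append_left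
  have : Nonempty R.E := ⟨a⟩
  -- The images of the auxiliary conclusions are fixed before any copy is chosen. All copies agree
  -- on them, and they are needed even when there is no copy at all.
  obtain ⟨qC, hqC⟩ := exists_map_eq (β := R.E) hndC hlen
  have hqmem : ∀ c ∈ C, qC c ∈ C' := fun c hc => hqC ▸ List.mem_map_of_mem hc
  have hqinj : ∀ c ∈ C, ∀ d ∈ C, qC c = qC d → c = d :=
    fun c hc d hd hh => List.inj_on_of_nodup_map (hqC ▸ hndC') hc hd hh
  have hqsurj : ∀ c' ∈ C', ∃ c ∈ C, qC c = c' := fun c' hc' => by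
    rw [← hqC] at hc'; exact List.mem_map.1 hc'
  -- the three kinds of cells
  have outo : N.IsOut (N.src o) o := hN.isOut_bang hv
  have outC : ∀ c ∈ C, N.IsOut (N.src c) c := fun c hc => hN.isOut_wn (hC c hc)
  have mem_concl : ∀ g, N.tgt g = none ↔ g ∈ C ∨ g = o := fun g => by
    rw [← hN.mem_concl, hc]; simp
  have tri : ∀ v, v = N.src o ∨ (∃ c ∈ C, N.src c = v) ∨ N.Inner v := fun v => by
    by_cases hi : N.Inner v
    · exact Or.inr (Or.inr hi)
    · unfold Net.Inner at hi
      push Not at hi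
      obtain ⟨c, hcm, rfl⟩ := hi
      rw [hN.mem_concl, mem_concl] at hcm
      rcases hcm with hcm | rfl
      · exact Or.inr (Or.inl ⟨c, hcm, rfl⟩)
      · exact Or.inl rfl
  have not_inner_o : ¬ N.Inner (N.src o) := fun hi => hi o (by rw [hc]; simp) rfl
  have not_inner_C : ∀ c ∈ C, ¬ N.Inner (N.src c) := fun c hcC hi =>
    hi c (by rw [hc]; simp [hcC]) rfl
  have C_ne_o : ∀ c ∈ C, N.src c ≠ N.src o := fun c hcC hh => hoC ((outo c).1 hh ▸ hcC)
  have inner_src : ∀ e v, N.tgt e = some v → N.Inner (N.src e) := fun e v he => by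
    rcases tri (N.src e) with h1 | ⟨c, h1, h2⟩ | h1
    · rw [(outo e).1 h1, (mem_concl o).2 (Or.inr rfl)] at he; cases he
    · rw [(outC c h1 e).1 h2.symm, (mem_concl c).2 (Or.inl h1)] at he; cases he
    · exact h1
  have memI : ∀ v (hi : N.Inner v), v ∈ N.copy C k (k v hi) := fun v hi => Or.inl ⟨hi, rfl⟩
  have memC : ∀ c ∈ C, ∀ j, N.src c ∈ N.copy C k j := fun c hcC j => Or.inr ⟨c, hcC, rfl⟩
  -- the expansions agree on the `wn` cells of the border
  have hmap : ∀ j, (C ++ [f j]).pmap (fun e he => (E j).q ⟨e, he⟩) (hs j) = C' ++ [a] := fun j => by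
    rw [← h.concl, ← (E j).concl_q]
    simp [Net.restrict, List.map_pmap]
  have hmap' : ∀ j, C.pmap (fun e he => (E j).q ⟨e, he⟩)
      (fun e he => hs j e (List.mem_append_left _ he)) = C.map qC ∧
      (E j).q ⟨f j, hs j _ (by simp)⟩ = a := fun j => by
    have h1 := hmap j
    rw [List.pmap_append] at h1
    obtain ⟨h2, h3⟩ := List.append_inj h1 (by simp [hlen])
    rw [hqC]
    refine ⟨h2, by simpa using h3⟩
  have EqC : ∀ j c (hcC : c ∈ C), (E j).q ⟨c, memC c hcC j⟩ = qC c := fun j c hcC => by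
    have h1 := (hmap' j).1
    obtain ⟨i, hi, rfl⟩ := List.getElem_of_mem hcC
    have h2 := congrArg (fun l => l[i]?) h1
    simpa [List.getElem?_pmap, hi] using h2
  have Eqf : ∀ j (hh : N.src (f j) ∈ N.copy C k j), (E j).q ⟨f j, hh⟩ = a :=
    fun j hh => (hmap' j).2
  have EpC : ∀ j c (hcC : c ∈ C), (E j).p ⟨N.src c, memC c hcC j⟩ = R.src (qC c) :=
    fun j c hcC => by
      rw [← EqC j c hcC]; exact ((E j).src_q ⟨c, memC c hcC j⟩).symm
  have qC_root : ∀ c ∈ C, R.box (R.src (qC c)) = R.tree.root := fun c hcC =>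
    R.box_tail _ (h.tgt_of_mem R.wf (hqmem c hcC))
  have inner_door : ∀ v (hi : N.Inner v) j (hj : v ∈ N.copy C k j),
      ¬ ∃ c' ∈ C', R.src c' = (E j).p ⟨v, hj⟩ := by
    rintro v hi j hj ⟨c', hc', hcv⟩
    obtain ⟨c, hcC, rfl⟩ := hqsurj c' hc'
    have h1 := (EpC j c hcC).trans hcv
    have h2 := (E j).inj_root h1 (by rw [EpC j c hcC, qC_root c hcC])
    have h3 : N.src c = v := congrArg Subtype.val h2
    exact not_inner_C c hcC (h3 ▸ hi)
  -- the maps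
  let Dc : N.V → N.E := fun v => if hd : ∃ c ∈ C, N.src c = v then hd.choose else o
  have Dc_eq : ∀ c ∈ C, Dc (N.src c) = c := fun c hcC => by
    have hd : ∃ d ∈ C, N.src d = N.src c := ⟨c, hcC, rfl⟩
    exact (dif_pos hd).trans ((outC c hcC _).1 hd.choose_spec.2)
  -- An inner cell is sent where the expansion of its own copy sends it, the source of `o` to the
  -- new `bang` cell, and a border cell to the source of the corresponding conclusion of `R`.
  let p : N.V → Option R.V := fun v =>
    if hi : N.Inner v then some ((E (k v hi)).p ⟨v, memI v hi⟩)
    else if v = N.src o then none else some (R.src (qC (Dc v)))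
  let b : N.V → Option (Σ j, (E j).t.tree.Node) := fun v =>
    if hi : N.Inner v then some ⟨k v hi, (E (k v hi)).b ⟨v, memI v hi⟩⟩ else none
  let q : N.E → R.E ⊕ Unit := fun e =>
    if hi : N.Inner (N.src e) then Sum.inl ((E (k _ hi)).q ⟨e, memI _ hi⟩)
    else if e = o then Sum.inr () else Sum.inl (qC e)
  have pI : ∀ v (hi : N.Inner v), p v = some ((E (k v hi)).p ⟨v, memI v hi⟩) :=
    fun v hi => dif_pos hi
  have pO : p (N.src o) = none := (dif_neg not_inner_o).trans (if_pos rfl)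
  have pC : ∀ c ∈ C, p (N.src c) = some (R.src (qC c)) := fun c hcC =>
    (dif_neg (not_inner_C c hcC)).trans ((if_neg (C_ne_o c hcC)).trans (by rw [Dc_eq c hcC]))
  have bI : ∀ v (hi : N.Inner v), b v = some ⟨k v hi, (E (k v hi)).b ⟨v, memI v hi⟩⟩ :=
    fun v hi => dif_pos hi
  have bO : b (N.src o) = none := dif_neg not_inner_o
  have bC : ∀ c ∈ C, b (N.src c) = none := fun c hcC => dif_neg (not_inner_C c hcC)
  have qI : ∀ e (hi : N.Inner (N.src e)), q e = Sum.inl ((E (k _ hi)).q ⟨e, memI _ hi⟩) :=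
    fun v hi => dif_pos hi
  have qO : q o = Sum.inr () := (dif_neg not_inner_o).trans (if_pos rfl)
  have qCe : ∀ c ∈ C, q c = Sum.inl (qC c) := fun c hcC =>
    (dif_neg (not_inner_C c hcC)).trans (if_neg fun hh : c = o => hoC (hh ▸ hcC))
  have etri : ∀ e, e = o ∨ e ∈ C ∨ N.Inner (N.src e) := fun e => by
    rcases tri (N.src e) with h1 | ⟨c, h1, h2⟩ | h1
    · exact Or.inl ((outo e).1 h1)
    · exact Or.inr (Or.inl ((outC c h1 e).1 h2.symm ▸ h1))
    · exact Or.inr (Or.inr h1)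
  have pO_iff : ∀ v, p v = none → v = N.src o := fun v hp => by
    rcases tri v with rfl | ⟨c, hcC, rfl⟩ | hi
    · rfl
    · rw [pC c hcC] at hp; cases hp
    · rw [pI v hi] at hp; cases hp
  have pK : ∀ v j (hj : v ∈ N.copy C k j), p v = some ((E j).p ⟨v, hj⟩) := by
    rintro v j (⟨hi, rfl⟩ | ⟨c, hcC, rfl⟩)
    · exact pI v hi
    · rw [pC c hcC]; exact congrArg some (EpC j c hcC).symm
  have bK : ∀ v j (hv : v ∈ N.copy C k j), N.Inner v → b v = some ⟨j, (E j).b ⟨v, hv⟩⟩ := by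
    rintro v j (⟨hi, rfl⟩ | ⟨c, hcC, rfl⟩) hi'
    · exact bI v hi
    · exact absurd hi' (not_inner_C c hcC)
  have qK : ∀ e j (he : N.src e ∈ N.copy C k j), N.Inner (N.src e) →
      q e = Sum.inl ((E j).q ⟨e, he⟩) := by
    rintro e j he hi'
    have h1 : ∃ hi : N.Inner (N.src e), k _ hi = j := by
      rcases he with he | ⟨c, hcC, hce⟩
      · exact he
      · exact absurd hi' (hce ▸ not_inner_C c hcC)
    obtain ⟨hi, rfl⟩ := h1
    exact qI e hi
  have tgtR : ∀ e v j (he : N.src e ∈ N.copy C k j) (hv : v ∈ N.copy C k j), N.tgt e = some v →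
      (N.restrict (N.copy C k j) (C ++ [f j]) (hs j)).tgt ⟨e, he⟩ = some ⟨v, hv⟩ :=
    fun e v j he hv h' => (Net.restrict_tgt _ _).2 h'
  refine ⟨⟨Thick.graft fun j => (E j).t, p, b, q, ?_, ?_, ?_, ?_, ?_, ?_, ?_, ?_, ?_, ?_, ?_, ?_⟩⟩
  · intro v
    rcases tri v with rfl | ⟨c, hcC, rfl⟩ | hi
    · rw [pO, bO]; rfl
    · rw [pC c hcC, bC c hcC]
      exact BoxNet.closeBox_door ⟨qC c, hqmem c hcC, rfl⟩
    · rw [pI v hi, bI v hi]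
      exact (BoxNet.closeBox_inner (inner_door v hi _ _)).trans
        (congrArg (fun y => (some ⟨(), y⟩ : Option (Σ _ : Unit, R.tree.Node))) ((E (k v hi)).box_p ⟨v, memI v hi⟩))
  · intro v w h1 h2
    rcases tri v with rfl | ⟨c, hcC, rfl⟩ | hi
    · rw [pO] at h1
      exact (pO_iff w h1.symm).symm
    · rcases tri w with rfl | ⟨d, hdC, rfl⟩ | hi'
      · rw [pO] at h1; exact pO_iff _ h1
      · have h1' := Option.some.inj ((pC c hcC).symm.trans (h1.trans (pC d hdC)))
        rw [hqinj c hcC d hdC (h.mem_of_src R.wf (hqmem d hdC) h1')]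
      · rw [bC c hcC, bI w hi'] at h2; cases h2
    · rcases tri w with rfl | ⟨d, hdC, rfl⟩ | hi'
      · rw [pO] at h1; exact pO_iff _ h1
      · rw [bC d hdC, bI v hi] at h2; cases h2
      · have h3 := Option.some.inj ((bI v hi).symm.trans (h2.trans (bI w hi')))
        have hw : w ∈ N.copy C k (k v hi) := by
          have h4 : k v hi = k w hi' := congrArg Sigma.fst h3
          rw [h4]; exact memI w hi'
        have h4 := Option.some.inj ((bI v hi).symm.trans (h2.trans (bK w _ hw hi')))
        have h5 := Option.some.inj ((pI v hi).symm.trans (h1.trans (pK w _ hw)))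
        simp only [Sigma.mk.injEq, heq_eq_eq, true_and] at h4
        exact congrArg Subtype.val ((E _).inj _ _ h5 h4)
  · rintro (_ | u) x hx
    · rcases x with _ | x
      · exact ⟨N.src o, pO, bO⟩
      · cases hx
    · by_cases hd : ∃ c' ∈ C', R.src c' = u
      · have hx' : (none : Option (Σ _ : Unit, R.tree.Node)) = (Thick.graft fun j => (E j).t).h x :=
          (BoxNet.closeBox_door hd).symm.trans hx
        obtain ⟨c', hc', rfl⟩ := hd
        obtain ⟨c, hcC, rfl⟩ := hqsurj c' hc'
        rcases x with _ | x
        · exact ⟨N.src c, pC c hcC, bC c hcC⟩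
        · cases hx'
      · have hx' := (BoxNet.closeBox_inner hd).symm.trans hx
        rcases x with _ | ⟨j, y⟩
        · cases hx'
        · have hy : R.box u = (E j).t.h y := by
            have h1 := Option.some.inj hx'
            have h2 : (⟨(), R.box u⟩ : Σ _ : Unit, R.tree.Node) = ⟨(), (E j).t.h y⟩ := h1
            simpa using h2
          obtain ⟨w, rfl, rfl⟩ := (E j).surj u y hy
          have hcases : ∃ hi : N.Inner w.1, k w.1 hi = j := by
            rcases w.2 with hw | ⟨c, hcC, hcw⟩
            · exact hw
            · exfalso
              refine hd ⟨qC c, hqmem c hcC, ?_⟩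
              rw [← EpC j c hcC]
              exact congrArg (E j).p (Subtype.ext hcw)
          obtain ⟨hi, _⟩ := hcases
          exact ⟨w.1, pK w.1 j w.2, bK w.1 j w.2 hi⟩
  · intro e
    rcases etri e with rfl | hcC | hi
    · rw [qO, pO]; rfl
    · rw [qCe e hcC, pC e hcC]; rfl
    · rw [qI e hi, pI _ hi]
      exact congrArg some ((E _).src_q ⟨e, memI _ hi⟩)
  · intro e g h1 h2
    rcases etri e with rfl | hcC | hi
    · exact ((outo g).1 h2.symm).symm
    · exact ((outC e hcC g).1 h2.symm).symm
    · have he := memI _ hi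
      have hg : N.src g ∈ N.copy C k (k _ hi) := by rw [← h2]; exact he
      have h4 := Sum.inl_injective
        ((qK e _ he hi).symm.trans (h1.trans (qK g _ hg (by rw [← h2]; exact hi))))
      exact congrArg Subtype.val ((E _).injE _ _ h4 (Subtype.ext h2))
  · intro e w hw
    rcases tri w with rfl | ⟨c, hcC, rfl⟩ | hi
    · rw [pO] at hw
      rcases e with e | ⟨⟩
      · cases hw
      · exact ⟨o, qO, rfl⟩
    · rw [pC c hcC] at hw
      rcases e with e | ⟨⟩
      · have h1 := h.mem_of_src R.wf (hqmem c hcC) (Option.some.inj hw)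
        exact ⟨c, (qCe c hcC).trans (congrArg Sum.inl h1.symm), rfl⟩
      · cases hw
    · rw [pI w hi] at hw
      rcases e with e | ⟨⟩
      · obtain ⟨g, hg1, hg2⟩ := (E (k w hi)).surjE e _ (Option.some.inj hw)
        have hg3 : N.src g.1 = w := congrArg Subtype.val hg2
        exact ⟨g.1, (qK g.1 _ g.2 (by rw [hg3]; exact hi)).trans (congrArg Sum.inl hg1), hg3⟩
      · cases hw
  · intro e v hev
    have hi := inner_src e v hev
    rw [qI e hi, bI _ hi]
    rcases tri v with rfl | ⟨c, hcC, rfl⟩ | hi'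
    · obtain ⟨j, rfl⟩ := (hf e).1 hev
      rw [pO, bO]
      refine ⟨(Net.addCell_tgt_none _).2 ⟨_, List.mem_singleton.2 ?_, rfl⟩, RTree.reach_root _ _⟩
      -- The copy that contains the source of `f j` equals `j` only propositionally, and `E` depends
      -- on it; the index is generalised so that it can be substituted.
      have h1 : ∀ j' (hj : j' = j) (hm : N.src (f j) ∈ N.copy C k j'),
          (E j').q ⟨f j, hm⟩ = a := by
        rintro _ rfl hm; exact Eqf _ _
      exact h1 _ (hfk j hi) _
    · obtain ⟨h1, _⟩ := (E (k _ hi)).tgt_q _ _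
        (tgtR e _ (k _ hi) (memI _ hi) (memC c hcC _) hev)
      rw [bC c hcC, pK _ _ (memC c hcC (k _ hi))]
      exact ⟨(Net.addCell_tgt_some (BoxNet.tgt_mem_last h) _ _).2 ⟨_, rfl, h1⟩,
        RTree.reach_root _ _⟩
    · have hkk : k _ hi = k v hi' := hk e v hev hi' hi
      have hm : v ∈ N.copy C k (k _ hi) := hkk ▸ memI v hi'
      obtain ⟨h1, h2⟩ := (E (k _ hi)).tgt_q _ _ (tgtR e v (k _ hi) (memI _ hi) hm hev)
      rw [bK v _ hm hi', pK _ _ hm]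
      exact ⟨(Net.addCell_tgt_some (BoxNet.tgt_mem_last h) _ _).2 ⟨_, rfl, h1⟩,
        RTree.graft_reach (fun j => (E j).t.tree) _ h2⟩
  · intro e u hu
    by_contra hne
    push Not at hne
    have hno : N.tgt e = none := Option.eq_none_iff_forall_ne_some.2 hne
    rcases (mem_concl e).1 hno with hcC | rfl
    · rw [qCe e hcC] at hu
      have h1 : qC e ∉ [a] := fun hh => h.not_mem R.wf (List.mem_singleton.1 hh ▸ hqmem e hcC)
      have h2 := (Net.addCell_tgt_inl h1).symm.trans hu
      rw [h.tgt_of_mem R.wf (hqmem e hcC)] at h2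
      cases h2
    · rw [qO] at hu; cases hu
  · intro v
    rcases tri v with rfl | ⟨c, hcC, rfl⟩ | hi
    · rw [pO]; exact hv
    · rw [pC c hcC]; exact (hC c hcC).trans (h.wn _ (hqmem c hcC)).symm
    · rw [pI v hi]; exact (E _).label_p ⟨v, memI v hi⟩
  · intro e
    rcases etri e with rfl | hcC | hi
    · rw [qO]; exact hto
    · rw [qCe e hcC]
      rw [← hqC, List.map_map] at hty
      exact List.map_inj_left.1 hty e hcC
    · rw [qI e hi]; exact (E _).ty_q ⟨e, memI _ hi⟩
  · intro e v hev hl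
    have hi := inner_src e v hev
    have hi' : N.Inner v := by
      rcases tri v with rfl | ⟨c, hcC, rfl⟩ | hi'
      · simp [hv] at hl
      · simp [hC c hcC] at hl
      · exact hi'
    have hm : v ∈ N.copy C k (k _ hi) := hk e v hev hi' hi ▸ memI v hi'
    have h0 := tgtR e v (k _ hi) (memI _ hi) hm hev
    have h1 := (E (k _ hi)).left_q _ _ h0 hl
    have h2 := ((E (k _ hi)).tgt_q _ _ h0).1
    rw [qI e hi]
    refine h1.trans ?_
    have h3 : (E (k _ hi)).q ⟨e, memI _ hi⟩ ∉ [a] := fun hh => by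
      rw [List.mem_singleton.1 hh, h.tgt_last R.wf] at h2; cases h2
    change _ ↔ (if _ then _ else _)
    rw [if_neg h3]
  · suffices hh : N.concl.map q = C'.map Sum.inl ++ [Sum.inr ()] from hh
    rw [hc, List.map_append, ← hqC, List.map_map]
    congr 1
    · exact List.map_congr_left fun c hcC => qCe c hcC
    · simp [qO]

/-! ## Components filled by a daimon -/

/-- The component made of a daimon with outputs indexed by `ι`, and of the `wn` cells below it;
the conclusions are ordered by `c`. -/
def daimonGen {ι : Type} (x : ι → DaimonOut) (c : List ι) : Net where
  V := Option {i : ι // (x i).viaWn = true}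
  E := ι ⊕ {i : ι // (x i).viaWn = true}
  label v := v.elim .daimon fun _ => .wn
  ty := Sum.elim (fun i => (x i).top) (fun i => .wn (x i.1).top)
  src := Sum.elim (fun _ => none) some
  tgt := Sum.elim (fun i => if h : (x i).viaWn = true then some (some ⟨i, h⟩) else none)
    (fun _ => none)
  left _ := False
  concl := c.map fun i => if h : (x i).viaWn = true then Sum.inr ⟨i, h⟩ else Sum.inl i

theorem daimonNet_eq (l : List DaimonOut) :
    daimonNet l = daimonGen (fun i : Fin l.length => l[i]) (List.finRange l.length) := rfl

/-- The conclusion below an output of the daimon. -/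
def daimonGen.door {ι : Type} (x : ι → DaimonOut) (i : ι) :
    ι ⊕ {i : ι // (x i).viaWn = true} :=
  if h : (x i).viaWn = true then Sum.inr ⟨i, h⟩ else Sum.inl i

namespace daimonGen

variable {ι : Type} (x : ι → DaimonOut)

theorem door_pos {i : ι} (h : (x i).viaWn = true) : door x i = Sum.inr ⟨i, h⟩ := dif_pos h

theorem door_neg {i : ι} (h : (x i).viaWn = false) : door x i = Sum.inl i :=
  dif_neg (by simp [h])

theorem door_elim (i : ι) : (door x i).elim id Subtype.val = i := by
  unfold door; split <;> rfl

theorem door_injective : Function.Injective (door x) := fun i j h => by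
  rw [← door_elim x i, h, door_elim]

theorem ty_door (c : List ι) (i : ι) : (daimonGen x c).ty (door x i) = (x i).type := by
  by_cases h : (x i).viaWn = true
  · rw [door_pos x h]; simp [daimonGen, DaimonOut.type, h]
  · rw [door_neg x (by simpa using h)]; simp [daimonGen, DaimonOut.type, h]

theorem type (c : List ι) : (daimonGen x c).type = c.map fun i => (x i).type := by
  exact (List.map_map ..).trans (List.map_congr_left fun i _ => ty_door x c i)

theorem tgt_eq_none {c : List ι} {e : ι ⊕ {i : ι // (x i).viaWn = true}} :
    (daimonGen x c).tgt e = none ↔ ∃ i, door x i = e := by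
  rcases e with i | ⟨i, hi⟩
  · by_cases h : (x i).viaWn = true
    · refine iff_of_false ?_ ?_
      · simp [daimonGen, h]
      · rintro ⟨j, hj⟩
        have := door_elim x j
        rw [hj] at this
        obtain rfl : i = j := this
        rw [door_pos x h] at hj; cases hj
    · refine iff_of_true ?_ ⟨i, door_neg x (by simpa using h)⟩
      simp [daimonGen, h]
  · exact iff_of_true rfl ⟨i, door_pos x hi⟩

theorem tgt_eq_some {c : List ι} {e : ι ⊕ {i : ι // (x i).viaWn = true}}
    {v : Option {i : ι // (x i).viaWn = true}} :
    (daimonGen x c).tgt e = some v ↔ ∃ i, e = Sum.inl i.1 ∧ v = some i := by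
  rcases e with i | i
  · by_cases h : (x i).viaWn = true
    · have : (daimonGen x c).tgt (Sum.inl i) = some (some ⟨i, h⟩) := dif_pos h
      rw [this]
      refine ⟨fun hv => ⟨⟨i, h⟩, rfl, (Option.some.inj hv).symm⟩, ?_⟩
      rintro ⟨j, hj, rfl⟩
      obtain rfl : i = j.1 := Sum.inl_injective hj
      rfl
    · have : (daimonGen x c).tgt (Sum.inl i) = none := dif_neg h
      rw [this]
      refine iff_of_false (by simp) ?_
      rintro ⟨j, hj, rfl⟩
      obtain rfl : i = j.1 := Sum.inl_injective hj
      exact h j.2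
  · refine iff_of_false (by simp [daimonGen]) ?_
    rintro ⟨j, hj, rfl⟩; cases hj

theorem wf [Finite ι] {c : List ι} (hc : c.Nodup) (hm : ∀ i, i ∈ c) : (daimonGen x c).WF where
  finite_V := inferInstanceAs (Finite (Option {i : ι // (x i).viaWn = true}))
  finite_E := inferInstanceAs (Finite (ι ⊕ {i : ι // (x i).viaWn = true}))
  nonempty := ⟨none⟩
  concl_nodup := hc.map (door_injective x)
  mem_concl e := by
    refine (List.mem_map (f := door x)).trans (Iff.trans ?_ (tgt_eq_none x).symm)
    exact ⟨fun ⟨i, _, h⟩ => ⟨i, h⟩, fun ⟨i, h⟩ => ⟨i, hm i, h⟩⟩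
  cell_ok v := by
    rcases v with _ | i
    · intro g hg
      obtain ⟨i, _, hi⟩ := (tgt_eq_some x).1 hg
      cases hi
    · refine ⟨Sum.inr i, (x i.1).top, ?_, rfl, ?_⟩
      · rintro (j | j)
        · exact iff_of_false (fun h => by cases h) (fun h => by cases h)
        · exact ⟨fun h => congrArg Sum.inr (Option.some.inj h), fun h => by
            rw [Sum.inr_injective h]; rfl⟩
      · intro g hg
        obtain ⟨j, rfl, hj⟩ := (tgt_eq_some x).1 hg
        rw [Option.some.inj hj]; rfl

/-- Renaming the outputs of the daimon. -/
theorem iso {κ : Type} (y : κ → DaimonOut) (f : ι ≃ κ) (h : ∀ i, y (f i) = x i) {c : List ι}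
    {d : List κ} (hd : c.map f = d) : Iso (daimonGen x c) (daimonGen y d) := by
  subst hd
  let g : {i : ι // (x i).viaWn = true} ≃ {k : κ // (y k).viaWn = true} :=
    f.subtypeEquiv fun i => by rw [h]
  have hdoor : ∀ i, Sum.map f g (door x i) = door y (f i) := fun i => by
    by_cases hi : (x i).viaWn = true
    · rw [door_pos x hi, door_pos y (by rw [h]; exact hi)]; rfl
    · rw [door_neg x (by simpa using hi), door_neg y (by rw [h]; simpa using hi)]; rfl
  have hbi : Function.Bijective (Sum.map f g) := (Equiv.sumCongr f g).bijective
  have hbo : Function.Bijective (Option.map g) := (Equiv.optionCongr g).bijective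
  refine ⟨Option.map g, Sum.map f g, hbo.injective, hbi.injective, hbo.surjective.range_eq,
    hbi.surjective.range_eq, ?_, ?_, ?_, ?_, ?_, ?_⟩
  · rintro (_ | i) <;> rfl
  · rintro (i | i)
    · exact congrArg DaimonOut.top (h i).symm
    · exact congrArg (fun x => Formula.wn x.top) (h i.1).symm
  · rintro (i | i) <;> rfl
  · intro e v
    refine (tgt_eq_some x).trans (Iff.trans ?_ (tgt_eq_some y).symm)
    constructor
    · rintro ⟨i, rfl, rfl⟩
      exact ⟨g i, rfl, rfl⟩
    · rintro ⟨k, hk, hv⟩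
      obtain ⟨i, rfl⟩ := g.surjective k
      exact ⟨i, hbi.injective hk, hbo.injective hv⟩
  · intro e v he hl
    obtain ⟨i, rfl, rfl⟩ := (tgt_eq_some x).1 he
    rcases hl with hl | hl <;> cases hl
  · change (c.map (door x)).map _ = (c.map f).map (door y)
    refine (List.map_map ..).trans (Eq.trans ?_ (List.map_map ..).symm)
    exact List.map_congr_left fun i _ => hdoor i

/-- An arbitrary index type makes it easy to permute or single out outputs of a daimon; this brings
the result back to a list. -/
theorem iso_daimonNet {c : List ι} (hc : c.Nodup) (hm : ∀ i, i ∈ c) :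
    Iso (daimonGen x c) (daimonNet (c.map x)) := by
  classical
  rw [daimonNet_eq]
  let f : Fin (c.map x).length ≃ ι :=
    (finCongr (List.length_map _)).trans (hc.getEquivOfForallMemList c hm)
  refine (iso _ x f (fun i => ?_) ?_).symm
  · simp [f]
  · refine List.ext_getElem (by simp) fun i h1 h2 => ?_
    simp [f]

end daimonGen

theorem daimonNet_wf (l : List DaimonOut) : (daimonNet l).WF :=
  daimonGen.wf _ (List.nodup_finRange _) (List.mem_finRange)

theorem daimonNet_type (l : List DaimonOut) : (daimonNet l).type = l.map DaimonOut.type := by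
  rw [daimonNet_eq, daimonGen.type]
  refine List.ext_getElem (by simp) fun i h1 h2 => by simp

/-- A component isomorphic to a component filled by a daimon is not without daimon. -/
theorem Net.DaimonFree.not_iso {N : Net} (h : N.DaimonFree) {l : List DaimonOut} :
    ¬ Iso N (daimonNet l) := by
  rintro ⟨p, q, _, _, hp, _, hl, _⟩
  obtain ⟨v, hv⟩ : (none : (daimonNet l).V) ∈ Set.range p := by rw [hp]; trivial
  exact h v ((hl v).trans (by rw [hv]; rfl))

/-! ## Inverting the opening of a box -/

/-- A structure with one daimon, ready to be put in a box. -/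
theorem exists_boxable_daimon (D : List Formula) (A : Formula) :
    ∃ (R : BoxNet) (C : List R.E) (a : R.E), R.IsMELLDaimon ∧ R.toNet.Boxable C a ∧
      (∀ v, R.label v = .daimon →
        ∀ w, R.box w = R.box v → (¬ ∃ c ∈ C, R.src c = w) → w = v) ∧
      C.map R.ty = D.map .wn ∧ R.ty a = A := by
  let x : Option (Fin D.length) → DaimonOut := fun o => o.elim ⟨A, false⟩ fun i => ⟨D[i], true⟩
  let l : List (Option (Fin D.length)) := (List.finRange D.length).map some ++ [none]
  have hl : l.Nodup := by
    refine List.nodup_append.2 ⟨(List.nodup_finRange _).map (Option.some_injective _), by simp, ?_⟩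
    simp
  have hm : ∀ i, i ∈ l := by
    rintro (_ | i) <;> simp [l]
  let C : List (daimonGen x l).E := (List.finRange D.length).map fun i => Sum.inr ⟨some i, rfl⟩
  refine ⟨BoxNet.flat (daimonGen x l) (daimonGen.wf x hl hm), C, Sum.inl none, ⟨?_, ?_, ?_⟩,
    ⟨?_, ?_⟩, ?_, ?_, rfl⟩
  · rintro (_ | v) hv <;> cases hv
  · rintro e (_ | v) _ hv <;> cases hv
  · intro y hy; exact absurd rfl hy
  · refine (List.map_append (f := daimonGen.door x)).trans ?_
    refine congrArg (· ++ _) ?_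
    exact List.map_map ..
  · intro c hc
    obtain ⟨i, _, rfl⟩ := List.mem_map.1 hc
    rfl
  · rintro (_ | v) hv w _ hw
    · rcases w with _ | ⟨_ | i, hi⟩
      · rfl
      · cases hi
      · exact absurd ⟨_, List.mem_map.2 ⟨i, List.mem_finRange i, rfl⟩, rfl⟩ hw
    · cases hv
  · refine (List.map_map ..).trans ?_
    refine List.ext_getElem (by simp) fun i h1 h2 => ?_
    simp only [List.getElem_map, List.getElem_finRange]
    rfl

namespace Net

/-- The data of the opening of a box which contains `n` copies of its content. -/
structure Opening (N : Net) {n : ℕ} (N' : Fin n → Net) (C : List N.E) (o : N.E) (f : Fin n → N.E)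
    (k : N.V → Fin n) : Prop where
  concl : N.concl = C ++ [o]
  bang : N.label (N.src o) = .bang
  wn : ∀ c ∈ C, N.label (N.src c) = .wn
  input : ∀ g, N.tgt g = some (N.src o) ↔ ∃ j, g = f j
  copy_input : ∀ j, k (N.src (f j)) = j
  copy_tgt : ∀ e v, N.tgt e = some v → N.Inner v → k (N.src e) = k v
  sub : ∀ j, Sub (N' j) N
    ({v | N.Inner v ∧ k v = j} ∪ {v | ∃ c ∈ C, N.src c = v})
    ({e | N.Inner (N.src e) ∧ k (N.src e) = j} ∪ {e | e ∈ C})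
    (C ++ [f j])

theorem Opening.iso_restrict {N : Net} {n : ℕ} {N' : Fin n → Net} {C : List N.E} {o : N.E}
    {f : Fin n → N.E} {k : N.V → Fin n} (h : N.Opening N' C o f k) (hN : N.WF) (j : Fin n) :
    ∃ hs, Iso (N' j) (N.restrict (N.copy C (fun v _ => k v) j) (C ++ [f j]) hs) := by
  have h1 : N.copy C (fun v _ => k v) j =
      {v | N.Inner v ∧ k v = j} ∪ {v | ∃ c ∈ C, N.src c = v} := by
    ext v
    simp [copy]
  rw [h1]
  refine (h.sub j).iso_restrict fun e => or_congr_right ?_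
  constructor
  · exact fun he => ⟨e, he, rfl⟩
  · rintro ⟨c, hc, hce⟩
    rwa [(hN.isOut_wn (h.wn c hc) e).1 hce.symm]

/-- The type of a conclusion tells whether the cell above it is a `wn` or a `bang`. As every edge is
a conclusion, no cell is inner. -/
theorem WF.isEmptyBox {N : Net} (hN : N.WF) (h : N.IsEmptyBox) {D : List Formula} {A : Formula}
    (hD : N.type = D.map .wn ++ [.bang A]) :
    ∃ C o, N.concl = C ++ [o] ∧ N.label (N.src o) = .bang ∧
      (∀ c ∈ C, N.label (N.src c) = .wn) ∧ ∀ v, ¬ N.Inner v := by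
  obtain ⟨C, I, hC, hCD, hI⟩ := List.map_eq_append_iff.1 hD
  obtain ⟨o, I1, rfl, ho, hI1⟩ := List.map_eq_cons_iff.1 hI
  obtain rfl := List.map_eq_nil_iff.1 hI1
  refine ⟨C, o, hC, ?_, fun c hc => ?_, fun v hv => ?_⟩
  · rcases h.1 (N.src o) with h1 | h1
    · obtain ⟨o', A', h2, h3, _⟩ := (hN.cell_ok _).wn h1
      obtain rfl := (h2 o).1 rfl
      rw [ho] at h3; cases h3
    · exact h1
  · rcases h.1 (N.src c) with h1 | h1
    · exact h1
    · obtain ⟨o', A', h2, h3, _⟩ := (hN.cell_ok _).bang h1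
      obtain rfl := (h2 c).1 rfl
      have h4 : N.ty c ∈ D.map .wn := hCD ▸ List.mem_map_of_mem hc
      obtain ⟨B, _, hB⟩ := List.mem_map.1 h4
      rw [h3] at hB; cases hB
  · obtain ⟨g, hg⟩ : ∃ g, N.src g = v := by
      rcases h.1 v with h1 | h1
      · obtain ⟨g, _, hg, _⟩ := (hN.cell_ok v).wn h1
        exact ⟨g, hg.ex⟩
      · obtain ⟨g, _, hg, _⟩ := (hN.cell_ok v).bang h1
        exact ⟨g, hg.ex⟩
    exact hv g ((hN.mem_concl g).2 (h.2 g)) hg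

end Net

namespace BoxNet

/-- The content of the box has to be chosen before the net. If `r'` holds a structure whose
auxiliary conclusions are outputs of `wn` cells, it is put in a box, and empty boxes are expansions
of the result with zero copies. If not, no nonempty box can have been rewritten to expansions of
`r'`, since its copies keep the `wn` cells of the border. Only empty boxes remain, and these are
expansions of a box containing a daimon. -/
theorem exists_box {r' : Option BoxNet} {D : List Formula} {A : Formula}
    (hr : IsMELLOfType r' (D.map .wn ++ [A])) :
    ∃ R : BoxNet, R.IsMELL ∧ R.toNet.type = D.map .wn ++ [.bang A] ∧
      (∀ N : Net, N.WF → N.type = D.map .wn ++ [.bang A] → N.IsEmptyBox → Nonempty (Exp N R)) ∧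
      ∀ (N : Net) (n : ℕ) (_ : 0 < n) (N' : Fin n → Net) C o f k, N.WF →
        N.type = D.map .wn ++ [.bang A] → N.Opening N' C o f k →
        (∀ j, ∃ R', r' = some R' ∧ Nonempty (Exp (N' j) R')) → Nonempty (Exp N R) := by
  obtain ⟨R, C', a, hM, hb, hd, hC', ha, hrR⟩ : ∃ (R : BoxNet) (C : List R.E) (a : R.E),
      R.IsMELLDaimon ∧ R.toNet.Boxable C a ∧ (∀ v, R.label v = .daimon →
        ∀ w, R.box w = R.box v → (¬ ∃ c ∈ C, R.src c = w) → w = v) ∧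
      C.map R.ty = D.map .wn ∧ R.ty a = A ∧
      ∀ R', r' = some R' → (∃ C a, R'.toNet.Boxable C a ∧ R'.ty a = A) → R' = R := by
    by_cases h : ∃ R', r' = some R' ∧ ∃ C a, R'.toNet.Boxable C a ∧ R'.ty a = A
    · obtain ⟨R, rfl, C, a, h, ha⟩ := h
      obtain ⟨h1, h2⟩ := hr R rfl
      refine ⟨R, C, a, h1.1, h, fun v hv w hw _ => (h1.2 v hv).1 w hw, ?_, ha, ?_⟩
      · rw [Net.type, h.concl, List.map_append, List.map_singleton, ha] at h2
        exact List.append_cancel_right h2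
      · rintro _ ⟨⟩ _; rfl
    · obtain ⟨R, C, a, h1, h2, h3, h4, h5⟩ := exists_boxable_daimon D A
      exact ⟨R, C, a, h1, h2, h3, h4, h5, fun R' hR' h' => absurd ⟨R', hR', h'⟩ h⟩
  have htypes : ∀ {N : Net} {C : List N.E} {o : N.E}, N.type = D.map .wn ++ [.bang A] →
      N.concl = C ++ [o] → C.map N.ty = C'.map R.ty ∧ N.ty o = .bang (R.ty a) := by
    intro N C o hN hc
    rw [Net.type, hc, List.map_append, List.map_singleton] at hN
    obtain ⟨h1, h2⟩ := List.append_inj' hN rfl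
    exact ⟨h1.trans hC'.symm, by rw [ha]; exact List.singleton_inj.1 h2⟩
  refine ⟨R.close hb, hM.close hb hd, ?_, ?_, ?_⟩
  · suffices hh : (C'.map Sum.inl ++ [Sum.inr ()]).map
        (Sum.elim R.ty fun _ : Unit => .bang (R.ty a)) = D.map .wn ++ [.bang A] from hh
    simp [← hC', ha]
  · intro N hN hND he
    obtain ⟨C, o, hc, hv, hC, hi⟩ := hN.isEmptyBox he hND
    obtain ⟨h1, h2⟩ := htypes hND hc
    -- The box is taken zero times, so its content plays no role beyond the types and the border.
    exact Exp.close (n := 0) (f := Fin.elim0) (k := fun v h => absurd h (hi v)) hN hc hv hC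
      (fun g => iff_of_false (by rw [he.2 g]; simp) fun ⟨j, _⟩ => j.elim0) (fun j => j.elim0)
      (fun e v _ h => absurd h (hi v)) hb (hs := fun j => j.elim0) (fun j => j.elim0) h1 h2
  · intro N n hn N' C o f k hN hND h hE
    obtain ⟨h1, h2⟩ := htypes hND h.concl
    have key : ∀ j, ∃ hs, Nonempty
        (Exp (N.restrict (N.copy C (fun v _ => k v) j) (C ++ [f j]) hs) R) := by
      intro j
      obtain ⟨hs, hiso⟩ := h.iso_restrict hN j
      refine ⟨hs, ?_⟩
      obtain ⟨R', hR', hE'⟩ := hE j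
      obtain ⟨E⟩ := Exp.congr_iso' hiso hE'
      have hE0 : Nonempty (Exp (N.restrict (N.copy C (fun v _ => k v) j) (C ++ [f j]) hs) R') :=
        ⟨E⟩
      rwa [hrR R' hR' ?_] at hE0
      have h3 : (C ++ [f j]).pmap (fun e he => E.q ⟨e, he⟩) hs = R'.concl := by
        rw [← E.concl_q]
        simp [Net.restrict, List.map_pmap]
      rw [List.pmap_append] at h3
      obtain ⟨-, h5⟩ := hr R' hR'
      rw [Net.type, ← h3, List.map_append] at h5
      refine ⟨_, _, ⟨h3.symm, ?_⟩, ?_⟩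
      · intro c hc
        obtain ⟨e, he, rfl⟩ := List.mem_pmap.1 hc
        exact (congrArg R'.label (E.src_q ⟨e, _⟩)).trans
          ((E.label_p ⟨N.src e, _⟩).symm.trans (h.wn e he))
      · simpa using (List.append_inj' h5 rfl).2
    choose hs E using key
    exact Exp.close hN h.concl h.bang h.wn h.input (fun j _ => h.copy_input j)
      (fun e v he hv _ => h.copy_tgt e v he hv) hb (hs := hs) (fun j => (E j).some) h1 h2

end BoxNet

/-! ## Inverting paths -/

/-- The action of a step on components without daimon. -/
def FreeAct : {D : List Formula} → {X : List (List Formula)} → LocalPath D X →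
    Net → Set Poly → Prop
  | _, _, .exc D _ _ _, N, T => ∃ N', N'.DaimonFree ∧ T = {[N']} ∧
      ∃ (C : List N.E) (e f : N.E) (C' : List N.E),
      N.concl = C ++ e :: f :: C' ∧ C.length = D.length ∧
      Sub N' N Set.univ Set.univ (C ++ f :: e :: C')
  | _, _, .mix _ _ _ _, N, T => ∃ N₁ N₂, N₁.DaimonFree ∧ N₂.DaimonFree ∧ T = {[N₁, N₂]} ∧
      ∃ (S : Set N.V) (C₁ C₂ : List N.E),
      (∀ e v, N.tgt e = some v → (N.src e ∈ S ↔ v ∈ S)) ∧ N.concl = C₁ ++ C₂ ∧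
      Sub N₁ N S {e | N.src e ∈ S} C₁ ∧ Sub N₂ N Sᶜ {e | N.src e ∉ S} C₂
  | _, _, .ax _, N, _ => N.IsHypothesis .ax
  | _, _, .one, N, _ => N.IsHypothesis .one
  | _, _, .bot, N, _ => N.IsHypothesis .bot
  | _, _, .weak _, N, _ => N.IsHypothesis .wn
  | _, _, .daimon _ _, _, _ => False
  | _, _, .cut _ _, N, T => ∃ N', N'.DaimonFree ∧ T = {[N']} ∧ ∃ (v : N.V) (e f : N.E), N.label v = .cut ∧
      N.IsPairIn v e f ∧ Sub N' N {v}ᶜ Set.univ (N.concl ++ [e, f])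
  | _, _, .tensor _ _ _, N, T => ∃ N', N'.DaimonFree ∧ T = {[N']} ∧ ∃ (C : List N.E) (o e f : N.E),
      N.concl = C ++ [o] ∧ N.label (N.src o) = .tensor ∧ N.IsPairIn (N.src o) e f ∧ N.left e ∧
      Sub N' N {N.src o}ᶜ {o}ᶜ (C ++ [e, f])
  | _, _, .par _ _ _, N, T => ∃ N', N'.DaimonFree ∧ T = {[N']} ∧ ∃ (C : List N.E) (o e f : N.E),
      N.concl = C ++ [o] ∧ N.label (N.src o) = .par ∧ N.IsPairIn (N.src o) e f ∧ N.left e ∧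
      Sub N' N {N.src o}ᶜ {o}ᶜ (C ++ [e, f])
  | _, _, .contr _ _, N, T => ∃ N', N'.DaimonFree ∧ T = {[N']} ∧ ∃ (C : List N.E) (o : N.E) (S : Set N.E),
      N.concl = C ++ [o] ∧ N.label (N.src o) = .wn ∧ (∀ e ∈ S, N.tgt e = some (N.src o)) ∧
      Iso N' (N.split o S)
  | _, _, .der _ _, N, T => ∃ N', N'.DaimonFree ∧ T = {[N']} ∧ ∃ (C : List N.E) (o e : N.E),
      N.concl = C ++ [o] ∧ N.label (N.src o) = .wn ∧
      (∀ g, N.tgt g = some (N.src o) ↔ g = e) ∧ Sub N' N {N.src o}ᶜ {o}ᶜ (C ++ [e])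
  | _, _, .box _ _, N, T => N.IsEmptyBox ∨ ∃ (n : ℕ) (_ : 0 < n) (N' : Fin n → Net),
      (∀ j, (N' j).DaimonFree) ∧ (T = Set.range fun j => [N' j]) ∧ ∃ (C : List N.E) (o : N.E) (f : Fin n → N.E)
      (k : N.V → Fin n), N.Opening N' C o f k

theorem Net.DaimonFree.not_isHypothesis {N : Net} (h : N.DaimonFree) : ¬ N.IsHypothesis .daimon :=
  fun ⟨⟨v, hv, _⟩, _⟩ => h v hv

theorem Net.DaimonFree.split {N : Net} (h : N.DaimonFree) (e : N.E) (S : Set N.E) :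
    (N.split e S).DaimonFree := by
  rintro (_ | v)
  · exact fun h => by cases h
  · exact h v

/-- A component without daimons matches none of the rules for daimons, and its subgraphs and
splittings have no daimons either. The exception is the empty box, about whose result nothing is
kept. -/
theorem LocalAct.freeAct {D : List Formula} {X : List (List Formula)} {a : LocalPath D X} {N : Net}
    {T : Set Poly} (h : LocalAct a N T) (hN : N.DaimonFree) : FreeAct a N T := by
  cases h with
  | exc C e f C' hc hC h => exact ⟨_, h.daimonFree hN, rfl, C, e, f, C', hc, hC, h⟩
  | mix S C₁ C₂ hS hc _ _ hN1 hN2 =>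
    exact ⟨_, _, hN1.daimonFree hN, hN2.daimonFree hN, rfl, S, C₁, C₂, hS, hc, hN1, hN2⟩
  | mixD _ _ h => exact absurd h hN.not_iso
  | ax h => exact h.resolve_right hN.not_isHypothesis
  | one h => exact h.resolve_right hN.not_isHypothesis
  | bot h => exact h.resolve_right hN.not_isHypothesis
  | weak h => exact h.resolve_right hN.not_isHypothesis
  | daimon h => exact hN.not_isHypothesis h
  | cut v e f hv hi h => exact ⟨_, h.daimonFree hN, rfl, v, e, f, hv, hi, h⟩
  | cutD _ h => exact absurd h hN.not_iso
  | tensor C o e f hc hv hi he h => exact ⟨_, h.daimonFree hN, rfl, C, o, e, f, hc, hv, hi, he, h⟩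
  | tensorD _ h => exact absurd h hN.not_iso
  | par C o e f hc hv hi he h => exact ⟨_, h.daimonFree hN, rfl, C, o, e, f, hc, hv, hi, he, h⟩
  | parD _ h => exact absurd h hN.not_iso
  | contr C o S hc hv hS h =>
    exact ⟨_, Sub.daimonFree h (hN.split o S), rfl, C, o, S, hc, hv, hS, h⟩
  | contrD _ _ _ h => exact absurd h hN.not_iso
  | der C o e hc hv hi h => exact ⟨_, h.daimonFree hN, rfl, C, o, e, hc, hv, hi, h⟩
  | derD _ h => exact absurd h hN.not_iso
  | boxD _ h => exact absurd h hN.not_iso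
  | boxEmpty h _ => exact Or.inl h
  | box hn N' C o f k hc hv hC hf hfk hk h =>
    exact Or.inr ⟨_, hn, N', fun j => (h j).daimonFree hN, rfl, C, o, f, k,
      hc, hv, hC, hf, hfk, hk, h⟩

/-- The components that a step leaves alone are known only through its results, so there must be at
least one. The rule `box` provides one because `n` is positive. -/
theorem LocalAct.nonempty {D : List Formula} {X : List (List Formula)} {a : LocalPath D X} {N : Net}
    {T : Set Poly} (h : LocalAct a N T) : T.Nonempty := by
  cases h with
  | box hn => exact ⟨_, ⟨0, hn⟩, rfl⟩
  | _ => exact Set.singleton_nonempty _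

/-- The components without daimon which `a` rewrites to expansions of `rs` are expansions of `r`. -/
def Inverts {D : List Formula} {X : List (List Formula)} (a : LocalPath D X)
    (rs : List (Option BoxNet)) (r : Option BoxNet) : Prop :=
  IsMELLOfType r D ∧ ∀ N T, N.WF → N.type = D → FreeAct a N T →
    (∀ c ∈ T, List.Forall₂ ExpandsTo c rs) → ∃ R, r = some R ∧ Nonempty (Exp N R)

/-- It suffices to invert a step on an actual structure: if `r'` is `none`, no result is an
expansion of it and `none` is again the answer. -/
theorem IsMELLOfType.lift {G G' : List Formula} {r' : Option BoxNet} (hr : IsMELLOfType r' G')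
    {rel : Net → Net → Prop}
    (H : ∀ R : BoxNet, R.IsMELL → R.toNet.type = G' → ∃ r, IsMELLOfType r G ∧
      ∀ N N', rel N N' → Nonempty (Exp N' R) → ∃ R', r = some R' ∧ Nonempty (Exp N R')) :
    ∃ r, IsMELLOfType r G ∧ ∀ N N', rel N N' → (∃ R, r' = some R ∧ Nonempty (Exp N' R)) →
      ∃ R', r = some R' ∧ Nonempty (Exp N R') := by
  rcases r' with _ | R
  · exact ⟨none, fun R hR => (by cases hR), fun N N' _ ⟨R, hR, _⟩ => (by cases hR)⟩
  · obtain ⟨h1, h2⟩ := hr R rfl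
    obtain ⟨r, h3, h4⟩ := H R h1 h2
    refine ⟨r, h3, fun N N' h ⟨R', hR, hE⟩ => ?_⟩
    obtain rfl := Option.some.inj hR
    exact h4 N N' h hE

theorem IsMELLOfType.lift' {G G' : List Formula} {r' : Option BoxNet} (hr : IsMELLOfType r' G')
    {rel : Net → Net → Prop}
    (H : ∀ R : BoxNet, R.IsMELL → R.toNet.type = G' → ∃ R' : BoxNet, R'.IsMELL ∧
      R'.toNet.type = G ∧ ∀ N N', rel N N' → Nonempty (Exp N' R) → Nonempty (Exp N R')) :
    ∃ r, IsMELLOfType r G ∧ ∀ N N', rel N N' → (∃ R, r' = some R ∧ Nonempty (Exp N' R)) →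
      ∃ R', r = some R' ∧ Nonempty (Exp N R') := by
  refine hr.lift fun R h1 h2 => ?_
  obtain ⟨R', h3, h4, h5⟩ := H R h1 h2
  refine ⟨some R', ?_, fun N N' h hE => ⟨R', rfl, h5 N N' h hE⟩⟩
  rintro _ ⟨⟩; exact ⟨h3, h4⟩

theorem Inverts.of_single {D G : List Formula} {a : LocalPath D [G]} {r' : Option BoxNet}
    {rel : Net → Net → Prop}
    (ha : ∀ N T, FreeAct a N T → ∃ N', N'.DaimonFree ∧ T = {[N']} ∧ rel N N')
    (H : ∃ r, IsMELLOfType r D ∧ ∀ N N', N.WF ∧ N.type = D ∧ rel N N' →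
      (∃ R, r' = some R ∧ Nonempty (Exp N' R)) → ∃ R', r = some R' ∧ Nonempty (Exp N R')) :
    ∃ r, Inverts a [r'] r := by
  obtain ⟨r, h1, h2⟩ := H
  refine ⟨r, h1, fun N T hN hD h hT => ?_⟩
  obtain ⟨N', hN', rfl, hrel⟩ := ha N T h
  have h3 := hT [N'] rfl
  simp only [List.forall₂_cons, List.Forall₂.nil, and_true] at h3
  exact h2 N N' ⟨hN, hD, hrel⟩ (h3 hN')

/-- The point is the order of the quantifiers: `r` is built from the step and from `rs` alone, so it
is the same for all the nets of a possibly infinite set. The step `daimon` never applies to a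
daimon-free component, and the steps that delete one cell leave only one candidate. -/
theorem exists_inverts {D : List Formula} {X : List (List Formula)} (a : LocalPath D X)
    {rs : List (Option BoxNet)} (hrs : List.Forall₂ IsMELLOfType rs X) : ∃ r, Inverts a rs r := by
  have hyp : ∀ (l : Cell), l ≠ .bang → l ≠ .daimon → (∀ N T, N.WF → N.type = D → FreeAct a N T →
      N.DaimonFree ∧ N.IsHypothesis l) → ∃ r, Inverts a rs r := by
    intro l h1 h2 h3
    obtain ⟨r, h4, h5⟩ := exists_hypothesis l h1 h2 D
    exact ⟨r, h4, fun N T hN hD ha _ =>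
      h5 N hN hD (h3 N T hN hD ha).2 (h3 N T hN hD ha).1⟩
  have hfree : ∀ {N : Net} {l : Cell}, l ≠ .daimon → N.IsHypothesis l → N.DaimonFree := by
    rintro N l hl ⟨⟨w, hw, hu⟩, _⟩ v hv
    rw [hu v, hw] at hv
    exact hl hv
  cases a with
  | ax A => exact hyp .ax (by simp) (by simp) fun N T _ _ h => ⟨hfree (by simp) h, h⟩
  | one => exact hyp .one (by simp) (by simp) fun N T _ _ h => ⟨hfree (by simp) h, h⟩
  | bot => exact hyp .bot (by simp) (by simp) fun N T _ _ h => ⟨hfree (by simp) h, h⟩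
  | weak A => exact hyp .wn (by simp) (by simp) fun N T _ _ h => ⟨hfree (by simp) h, h⟩
  | daimon D A => exact ⟨none, fun R hR => (by cases hR), fun N T _ _ h _ => h.elim⟩
  | mix D A B D' =>
    obtain ⟨r₁, rs₁, h1, hrs₁, rfl⟩ := List.forall₂_cons_right_iff.1 hrs
    obtain ⟨r₂, rs₂, h2, hrs₂, rfl⟩ := List.forall₂_cons_right_iff.1 hrs₁
    obtain rfl := List.forall₂_nil_right_iff.1 hrs₂
    by_cases h : ∃ R₁ R₂, r₁ = some R₁ ∧ r₂ = some R₂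
    · obtain ⟨R₁, R₂, rfl, rfl⟩ := h
      obtain ⟨h3, h4⟩ := h1 R₁ rfl
      obtain ⟨h5, h6⟩ := h2 R₂ rfl
      obtain ⟨R, hR, hRt, hE⟩ := BoxNet.exists_mix h3 h5
      refine ⟨some R, ?_, ?_⟩
      · rintro _ ⟨⟩
        exact ⟨hR, by rw [hRt, h4, h6]; simp⟩
      · rintro N T hN hD ⟨N₁, N₂, d1, d2, rfl, S, C₁, C₂, hS, hc, s1, s2⟩ hT
        have h7 := hT _ rfl
        simp only [List.forall₂_cons, List.Forall₂.nil, and_true] at h7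
        obtain ⟨_, ⟨⟩, hE1⟩ := h7.1 d1
        obtain ⟨_, ⟨⟩, hE2⟩ := h7.2 d2
        exact ⟨R, rfl, hE N N₁ N₂ S C₁ C₂ hS hc s1 s2 hE1 hE2⟩
    · refine ⟨none, fun R hR => (by cases hR), ?_⟩
      rintro N T hN hD ⟨N₁, N₂, d1, d2, rfl, -⟩ hT
      have h7 := hT _ rfl
      simp only [List.forall₂_cons, List.Forall₂.nil, and_true] at h7
      obtain ⟨R₁, e1, _⟩ := h7.1 d1
      obtain ⟨R₂, e2, _⟩ := h7.2 d2
      exact absurd ⟨R₁, R₂, e1, e2⟩ h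
  | exc D A B D' =>
    obtain ⟨r', rs', h1, hrs', rfl⟩ := List.forall₂_cons_right_iff.1 hrs
    obtain rfl := List.forall₂_nil_right_iff.1 hrs'
    refine Inverts.of_single (fun N T h => h) (h1.lift' fun R hR hRt => ?_)
    obtain ⟨R', h2, h3, h4⟩ := BoxNet.exists_exc hR hRt
    exact ⟨R', h2, h3, fun N N' ⟨_, _, C, e, f, C', h5, h6, h7⟩ => h4 N N' C e f C' h5 h6 h7⟩
  | cut D A =>
    obtain ⟨r', rs', h1, hrs', rfl⟩ := List.forall₂_cons_right_iff.1 hrs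
    obtain rfl := List.forall₂_nil_right_iff.1 hrs'
    refine Inverts.of_single (fun N T h => h) (h1.lift' fun R hR hRt => ?_)
    obtain ⟨R', h2, h3, h4⟩ := BoxNet.exists_cut hR hRt
    exact ⟨R', h2, h3, fun N N' ⟨hN, _, v, e, f, h5, h6, h7⟩ => h4 N N' v e f hN h5 h6 h7⟩
  | tensor D A B =>
    obtain ⟨r', rs', h1, hrs', rfl⟩ := List.forall₂_cons_right_iff.1 hrs
    obtain rfl := List.forall₂_nil_right_iff.1 hrs'
    refine Inverts.of_single (fun N T h => h) (h1.lift' fun R hR hRt => ?_)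
    obtain ⟨R', h2, h3, h4⟩ := BoxNet.exists_binary hR _ _ (Or.inl ⟨rfl, rfl⟩) hRt
    exact ⟨R', h2, h3, fun N N' ⟨hN, _, C, o, e, f, h5, h6, h7, h8, h9⟩ =>
      h4 N N' C o e f hN h5 h6 h7 h8 h9⟩
  | par D A B =>
    obtain ⟨r', rs', h1, hrs', rfl⟩ := List.forall₂_cons_right_iff.1 hrs
    obtain rfl := List.forall₂_nil_right_iff.1 hrs'
    refine Inverts.of_single (fun N T h => h) (h1.lift' fun R hR hRt => ?_)
    obtain ⟨R', h2, h3, h4⟩ := BoxNet.exists_binary hR _ _ (Or.inr ⟨rfl, rfl⟩) hRt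
    exact ⟨R', h2, h3, fun N N' ⟨hN, _, C, o, e, f, h5, h6, h7, h8, h9⟩ =>
      h4 N N' C o e f hN h5 h6 h7 h8 h9⟩
  | der D A =>
    obtain ⟨r', rs', h1, hrs', rfl⟩ := List.forall₂_cons_right_iff.1 hrs
    obtain rfl := List.forall₂_nil_right_iff.1 hrs'
    refine Inverts.of_single (fun N T h => h) (h1.lift' fun R hR hRt => ?_)
    obtain ⟨R', h2, h3, h4⟩ := BoxNet.exists_der hR hRt
    exact ⟨R', h2, h3, fun N N' ⟨hN, _, C, o, e, h5, h6, h7, h8⟩ => h4 N N' C o e hN h5 h6 h7 h8⟩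
  | contr D A =>
    obtain ⟨r', rs', h1, hrs', rfl⟩ := List.forall₂_cons_right_iff.1 hrs
    obtain rfl := List.forall₂_nil_right_iff.1 hrs'
    refine Inverts.of_single (fun N T h => h) (h1.lift fun R hR hRt => ?_)
    obtain ⟨r, h2, h4⟩ := BoxNet.exists_contr hR hRt
    exact ⟨r, h2, fun N N' ⟨_, hD, C, o, S, h5, h6, h7, h8⟩ => h4 N N' C o S hD h5 h6 h7 h8⟩
  | box D A =>
    obtain ⟨r', rs', h1, hrs', rfl⟩ := List.forall₂_cons_right_iff.1 hrs
    obtain rfl := List.forall₂_nil_right_iff.1 hrs'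
    obtain ⟨R, h2, h3, h4, h5⟩ := BoxNet.exists_box h1
    refine ⟨some R, ?_, ?_⟩
    · rintro _ ⟨⟩; exact ⟨h2, h3⟩
    · rintro N T hN hD (he | ⟨n, hn, N', hd, rfl, C, o, f, k, ho⟩) hT
      · exact ⟨R, rfl, h4 N hN hD he⟩
      · refine ⟨R, rfl, h5 N n hn N' C o f k hN hD ho fun j => ?_⟩
        have h7 := hT _ ⟨j, rfl⟩
        simp only [List.forall₂_cons, List.Forall₂.nil, and_true] at h7
        exact h7 (hd j)

theorem ElemAct.inv {G G' : List (List Formula)} {a : ElemPath G G'} {r : Poly} {T : Set Poly}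
    (h : ElemAct a r T) : match a with
      | .ctx L M a => ∃ l m N T', l.map Net.type = L ∧ m.map Net.type = M ∧ LocalAct a N T' ∧
          r = l ++ [N] ++ m ∧ T = (fun c => l ++ c ++ m) '' T' := by
  cases h with
  | ctx hl hm h => exact ⟨_, _, _, _, hl, hm, h, rfl, rfl⟩

theorem forall₂_append_split {α β : Type*} {R : α → β → Prop} {l : List α} {m₁ m₂ : List β}
    (h : List.Forall₂ R l (m₁ ++ m₂)) :
    ∃ l₁ l₂, l = l₁ ++ l₂ ∧ List.Forall₂ R l₁ m₁ ∧ List.Forall₂ R l₂ m₂ :=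
  ⟨_, _, (List.take_append_drop m₁.length l).symm, List.forall₂_take_append _ _ _ h,
    List.forall₂_drop_append _ _ _ h⟩

theorem forall₂_append_inj {α β : Type*} {R : α → β → Prop} {l₁ l₂ : List α} {m₁ m₂ : List β}
    (h : List.Forall₂ R (l₁ ++ l₂) (m₁ ++ m₂)) (hl : l₁.length = m₁.length) :
    List.Forall₂ R l₁ m₁ ∧ List.Forall₂ R l₂ m₂ := by
  obtain ⟨k₁, k₂, h1, h2, h3⟩ := forall₂_append_split h
  obtain ⟨rfl, rfl⟩ := List.append_inj h1 (hl.trans h2.length_eq.symm)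
  exact ⟨h2, h3⟩

theorem ElemPath.exists_expands {G G' : List (List Formula)} (a : ElemPath G G')
    {rs' : List (Option BoxNet)} (hrs : List.Forall₂ IsMELLOfType rs' G') :
    ∃ rs, List.Forall₂ IsMELLOfType rs G ∧ ∀ r ∈ qDiLL G, ∀ T, ElemAct a r T →
      (∀ c ∈ T, List.Forall₂ ExpandsTo c rs') → List.Forall₂ ExpandsTo r rs := by
  cases a with
  | @ctx D X L M a =>
    obtain ⟨rs₁₂, rs₃, rfl, h12, h3⟩ := forall₂_append_split hrs
    obtain ⟨rs₁, rs₂, rfl, h1, h2⟩ := forall₂_append_split h12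
    obtain ⟨r, hr, hN⟩ := exists_inverts a h2
    refine ⟨rs₁ ++ [r] ++ rs₃, List.rel_append (List.rel_append h1 (by simpa using hr)) h3, ?_⟩
    intro ρ hρ T hT hc
    obtain ⟨l, m, N, T', rfl, rfl, hact, rfl, rfl⟩ := hT.inv
    have key : ∀ c ∈ T', List.Forall₂ ExpandsTo l rs₁ ∧ List.Forall₂ ExpandsTo c rs₂ ∧
        List.Forall₂ ExpandsTo m rs₃ := by
      intro c hcT
      have h4 := hc _ ⟨c, hcT, rfl⟩
      have h5 := h4.length_eq
      have h6 := h1.length_eq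
      have h7 := h3.length_eq
      simp only [List.length_append, List.length_map] at h5 h6 h7
      obtain ⟨h8, h9⟩ := forall₂_append_inj h4 (by simp only [List.length_append]; omega)
      obtain ⟨h10, h11⟩ := forall₂_append_inj h8 (by omega)
      exact ⟨h10, h11, h9⟩
    obtain ⟨c, hcT⟩ := hact.nonempty
    obtain ⟨h4, -, h5⟩ := key c hcT
    refine List.rel_append (List.rel_append h4 ?_) h5
    simp only [List.forall₂_cons, List.Forall₂.nil, and_true]
    intro hd
    have hND : N.type = D := by
      have := hρ.2
      simp only [List.map_append] at this
      have h6 := List.append_inj_left this (by simp)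
      simpa using (List.append_inj_right h6 rfl)
    exact hN N T' (hρ.1 N (by simp)) hND (hact.freeAct hd) fun c hc => (key c hc).2.1

/-- The hypothesis concerns the end of the path, and information flows backwards: one step gives
structures for the set before it. At the empty structure the list `[]` starts the process. -/
theorem PathAct.exists_expands {G G' : List (List Formula)} {p : Quiver.Path G G'}
    {P P' : Set Poly} (h : PathAct p P P') {rs' : List (Option BoxNet)}
    (hrs : List.Forall₂ IsMELLOfType rs' G') (hP' : ∀ c ∈ P', List.Forall₂ ExpandsTo c rs') :
    ∃ rs, List.Forall₂ IsMELLOfType rs G ∧ ∀ c ∈ P, List.Forall₂ ExpandsTo c rs := by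
  induction p generalizing P' rs' with
  | nil =>
    obtain ⟨_, rfl⟩ := h
    exact ⟨rs', hrs, hP'⟩
  | cons p a ih =>
    obtain ⟨Q, hQ, hQG, _, F, hF, rfl⟩ := h
    obtain ⟨rs, h1, h2⟩ := ElemPath.exists_expands a hrs
    refine ih hQ h1 fun c hc => h2 c (hQG hc) _ (hF c hc) fun d hd => hP' d ?_
    exact Set.mem_biUnion hc hd

/-- A glueable set of resource proof-structures is contained in a Taylor expansion. -/
theorem Glueable.exists_taylor {P : Set Poly} (hne : P.Nonempty)
    (hP : ∀ r ∈ P, IsDiLLProofStructure r) (h : Glueable P) :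
    ∃ R : List BoxNet, IsMELLProofStructure R ∧ P ⊆ Taylor R := by
  obtain ⟨G, p, hp⟩ := h
  obtain ⟨rs, hrs, hE⟩ := hp.exists_expands (rs' := []) List.Forall₂.nil fun c hc => by
    rw [hc]; exact List.Forall₂.nil
  obtain ⟨r₀, hr₀⟩ := hne
  have hlen := (hE r₀ hr₀).length_eq
  have hle := (hP r₀ hr₀).1
  rcases rs with _ | ⟨r, _ | ⟨r', rs⟩⟩
  · refine ⟨[], ⟨by simp, by simp⟩, fun c hc => ?_⟩
    rw [List.forall₂_nil_right_iff.1 (hE c hc)]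
    exact List.Forall₂.nil
  · have key : ∀ c ∈ P, ∃ N R, c = [N] ∧ r = some R ∧ Nonempty (Exp N R) := by
      intro c hc
      have h1 := hE c hc
      obtain ⟨N, c', hN, hc', rfl⟩ := List.forall₂_cons_right_iff.1 h1
      obtain rfl := List.forall₂_nil_right_iff.1 hc'
      obtain ⟨R, hR, hNR⟩ := hN ((hP _ hc).2 N (by simp)).2
      exact ⟨N, R, rfl, hR, hNR⟩
    -- Members of `P` are daimon-free, so a single one is enough to exclude `r = none`.
    obtain ⟨_, R, _, rfl, _⟩ := key r₀ hr₀
    obtain ⟨G₀, G', hG, -, rfl⟩ := List.forall₂_cons_left_iff.1 hrs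
    refine ⟨[R], ⟨by simp, fun c hc => ?_⟩, fun c hc => ?_⟩
    · rw [List.mem_singleton.1 hc]; exact (hG R rfl).1
    · obtain ⟨N, R', rfl, hR', hNR⟩ := key c hc
      obtain rfl := Option.some.inj hR'
      exact List.Forall₂.cons (Exp.iff_iso.1 hNR) List.Forall₂.nil
  · simp only [List.length_cons] at hlen
    omega

/-! ## Strategies -/

theorem PathAct.comp {G G' G'' : List (List Formula)} {p : Quiver.Path G G'}
    {q : Quiver.Path G' G''} {P Q P' : Set Poly} (h : PathAct p P Q) (h' : PathAct q Q P') :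
    PathAct (p.comp q) P P' := by
  induction q generalizing P' with
  | nil => obtain ⟨_, rfl⟩ := h'; exact h
  | cons q a ih =>
    obtain ⟨Q', h1, h2⟩ := h'
    exact ⟨Q', ih h1, h2⟩

/-- All sets of quasi-proof-structures of type `G` which satisfy `B` are glueable. -/
def Win (G : List (List Formula)) (B : Poly → Prop) : Prop :=
  ∀ P : Set Poly, P ⊆ qDiLL G → P.Nonempty → (∀ r ∈ P, B r) →
    ∃ p : Quiver.Path G [], PathAct p P {emptyPS}

theorem Win.mono {G : List (List Formula)} {B B' : Poly → Prop} (h : Win G B)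
    (h' : ∀ r ∈ qDiLL G, B' r → B r) : Win G B' :=
  fun P hP hne hB => h P hP hne fun r hr => h' r (hP hr) (hB r hr)

/-- `r` consists of a component satisfying `A`, followed by components satisfying `B`. -/
def ConsProp (A : Net → Prop) (B : Poly → Prop) (r : Poly) : Prop :=
  ∃ N m, r = N :: m ∧ A N ∧ B m

/-- Components of type `G` which satisfy `A` can be removed. -/
def Good (G : List Formula) (A : Net → Prop) : Prop :=
  ∀ M B, Win M B → Win (G :: M) (ConsProp A B)

/-- The same step is performed on the first component of every member, but the results may be chosen
member by member. Their union must be nonempty for the rest of the strategy to end on a singleton.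
-/
theorem Win.step {D : List Formula} {X M : List (List Formula)} (a : LocalPath D X)
    {A : Net → Prop} {C B : Poly → Prop}
    (h : ∀ N, N.WF → N.type = D → A N →
      ∃ T, LocalAct a N T ∧ ∀ c ∈ T, c ∈ qDiLL X ∧ C c)
    (hw : Win (X ++ M) fun r => ∃ c m, r = c ++ m ∧ C c ∧ B m) :
    Win (D :: M) (ConsProp A B) := by
  intro P hP hne hB
  have key : ∀ r : P, ∃ F : Set Poly, ElemAct (.ctx [] M a) r.1 F ∧ F.Nonempty ∧ F ⊆ qDiLL (X ++ M) ∧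
      ∀ c ∈ F, ∃ d m, c = d ++ m ∧ C d ∧ B m := by
    rintro ⟨r, hr⟩
    obtain ⟨N, m, rfl, hA, hm⟩ := hB r hr
    obtain ⟨hwf, hty⟩ := hP hr
    obtain ⟨hN, hM⟩ := List.cons_eq_cons.1 (hty : N.type :: m.map Net.type = D :: M)
    obtain ⟨T, hT, hc⟩ := h N (hwf N (by simp)) hN hA
    refine ⟨(fun c => [] ++ c ++ m) '' T, ElemAct.ctx (l := []) rfl hM hT, hT.nonempty.image _,
      ?_, ?_⟩
    · rintro _ ⟨c, hcT, rfl⟩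
      obtain ⟨⟨h1, h2⟩, _⟩ := hc c hcT
      refine ⟨fun N' hN' => ?_, by simp [h2, hM]⟩
      simp only [List.nil_append, List.mem_append] at hN'
      rcases hN' with hN' | hN'
      · exact h1 _ hN'
      · exact hwf _ (List.mem_cons_of_mem _ hN')
    · rintro _ ⟨c, hcT, rfl⟩
      exact ⟨c, m, rfl, (hc c hcT).2, hm⟩
  classical
  choose F hF1 hF2 hF3 hF4 using key
  let F' : Poly → Set Poly := fun r => if hr : r ∈ P then F ⟨r, hr⟩ else ∅
  have hF' : ∀ r (hr : r ∈ P), F' r = F ⟨r, hr⟩ := fun r hr => dif_pos hr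
  have hsub : (⋃ r ∈ P, F' r) ⊆ qDiLL (X ++ M) := by
    refine Set.iUnion₂_subset fun r hr => ?_
    rw [hF' r hr]; exact hF3 _
  have hne' : (⋃ r ∈ P, F' r).Nonempty := by
    obtain ⟨r, hr⟩ := hne
    obtain ⟨c, hc⟩ := hF2 ⟨r, hr⟩
    exact ⟨c, Set.mem_biUnion hr (by rw [hF' r hr]; exact hc)⟩
  obtain ⟨p, hp⟩ := hw _ hsub hne' (by
    intro c hc
    obtain ⟨r, hr, hc⟩ := Set.mem_iUnion₂.1 hc
    rw [hF' r hr] at hc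
    exact hF4 _ c hc)
  have hact : SetAct (ElemPath.ctx [] M a) P (⋃ r ∈ P, F' r) :=
    ⟨hP, hsub, F', fun r hr => by rw [hF' r hr]; exact hF1 ⟨r, hr⟩, rfl⟩
  let e : @Quiver.Hom (List (List Formula)) _ (D :: M) (X ++ M) := ElemPath.ctx [] M a
  exact ⟨(Quiver.Path.nil.cons e).comp p, PathAct.comp ⟨P, ⟨hP, rfl⟩, hact⟩ hp⟩

/-! ### Combining strategies -/

namespace Good

variable {G G' G₁ G₂ : List Formula} {A A' A₁ A₂ : Net → Prop}

theorem mono (h : Good G A) (h' : ∀ N, N.WF → N.type = G → A' N → A N) : Good G A' := by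
  intro M B hM
  refine (h M B hM).mono ?_
  rintro _ hr ⟨N, m, rfl, hA, hB⟩
  obtain ⟨hN, _⟩ := List.cons_eq_cons.1 (hr.2 : N.type :: m.map Net.type = G :: M)
  exact ⟨N, m, rfl, h' N (hr.1 N (by simp)) hN hA, hB⟩

theorem step₀ (a : LocalPath G []) (h : ∀ N, N.WF → N.type = G → A N → LocalAct a N {[]}) :
    Good G A := by
  intro M B hM
  refine Win.step a (C := fun c => c = []) (fun N h1 h2 h3 => ⟨_, h N h1 h2 h3, ?_⟩) ?_
  · rintro _ rfl
    exact ⟨⟨by simp, rfl⟩, rfl⟩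
  · refine hM.mono ?_
    rintro _ _ ⟨_, m, rfl, rfl, hm⟩
    exact hm

theorem step_set (hG : Good G' A') (a : LocalPath G [G'])
    (h : ∀ N, N.WF → N.type = G → A N → ∃ T, LocalAct a N T ∧
      ∀ c ∈ T, ∃ N', c = [N'] ∧ N'.WF ∧ N'.type = G' ∧ A' N') : Good G A := by
  intro M B hM
  refine Win.step a (C := fun c => ∃ N', c = [N'] ∧ A' N') (fun N h1 h2 h3 => ?_) ?_
  · obtain ⟨T, hT, hc⟩ := h N h1 h2 h3
    refine ⟨T, hT, fun c hcT => ?_⟩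
    obtain ⟨N', rfl, h4, h5, h6⟩ := hc c hcT
    exact ⟨⟨by simpa using h4, by simp [h5]⟩, N', rfl, h6⟩
  · refine (hG M B hM).mono ?_
    rintro _ _ ⟨_, m, rfl, ⟨N', rfl, hN'⟩, hm⟩
    exact ⟨N', m, rfl, hN', hm⟩

theorem step₁ (hG : Good G' A') (a : LocalPath G [G'])
    (h : ∀ N, N.WF → N.type = G → A N → ∃ N', LocalAct a N {[N']} ∧ N'.WF ∧ N'.type = G' ∧ A' N') :
    Good G A := by
  refine hG.step_set a fun N h1 h2 h3 => ?_
  obtain ⟨N', h4, h5⟩ := h N h1 h2 h3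
  exact ⟨_, h4, fun c hc => ⟨N', hc, h5⟩⟩

/-- After `mix` the second component is part of the continuation of the first one, so the two
strategies are simply nested. -/
theorem step₂ (hG₁ : Good G₁ A₁) (hG₂ : Good G₂ A₂) (a : LocalPath G [G₁, G₂])
    (h : ∀ N, N.WF → N.type = G → A N → ∃ N₁ N₂, LocalAct a N {[N₁, N₂]} ∧
      (N₁.WF ∧ N₁.type = G₁ ∧ A₁ N₁) ∧ N₂.WF ∧ N₂.type = G₂ ∧ A₂ N₂) : Good G A := by
  intro M B hM
  refine Win.step a (C := fun c => ∃ N₁ N₂, c = [N₁, N₂] ∧ A₁ N₁ ∧ A₂ N₂)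
    (fun N h1 h2 h3 => ?_) ?_
  · obtain ⟨N₁, N₂, hT, ⟨h4, h5, h6⟩, h7, h8, h9⟩ := h N h1 h2 h3
    refine ⟨_, hT, ?_⟩
    rintro _ rfl
    exact ⟨⟨by simpa using ⟨h4, h7⟩, by simp [h5, h8]⟩, N₁, N₂, rfl, h6, h9⟩
  · refine (hG₁ _ _ (hG₂ M B hM)).mono ?_
    rintro _ _ ⟨_, m, rfl, ⟨N₁, N₂, rfl, hN₁, hN₂⟩, hm⟩
    exact ⟨N₁, N₂ :: m, rfl, hN₁, N₂, m, rfl, hN₂, hm⟩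

/-- Proof-structures which satisfy `A` are glueable. -/
theorem glueable (hG : Good G A) {P : Set Poly} (hP : P.Nonempty)
    (h : ∀ r ∈ P, ∃ N, r = [N] ∧ N.WF ∧ N.type = G ∧ A N) : Glueable P := by
  -- The only quasi-proof-structure of type `[]` is the empty one, so a nonempty set of this type is
  -- already the singleton to be reached.
  have h0 : Win [] fun _ => True := by
    intro P hP hne _
    refine ⟨.nil, hP, ?_⟩
    have h1 : ∀ r ∈ P, r = [] := fun r hr => List.map_eq_nil_iff.1 (hP hr).2
    obtain ⟨r, hr⟩ := hne
    obtain rfl := h1 r hr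
    ext s
    exact ⟨fun hs => by rw [Set.mem_singleton_iff.1 hs]; exact hr, h1 s⟩
  obtain ⟨p, hp⟩ := hG _ _ h0 P (fun r hr => by
    obtain ⟨N, rfl, h1, h2, _⟩ := h r hr
    exact ⟨by simpa using h1, by simp [h2]⟩) hP fun r hr => by
    obtain ⟨N, rfl, _, _, h1⟩ := h r hr
    exact ⟨N, [], rfl, h1, trivial⟩
  exact ⟨_, p, hp⟩

end Good

/-- `N` is filled by a daimon, its conclusions have the prescribed types, and only those which are
flagged may be outputs of `wn` cells. -/
def DaimonForm (m : List (Formula × Prop)) (N : Net) : Prop :=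
  ∃ l, Iso N (daimonNet l) ∧
    List.Forall₂ (fun x y => x.type = y.1 ∧ (x.viaWn = true → y.2)) l m

/-- A deletion computed on an explicit model is carried over to the net at hand; dereliction of a
daimon is treated in this way. -/
theorem Sub.trans_iso {N' M N : Net} {K KE c} (h : Sub N' M K KE c) {p : M.V → N.V}
    {q : M.E → N.E} (hp : Function.Bijective p) (hq : Function.Bijective q)
    (hl : ∀ v, M.label v = N.label (p v)) (ht : ∀ e, M.ty e = N.ty (q e))
    (hs : ∀ e, p (M.src e) = N.src (q e)) (hg : ∀ e v, M.tgt e = some v ↔ N.tgt (q e) = some (p v))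
    (hf : ∀ e v, M.tgt e = some v → (M.label v = .tensor ∨ M.label v = .par) →
      (M.left e ↔ N.left (q e))) : Sub N' N (p '' K) (q '' KE) (c.map q) := by
  obtain ⟨p', q', hp', hq', rp', rq', hl', ht', hs', hg', hf', hc'⟩ := h
  refine ⟨p ∘ p', q ∘ q', hp.injective.comp hp', hq.injective.comp hq', by rw [Set.range_comp, rp'],
    by rw [Set.range_comp, rq'], ?_, ?_, ?_, ?_, ?_, ?_⟩
  · intro v; rw [hl', hl]; rfl
  · intro e; rw [ht', ht]; rfl
  · intro e; exact (congrArg p (hs' e)).trans (hs _)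
  · intro e v; exact (hg' e v).trans (hg _ _)
  · intro e v h1 h2
    exact (hf' e v h1 h2).trans (hf _ _ ((hg' e v).1 h1) (by rw [← hl']; exact h2))
  · rw [← hc', List.map_map]

/-! ### Steps on components filled by a daimon -/

namespace DaimonForm

variable {m m' : List (Formula × Prop)} {N : Net}

theorem wf (h : DaimonForm m N) : N.WF := by
  obtain ⟨l, h1, _⟩ := h
  exact h1.wf (daimonNet_wf l)

theorem type (h : DaimonForm m N) : N.type = m.map Prod.fst := by
  obtain ⟨l, h1, h2⟩ := h
  rw [h1.type_eq, daimonNet_type]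
  clear h1
  induction h2 with
  | nil => rfl
  | cons h _ ih => rw [List.map_cons, List.map_cons, ih, h.1]

theorem mono (h : DaimonForm m N)
    (hm : List.Forall₂ (fun x y => x.1 = y.1 ∧ (x.2 → y.2)) m m') : DaimonForm m' N := by
  obtain ⟨l, h1, h2⟩ := h
  refine ⟨l, h1, ?_⟩
  clear h1
  induction h2 generalizing m' with
  | nil => rw [List.forall₂_nil_left_iff.1 hm]; exact List.Forall₂.nil
  | cons h _ ih =>
    obtain ⟨y, m'', h3, h4, rfl⟩ := List.forall₂_cons_left_iff.1 hm
    exact List.Forall₂.cons ⟨h.1.trans h3.1, fun hh => h3.2 (h.2 hh)⟩ (ih h4)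

theorem of_list (l : List DaimonOut)
    (h : List.Forall₂ (fun x y => x.type = y.1 ∧ (x.viaWn = true → y.2)) l m) :
    DaimonForm m (daimonNet l) := ⟨l, Iso.refl _, h⟩

/-- Without flags no `wn` cell can stand below the daimon, which is then the only cell. This is the
situation in which the deleting steps apply to a daimon. -/
theorem isHypothesis (h : DaimonForm m N) (hm : ∀ x ∈ m, ¬ x.2) : N.IsHypothesis .daimon := by
  obtain ⟨l, ⟨p, q, hp, hq, rp, rq, hl, ht, hs, hg, hf, hc⟩, h2⟩ := h
  have h3 : ∀ x ∈ l, x.viaWn ≠ true := by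
    clear * - h2 hm
    induction h2 with
    | nil => simp
    | cons h _ ih =>
      simp only [List.forall_mem_cons] at hm ⊢
      exact ⟨fun hx => hm.1 (h.2 hx), ih hm.2⟩
  have h4 : ∀ v : (daimonNet l).V, v = none := by
    rintro (_ | ⟨i, hi⟩)
    · rfl
    · exact absurd hi (h3 _ (List.getElem_mem _))
  obtain ⟨v, hv⟩ : (none : (daimonNet l).V) ∈ Set.range p := by rw [rp]; trivial
  refine ⟨⟨v, (hl v).trans (by rw [hv]; rfl), fun w => hp ((h4 _).trans (h4 _).symm)⟩, fun e => ?_⟩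
  refine Option.eq_none_iff_forall_ne_some.2 fun w hw => ?_
  obtain ⟨i, _, hi⟩ := (daimonGen.tgt_eq_some _).1 ((hg e w).1 hw)
  exact h3 _ (List.getElem_mem _) i.2

/-- Exchange has no special rule for daimons. The ordinary rule is used, and permuting the index
list of `daimonGen` shows that the result is still filled by a daimon. -/
theorem exc {m₁ m₂ : List (Formula × Prop)}
    {x y : Formula × Prop} {C C' : List N.E} {e f : N.E} (h : DaimonForm (m₁ ++ x :: y :: m₂) N)
    (hc : N.concl = C ++ e :: f :: C') (hC : C.length = m₁.length) :
    DaimonForm (m₁ ++ y :: x :: m₂) (N.reconcl (C ++ f :: e :: C')) := by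
  obtain ⟨l, ⟨p, q, hp, hq, rp, rq, hl, ht, hs, hg, hf, hcc⟩, h2⟩ := h
  let z : Fin l.length → DaimonOut := fun i => l[i]
  have h3 : (List.finRange l.length).map (daimonGen.door z) = (C ++ e :: f :: C').map q := by
    rw [← hc]; exact hcc.symm
  rw [List.map_append] at h3
  obtain ⟨c₁, c₂, h4, h5, h6⟩ := List.map_eq_append_iff.1 h3
  obtain ⟨i, c₃, rfl, hi, h7⟩ := List.map_eq_cons_iff.1 h6
  obtain ⟨j, c₄, rfl, hj, h8⟩ := List.map_eq_cons_iff.1 h7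
  have hperm : (c₁ ++ j :: i :: c₄).Perm (List.finRange l.length) := by
    rw [h4]; exact (List.Perm.swap _ _ _).append_left _
  have hiso : Iso (N.reconcl (C ++ f :: e :: C')) (daimonGen z (c₁ ++ j :: i :: c₄)) := by
    refine ⟨p, q, hp, hq, rp, rq, hl, ht, hs, hg, hf, ?_⟩
    refine Eq.trans ?_ (List.map_append (f := daimonGen.door z)).symm
    refine (List.map_append ..).trans ?_
    rw [h5]
    refine congrArg _ ?_
    refine congrArg₂ _ hj.symm (congrArg₂ _ hi.symm h8.symm)
  refine ⟨_, hiso.trans (daimonGen.iso_daimonNet z (hperm.nodup_iff.2 (List.nodup_finRange _))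
    fun k => hperm.mem_iff.2 (List.mem_finRange k)), ?_⟩
  have h9 : l = c₁.map z ++ z i :: z j :: c₄.map z := by
    have h10 : (List.finRange l.length).map z = l :=
      List.ext_getElem (by simp) fun i h1 h2 => by simp [z]
    exact h10.symm.trans (by rw [h4]; simp)
  rw [h9] at h2
  have hlen : (c₁.map z).length = m₁.length := by
    rw [List.length_map, ← hC]
    exact (List.length_map (daimonGen.door z)).symm.trans
      ((congrArg List.length h5).trans (List.length_map q))
  obtain ⟨h11, h12⟩ := forall₂_append_inj h2 hlen
  simp only [List.forall₂_cons] at h12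
  simp only [List.map_append, List.map_cons]
  exact List.rel_append h11 (.cons h12.2.1 (.cons h12.1 h12.2.2))

theorem mix (h : DaimonForm (m ++ m') N) (D : List Formula) (A B : Formula) (D' : List Formula) :
    ∃ N₁ N₂, LocalAct (.mix D A B D') N {[N₁, N₂]} ∧ DaimonForm m N₁ ∧ DaimonForm m' N₂ := by
  obtain ⟨l, h1, h2⟩ := h
  obtain ⟨l₁, l₂, rfl, h3, h4⟩ := forall₂_append_split h2
  exact ⟨_, _, .mixD l₁ l₂ h1 (Iso.refl _) (Iso.refl _), of_list _ h3, of_list _ h4⟩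

theorem cut (h : DaimonForm m N) (D : List Formula) (A : Formula) :
    ∃ N', LocalAct (.cut D A) N {[N']} ∧ DaimonForm (m ++ [(A, False), (A.dual, False)]) N' := by
  obtain ⟨l, h1, h2⟩ := h
  refine ⟨_, .cutD l h1 (Iso.refl _), of_list _ (List.rel_append h2 ?_)⟩
  simp [DaimonOut.type]

theorem exists_last {x : Formula × Prop} (h : DaimonForm (m ++ [x]) N) :
    ∃ l y, Iso N (daimonNet (l ++ [y])) ∧
      List.Forall₂ (fun x y => x.type = y.1 ∧ (x.viaWn = true → y.2)) l m ∧
      y.type = x.1 ∧ (y.viaWn = true → x.2) := by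
  obtain ⟨l, h1, h2⟩ := h
  obtain ⟨l₁, l₂, rfl, h3, h4⟩ := forall₂_append_split h2
  obtain ⟨y, l₃, hy, h5, rfl⟩ := List.forall₂_cons_right_iff.1 h4
  obtain rfl := List.forall₂_nil_right_iff.1 h5
  exact ⟨l₁, y, h1, h3, hy.1, hy.2⟩

theorem _root_.Glue.DaimonOut.eq_of_type {x : DaimonOut} {A : Formula} (h : x.type = A)
    (hA : ∀ B, A ≠ .wn B) : x = ⟨A, false⟩ := by
  obtain ⟨B, _ | _⟩ := x
  · obtain rfl : B = A := h
    rfl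
  · exact absurd h.symm (hA B)

theorem tensor {A B : Formula} {P : Prop} (h : DaimonForm (m ++ [(.tensor A B, P)]) N)
    (D : List Formula) :
    ∃ N', LocalAct (.tensor D A B) N {[N']} ∧ DaimonForm (m ++ [(A, False), (B, False)]) N' := by
  obtain ⟨l, y, h1, h2, h3, _⟩ := h.exists_last
  obtain rfl := DaimonOut.eq_of_type h3 (by simp)
  refine ⟨_, .tensorD l h1 (Iso.refl _), of_list _ (List.rel_append h2 ?_)⟩
  simp [DaimonOut.type]

theorem par {A B : Formula} {P : Prop} (h : DaimonForm (m ++ [(.par A B, P)]) N)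
    (D : List Formula) :
    ∃ N', LocalAct (.par D A B) N {[N']} ∧ DaimonForm (m ++ [(A, False), (B, False)]) N' := by
  obtain ⟨l, y, h1, h2, h3, _⟩ := h.exists_last
  obtain rfl := DaimonOut.eq_of_type h3 (by simp)
  refine ⟨_, .parD l h1 (Iso.refl _), of_list _ (List.rel_append h2 ?_)⟩
  simp [DaimonOut.type]

theorem box {A : Formula} {P : Prop} (h : DaimonForm (m ++ [(.bang A, P)]) N)
    (D : List Formula) :
    ∃ N', LocalAct (.box D A) N {[N']} ∧ DaimonForm (m ++ [(A, False)]) N' := by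
  obtain ⟨l, y, h1, h2, h3, _⟩ := h.exists_last
  obtain rfl := DaimonOut.eq_of_type h3 (by simp)
  refine ⟨_, .boxD l h1 (Iso.refl _), of_list _ (List.rel_append h2 ?_)⟩
  simp [DaimonOut.type]

theorem contr {A : Formula} {P : Prop} (h : DaimonForm (m ++ [(.wn A, P)]) N)
    (D : List Formula) :
    ∃ N', LocalAct (.contr D A) N {[N']} ∧
      DaimonForm (m ++ [(.wn A, True), (.wn A, True)]) N' := by
  obtain ⟨l, y, h1, h2, h3, _⟩ := h.exists_last
  refine ⟨_, .contrD l y h3 h1 (Iso.refl _), of_list _ (List.rel_append h2 ?_)⟩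
  simp [DaimonOut.type]

/-- If `?A` is a direct output of the daimon, the rule for daimons retypes it. If it is the output
of a `wn` cell, that cell has exactly one input and the ordinary rule deletes it. Either way `A`
ends up as a direct output, with its flag cleared. -/
theorem der {A : Formula} {P : Prop} (h : DaimonForm (m ++ [(.wn A, P)]) N)
    (D : List Formula) :
    ∃ N', LocalAct (.der D A) N {[N']} ∧ DaimonForm (m ++ [(A, False)]) N' := by
  obtain ⟨l, y, h1, h2, h3, _⟩ := h.exists_last
  obtain ⟨B, _ | _⟩ := y
  · obtain rfl : B = .wn A := h3
    refine ⟨_, .derD l h1 (Iso.refl _), of_list _ (List.rel_append h2 ?_)⟩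
    simp [DaimonOut.type]
  · obtain rfl : B = A := Formula.wn.inj h3
    -- The last output is isolated as `none`. The models before and after the step then share their
    -- index type and differ only in whether `none` passes through a `wn` cell.
    let ι := Option (Fin l.length)
    let x : Bool → ι → DaimonOut := fun b o => o.elim ⟨B, b⟩ fun i => l[i]
    let c : List ι := (List.finRange l.length).map some ++ [none]
    have hc : c.Nodup := by
      refine List.nodup_append.2
        ⟨(List.nodup_finRange _).map (Option.some_injective _), by simp, by simp⟩
    have hm : ∀ i, i ∈ c := by rintro (_ | i) <;> simp [c]
    have hx : ∀ b, c.map (x b) = l ++ [⟨B, b⟩] := fun b => by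
      simp only [c, List.map_append, List.map_map, List.map_singleton]
      refine congrArg (· ++ _) ?_
      exact List.ext_getElem (by simp) fun i h1 h2 => by simp [x]
    have hiso : ∀ b, Iso (daimonGen (x b) c) (daimonNet (l ++ [⟨B, b⟩])) := fun b => by
      rw [← hx b]; exact daimonGen.iso_daimonNet (x b) hc hm
    let d : {i : ι // (x true i).viaWn = true} := ⟨none, rfl⟩
    let C : List (daimonGen (x true) c).E := (List.finRange l.length).map fun i =>
      daimonGen.door (x true) (some i)
    let eD : (daimonGen (x true) c).E := Sum.inr d
    let eN : (daimonGen (x true) c).E := Sum.inl none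
    let vD : (daimonGen (x true) c).V := some d
    have hCc : (daimonGen (x true) c).concl = C ++ [eD] := by
      refine (List.map_append (f := daimonGen.door (x true))).trans ?_
      refine congrArg (· ++ _) ?_
      exact List.map_map ..
    have hsub : Sub (daimonGen (x false) c) (daimonGen (x true) c) {vD}ᶜ {eD}ᶜ
        (C ++ [eN]) := by
      let g : {i : ι // (x false i).viaWn = true} → {i : ι // (x true i).viaWn = true} := fun i =>
        ⟨i.1, by rcases i with ⟨_ | i, hi⟩ <;> [cases hi; exact hi]⟩
      have hg : Function.Injective g := fun a b h => Subtype.ext (congrArg (fun z => z.1) h)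
      have hgd : ∀ i, g i ≠ d ↔ True := by
        rintro ⟨_ | i, hi⟩
        · cases hi
        · exact iff_of_true (fun h => by cases congrArg (fun z => z.1) h) trivial
      have hgr : ∀ i, i ≠ d → ∃ j, g j = i := by
        rintro ⟨_ | i, hi⟩ h
        · exact absurd rfl h
        · exact ⟨⟨some i, hi⟩, rfl⟩
      refine ⟨Option.map g, Sum.map id g, Option.map_injective hg,
        Sum.map_injective.2 ⟨Function.injective_id, hg⟩, ?_, ?_, ?_, ?_, ?_, ?_, ?_, ?_⟩
      · ext v
        constructor
        · rintro ⟨_ | i, rfl⟩ h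
          · exact Option.some_ne_none d h.symm
          · exact (hgd i).2 trivial (Option.some.inj h)
        · intro hv
          rcases v with _ | i
          · exact ⟨none, rfl⟩
          · obtain ⟨j, rfl⟩ := hgr i fun h => hv (congrArg some h)
            exact ⟨some j, rfl⟩
      · ext v
        constructor
        · rintro ⟨i | i, rfl⟩ h
          · exact Sum.inr_ne_inl h.symm
          · exact (hgd i).2 trivial (Sum.inr_injective h)
        · intro hv
          rcases v with i | i
          · exact ⟨Sum.inl i, rfl⟩
          · obtain ⟨j, rfl⟩ := hgr i fun h => hv (congrArg Sum.inr h)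
            exact ⟨Sum.inr j, rfl⟩
      · rintro (_ | i) <;> rfl
      · rintro ((_ | i) | ⟨_ | i, hi⟩)
        · rfl
        · rfl
        · cases hi
        · rfl
      · rintro (i | i) <;> rfl
      · intro e v
        refine (daimonGen.tgt_eq_some _).trans (Iff.trans ?_ (daimonGen.tgt_eq_some _).symm)
        constructor
        · rintro ⟨i, rfl, rfl⟩; exact ⟨g i, rfl, rfl⟩
        · rintro ⟨i, hi, hv⟩
          rcases v with _ | v
          · cases hv
          · obtain rfl := Option.some.inj hv
            rcases e with e | e
            · obtain rfl : e = v.1 := Sum.inl_injective hi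
              exact ⟨v, rfl, rfl⟩
            · cases hi
      · intro e v _ h
        obtain ⟨i, rfl, rfl⟩ := (daimonGen.tgt_eq_some _).1 ‹_›
        rcases h with h | h <;> cases h
      · refine (List.map_map (f := daimonGen.door (x false)) ..).trans ?_
        refine List.map_append.trans ?_
        refine congrArg (· ++ _) ?_
        refine (List.map_map ..).trans ?_
        refine List.map_congr_left fun i _ => ?_
        change Sum.map id g (daimonGen.door (x false) (some i)) = daimonGen.door (x true) (some i)
        by_cases hi : l[i].viaWn = true
        · rw [daimonGen.door_pos (x false) (i := some i) hi,
            daimonGen.door_pos (x true) (i := some i) hi]; rfl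
        · rw [daimonGen.door_neg (x false) (i := some i) (eq_false_of_ne_true hi),
            daimonGen.door_neg (x true) (i := some i) (eq_false_of_ne_true hi)]; rfl
    obtain ⟨p, q, hp, hq, rp, rq, hl, ht, hs, hg, hf, hcc⟩ := (hiso true).trans h1.symm
    have bp : Function.Bijective p := ⟨hp, Set.range_eq_univ.1 rp⟩
    have bq : Function.Bijective q := ⟨hq, Set.range_eq_univ.1 rq⟩
    have hsub' := hsub.trans_iso bp bq hl ht hs hg hf
    rw [Set.image_compl_eq bp, Set.image_compl_eq bq, Set.image_singleton, Set.image_singleton,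
      List.map_append] at hsub'
    have hsd : p vD = N.src (q eD) := hs eD
    rw [hsd] at hsub'
    refine ⟨_, .der (C.map q) (q eD) (q eN) ?_ ?_ ?_ hsub', ?_⟩
    · rw [← hcc, hCc]; exact List.map_append
    · rw [← hsd]; exact (hl _).symm
    · intro g
      obtain ⟨g, rfl⟩ := bq.surjective g
      rw [← hsd, ← hg, hq.eq_iff]
      refine (daimonGen.tgt_eq_some (x true)).trans ?_
      constructor
      · rintro ⟨i, rfl, hi⟩
        rw [← Option.some.inj hi]
      · rintro rfl; exact ⟨d, rfl, rfl⟩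
    · refine ⟨_, hiso false, List.rel_append h2 ?_⟩
      simp [DaimonOut.type]

end DaimonForm

/-- Components of the form `m`, filled by a daimon, can be removed. -/
def GoodForm (m : List (Formula × Prop)) : Prop := Good (m.map Prod.fst) (DaimonForm m)

theorem GoodForm.swap {m₁ m₂ : List (Formula × Prop)} {x y : Formula × Prop}
    (h : GoodForm (m₁ ++ y :: x :: m₂)) : GoodForm (m₁ ++ x :: y :: m₂) := by
  rw [GoodForm, List.map_append, List.map_cons, List.map_cons] at h ⊢
  refine h.step₁ (.exc (m₁.map Prod.fst) x.1 y.1 (m₂.map Prod.fst)) fun N _ hN hA => ?_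
  obtain ⟨C, I, hc, hC, hI⟩ := List.map_eq_append_iff.1 hN
  obtain ⟨e, I1, rfl, _, hI1⟩ := List.map_eq_cons_iff.1 hI
  obtain ⟨f, C', rfl, _, _⟩ := List.map_eq_cons_iff.1 hI1
  have hlen : C.length = m₁.length := by simpa using congrArg List.length hC
  have h1 := hA.exc hc hlen
  exact ⟨_, .exc C e f C' hc (by simpa using hlen) (N.sub_reconcl _), h1.wf,
    h1.type.trans (by simp), h1⟩

theorem GoodForm.perm {c c' : List (Formula × Prop)} (h : c.Perm c') :
    ∀ m, GoodForm (m ++ c') → GoodForm (m ++ c) := by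
  induction h with
  | nil => exact fun _ h => h
  | cons x _ ih => exact fun m h => by simpa using ih (m ++ [x]) (by simpa using h)
  | swap x y l => exact fun m h => h.swap
  | trans _ _ ih₁ ih₂ => exact fun m h => ih₁ m (ih₂ m h)

/-- Each possibly flagged conclusion is moved to the end and its flag is cleared: a type `?A` is
derelicted, and any other type cannot come from a `wn` cell, so nothing has to be done. When no flag
is left the daimon is alone and the step `daimon` deletes it; this step needs at least one
conclusion. -/
theorem goodForm (m : List (Formula × Prop)) : ∀ m' : List (Formula × Prop),
    (∀ x ∈ m', ¬ x.2) → m ++ m' ≠ [] → GoodForm (m ++ m') := by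
  induction m with
  | nil =>
    intro m' hm' hne
    obtain ⟨m'', x, rfl⟩ := (List.eq_nil_or_concat' m').resolve_left hne
    rw [List.nil_append, GoodForm, List.map_append]
    exact Good.step₀ (.daimon (m''.map Prod.fst) x.1) fun N _ _ hN =>
      .daimon (hN.isHypothesis hm')
  | cons x m ih =>
    intro m' hm' _
    have hp : (x :: m ++ m').Perm (m ++ m' ++ [x]) := by
      simpa using (List.perm_append_singleton x (m ++ m')).symm
    refine GoodForm.perm hp [] ?_
    rw [List.nil_append]
    have key : ∀ A : Formula, GoodForm (m ++ m' ++ [(A, False)]) := fun A => by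
      rw [List.append_assoc]
      refine ih _ (fun y hy => ?_) (by simp)
      rcases List.mem_append.1 hy with hy | hy
      · exact hm' y hy
      · rw [List.mem_singleton.1 hy]; exact not_false
    have hx : x = (x.1, x.2) := rfl
    by_cases hA : ∃ A, x.1 = .wn A
    · obtain ⟨A, hA⟩ := hA
      rw [hA] at hx
      have h1 := key A
      rw [hx]
      rw [GoodForm, List.map_append] at h1 ⊢
      exact h1.step₁ (.der _ A) fun N _ _ hN => by
        obtain ⟨N', h2, h3⟩ := hN.der ((m ++ m').map Prod.fst)
        exact ⟨N', h2, h3.wf, h3.type.trans List.map_append, h3⟩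
    · have h1 := key x.1
      rw [GoodForm, List.map_append] at h1 ⊢
      refine h1.mono fun N _ _ hN => ?_
      obtain ⟨l, y, h2, h3, h4, _⟩ := hN.exists_last
      obtain rfl := DaimonOut.eq_of_type h4 fun B hB => hA ⟨B, hB⟩
      exact ⟨_, h2, List.rel_append h3 (by simp [DaimonOut.type])⟩

/-! ## Positions -/

/-- The type of a conclusion, and whether it is the output of a `wn` cell with inputs. -/
def BoxNet.flag (R : BoxNet) (e : R.E) : Formula × Prop :=
  (R.ty e, R.label (R.src e) = .wn ∧ ∃ f, R.tgt f = some (R.src e))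

/-- The components met when the original structure has become `R`. -/
def BoxNet.Admits (R : BoxNet) (N : Net) : Prop :=
  (N.DaimonFree ∧ Nonempty (Exp N R)) ∨ DaimonForm (R.concl.map R.flag) N

/-- The components admitted by `R` can be removed. -/
def BoxNet.IsGood (R : BoxNet) : Prop := Good R.toNet.type R.Admits

namespace BoxNet

/-- The step is dictated by `R`, and has to be playable both on the expansions of `R` and on the
daimons that stand for erased boxes. -/
theorem IsGood.step {R R' : BoxNet} (h : R'.IsGood) {G G' : List Formula} (hG : R.toNet.type = G)
    (hG' : R'.toNet.type = G') (hroot : ∃ v, R'.box v = R'.tree.root) (a : LocalPath G [G'])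
    (h₁ : ∀ N, N.WF → Exp N R → ∃ N', (N.DaimonFree → N'.DaimonFree) ∧ LocalAct a N {[N']} ∧
      Nonempty (Exp N' R'))
    (h₂ : ∀ N, DaimonForm (R.concl.map R.flag) N → ∃ N', LocalAct a N {[N']} ∧
      DaimonForm (R'.concl.map R'.flag) N') : R.IsGood := by
  subst hG hG'
  refine Good.step₁ h a ?_
  rintro N hN _ (⟨hd, ⟨E⟩⟩ | hA)
  · obtain ⟨N', hs, h3, ⟨E'⟩⟩ := h₁ N hN E
    exact ⟨N', h3, E'.wf hroot, E'.type_eq, Or.inl ⟨hs hd, ⟨E'⟩⟩⟩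
  · obtain ⟨N', h3, h4⟩ := h₂ N hA
    refine ⟨N', h3, h4.wf, h4.type.trans ?_, Or.inr h4⟩
    exact List.map_map ..

theorem IsGood.swap {R : BoxNet} (hroot : ∃ v, R.box v = R.tree.root) {C C' : List R.E} {e f : R.E}
    (hc : R.concl = C ++ e :: f :: C') {hp : (C ++ f :: e :: C').Perm R.concl}
    (h : (R.reconcl _ hp).IsGood) : R.IsGood := by
  refine h.step (G := C.map R.ty ++ R.ty e :: R.ty f :: C'.map R.ty)
    (G' := C.map R.ty ++ R.ty f :: R.ty e :: C'.map R.ty) (by simp [Net.type, hc])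
    (by simp [Net.type, reconcl, Net.reconcl]) hroot (.exc _ _ _ _) (fun N hN E => ?_)
    fun N hA => ?_
  · have h1 : N.concl.map E.q = C ++ e :: f :: C' := E.concl_q.trans hc
    obtain ⟨K, I, hK, hKC, hI⟩ := List.map_eq_append_iff.1 h1
    obtain ⟨e', I1, rfl, he', hI1⟩ := List.map_eq_cons_iff.1 hI
    obtain ⟨f', K', rfl, hf', hK'⟩ := List.map_eq_cons_iff.1 hI1
    have hsub := N.sub_reconcl (K ++ f' :: e' :: K')
    refine ⟨_, hsub.daimonFree, .exc K e' f' K' hK ?_ hsub,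
      ⟨E.reconcl _ hp _ ?_⟩⟩
    · simpa using congrArg List.length hKC
    · rw [List.map_append, List.map_cons, List.map_cons, hKC, he', hf', hK']
  · have h1 : N.concl.length = (C ++ e :: f :: C').length := by
      have := congrArg List.length hA.type
      rw [← hc]; simpa [Net.type] using this
    obtain ⟨K, I, hK, hKC⟩ : ∃ K I, N.concl = K ++ I ∧ K.length = C.length :=
      ⟨_, _, (List.take_append_drop C.length _).symm, by
        rw [List.length_take, h1]; simp⟩
    obtain ⟨e', f', K', rfl⟩ : ∃ e' f' K', I = e' :: f' :: K' := by
      rw [hK] at h1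
      simp only [List.length_append, List.length_cons] at h1
      rcases I with _ | ⟨a, _ | ⟨b, K'⟩⟩
      · simp only [List.length_nil] at h1; omega
      · simp only [List.length_cons, List.length_nil] at h1; omega
      · exact ⟨a, b, K', rfl⟩
    rw [hc, List.map_append, List.map_cons, List.map_cons] at hA
    have h2 := hA.exc hK (by simpa using hKC)
    refine ⟨_, .exc K e' f' K' hK (by simpa using hKC) (N.sub_reconcl _), ?_⟩
    have h3 : (C ++ f :: e :: C').map R.flag =
        C.map R.flag ++ R.flag f :: R.flag e :: C'.map R.flag := by simp
    rw [← h3] at h2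
    exact h2

theorem IsGood.of_append_perm {R : BoxNet} (hroot : ∃ v, R.box v = R.tree.root) {c c' : List R.E}
    (h : c.Perm c') : ∀ (C : List R.E) (h₁ : (C ++ c).Perm R.concl) (h₂ : (C ++ c').Perm R.concl),
      (R.reconcl _ h₂).IsGood → (R.reconcl _ h₁).IsGood := by
  induction h with
  | nil => exact fun _ _ _ h => h
  | @cons x c c' _ ih =>
    intro C h₁ h₂ h
    have e₁ : C ++ x :: c = (C ++ [x]) ++ c := by simp
    have e₂ : C ++ x :: c' = (C ++ [x]) ++ c' := by simp
    simp only [e₁, e₂] at h ⊢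
    exact ih (C ++ [x]) (e₁ ▸ h₁) (e₂ ▸ h₂) h
  | swap x y c =>
    intro C h₁ h₂ h
    exact IsGood.swap (R := R.reconcl _ h₁) hroot rfl (hp := h₂.trans h₁.symm) h
  | trans h h' ih₁ ih₂ =>
    intro C h₁ h₂ hg
    have h₃ := (h.symm.append_left C).trans h₁
    exact ih₁ C h₁ h₃ (ih₂ C h₃ h₂ hg)

/-- The order on the conclusions is irrelevant. -/
theorem IsGood.of_reconcl {R : BoxNet} (hroot : ∃ v, R.box v = R.tree.root) {c : List R.E}
    (hp : c.Perm R.concl) (h : (R.reconcl c hp).IsGood) : R.IsGood :=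
  of_append_perm hroot hp.symm [] (List.Perm.refl _) hp h

/-! ### Removal of a cell -/

/-- A cell in the root, with list of inputs `I` coming from the root, and with list of outputs `O`,
which are the last conclusions. -/
structure Removable (R : BoxNet) (v : R.V) (I C O : List R.E) : Prop where
  concl : R.concl = C ++ O
  root : R.box v = R.tree.root
  label : R.label v ≠ .bang
  out : ∀ g, R.src g = v ↔ g ∈ O
  input : ∀ g, R.tgt g = some v ↔ g ∈ I
  nodup : I.Nodup
  -- This keeps the structure nonempty after the removal. Cells without inputs are deleted by other
  -- steps, which remove the whole component.
  ne_nil : I ≠ []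
  input_root : ∀ g ∈ I, R.box (R.src g) = R.tree.root

namespace Removable

variable {R : BoxNet} {v : R.V} {I C O : List R.E}

theorem tgt_out (h : R.Removable v I C O) {g : R.E} (hg : g ∈ O) : R.tgt g = none := by
  rw [← R.wf.mem_concl, h.concl]; exact List.mem_append_right _ hg

theorem tgt_concl (h : R.Removable v I C O) {g : R.E} (hg : g ∈ C) : R.tgt g = none := by
  rw [← R.wf.mem_concl, h.concl]; exact List.mem_append_left _ hg

theorem src_ne_of_tgt (h : R.Removable v I C O) {g : R.E} {w : R.V} (hg : R.tgt g = some w) :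
    R.src g ≠ v := fun hv => by
  rw [h.tgt_out ((h.out g).1 hv)] at hg; cases hg

theorem restrictable (h : R.Removable v I C O) : R.toNet.Restrictable {v}ᶜ (C ++ I) where
  src_mem e he := by
    rcases List.mem_append.1 he with he | he
    · intro hv
      have hd := h.concl ▸ R.wf.concl_nodup
      exact (List.nodup_append.1 hd).2.2 e he e ((h.out e).1 hv) rfl
    · exact h.src_ne_of_tgt ((h.input e).2 he)
  nonempty := by
    obtain ⟨e, he⟩ := List.exists_mem_of_ne_nil I h.ne_nil
    exact ⟨R.src e, h.src_ne_of_tgt ((h.input e).2 he)⟩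
  nodup := by
    refine List.nodup_append.2 ⟨(h.concl ▸ R.wf.concl_nodup : (C ++ O).Nodup).of_append_left,
      h.nodup, ?_⟩
    rintro e he _ he' rfl
    have := h.tgt_concl he
    rw [(h.input e).2 he'] at this; cases this
  mem_iff e he := by
    rw [List.mem_append]
    constructor
    · rintro (h1 | h1) w hw
      · rw [h.tgt_concl h1] at hw; cases hw
      · rw [(h.input e).2 h1] at hw
        rw [← Option.some.inj hw]; exact fun h => h rfl
    · intro h1
      rcases h2 : R.tgt e with _ | w
      · rw [← R.wf.mem_concl, h.concl, List.mem_append] at h2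
        exact h2.imp_right fun h3 => absurd ((h.out e).2 h3) he
      · have h3 : w = v := not_not.1 (h1 w h2)
        exact Or.inr ((h.input e).1 (h3 ▸ h2))
  up e w hw _ := h.src_ne_of_tgt hw

theorem hroot (h : R.Removable v I C O) (e : R.E) (he : e ∈ C ++ I) :
    R.box (R.src e) = R.tree.root := by
  rcases List.mem_append.1 he with he | he
  · exact R.box_tail _ (h.tgt_concl he)
  · exact h.input_root e he

theorem inv (h : R.Removable v I C O) (hR : R.Inv) :
    (R.restrict _ _ h.restrictable h.hroot).Inv :=
  hR.restrict _ _ fun _ _ _ _ _ hu _ => fun huv => h.label (huv ▸ hu)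

/-- The removal of the cell in an expansion. -/
theorem exp (h : R.Removable v I C O) {N : Net} (E : Exp N R) :
    ∃ (N' : Net) (w : N.V) (J D P : List N.E), E.p w = v ∧ N.concl = D ++ P ∧ P.map E.q = O ∧
      J.map E.q = I ∧ D.map E.q = C ∧
      (∀ g, N.tgt g = some w ↔ g ∈ J) ∧ (∀ g, N.src g = w ↔ g ∈ P) ∧
      Sub N' N {w}ᶜ {e | N.src e ∈ ({w}ᶜ : Set N.V)} (D ++ J) ∧
      Nonempty (Exp N' (R.restrict _ _ h.restrictable h.hroot)) := by
  obtain ⟨w, rfl, -⟩ := E.surj_root h.root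
  obtain ⟨D, P, hDP, hD, hP⟩ := List.map_eq_append_iff.1 (E.concl_q.trans h.concl)
  have hJ : ∃ J : List N.E, J.map E.q = I := by
    have : I ∈ Set.range (List.map E.q) := by
      rw [Set.range_list_map]
      intro g hg
      obtain ⟨u, hu, -⟩ := E.surj_root (h.input_root g hg)
      obtain ⟨f, hf, -⟩ := E.surjE g u hu.symm
      exact ⟨f, hf⟩
    exact this
  obtain ⟨J, rfl⟩ := hJ
  subst hD hP
  have hpre : E.p ⁻¹' {E.p w}ᶜ = {w}ᶜ := by
    ext u
    exact not_congr ⟨fun hu => E.inj_root hu (by rw [hu]; exact h.root), fun hu => congrArg _ hu⟩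
  have hsrc : ∀ e ∈ D ++ J, N.src e ∈ E.p ⁻¹' {E.p w}ᶜ := fun e he => by
    have := h.restrictable.src_mem (E.q e)
      (by rw [← List.map_append]; exact List.mem_map_of_mem he)
    rwa [E.src_q] at this
  have E' := E.restrict _ _ h.restrictable h.hroot (D ++ J) List.map_append hsrc
  refine ⟨_, w, J, D, P, rfl, hDP, rfl, rfl, rfl, fun g => ?_, fun g => ?_, ?_, ⟨E'⟩⟩
  · constructor
    · intro hg
      obtain ⟨f, hf, hfg⟩ := List.mem_map.1 ((h.input _).1 (E.tgt_q g w hg).1)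
      have : N.src f = N.src g := E.inj_root (by rw [← E.src_q, ← E.src_q, hfg])
        (by rw [← E.src_q]; exact h.input_root _ (List.mem_map_of_mem hf))
      rwa [← E.injE _ _ hfg this]
    · intro hg
      have h1 := (h.input _).2 (List.mem_map_of_mem hg)
      obtain ⟨u, hu⟩ := E.tgt_some g _ h1
      rw [hu]
      refine congrArg some (E.inj_root ?_ ?_)
      · exact Option.some.inj ((E.tgt_q g u hu).1.symm.trans h1)
      · rw [Option.some.inj ((E.tgt_q g u hu).1.symm.trans h1)]; exact h.root
  · constructor
    · rintro rfl
      obtain ⟨f, hf, hfg⟩ := List.mem_map.1 ((h.out _).1 (E.src_q g))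
      rwa [← E.q_inj hfg (h.tgt_out (List.mem_map_of_mem hf))]
    · intro hg
      refine E.inj_root ?_ ?_
      · rw [← E.src_q]; exact (h.out _).2 (List.mem_map_of_mem hg)
      · rw [← E.src_q, (h.out _).2 (List.mem_map_of_mem hg)]; exact h.root
  · have := N.sub_restrict (K := E.p ⁻¹' {E.p w}ᶜ) (c := D ++ J) (hc := hsrc)
    simp only [hpre] at this ⊢
    exact this

/-- The premises of the removed cell are direct outputs of the daimon, so they carry no flag and
satisfy any requirement. The other conclusions keep their flags, because the inputs of the remaining
`wn` cells do not come from the removed cell. -/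
theorem form (h : R.Removable v I C O) {N : Net}
    (hN : DaimonForm (C.map R.flag ++ I.map fun e => (R.ty e, False)) N) :
    DaimonForm ((R.restrict _ _ h.restrictable h.hroot).concl.map
      (R.restrict _ _ h.restrictable h.hroot).flag) N := by
  let R' := R.restrict _ _ h.restrictable h.hroot
  let u : R'.E → R.E := Subtype.val
  have h1 : R'.concl.map u = C ++ I := Net.restrict_concl
  let g : R.E → Formula × Prop := fun e => (R.ty e, e ∈ C ∧ (R.flag e).2)
  have h2 : DaimonForm ((C ++ I).map g) N := by
    refine hN.mono ?_
    rw [List.map_append]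
    refine List.rel_append ?_ ?_
    · rw [List.forall₂_map_left_iff, List.forall₂_map_right_iff, List.forall₂_same]
      exact fun e he => ⟨rfl, fun h => ⟨he, h⟩⟩
    · rw [List.forall₂_map_left_iff, List.forall₂_map_right_iff, List.forall₂_same]
      exact fun e he => ⟨rfl, False.elim⟩
  rw [← h1, List.map_map] at h2
  refine h2.mono ?_
  rw [List.forall₂_map_left_iff, List.forall₂_map_right_iff, List.forall₂_same]
  intro e _
  refine ⟨rfl, fun ⟨_, h3, f, hf⟩ => ⟨h3, ⟨f, h.src_ne_of_tgt hf⟩, ?_⟩⟩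
  exact (Net.restrict_tgt _ _).2 hf

theorem type (h : R.Removable v I C O) :
    (R.restrict _ _ h.restrictable h.hroot).toNet.type = C.map R.ty ++ I.map R.ty := by
  rw [← List.map_append]
  let R' := R.restrict _ _ h.restrictable h.hroot
  have h1 : R'.concl.map (Subtype.val : R'.E → R.E) = C ++ I := Net.restrict_concl
  have h2 : R'.toNet.type = (R'.concl.map (Subtype.val : R'.E → R.E)).map R.ty :=
    (List.map_map (f := (Subtype.val : R'.E → R.E)) (g := R.ty)).symm
  exact h2.trans (congrArg (List.map R.ty) h1)

end Removable

end BoxNet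

namespace BoxNet

namespace Removable

variable {R : BoxNet} {v : R.V} {I C O : List R.E}

/-- The structure where the cell is removed. -/
noncomputable def remove (h : R.Removable v I C O) : BoxNet :=
  R.restrict _ _ h.restrictable h.hroot

theorem isGood (h : R.Removable v I C O) (hR : R.Inv) (hg : h.remove.IsGood) {G G' : List Formula}
    (hG : R.toNet.type = G) (hG' : C.map R.ty ++ I.map R.ty = G') (a : LocalPath G [G'])
    (h₁ : ∀ (N N' : Net) (E : Exp N R) (w : N.V) (J D P : List N.E), N.WF → E.p w = v →
      N.concl = D ++ P → P.map E.q = O → J.map E.q = I →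
      (∀ g, N.tgt g = some w ↔ g ∈ J) → (∀ g, N.src g = w ↔ g ∈ P) →
      Sub N' N {w}ᶜ {e | N.src e ∈ ({w}ᶜ : Set N.V)} (D ++ J) → LocalAct a N {[N']})
    (h₂ : ∀ N, DaimonForm (C.map R.flag ++ O.map R.flag) N → ∃ N', LocalAct a N {[N']} ∧
      DaimonForm (C.map R.flag ++ I.map fun e => (R.ty e, False)) N') : R.IsGood := by
  refine hg.step hG (h.type.trans hG') (h.inv hR).exists_root a (fun N hN E => ?_) fun N hN => ?_
  · obtain ⟨N', w, J, D, P, h3, h4, h5, h6, h7, h8, h9, h10, h11⟩ := h.exp E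
    exact ⟨N', h10.daimonFree, h₁ N N' E w J D P hN h3 h4 h5 h6 h8 h9 h10, h11⟩
  · rw [h.concl, List.map_append] at hN
    obtain ⟨N', h3, h4⟩ := h₂ N hN
    exact ⟨N', h3, h.form h4⟩

end Removable

theorem removable_binary {R : BoxNet} {C : List R.E} {o : R.E} (hc : R.concl = C ++ [o])
    (l : Cell) (op : Formula → Formula → Formula)
    (hl : l = .tensor ∧ op = .tensor ∨ l = .par ∧ op = .par) (ho : R.label (R.src o) = l) :
    ∃ e f, R.Removable (R.src o) [e, f] C [o] ∧ R.left e ∧ R.ty o = op (R.ty e) (R.ty f) := by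
  have hok := R.wf.cell_ok (R.src o)
  have hpair : ∃ e f o', R.IsPairIn (R.src o) e f ∧ R.left e ∧ ¬ R.left f ∧
      R.IsOut (R.src o) o' ∧ R.ty o' = op (R.ty e) (R.ty f) := by
    unfold Net.CellOK at hok
    rcases hl with ⟨rfl, rfl⟩ | ⟨rfl, rfl⟩ <;> rw [ho] at hok <;> exact hok
  obtain ⟨e, f, o', hi, he, -, hout, hty⟩ := hpair
  obtain rfl : o = o' := (hout o).1 rfl
  have hto : R.tgt o = none := by rw [← R.wf.mem_concl, hc]; simp
  have hnl : R.label (R.src o) ≠ .bang ∧ R.label (R.src o) ≠ .wn := by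
    rcases hl with ⟨rfl, -⟩ | ⟨rfl, -⟩ <;> simp [ho]
  refine ⟨e, f, ⟨hc, R.box_tail _ hto, hnl.1, fun g => (hout g).trans (by simp),
    fun g => (hi.2 g).trans (by simp), by simpa using hi.1, by simp, fun g hg => ?_⟩, he, hty⟩
  rw [← R.box_tail _ hto]
  by_contra hb
  rcases R.border _ _ ((hi.2 g).2 (by simpa using hg)) hb with h | h
  · exact hnl.1 h
  · exact hnl.2 h

theorem Removable.isGood_binary {R : BoxNet} {C : List R.E} {o e f : R.E} (hR : R.Inv)
    (h : R.Removable (R.src o) [e, f] C [o])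
    (ho : R.label (R.src o) = .tensor ∧ R.ty o = .tensor (R.ty e) (R.ty f) ∨
      R.label (R.src o) = .par ∧ R.ty o = .par (R.ty e) (R.ty f))
    (he : R.left e) (hg : h.remove.IsGood) : R.IsGood := by
  have key : ∀ (N : Net) (E : Exp N R) (w : N.V) (J D P : List N.E), E.p w = R.src o →
      N.concl = D ++ P → P.map E.q = [o] → J.map E.q = [e, f] →
      (∀ g, N.tgt g = some w ↔ g ∈ J) → (∀ g, N.src g = w ↔ g ∈ P) →
      ∃ o' e' f', P = [o'] ∧ J = [e', f'] ∧ w = N.src o' ∧ N.IsPairIn (N.src o') e' f' ∧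
        N.left e' ∧ {e | N.src e ∈ ({w}ᶜ : Set N.V)} = {o'}ᶜ := by
    intro N E w J D P hw hc hP hJ ht hs
    obtain ⟨o', P', rfl, ho', hP'⟩ := List.map_eq_cons_iff.1 hP
    obtain rfl := List.map_eq_nil_iff.1 hP'
    obtain ⟨e', J1, rfl, he', hJ1⟩ := List.map_eq_cons_iff.1 hJ
    obtain ⟨f', J2, rfl, hf', hJ2⟩ := List.map_eq_cons_iff.1 hJ1
    obtain rfl := List.map_eq_nil_iff.1 hJ2
    have hwo : w = N.src o' := ((hs o').2 (by simp)).symm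
    refine ⟨o', e', f', rfl, rfl, hwo, ⟨?_, fun g => ?_⟩, ?_, ?_⟩
    · rintro rfl
      have := h.nodup
      rw [← he', ← hf'] at this
      simp at this
    · rw [← hwo, ht]; simp
    · rw [E.left_q e' w ((ht e').2 (by simp))]
      · rwa [he']
      · rw [E.label_p, hw]; exact ho.imp And.left And.left
    · ext g
      exact not_congr ((hs g).trans (by simp))
  have hty : R.toNet.type = C.map R.ty ++ [R.ty o] := by rw [Net.type, h.concl]; simp
  rcases ho with ⟨ho, hto⟩ | ⟨ho, hto⟩
  · rw [hto] at hty
    refine h.isGood hR hg hty rfl (.tensor _ _ _) ?_ fun N hN => ?_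
    · intro N N' E w J D P hN hw hc hP hJ ht hs hsub
      obtain ⟨o', e', f', rfl, rfl, rfl, hi, hl, hset⟩ := key N E w J D P hw hc hP hJ ht hs
      rw [hset] at hsub
      exact .tensor D o' e' f' hc (by rw [E.label_p, hw, ho]) hi hl hsub
    · rw [List.map_singleton, flag, hto] at hN
      exact hN.tensor _
  · rw [hto] at hty
    refine h.isGood hR hg hty rfl (.par _ _ _) ?_ fun N hN => ?_
    · intro N N' E w J D P hN hw hc hP hJ ht hs hsub
      obtain ⟨o', e', f', rfl, rfl, rfl, hi, hl, hset⟩ := key N E w J D P hw hc hP hJ ht hs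
      rw [hset] at hsub
      exact .par D o' e' f' hc (by rw [E.label_p, hw, ho]) hi hl hsub
    · rw [List.map_singleton, flag, hto] at hN
      exact hN.par _

theorem removable_der {R : BoxNet} {C : List R.E} {o e : R.E} (hc : R.concl = C ++ [o])
    (ho : R.label (R.src o) = .wn) (he : ∀ g, R.tgt g = some (R.src o) ↔ g = e)
    (hb : R.box (R.src e) = R.tree.root) : R.Removable (R.src o) [e] C [o] where
  concl := hc
  root := R.box_tail _ (by rw [← R.wf.mem_concl, hc]; simp)
  label := by simp [ho]
  out g := (R.wf.isOut_wn ho g).trans (by simp)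
  input g := (he g).trans (by simp)
  nodup := by simp
  ne_nil := by simp
  input_root g hg := by rwa [List.mem_singleton.1 hg]

theorem Removable.isGood_der {R : BoxNet} {C : List R.E} {o e : R.E} (hR : R.Inv)
    (h : R.Removable (R.src o) [e] C [o]) (ho : R.label (R.src o) = .wn)
    (hg : h.remove.IsGood) : R.IsGood := by
  obtain ⟨o', A, h1, h2, h3⟩ := (R.wf.cell_ok _).wn ho
  obtain rfl := (h1 o).1 rfl
  have h4 : R.ty e = A := h3 e ((h.input e).2 (by simp))
  subst h4
  have hty : R.toNet.type = C.map R.ty ++ [.wn (R.ty e)] := by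
    rw [Net.type, h.concl]; simp [h2]
  refine h.isGood hR hg hty rfl (.der _ _) ?_ fun N hN => ?_
  · intro N N' E w J D P hN hw hc hP hJ ht hs hsub
    obtain ⟨o', P', rfl, ho', hP'⟩ := List.map_eq_cons_iff.1 hP
    obtain rfl := List.map_eq_nil_iff.1 hP'
    obtain ⟨e', J1, rfl, he', hJ1⟩ := List.map_eq_cons_iff.1 hJ
    obtain rfl := List.map_eq_nil_iff.1 hJ1
    obtain rfl : w = N.src o' := ((hs o').2 (by simp)).symm
    refine .der D o' e' hc (by rw [E.label_p, hw, ho]) (fun g => (ht g).trans (by simp)) ?_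
    have hset : {e | N.src e ∈ ({N.src o'}ᶜ : Set N.V)} = {o'}ᶜ := by
      ext g
      exact not_congr ((hs g).trans (by simp))
    rwa [hset] at hsub
  · rw [List.map_singleton, flag, h2] at hN
    exact hN.der _

theorem exists_removable_cut {R : BoxNet} {v : R.V} (hv : R.label v = .cut)
    (hb : R.box v = R.tree.root) :
    ∃ e f, R.Removable v [e, f] R.concl [] ∧ R.ty f = (R.ty e).dual := by
  have hok := R.wf.cell_ok v
  unfold Net.CellOK at hok
  rw [hv] at hok
  obtain ⟨h1, f, e, h2, h3⟩ := hok
  refine ⟨e, f, ⟨by simp, hb, by simp [hv], fun g => iff_of_false (h1 g) (by simp),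
    fun g => (h2.2 g).trans (by simp [or_comm]), by simpa using h2.1.symm, by simp,
    fun g hg => ?_⟩, h3⟩
  rw [← hb]
  by_contra h
  have hg' : R.tgt g = some v := (h2.2 g).2 (by simpa [or_comm] using hg)
  rcases R.border g v hg' h with h | h <;> simp [hv] at h

theorem Removable.isGood_cut {R : BoxNet} {v : R.V} {e f : R.E} (hR : R.Inv)
    (h : R.Removable v [e, f] R.concl []) (hv : R.label v = .cut)
    (hty : R.ty f = (R.ty e).dual) (hg : h.remove.IsGood) : R.IsGood := by
  refine h.isGood hR hg rfl (G' := R.concl.map R.ty ++ [R.ty e, (R.ty e).dual]) (by simp [hty])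
    (.cut _ _) ?_ fun N hN => ?_
  · intro N N' E w J D P hN hw hc hP hJ ht hs hsub
    obtain rfl := List.map_eq_nil_iff.1 hP
    obtain ⟨e', J1, rfl, he', hJ1⟩ := List.map_eq_cons_iff.1 hJ
    obtain ⟨f', J2, rfl, hf', hJ2⟩ := List.map_eq_cons_iff.1 hJ1
    obtain rfl := List.map_eq_nil_iff.1 hJ2
    refine .cut w e' f' (by rw [E.label_p, hw, hv]) ⟨?_, fun g => (ht g).trans (by simp)⟩ ?_
    · rintro rfl
      have := h.nodup
      rw [← he', ← hf'] at this
      simp at this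
    · have hset : {e | N.src e ∈ ({w}ᶜ : Set N.V)} = Set.univ := by
        ext g
        exact iff_of_true (fun h => by simpa using (hs g).1 h) trivial
      rw [hset] at hsub
      rw [hc, List.append_nil]; exact hsub
  · rw [List.map_nil, List.append_nil] at hN
    obtain ⟨N', h1, h2⟩ := hN.cut R.toNet.type (R.ty e)
    exact ⟨N', h1, by simpa [hty] using h2⟩

end BoxNet

/-! ### Splitting a `wn` cell -/

namespace Net

variable {N : Net} {o : N.E} {S : Set N.E}

theorem split_tgt_eq_none {g : N.E} (hS : ∀ e ∈ S, N.tgt e = some (N.src o)) :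
    (N.split o S).tgt (some g) = none ↔ N.tgt g = none := by
  by_cases hg : g ∈ S
  · rw [(split_tgt_none g).2 hg, hS g hg]; simp
  · have : (N.split o S).tgt (some g) = (N.tgt g).map some := if_neg hg
    rw [this]; exact Option.map_eq_none_iff

theorem WF.split (hN : N.WF) (ho : N.label (N.src o) = .wn)
    (hS : ∀ e ∈ S, N.tgt e = some (N.src o)) : (N.split o S).WF where
  finite_V := by have := hN.finite_V; exact inferInstanceAs (Finite (Option N.V))
  finite_E := by have := hN.finite_E; exact inferInstanceAs (Finite (Option N.E))
  nonempty := ⟨none⟩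
  concl_nodup := by
    refine List.nodup_append.2
      ⟨hN.concl_nodup.map (Option.some_injective _), List.nodup_singleton _, ?_⟩
    intro a ha b hb hab
    obtain ⟨c, _, rfl⟩ := List.mem_map.1 ha
    rw [List.mem_singleton.1 hb] at hab
    cases hab
  mem_concl e := by
    refine List.mem_append.trans ?_
    rcases e with _ | e
    · exact iff_of_true (Or.inr (List.mem_singleton.2 rfl)) rfl
    · refine (or_congr_left (List.mem_map_of_injective (Option.some_injective _))).trans
        ((or_iff_left fun h => ?_).trans ((hN.mem_concl e).trans (split_tgt_eq_none hS).symm))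
      cases List.mem_singleton.1 h
  cell_ok v := by
    rcases v with _ | v
    · obtain ⟨o', A, h1, h2, h3⟩ := (hN.cell_ok _).wn ho
      obtain rfl := (h1 o).1 rfl
      refine ⟨none, A, ?_, h2, ?_⟩
      · rintro (_ | g)
        · exact iff_of_true rfl rfl
        · exact iff_of_false (fun h => by cases h) (fun h => by cases h)
      · rintro (_ | g) hg
        · cases hg
        · exact h3 g (hS g ((split_tgt_none g).1 hg))
    · refine CellOK.transfer (M := N) (w := v) (fun g k => g = some k) rfl ?_ ?_ ?_ ?_ ?_ ?_ ?_
        (hN.cell_ok v)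
      · rintro g k k' rfl h; exact Option.some.inj h
      · rintro g k rfl; rfl
      · rintro (_ | g) hg
        · cases hg
        · exact ⟨g, rfl, Option.some.inj hg⟩
      · intro g hg
        exact ⟨some g, ⟨rfl, congrArg some hg⟩, fun k hk => hk.1⟩
      · rintro (_ | g) hg
        · cases hg
        · exact ⟨g, rfl, ((split_tgt_some g v).1 hg).2⟩
      · intro hv _ g hg
        refine ⟨some g, ⟨rfl, (split_tgt_some g v).2 ⟨fun hgS => hv ?_, hg⟩⟩, fun k hk => hk.1⟩
        have := (hS g hgS).symm.trans hg
        rw [← Option.some.inj this, ho]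
      · rintro g k rfl _ _; exact Iff.rfl

end Net

namespace BoxNet

/-- `e` is an input of the `wn` cell of the last conclusion. -/
structure Splittable (R : BoxNet) (C : List R.E) (o e : R.E) : Prop where
  concl : R.concl = C ++ [o]
  label : R.label (R.src o) = .wn
  input : R.tgt e = some (R.src o)

namespace Splittable

variable {R : BoxNet} {C : List R.E} {o e : R.E}

theorem mem (h : R.Splittable C o e) : ∀ g ∈ ({e} : Set R.E), R.tgt g = some (R.src o) := by
  rintro _ rfl; exact h.input

theorem tgt_none (h : R.Splittable C o e) : R.tgt o = none := by
  rw [← R.wf.mem_concl, h.concl]; simp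

/-- The structure where the input `e` is moved to a new `wn` cell. -/
noncomputable def split (h : R.Splittable C o e) : BoxNet where
  toNet := R.toNet.split o {e}
  wf := R.wf.split h.label h.mem
  tree := R.tree
  box v := v.elim R.tree.root R.box
  box_edge g v hv := by
    rcases v with _ | v
    · exact R.tree.reach_root _
    · rcases g with _ | g
      · cases hv
      · exact R.box_edge g v ((Net.split_tgt_some g v).1 hv).2
  box_tail g hg := by
    rcases g with _ | g
    · rfl
    · exact R.box_tail g ((Net.split_tgt_eq_none h.mem).1 hg)
  border g v hv hb := by
    rcases v with _ | v
    · exact Or.inr rfl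
    · rcases g with _ | g
      · cases hv
      · exact R.border g v ((Net.split_tgt_some g v).1 hv).2 hb
  door_inj g g' v v' hv hv' hl hl' h1 h2 h3 := by
    rcases v with _ | v
    · cases hl
    rcases v' with _ | v'
    · cases hl'
    rcases g with _ | g
    · cases hv
    rcases g' with _ | g'
    · cases hv'
    exact congrArg some (R.door_inj g g' v v' ((Net.split_tgt_some g v).1 hv).2
      ((Net.split_tgt_some g' v').1 hv').2 hl hl' h1 h2 h3)

theorem tgt_bang (h : R.Splittable C o e) {g : R.E} {v : R.V} (hg : R.tgt g = some v)
    (hv : R.label v = .bang) : h.split.tgt (some g) = some (some v) := by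
  refine (Net.split_tgt_some g v).2 ⟨?_, hg⟩
  rintro rfl
  rw [h.input] at hg
  rw [← Option.some.inj hg, h.label] at hv
  cases hv

theorem inv (h : R.Splittable C o e) (hR : R.Inv) : h.split.Inv where
  bang v hv := by
    rcases v with _ | v
    · cases hv
    obtain ⟨f, hf⟩ := hR.bang v hv
    refine ⟨some f, ?_⟩
    rintro (_ | g)
    · exact iff_of_false (fun h => by cases h) (fun h => by cases h)
    · refine ⟨fun hg => congrArg some ((hf g).1 ((Net.split_tgt_some g v).1 hg).2), fun hg => ?_⟩
      exact h.tgt_bang ((hf g).2 (Option.some.inj hg)) hv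
  bang_parent g v hg hv := by
    rcases v with _ | v
    · cases hv
    rcases g with _ | g
    · cases hg
    exact hR.bang_parent g v ((Net.split_tgt_some g v).1 hg).2 hv
  door w x hx hne := by
    have : ∃ w, R.tree.Reach (R.box w) x := by
      rcases w with _ | w
      · exact absurd (RTree.reach_root_iff.1 hx) hne
      · exact ⟨w, hx⟩
    obtain ⟨w, hw⟩ := this
    obtain ⟨g, v, h1, h2, h3⟩ := hR.door w x hw hne
    exact ⟨some g, some v, h.tgt_bang h1 h2, h2, h3⟩
  daimon v hv := by
    rcases v with _ | v
    · cases hv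
    · exact hR.daimon v hv

/-- Splitting commutes with expansions. -/
theorem exp (h : R.Splittable C o e) {N : Net} (E : Exp N R) {o' : N.E} (ho : E.q o' = o) :
    Nonempty (Exp (N.split o' {g | E.q g = e}) h.split) := by
  have hS : ∀ g, E.q g = e → N.tgt g = some (N.src o') := by
    rintro g rfl
    obtain ⟨u, hu⟩ := E.tgt_some g _ h.input
    have h1 := Option.some.inj ((E.tgt_q g u hu).1.symm.trans h.input)
    rw [hu, ← ho, E.src_q] at *
    refine congrArg some (E.inj_root h1 ?_)
    rw [h1, ← E.src_q, ho]
    exact R.box_tail _ h.tgt_none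
  refine ⟨⟨E.t, Option.map E.p, fun v => v.elim E.t.tree.root E.b, Option.map E.q, ?_, ?_, ?_, ?_,
    ?_, ?_, ?_, ?_, ?_, ?_, ?_, ?_⟩⟩
  · rintro (_ | v)
    · exact E.t.h_root.symm
    · exact E.box_p v
  · rintro (_ | v) (_ | w) h1 h2
    · rfl
    · cases h1
    · cases h1
    · exact congrArg some (E.inj v w (Option.some.inj h1) h2)
  · rintro (_ | v) x hx
    · exact ⟨none, rfl, (E.t.h_eq_root.1 hx.symm).symm⟩
    · obtain ⟨w, hw1, hw2⟩ := E.surj v x hx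
      exact ⟨some w, congrArg some hw1, hw2⟩
  · rintro (_ | g)
    · rfl
    · exact congrArg some (E.src_q g)
  · rintro (_ | g) (_ | k) h1 h2
    · rfl
    · cases h1
    · cases h1
    · exact congrArg some (E.injE g k (Option.some.inj h1) (Option.some.inj h2))
  · rintro (_ | g) (_ | w) hw
    · exact ⟨none, rfl, rfl⟩
    · cases hw
    · cases hw
    · obtain ⟨k, hk1, hk2⟩ := E.surjE g w (Option.some.inj hw)
      exact ⟨some k, congrArg some hk1, congrArg some hk2⟩
  · rintro (_ | g) (_ | v) hv
    · cases hv
    · cases hv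
    · exact ⟨(Net.split_tgt_none (E.q g)).2 ((Net.split_tgt_none g).1 hv), E.t.tree.reach_root _⟩
    · obtain ⟨h1, h2⟩ := (Net.split_tgt_some g v).1 hv
      obtain ⟨h3, h4⟩ := E.tgt_q g v h2
      exact ⟨(Net.split_tgt_some _ _).2 ⟨h1, h3⟩, h4⟩
  · rintro (_ | g) (_ | u) hu
    · cases hu
    · cases hu
    · exact ⟨none, (Net.split_tgt_none g).2 ((Net.split_tgt_none (E.q g)).1 hu)⟩
    · obtain ⟨h1, h2⟩ := (Net.split_tgt_some (E.q g) u).1 hu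
      obtain ⟨v, hv⟩ := E.tgt_some g u h2
      exact ⟨some v, (Net.split_tgt_some g v).2 ⟨h1, hv⟩⟩
  · rintro (_ | v)
    · rfl
    · exact E.label_p v
  · rintro (_ | g)
    · exact (E.ty_q o').trans (congrArg R.ty ho)
    · exact E.ty_q g
  · rintro (_ | g) (_ | v) hv hl
    · cases hv
    · cases hv
    · rcases hl with hl | hl <;> cases hl
    · exact E.left_q g v ((Net.split_tgt_some g v).1 hv).2 hl
  · change List.map (Option.map E.q) (N.concl.map some ++ [none]) = R.concl.map some ++ [none]
    rw [← E.concl_q]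
    simp

/-- In an expansion all copies of `e` are moved to the new cell. On a daimon, contraction puts a
`wn` cell above both new conclusions, so both must be flagged: the old cell keeps the input `e'` and
the new one has `e`. This is why only cells with two distinct inputs are split. -/
theorem isGood (h : R.Splittable C o e) (hR : R.Inv) {e' : R.E} (he' : R.tgt e' = some (R.src o))
    (hne : e' ≠ e) (hg : h.split.IsGood) : R.IsGood := by
  obtain ⟨o', A, h1, h2, h3⟩ := (R.wf.cell_ok _).wn h.label
  obtain rfl := (h1 o).1 rfl
  have hty : R.toNet.type = C.map R.ty ++ [.wn A] := by
    rw [Net.type, h.concl]; simp [h2]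
  have hconcl : h.split.concl = C.map some ++ [some o, none] := by
    suffices h' : R.concl.map some ++ [none] = C.map some ++ [some o, none] from h'
    rw [h.concl, List.map_append, List.append_assoc]; rfl
  have hty' : h.split.toNet.type = C.map R.ty ++ [.wn A, .wn A] := by
    have h4 : h.split.toNet.type =
        (C.map some ++ [some o, none]).map (fun f => f.elim (R.ty o) R.ty) :=
      congrArg (List.map _) hconcl
    rw [h4]; simp [h2]
  refine hg.step hty hty' (h.inv hR).exists_root (.contr _ _) (fun N hN E => ?_) fun N hN => ?_
  · obtain ⟨D, P, hDP, hD, hP⟩ := List.map_eq_append_iff.1 (E.concl_q.trans h.concl)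
    obtain ⟨o', P', rfl, ho', hP'⟩ := List.map_eq_cons_iff.1 hP
    obtain rfl := List.map_eq_nil_iff.1 hP'
    refine ⟨_, fun hd => hd.split o' _, .contr D o' {g | E.q g = e} hDP ?_ ?_ (Iso.refl _),
      h.exp E ho'⟩
    · rw [E.label_p, ← E.src_q, ho', h.label]
    · rintro g rfl
      obtain ⟨u, hu⟩ := E.tgt_some g _ h.input
      have h4 := Option.some.inj ((E.tgt_q g u hu).1.symm.trans h.input)
      rw [hu]
      refine congrArg some (E.inj_root ?_ ?_)
      · rw [h4, ← E.src_q, ho']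
      · rw [h4]; exact R.box_tail _ h.tgt_none
  · rw [h.concl, List.map_append, List.map_singleton, flag, h2] at hN
    obtain ⟨N', h4, h5⟩ := hN.contr (C.map R.ty)
    refine ⟨N', h4, h5.mono ?_⟩
    have hm : h.split.concl.map h.split.flag = C.map (fun c => h.split.flag (some c)) ++
        [h.split.flag (some o), h.split.flag none] :=
      (congrArg (List.map _) hconcl).trans (List.map_append.trans (congrArg (· ++ _) List.map_map))
    rw [hm]
    refine List.rel_append ?_ ?_
    · rw [List.forall₂_map_left_iff, List.forall₂_map_right_iff, List.forall₂_same]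
      rintro c hc
      refine ⟨rfl, fun ⟨h6, f, hf⟩ => ⟨h6, some f, (Net.split_tgt_some f _).2 ⟨?_, hf⟩⟩⟩
      rintro rfl
      rw [h.input] at hf
      have h7 := (h1 c).1 (Option.some.inj hf).symm
      have hd := h.concl ▸ R.wf.concl_nodup
      exact (List.nodup_append.1 hd).2.2 c hc o (by simp) h7
    · refine .cons ⟨h2.symm, fun _ => ⟨h.label, some e', ?_⟩⟩
        (.cons ⟨h2.symm, fun _ => ⟨rfl, some e, ?_⟩⟩ .nil)
      · exact (Net.split_tgt_some e' _).2 ⟨hne, he'⟩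
      · exact (Net.split_tgt_none e).2 rfl

end Splittable

end BoxNet

namespace BoxNet

/-! ### A measure on structures -/

/-- The pairs of distinct inputs of a `wn` cell. -/
def rivals (R : BoxNet) : Set (R.E × R.E) :=
  {p | p.1 ≠ p.2 ∧ ∃ v, R.label v = .wn ∧ R.tgt p.1 = some v ∧ R.tgt p.2 = some v}

/-- A measure which decreases along the rewriting steps. -/
noncomputable def size (R : BoxNet) : ℕ := Nat.card R.V + 2 * R.rivals.ncard

theorem ncard_rivals_le {R R' : BoxNet} (φ : R'.E → R.E) (hφ : Function.Injective φ)
    {S : Set (R.E × R.E)}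
    (h : ∀ p ∈ R'.rivals, (φ p.1, φ p.2) ∈ S) : R'.rivals.ncard ≤ S.ncard := by
  have := R.wf.finite_E
  refine Set.ncard_le_ncard_of_injOn (fun p => (φ p.1, φ p.2)) h ?_ (Set.toFinite _)
  rintro ⟨e, f⟩ _ ⟨e', f'⟩ _ h
  exact Prod.ext (hφ (Prod.ext_iff.1 h).1) (hφ (Prod.ext_iff.1 h).2)

/-- A structure that embeds in another one and misses a cell is smaller. Removal of a cell,
splitting in two and opening of a box are all of this kind. -/
theorem size_lt {R R' : BoxNet} (ψ : R'.V → R.V) (φ : R'.E → R.E) (hψ : Function.Injective ψ)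
    (hφ : Function.Injective φ) (hne : ∃ v, v ∉ Set.range ψ)
    (hl : ∀ v, R'.label v = R.label (ψ v))
    (ht : ∀ e v, R'.tgt e = some v → R.tgt (φ e) = some (ψ v)) : R'.size < R.size := by
  have := R.wf.finite_V
  have h1 : Nat.card R'.V < Nat.card R.V := by
    obtain ⟨v, hv⟩ := hne
    rw [← Set.ncard_univ R.V, ← Nat.card_range_of_injective hψ]
    exact Set.ncard_lt_ncard ⟨Set.subset_univ _, fun h => hv (h trivial)⟩ (Set.toFinite _)
  have h2 := ncard_rivals_le (S := R.rivals) φ hφ fun p ⟨h3, v, h4, h5, h6⟩ =>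
    (⟨hφ.ne h3, ψ v, by rw [← hl, h4], ht _ _ h5, ht _ _ h6⟩ : (φ p.1, φ p.2) ∈ R.rivals)
  unfold size
  omega

theorem size_restrict {R : BoxNet} {K : Set R.V} {c : List R.E} (h : R.toNet.Restrictable K c)
    (hroot : ∀ e ∈ c, R.box (R.src e) = R.tree.root) {v : R.V} (hv : v ∉ K) :
    (R.restrict K c h hroot).size < R.size :=
  size_lt (R' := R.restrict K c h hroot) Subtype.val Subtype.val Subtype.val_injective
    Subtype.val_injective ⟨v, fun ⟨w, hw⟩ => hv (hw ▸ w.2)⟩ (fun _ => rfl)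
    fun _ _ h => (Net.restrict_tgt _ _).1 h

/-- Splitting adds a cell but separates `e'` from `e`, so at least one rival pair is lost. The
factor 2 in `size` makes this loss prevail. -/
theorem Splittable.size_split {R : BoxNet} {C : List R.E} {o e e' : R.E} (h : R.Splittable C o e)
    (he' : R.tgt e' = some (R.src o)) (hne : e' ≠ e) : h.split.size < R.size := by
  have := R.wf.finite_V
  have := R.wf.finite_E
  have h1 : Nat.card h.split.V = Nat.card R.V + 1 := Finite.card_option
  have hS : ((e', e) : R.E × R.E) ∈ R.rivals := ⟨hne, _, h.label, he', h.input⟩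
  have h2 : h.split.rivals.ncard ≤ (R.rivals \ {(e', e)}).ncard := by
    -- The default value never matters: the new edge is a conclusion, hence belongs to no rival
    -- pair.
    let g : h.split.E → R.E := fun f => (f : Option R.E).getD e
    refine Set.ncard_le_ncard_of_injOn (fun p => (g p.1, g p.2)) ?_ ?_ (Set.toFinite _)
    all_goals
      have key : ∀ p ∈ h.split.rivals, ∃ a b, p = (some a, some b) ∧
          (a, b) ∈ R.rivals \ {(e', e)} := by
        rintro ⟨f, k⟩ ⟨h3, v, h4, h5, h6⟩
        rcases f with _ | f
        · cases h5
        rcases k with _ | k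
        · cases h6
        refine ⟨f, k, rfl, ?_⟩
        rcases v with _ | v
        · have h5 := (Net.split_tgt_none f).1 h5
          have h6 := (Net.split_tgt_none k).1 h6
          exact absurd (congrArg some (h5.trans h6.symm)) h3
        · obtain ⟨h5, h5'⟩ := (Net.split_tgt_some f v).1 h5
          obtain ⟨h6, h6'⟩ := (Net.split_tgt_some k v).1 h6
          exact ⟨⟨fun h => h3 (congrArg some h), v, h4, h5', h6'⟩,
            fun h => h6 (Prod.ext_iff.1 h).2⟩
    · intro p hp
      obtain ⟨a, b, rfl, hab⟩ := key p hp
      exact hab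
    · intro p hp p' hp' h
      obtain ⟨a, b, rfl, -⟩ := key p hp
      obtain ⟨a', b', rfl, -⟩ := key p' hp'
      have h3 : a = a' := (Prod.ext_iff.1 h).1
      have h4 : b = b' := (Prod.ext_iff.1 h).2
      rw [h3, h4]
  have h3 := Set.ncard_sdiff_singleton_lt_of_mem hS (Set.toFinite _)
  unfold size
  omega

/-! ### Splitting a structure in two -/

theorem restrict_type {R : BoxNet} {K : Set R.V} {c : List R.E} (h : R.toNet.Restrictable K c)
    (hroot : ∀ e ∈ c, R.box (R.src e) = R.tree.root) :
    (R.restrict K c h hroot).toNet.type = c.map R.ty := by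
  let R' := R.restrict K c h hroot
  have h1 : R'.concl.map (Subtype.val : R'.E → R.E) = c := Net.restrict_concl
  have h2 : R'.toNet.type = (R'.concl.map (Subtype.val : R'.E → R.E)).map R.ty :=
    (List.map_map (f := (Subtype.val : R'.E → R.E)) (g := R.ty)).symm
  exact h2.trans (congrArg (List.map R.ty) h1)

/-- As `K` is closed under taking premises, a `wn` cell that had inputs still has them, and no flag
is lost. -/
theorem restrict_form {R : BoxNet} {K : Set R.V} {c : List R.E} (h : R.toNet.Restrictable K c)
    (hroot : ∀ e ∈ c, R.box (R.src e) = R.tree.root) (hK : ∀ e v, R.tgt e = some v → v ∈ K →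
      R.src e ∈ K) {N : Net} (hN : DaimonForm (c.map R.flag) N) :
    DaimonForm ((R.restrict K c h hroot).concl.map (R.restrict K c h hroot).flag) N := by
  let R' := R.restrict K c h hroot
  let u : R'.E → R.E := Subtype.val
  have h1 : R'.concl.map u = c := Net.restrict_concl
  rw [← h1, List.map_map] at hN
  refine hN.mono ?_
  rw [List.forall₂_map_left_iff, List.forall₂_map_right_iff, List.forall₂_same]
  rintro ⟨e, he⟩ _
  refine ⟨rfl, fun ⟨h3, f, hf⟩ => ⟨h3, ⟨f, hK f _ hf he⟩, ?_⟩⟩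
  exact (Net.restrict_tgt _ _).2 hf

/-- Every edge coming from the root is a conclusion. -/
def Saturated (R : BoxNet) : Prop := ∀ e, R.box (R.src e) = R.tree.root → R.tgt e = none

/-- A union of connected components, boxes being identified with their doors. -/
structure Closed (R : BoxNet) (K : Set R.V) : Prop where
  edge : ∀ e v, R.tgt e = some v → (R.src e ∈ K ↔ v ∈ K)
  door : ∀ w e v, R.tgt e = some v → R.label v = .bang → R.tree.Reach (R.box w) (R.box (R.src e)) →
    (w ∈ K ↔ v ∈ K)

theorem Closed.compl {R : BoxNet} {K : Set R.V} (h : R.Closed K) : R.Closed Kᶜ :=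
  ⟨fun e v hv => not_congr (h.edge e v hv), fun w e v h1 h2 h3 => not_congr (h.door w e v h1 h2 h3)⟩

theorem _root_.Glue.Net.CellOK.exists_out {N : Net} {v : N.V} (h : N.CellOK v) (h1 : N.label v ≠ .cut)
    (h2 : N.label v ≠ .daimon) : ∃ e, N.src e = v := by
  unfold Net.CellOK at h
  split at h
  · obtain ⟨_, e, f, _, h, _⟩ := h
    exact ⟨e, (h e).2 (Or.inl rfl)⟩
  · contradiction
  · obtain ⟨_, e, h, _⟩ := h; exact ⟨e, h.ex⟩
  · obtain ⟨_, e, h, _⟩ := h; exact ⟨e, h.ex⟩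
  · obtain ⟨_, _, e, _, _, _, h, _⟩ := h; exact ⟨e, h.ex⟩
  · obtain ⟨_, _, e, _, _, _, h, _⟩ := h; exact ⟨e, h.ex⟩
  · obtain ⟨e, _, h, _⟩ := h; exact ⟨e, h.ex⟩
  · obtain ⟨e, _, h, _⟩ := h; exact ⟨e, h.ex⟩
  · contradiction

/-- The inputs of a `cut`, a `tensor` or a `par` cell come from its box. -/
theorem box_src {R : BoxNet} {e : R.E} {v : R.V} (h : R.tgt e = some v) (h1 : R.label v ≠ .bang)
    (h2 : R.label v ≠ .wn) : R.box (R.src e) = R.box v := by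
  by_contra hb
  rcases R.border e v h hb with h | h <;> contradiction

namespace Saturated

variable {R : BoxNet}

theorem ne_cut (hs : R.Saturated) {v : R.V} (hv : R.box v = R.tree.root) : R.label v ≠ .cut := by
  intro hl
  have hok := R.wf.cell_ok v
  unfold Net.CellOK at hok
  rw [hl] at hok
  obtain ⟨_, e, f, h, _⟩ := hok
  have h1 : R.tgt e = some v := (h.2 e).2 (Or.inl rfl)
  have h2 := hs e ((box_src h1 (by simp [hl]) (by simp [hl])).trans hv)
  rw [h1] at h2; cases h2

theorem exists_concl (hs : R.Saturated) (hR : R.Inv) {v : R.V} (hv : R.box v = R.tree.root) :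
    ∃ e ∈ R.concl, R.src e = v := by
  obtain ⟨e, rfl⟩ := (R.wf.cell_ok v).exists_out (hs.ne_cut hv) fun h => hR.daimon v h hv
  exact ⟨e, (R.wf.mem_concl e).2 (hs e hv), rfl⟩

/-- A cell in a box drags into `K` the `bang` cell of its outermost box, so `K` meets the root,
where saturation provides a conclusion. Both sides of a `mix` need one, since this step cuts the
list of conclusions into two nonempty lists. -/
theorem exists_concl_mem (hs : R.Saturated) (hR : R.Inv) {K : Set R.V} (hK : R.Closed K)
    (hne : K.Nonempty) : ∃ e ∈ R.concl, R.src e ∈ K := by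
  obtain ⟨w, hw⟩ := hne
  obtain ⟨v, hv, hvK⟩ : ∃ v, R.box v = R.tree.root ∧ v ∈ K := by
    by_cases h : R.box w = R.tree.root
    · exact ⟨w, h, hw⟩
    · obtain ⟨e, v, h1, h2, h3, h4⟩ := hR.exists_root_door h
      exact ⟨v, h3, (hK.door w e v h1 h2 h4).1 hw⟩
  obtain ⟨e, he, rfl⟩ := hs.exists_concl hR hv
  exact ⟨e, he, hvK⟩

end Saturated

theorem Closed.restrictable {R : BoxNet} {K : Set R.V} (hK : R.Closed K) (hne : K.Nonempty)
    {C C' : List R.E} (hc : (C ++ C').Perm R.concl) (hC : ∀ e ∈ C, R.src e ∈ K)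
    (hC' : ∀ e ∈ C', R.src e ∉ K) : R.toNet.Restrictable K C where
  src_mem := hC
  nonempty := hne
  nodup := (hc.nodup_iff.2 R.wf.concl_nodup).of_append_left
  mem_iff e he := by
    constructor
    · intro h v hv
      rw [(R.wf.mem_concl e).1 (hc.mem_iff.1 (List.mem_append_left _ h))] at hv
      cases hv
    · intro h
      have h1 : R.tgt e = none := by
        rcases h2 : R.tgt e with _ | v
        · rfl
        · exact absurd ((hK.edge e v h2).1 he) (h v h2)
      rcases List.mem_append.1 (hc.mem_iff.2 ((R.wf.mem_concl e).2 h1)) with h2 | h2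
      · exact h2
      · exact absurd he (hC' e h2)
  up e v hv h := (hK.edge e v hv).2 h

/-- The cells of an expansion that lie over `K` are not joined to the others, so one cut of `R`
splits all its expansions at the same place; a daimon is split by its own rule. Both halves miss a
cell of `R` and the induction hypothesis applies to each. -/
theorem Closed.isGood_of_concl {R : BoxNet} {K : Set R.V} (hK : R.Closed K) (hR : R.Inv)
    (ih : ∀ R' : BoxNet, R'.Inv → R'.size < R.size → R'.IsGood)
    {C C' : List R.E} {a b : R.E} (hc : R.concl = (C ++ [a]) ++ b :: C')
    (hC : ∀ e ∈ C ++ [a], R.src e ∈ K) (hC' : ∀ e ∈ b :: C', R.src e ∉ K) : R.IsGood := by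
  have ha : R.src a ∈ K := hC a (by simp)
  have hb : R.src b ∉ K := hC' b (by simp)
  have hp : ((C ++ [a]) ++ b :: C').Perm R.concl := by rw [hc]
  have hr₁ := hK.restrictable ⟨_, ha⟩ hp hC hC'
  have hr₂ := hK.compl.restrictable ⟨_, hb⟩ (List.perm_append_comm.trans hp) hC'
    fun e he => not_not.2 (hC e he)
  have hroot : ∀ e ∈ R.concl, R.box (R.src e) = R.tree.root := fun e he =>
    R.box_tail e ((R.wf.mem_concl e).1 he)
  have hroot₁ : ∀ e ∈ C ++ [a], R.box (R.src e) = R.tree.root := fun e he =>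
    hroot e (hp.mem_iff.1 (List.mem_append_left _ he))
  have hroot₂ : ∀ e ∈ b :: C', R.box (R.src e) = R.tree.root := fun e he =>
    hroot e (hp.mem_iff.1 (List.mem_append_right _ he))
  have hi₁ := hR.restrict hr₁ hroot₁ fun w hw e v h1 h2 h3 => (hK.door w e v h1 h2 h3).1 hw
  have hi₂ := hR.restrict hr₂ hroot₂ fun w hw e v h1 h2 h3 => (hK.compl.door w e v h1 h2 h3).1 hw
  have hg₁ := ih _ hi₁ (size_restrict hr₁ hroot₁ hb)
  have hg₂ := ih _ hi₂ (size_restrict hr₂ hroot₂ (not_not.2 ha))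
  unfold IsGood at hg₁ hg₂ ⊢
  rw [restrict_type] at hg₁ hg₂
  have hty : R.toNet.type = C.map R.ty ++ R.ty a :: R.ty b :: C'.map R.ty := by
    rw [Net.type, hc]; simp
  rw [List.map_append, List.map_singleton] at hg₁
  rw [List.map_cons] at hg₂
  rw [hty]
  refine hg₁.step₂ hg₂ (.mix _ _ _ _) ?_
  rintro N - - (⟨hd, ⟨E⟩⟩ | hN)
  · obtain ⟨D, D', hDD, hD, hD'⟩ := List.map_eq_append_iff.1 (E.concl_q.trans hc)
    have hs : ∀ e ∈ D, N.src e ∈ E.p ⁻¹' K := fun e he => by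
      have := hC (E.q e) (hD ▸ List.mem_map_of_mem he)
      rwa [E.src_q] at this
    have hs' : ∀ e ∈ D', N.src e ∈ E.p ⁻¹' Kᶜ := fun e he => by
      have := hC' (E.q e) (hD' ▸ List.mem_map_of_mem he)
      rwa [E.src_q] at this
    have E₁ := E.restrict K _ hr₁ hroot₁ D hD hs
    have E₂ := E.restrict Kᶜ _ hr₂ hroot₂ D' hD' hs'
    have hsub₁ := N.sub_restrict (hc := hs)
    have hsub₂ := N.sub_restrict (hc := hs')
    refine ⟨_, _, .mix (E.p ⁻¹' K) D D' (fun e v hv => ?_) hDD hs hs' hsub₁ hsub₂,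
      ⟨E₁.wf hi₁.exists_root, ?_, Or.inl ⟨hsub₁.daimonFree hd, ⟨E₁⟩⟩⟩,
      E₂.wf hi₂.exists_root, ?_, Or.inl ⟨hsub₂.daimonFree hd, ⟨E₂⟩⟩⟩
    · have := hK.edge _ _ (E.tgt_q e v hv).1
      rw [E.src_q] at this
      exact this
    · rw [E₁.type_eq, restrict_type]; simp
    · rw [E₂.type_eq, restrict_type]; simp
  · rw [hc, List.map_append] at hN
    obtain ⟨N₁, N₂, h1, h2, h3⟩ := hN.mix (C.map R.ty) (R.ty a) (R.ty b) (C'.map R.ty)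
    have f₁ := restrict_form hr₁ hroot₁ hr₁.up h2
    have f₂ := restrict_form hr₂ hroot₂ hr₂.up h3
    refine ⟨N₁, N₂, h1, ⟨h2.wf, h2.type.trans ?_, Or.inr f₁⟩, h3.wf, h3.type.trans ?_, Or.inr f₂⟩
    · rw [List.map_map, List.map_append]; rfl
    · rw [List.map_map, List.map_cons]; rfl

theorem Closed.isGood {R : BoxNet} {K : Set R.V} (hK : R.Closed K) (hR : R.Inv)
    (hs : R.Saturated) (hne : K.Nonempty) (hne' : Kᶜ.Nonempty)
    (ih : ∀ R' : BoxNet, R'.Inv → R'.size < R.size → R'.IsGood) : R.IsGood := by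
  classical
  obtain ⟨a, ha, haK⟩ := hs.exists_concl_mem hR hK hne
  obtain ⟨b, hb, hbK⟩ := hs.exists_concl_mem hR hK.compl hne'
  let C := R.concl.filter fun e => R.src e ∈ K
  let C' := R.concl.filter fun e => ¬ (R.src e ∈ K)
  have hp : (C ++ C').Perm R.concl := by
    have := List.filter_append_perm (fun e => decide (R.src e ∈ K)) R.concl
    simpa [C, C'] using this
  have hC : ∀ e ∈ C, R.src e ∈ K := fun e he => by simpa using (List.mem_filter.1 he).2
  have hC' : ∀ e ∈ C', R.src e ∉ K := fun e he => by simpa using (List.mem_filter.1 he).2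
  have haC : a ∈ C := List.mem_filter.2 ⟨ha, by simpa using haK⟩
  have hbC : b ∈ C' := List.mem_filter.2 ⟨hb, by simpa using hbK⟩
  clear_value C C'
  obtain ⟨C, a, rfl⟩ := (List.eq_nil_or_concat' C).resolve_left (List.ne_nil_of_mem haC)
  obtain ⟨b, C', rfl⟩ := List.exists_cons_of_ne_nil (List.ne_nil_of_mem hbC)
  refine IsGood.of_reconcl hR.exists_root hp ?_
  have hK' : (R.reconcl _ hp).Closed K := ⟨hK.edge, hK.door⟩
  exact hK'.isGood_of_concl (hR.reconcl _ hp) ih rfl hC hC'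

end BoxNet

/-! ### Choosing the cell of the root to remove -/

namespace BoxNet

variable {R : BoxNet}

theorem exists_perm_concl {o : R.E} (ho : R.tgt o = none) :
    ∃ C, (C ++ [o]).Perm R.concl := by
  obtain ⟨s, t, h⟩ := List.append_of_mem ((R.wf.mem_concl o).2 ho)
  refine ⟨s ++ t, ?_⟩
  rw [h, List.append_assoc]
  exact List.perm_append_comm.append_left s

theorem Removable.inv_remove {v : R.V} {I C O : List R.E} (h : R.Removable v I C O)
    (hR : R.Inv) : h.remove.Inv := h.inv hR

theorem Removable.size_remove {v : R.V} {I C O : List R.E} (h : R.Removable v I C O) :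
    h.remove.size < R.size := size_restrict h.restrictable h.hroot fun h => h rfl

theorem isGood_of_contr (hR : R.Inv) (ih : ∀ R' : BoxNet, R'.Inv → R'.size < R.size → R'.IsGood)
    {o e e' : R.E} (ho : R.tgt o = none) (hl : R.label (R.src o) = .wn)
    (he : R.tgt e = some (R.src o)) (he' : R.tgt e' = some (R.src o)) (hne : e' ≠ e) :
    R.IsGood := by
  obtain ⟨C, hp⟩ := exists_perm_concl ho
  refine IsGood.of_reconcl hR.exists_root hp ?_
  have h : (R.reconcl _ hp).Splittable C o e := ⟨rfl, hl, he⟩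
  exact h.isGood (hR.reconcl _ hp) he' hne (ih _ (h.inv (hR.reconcl _ hp)) (h.size_split he' hne))

theorem isGood_of_binary (hR : R.Inv) (ih : ∀ R' : BoxNet, R'.Inv → R'.size < R.size → R'.IsGood)
    {o : R.E} (ho : R.tgt o = none) (hl : R.label (R.src o) = .tensor ∨ R.label (R.src o) = .par) :
    R.IsGood := by
  obtain ⟨C, hp⟩ := exists_perm_concl ho
  refine IsGood.of_reconcl hR.exists_root hp ?_
  have hR' := hR.reconcl _ hp
  rcases hl with hl | hl
  · obtain ⟨e, f, h, h1, h2⟩ := removable_binary (R := R.reconcl _ hp) (C := C) (o := o) rfl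
      .tensor .tensor (Or.inl ⟨rfl, rfl⟩) hl
    exact h.isGood_binary hR' (Or.inl ⟨hl, h2⟩) h1 (ih _ (h.inv_remove hR') h.size_remove)
  · obtain ⟨e, f, h, h1, h2⟩ := removable_binary (R := R.reconcl _ hp) (C := C) (o := o) rfl
      .par .par (Or.inr ⟨rfl, rfl⟩) hl
    exact h.isGood_binary hR' (Or.inr ⟨hl, h2⟩) h1 (ih _ (h.inv_remove hR') h.size_remove)

theorem isGood_of_der (hR : R.Inv) (ih : ∀ R' : BoxNet, R'.Inv → R'.size < R.size → R'.IsGood)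
    {o e : R.E} (ho : R.tgt o = none) (hl : R.label (R.src o) = .wn)
    (he : R.tgt e = some (R.src o)) (hb : R.box (R.src e) = R.tree.root) : R.IsGood := by
  by_cases h : ∃ e', R.tgt e' = some (R.src o) ∧ e' ≠ e
  · obtain ⟨e', h1, h2⟩ := h
    exact isGood_of_contr hR ih ho hl he h1 h2
  · obtain ⟨C, hp⟩ := exists_perm_concl ho
    refine IsGood.of_reconcl hR.exists_root hp ?_
    have hR' := hR.reconcl _ hp
    have h1 : ∀ g, R.tgt g = some (R.src o) ↔ g = e := fun g =>
      ⟨fun hg => by_contra fun hne => h ⟨g, hg, hne⟩, fun hg => hg ▸ he⟩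
    have h2 := removable_der (R := R.reconcl _ hp) (C := C) (o := o) rfl hl h1 hb
    exact h2.isGood_der hR' hl (ih _ (h2.inv_remove hR') h2.size_remove)

theorem isGood_of_cut (hR : R.Inv) (ih : ∀ R' : BoxNet, R'.Inv → R'.size < R.size → R'.IsGood)
    {v : R.V} (hv : R.label v = .cut) (hb : R.box v = R.tree.root) : R.IsGood := by
  obtain ⟨e, f, h, h1⟩ := exists_removable_cut hv hb
  exact h.isGood_cut hR hv h1 (ih _ (h.inv_remove hR) h.size_remove)

/-- The cells which are not in a box are removed from the conclusions upwards. -/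
theorem isGood_of_not_saturated (hR : R.Inv)
    (ih : ∀ R' : BoxNet, R'.Inv → R'.size < R.size → R'.IsGood) (hs : ¬ R.Saturated) :
    R.IsGood := by
  have hE := R.wf.finite_E
  have hne : {e | R.box (R.src e) = R.tree.root ∧ R.tgt e ≠ none}.Nonempty := by
    by_contra h
    exact hs fun e he => by_contra fun h' => h ⟨e, he, h'⟩
  -- Among the edges of the root that are not conclusions, one with the largest type is taken. If it
  -- enters a tensor, par or `wn` cell, the output of that cell has a larger type, hence is a
  -- conclusion by maximality. The growth of types replaces an argument on the shape of the graph,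
  -- which may have cycles.
  obtain ⟨e, ⟨heb, he⟩, hmax⟩ := Set.exists_max_image _ (fun e => sizeOf (R.ty e))
    (Set.toFinite _) hne
  obtain ⟨v, hv⟩ := Option.ne_none_iff_exists'.1 he
  have hvb : R.box v = R.tree.root := RTree.reach_root_iff.1 (heb ▸ R.box_edge e v hv)
  have hout : ∀ o, R.src o = v → sizeOf (R.ty e) < sizeOf (R.ty o) → R.tgt o = none := by
    intro o ho hlt
    by_contra h
    exact absurd (hmax o ⟨by rw [ho, hvb], h⟩) (not_le.2 hlt)
  have hok := R.wf.cell_ok v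
  unfold Net.CellOK at hok
  rcases hl : R.label v with _ | _ | _ | _ | _ | _ | _ | _ | _ <;> rw [hl] at hok
  · exact absurd hv (hok.1 e)
  · exact isGood_of_cut hR ih hl hvb
  · exact absurd hv (hok.1 e)
  · exact absurd hv (hok.1 e)
  · obtain ⟨f, g, o, h1, _, _, h2, h3⟩ := hok
    obtain rfl := h2.ex
    refine isGood_of_binary hR ih (hout o rfl ?_) (Or.inl hl)
    rw [h3]
    rcases (h1.2 e).1 hv with rfl | rfl <;> (rw [Formula.tensor.sizeOf_spec]; omega)
  · obtain ⟨f, g, o, h1, _, _, h2, h3⟩ := hok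
    obtain rfl := h2.ex
    refine isGood_of_binary hR ih (hout o rfl ?_) (Or.inr hl)
    rw [h3]
    rcases (h1.2 e).1 hv with rfl | rfl <;> (rw [Formula.par.sizeOf_spec]; omega)
  · obtain ⟨o, A, h2, h3, h4⟩ := hok
    obtain rfl := h2.ex
    refine isGood_of_der hR ih (hout o rfl ?_) hl hv heb
    rw [h3, h4 e hv]
    simp
  · have := hR.bang_parent e v hv hl
    rw [heb, R.tree.parent_root] at this
    cases this
  · exact absurd hv (hok e)

/-! ### Cells without inputs -/

/-- In a saturated structure a cell of the root without inputs is not joined to anything, so it can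
be split off if other cells exist. If it is the only cell, it is deleted by the step named after its
label; an admitted daimon carries no flag then, as no `wn` cell has inputs, and the same step
deletes it. -/
theorem Saturated.isGood_of_noIn (hs : R.Saturated) (hR : R.Inv)
    (ih : ∀ R' : BoxNet, R'.Inv → R'.size < R.size → R'.IsGood) {v : R.V}
    (hv : R.box v = R.tree.root) (hi : R.NoIn v) : R.IsGood := by
  by_cases hu : ∃ w, w ≠ v
  · refine Closed.isGood (K := {v}) ⟨fun e w hw => ?_, fun u e w h1 h2 h3 => ?_⟩ hR hs
      ⟨v, rfl⟩ hu ih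
    · refine iff_of_false ?_ ?_
      · rintro (h : R.src e = v)
        rw [hs e (by rw [h, hv])] at hw; cases hw
      · rintro (rfl : w = v)
        exact hi e hw
    · refine iff_of_false ?_ ?_
      · rintro (rfl : u = v)
        have h4 := hR.bang_parent e w h1 h2
        rw [hv] at h3
        rw [RTree.reach_root_iff.1 h3, R.tree.parent_root] at h4
        cases h4
      · rintro (rfl : w = v)
        exact hi e h1
  have huniq : ∀ w, w = v := fun w => by_contra fun h => hu ⟨w, h⟩
  have hout : ∀ e, R.tgt e = none := fun e => hs e (by rw [huniq (R.src e), hv])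
  have hN : ∀ N : Net, Exp N R → N.IsHypothesis (R.label v) := by
    intro N E
    obtain ⟨w, hw, -⟩ := E.surj_root hv
    refine ⟨⟨w, by rw [E.label_p, hw], fun u => E.inj_root ?_ ?_⟩, fun e =>
      (E.tgt_none e).2 (hout _)⟩
    · rw [huniq (E.p u), hw]
    · rw [huniq (E.p u), hv]
  have hD : ∀ N, DaimonForm (R.concl.map R.flag) N → N.IsHypothesis .daimon := by
    refine fun N h => h.isHypothesis fun x hx => ?_
    obtain ⟨e, _, rfl⟩ := List.mem_map.1 hx
    rintro ⟨_, f, hf⟩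
    rw [hout f] at hf; cases hf
  have key : ∀ {G : List Formula} (a : LocalPath G []), R.toNet.type = G →
      (∀ N : Net, N.IsHypothesis (R.label v) ∨ N.IsHypothesis .daimon → LocalAct a N {[]}) →
      R.IsGood := by
    rintro _ a rfl h
    refine Good.step₀ a fun N _ _ hA => h N ?_
    rcases hA with ⟨_, ⟨E⟩⟩ | hA
    · exact Or.inl (hN N E)
    · exact Or.inr (hD N hA)
  have hmem : ∀ e, e ∈ R.concl := fun e => (R.wf.mem_concl e).2 (hout e)
  have hsing : ∀ o, R.IsOut v o → R.toNet.type = [R.ty o] := by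
    intro o ho
    have hp : R.concl.Perm [o] :=
      (List.perm_ext_iff_of_nodup R.wf.concl_nodup (List.nodup_singleton o)).2 fun g =>
        iff_of_true (hmem g) (List.mem_singleton.2 ((ho g).1 (huniq _)))
    rw [Net.type, List.perm_singleton.1 hp]; rfl
  have hok := R.wf.cell_ok v
  unfold Net.CellOK at hok
  rcases hl : R.label v with _ | _ | _ | _ | _ | _ | _ | _ | _ <;> rw [hl] at hok
  · obtain ⟨_, e, f, hef, h1, h2⟩ := hok
    have hp : R.concl.Perm [f, e] := by
      refine (List.perm_ext_iff_of_nodup R.wf.concl_nodup (by simpa using hef.symm)).2 fun g => ?_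
      refine iff_of_true (hmem g) ?_
      simpa [or_comm] using (h1 g).1 (huniq _)
    obtain ⟨a, b, hab⟩ := List.length_eq_two.1 hp.length_eq
    have hnd := R.wf.concl_nodup
    rw [hab] at hp hnd
    have hne : a ≠ b := by simpa using hnd
    -- The conclusions of the axiom may be listed in either order; the step fits both because
    -- duality is an involution.
    have hty : R.ty b = (R.ty a).dual := by
      rcases (h1 a).1 (huniq _) with rfl | rfl <;> rcases (h1 b).1 (huniq _) with rfl | rfl
      · exact absurd rfl hne
      · rw [h2, Formula.dual_dual]
      · exact h2
      · exact absurd rfl hne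
    exact key (.ax (R.ty a)) (by rw [Net.type, hab, ← hty]; rfl) fun N h => .ax (hl ▸ h)
  · exact absurd hl (hs.ne_cut hv)
  · obtain ⟨_, o, h1, h2⟩ := hok
    exact key .one ((hsing o h1).trans (by rw [h2])) fun N h => .one (hl ▸ h)
  · obtain ⟨_, o, h1, h2⟩ := hok
    exact key .bot ((hsing o h1).trans (by rw [h2])) fun N h => .bot (hl ▸ h)
  · obtain ⟨f, g, o, h1, _⟩ := hok
    exact absurd ((h1.2 f).2 (Or.inl rfl)) (hi f)
  · obtain ⟨f, g, o, h1, _⟩ := hok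
    exact absurd ((h1.2 f).2 (Or.inl rfl)) (hi f)
  · obtain ⟨o, A, h1, h2, _⟩ := hok
    exact key (.weak A) ((hsing o h1).trans (by rw [h2])) fun N h => .weak (hl ▸ h)
  · obtain ⟨e, he⟩ := hR.bang v hl
    exact absurd ((he e).2 rfl) (hi e)
  · exact absurd hv (hR.daimon v hl)

end BoxNet

/-- The ancestors of a node above a child `b` of the root are above `b`, except the root. -/
theorem RTree.Reach.of_child {T : RTree} {x y b : T.Node} (hb : T.parent b = some T.root)
    (h : T.Reach x b) (h' : T.Reach x y) (hy : y ≠ T.root) : T.Reach y b := by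
  rcases h.total h' with h1 | h1
  · rcases h1.cases_parent with rfl | ⟨z, hz, hzy⟩
    · exact T.reach_refl _
    · rw [hb] at hz
      rw [← Option.some.inj hz] at hzy
      exact absurd (RTree.reach_root_iff.1 hzy) hy
  · exact h1

theorem RTree.not_reach_of_child {T : RTree} {b : T.Node} (hb : T.parent b = some T.root) :
    ¬ T.Reach T.root b := fun h => by
  rw [RTree.reach_root_iff.1 h, T.parent_root] at hb; cases hb

/-! ### Reduction to a single box -/

namespace BoxNet

variable {R : BoxNet}

/-- A structure with one box, the conclusions of which are its doors, the principal one being the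
last one. -/
structure Boxed (R : BoxNet) (C : List R.E) (o e : R.E) : Prop where
  concl : R.concl = C ++ [o]
  bang : R.label (R.src o) = .bang
  wn : ∀ c ∈ C, R.label (R.src c) = .wn
  input : R.tgt e = some (R.src o)
  above : ∀ v, R.box v ≠ R.tree.root → R.tree.Reach (R.box v) (R.box (R.src e))
  saturated : R.Saturated

/-- The cells in the box `b`, or at its border. -/
def boxed (R : BoxNet) (b : R.tree.Node) : Set R.V :=
  {v | R.tree.Reach (R.box v) b ∨ ∃ e, R.tgt e = some v ∧ R.tree.Reach (R.box (R.src e)) b}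

theorem mem_boxed {b : R.tree.Node} (hb : R.tree.parent b = some R.tree.root) {v : R.V}
    (hv : R.box v ≠ R.tree.root) : v ∈ R.boxed b ↔ R.tree.Reach (R.box v) b := by
  refine ⟨?_, Or.inl⟩
  rintro (h | ⟨e, h1, h2⟩)
  · exact h
  · exact h2.of_child hb (R.box_edge e v h1) hv

/-- Two boxes above the root could only be linked through a cell of the root with inputs in both. A
`bang` cell has one input, a `wn` cell too by `hw`, and other cells take their inputs from their own
box, which saturation forbids at the root. -/
theorem Saturated.closed_boxed (hs : R.Saturated) (hR : R.Inv)
    (hw : ∀ v e f, R.box v = R.tree.root → R.label v = .wn → R.tgt e = some v → R.tgt f = some v →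
      e = f) {b : R.tree.Node} (hb : R.tree.parent b = some R.tree.root) :
    R.Closed (R.boxed b) := by
  have hsrc : ∀ {e v}, R.tgt e = some v → R.box (R.src e) ≠ R.tree.root := fun he h => by
    rw [hs _ h] at he; cases he
  have hedge : ∀ e v, R.tgt e = some v → (R.src e ∈ R.boxed b ↔ v ∈ R.boxed b) := by
    intro e v he
    rw [mem_boxed hb (hsrc he)]
    refine ⟨fun h => Or.inr ⟨e, he, h⟩, fun h => ?_⟩
    by_cases hv : R.box v = R.tree.root
    · obtain ⟨g, hg, hgb⟩ := h.resolve_left fun h => RTree.not_reach_of_child hb (hv ▸ h)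
      have : e = g := by
        by_cases h1 : R.label v = .wn
        · exact hw v e g hv h1 he hg
        by_cases h2 : R.label v = .bang
        · obtain ⟨k, hk⟩ := hR.bang v h2
          rw [(hk e).1 he, (hk g).1 hg]
        · exact absurd ((box_src hg h2 h1).trans hv) (hsrc hg)
      exact this ▸ hgb
    · exact (R.box_edge e v he).trans ((mem_boxed hb hv).1 h)
  refine ⟨hedge, fun w e v he hv hwe => ?_⟩
  have hw : R.box w ≠ R.tree.root := fun h => by
    rw [h] at hwe
    exact hsrc he (RTree.reach_root_iff.1 hwe)
  rw [← hedge e v he, mem_boxed hb hw, mem_boxed hb (hsrc he)]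
  exact ⟨fun h => h.of_child hb hwe (hsrc he), fun h => hwe.trans h⟩

/-- A structure is reduced to structures with one box. -/
theorem Saturated.isGood (hs : R.Saturated) (hR : R.Inv)
    (ih : ∀ R' : BoxNet, R'.Inv → R'.size < R.size → R'.IsGood)
    (hbox : ∀ (c : List R.E) (hp : c.Perm R.concl) (C : List R.E) (o e : R.E),
      (R.reconcl c hp).Boxed C o e → (R.reconcl c hp).IsGood) : R.IsGood := by
  by_cases hi : ∃ v, R.box v = R.tree.root ∧ R.NoIn v
  · obtain ⟨v, h1, h2⟩ := hi
    exact hs.isGood_of_noIn hR ih h1 h2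
  have hin : ∀ v, R.box v = R.tree.root → ∃ e, R.tgt e = some v := fun v hv => by
    by_contra h
    exact hi ⟨v, hv, fun e he => h ⟨e, he⟩⟩
  have hsrc : ∀ {e v}, R.tgt e = some v → R.box (R.src e) ≠ R.tree.root := fun he h => by
    rw [hs _ h] at he; cases he
  by_cases hc : ∃ v e f, R.box v = R.tree.root ∧ R.label v = .wn ∧ R.tgt e = some v ∧
      R.tgt f = some v ∧ e ≠ f
  · obtain ⟨v, e, f, h1, h2, h3, h4, h5⟩ := hc
    obtain ⟨o, ho, rfl⟩ := hs.exists_concl hR h1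
    exact isGood_of_contr hR ih ((R.wf.mem_concl o).1 ho) h2 h4 h3 h5
  have hw : ∀ v e f, R.box v = R.tree.root → R.label v = .wn → R.tgt e = some v →
      R.tgt f = some v → e = f := fun v e f h1 h2 h3 h4 =>
    by_contra fun h5 => hc ⟨v, e, f, h1, h2, h3, h4, h5⟩
  obtain ⟨e, v, he, hl, hv⟩ : ∃ e v, R.tgt e = some v ∧ R.label v = .bang ∧
      R.box v = R.tree.root := by
    obtain ⟨v, hv⟩ := hR.exists_root
    obtain ⟨e, he⟩ := hin v hv
    obtain ⟨f, u, h1, h2, h3, _⟩ := hR.exists_root_door (hsrc he)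
    exact ⟨f, u, h1, h2, h3⟩
  have hb : R.tree.parent (R.box (R.src e)) = some R.tree.root := by
    rw [hR.bang_parent e v he hl, hv]
  have hK := hs.closed_boxed hR hw hb
  by_cases hne : ∃ w, w ∉ R.boxed (R.box (R.src e))
  · exact hK.isGood hR hs ⟨_, Or.inl (R.tree.reach_refl _)⟩ hne ih
  have hall : ∀ w, w ∈ R.boxed (R.box (R.src e)) := fun w => by_contra fun h => hne ⟨w, h⟩
  obtain ⟨o, ho, rfl⟩ := hs.exists_concl hR hv
  obtain ⟨C, hp⟩ := exists_perm_concl ((R.wf.mem_concl o).1 ho)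
  refine IsGood.of_reconcl hR.exists_root hp (hbox _ hp C o e ⟨rfl, hl, fun c hcC => ?_, he,
    fun v hv => (mem_boxed hb hv).1 (hall v), hs⟩)
  change R.label (R.src c) = .wn
  have hcn : R.tgt c = none := (R.wf.mem_concl c).1 (hp.mem_iff.1 (List.mem_append_left _ hcC))
  have hcb := R.box_tail c hcn
  obtain ⟨g, hg⟩ := hin _ hcb
  by_contra h1
  by_cases h2 : R.label (R.src c) = .bang
  -- A second `bang` cell among the conclusions would have its input at the bottom of the same box;
  -- since a box has one door, it would be the first one.
  · have h3 : R.box (R.src g) = R.box (R.src e) := by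
      have h4 := hR.bang_parent g _ hg h2
      rw [hcb] at h4
      rcases ((mem_boxed hb (hsrc hg)).1 (hall _)).cases_parent with h | ⟨z, hz, hzb⟩
      · exact h
      · rw [h4] at hz
        rw [← Option.some.inj hz] at hzb
        exact absurd hzb (RTree.not_reach_of_child hb)
    have h4 : g = e := R.door_inj g e _ _ hg he h2 hl (hR.bang_parent g _ hg h2)
      (hR.bang_parent e _ he hl) h3
    subst h4
    have h5 : R.src c = R.src o := Option.some.inj (hg.symm.trans he)
    have h6 : c = o := (R.wf.isOut_bang hl c).1 h5
    have hd := hp.nodup_iff.2 R.wf.concl_nodup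
    exact (List.nodup_append.1 hd).2.2 c hcC o (by simp) h6
  · exact hsrc hg ((box_src hg h2 h1).trans hcb)

end BoxNet

/-! ### The content of a box -/

namespace RTree

/-- The retraction of a tree onto the subtree above `b`. -/
noncomputable def toSub (T : RTree) (b x : T.Node) : (T.sub b).Node :=
  open Classical in if h : T.Reach x b then ⟨x, h⟩ else (T.sub b).root

variable {T : RTree} {b x : T.Node}

theorem toSub_of_reach (h : T.Reach x b) : T.toSub b x = ⟨x, h⟩ := dif_pos h

theorem toSub_of_not_reach (h : ¬ T.Reach x b) : T.toSub b x = (T.sub b).root := dif_neg h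

theorem toSub_self : T.toSub b b = (T.sub b).root := toSub_of_reach (T.reach_refl b)

theorem reach_of_toSub_ne (h : T.toSub b x ≠ (T.sub b).root) : T.Reach x b := by
  by_contra h'
  exact h (toSub_of_not_reach h')

theorem Reach.toSub {y : T.Node} (h : T.Reach x y) : (T.sub b).Reach (T.toSub b x) (T.toSub b y) := by
  by_cases hy : T.Reach y b
  · rw [toSub_of_reach hy, toSub_of_reach (h.trans hy)]
    exact (sub_reach _ _).2 h
  · rw [toSub_of_not_reach hy]
    exact (T.sub b).reach_root _

end RTree

namespace BoxNet.Boxed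

variable {R : BoxNet} {C : List R.E} {o e : R.E}

theorem tgt_concl (h : R.Boxed C o e) {c : R.E} (hc : c ∈ C) : R.tgt c = none := by
  rw [← R.wf.mem_concl, h.concl]; exact List.mem_append_left _ hc

theorem tgt_last (h : R.Boxed C o e) : R.tgt o = none := by
  rw [← R.wf.mem_concl, h.concl]; simp

theorem parent (h : R.Boxed C o e) (hR : R.Inv) :
    R.tree.parent (R.box (R.src e)) = some R.tree.root := by
  rw [hR.bang_parent e _ h.input h.bang, R.box_tail o h.tgt_last]

theorem input_iff (h : R.Boxed C o e) (hR : R.Inv) (g : R.E) :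
    R.tgt g = some (R.src o) ↔ g = e := by
  obtain ⟨k, hk⟩ := hR.bang _ h.bang
  rw [hk, (hk e).1 h.input]

theorem src_ne (h : R.Boxed C o e) {g : R.E} {v : R.V} (hg : R.tgt g = some v) :
    R.src g ≠ R.src o := fun hs => by
  rw [(R.wf.isOut_bang h.bang g).1 hs, h.tgt_last] at hg; cases hg

theorem src_concl_ne (h : R.Boxed C o e) {c : R.E} (hc : c ∈ C) : R.src c ≠ R.src o := fun hs => by
  have h1 := h.wn c hc
  rw [hs, h.bang] at h1; cases h1

theorem root_cases (h : R.Boxed C o e) (hR : R.Inv) {v : R.V} (hv : R.box v = R.tree.root)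
    (hne : v ≠ R.src o) : ∃ c ∈ C, R.src c = v := by
  obtain ⟨c, hc, rfl⟩ := h.saturated.exists_concl hR hv
  rw [h.concl, List.mem_append, List.mem_singleton] at hc
  rcases hc with hc | rfl
  · exact ⟨c, hc, rfl⟩
  · exact absurd rfl hne

theorem reach_of_bang (h : R.Boxed C o e) (hR : R.Inv) {v : R.V} (hv : R.label v = .bang)
    (hne : v ≠ R.src o) : R.tree.Reach (R.box v) (R.box (R.src e)) := by
  refine h.above v fun hb => ?_
  obtain ⟨c, hc, rfl⟩ := h.root_cases hR hb hne
  rw [h.wn c hc] at hv; cases hv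

theorem restrictable (h : R.Boxed C o e) (hR : R.Inv) :
    R.toNet.Restrictable {R.src o}ᶜ (C ++ [e]) where
  src_mem g hg := by
    rcases List.mem_append.1 hg with hg | hg
    · exact h.src_concl_ne hg
    · rw [List.mem_singleton.1 hg]
      exact h.src_ne h.input
  nonempty := ⟨R.src e, h.src_ne h.input⟩
  nodup := by
    refine List.nodup_append.2 ⟨(h.concl ▸ R.wf.concl_nodup : (C ++ [o]).Nodup).of_append_left,
      List.nodup_singleton _, ?_⟩
    rintro c hc _ he rfl
    have := h.tgt_concl hc
    rw [List.mem_singleton.1 he, h.input] at this; cases this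
  mem_iff g hg := by
    rw [List.mem_append, List.mem_singleton]
    constructor
    · rintro (h1 | rfl) w hw
      · rw [h.tgt_concl h1] at hw; cases hw
      · rw [h.input] at hw
        rw [← Option.some.inj hw]; exact fun h => h rfl
    · intro h1
      rcases h2 : R.tgt g with _ | w
      · rw [← R.wf.mem_concl, h.concl, List.mem_append, List.mem_singleton] at h2
        rcases h2 with h2 | rfl
        · exact Or.inl h2
        · exact absurd rfl hg
      · obtain rfl : w = R.src o := not_not.1 (h1 w h2)
        exact Or.inr ((h.input_iff hR g).1 h2)
  up g w hw _ := h.src_ne hw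

/-- The content of the box. -/
noncomputable def unbox (h : R.Boxed C o e) (hR : R.Inv) : BoxNet where
  toNet := R.toNet.restrict {R.src o}ᶜ (C ++ [e]) (h.restrictable hR).src_mem
  wf := (h.restrictable hR).wf R.wf
  tree := R.tree.sub (R.box (R.src e))
  -- The `wn` cells of the border, which were at the old root, are retracted onto the root of the
  -- content. They become ordinary cells of the opened box.
  box v := R.tree.toSub _ (R.box v.1)
  box_edge g v hv := (R.box_edge g.1 v.1 ((Net.restrict_tgt _ _).1 hv)).toSub
  box_tail g hg := by
    rw [← ((h.restrictable hR).wf R.wf).mem_concl, Net.mem_restrict_concl] at hg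
    change R.tree.toSub _ (R.box (R.src g.1)) = _
    rcases List.mem_append.1 hg with hg | hg
    · rw [R.box_tail _ (h.tgt_concl hg)]
      exact RTree.toSub_of_not_reach (RTree.not_reach_of_child (h.parent hR))
    · rw [List.mem_singleton.1 hg]
      exact RTree.toSub_self
  border g v hv hb := R.border g.1 v.1 ((Net.restrict_tgt _ _).1 hv) fun h => hb (congrArg _ h)
  door_inj f g v w hf hg hv hw _ _ h3 := by
    have hf := (Net.restrict_tgt _ _).1 hf
    have hg := (Net.restrict_tgt _ _).1 hg
    have h1 := (R.box_edge _ _ hf).trans (h.reach_of_bang hR hv v.2)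
    have h2 := (R.box_edge _ _ hg).trans (h.reach_of_bang hR hw w.2)
    have h4 : R.tree.toSub (R.box (R.src e)) (R.box (R.src f.1)) =
      R.tree.toSub (R.box (R.src e)) (R.box (R.src g.1)) := h3
    rw [RTree.toSub_of_reach h1, RTree.toSub_of_reach h2] at h4
    exact Subtype.ext (R.door_inj f.1 g.1 v.1 w.1 hf hg hv hw (hR.bang_parent _ _ hf hv)
      (hR.bang_parent _ _ hg hw) (congrArg Subtype.val h4))

theorem size_unbox (h : R.Boxed C o e) (hR : R.Inv) : (h.unbox hR).size < R.size :=
  size_lt (R' := h.unbox hR) Subtype.val Subtype.val Subtype.val_injective Subtype.val_injective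
    ⟨R.src o, fun ⟨w, hw⟩ => w.2 hw⟩ (fun _ => rfl) fun _ _ h => (Net.restrict_tgt _ _).1 h

/-- The only door that disappears is `e`, and its box is the new root, which needs none. A daimon
directly in the box would come to lie at the new root; `hd` excludes it, and that case has a
strategy of its own. -/
theorem inv_unbox (h : R.Boxed C o e) (hR : R.Inv)
    (hd : ∀ v, R.label v = .daimon → R.box v ≠ R.box (R.src e)) : (h.unbox hR).Inv where
  bang v hv := by
    obtain ⟨f, hf⟩ := hR.bang v.1 hv
    refine ⟨⟨f, h.src_ne ((hf f).2 rfl)⟩, fun g => ?_⟩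
    exact (Net.restrict_tgt g v).trans ((hf g.1).trans ⟨fun h => Subtype.ext h, fun h => h ▸ rfl⟩)
  bang_parent g v hg hv := by
    have hg := (Net.restrict_tgt _ _).1 hg
    have hr := h.reach_of_bang hR hv v.2
    have hr' := (R.box_edge _ _ hg).trans hr
    have hp := hR.bang_parent g.1 v.1 hg hv
    change (R.tree.sub _).parent (R.tree.toSub _ (R.box (R.src g.1))) =
      some (R.tree.toSub _ (R.box v.1))
    rw [RTree.toSub_of_reach hr, RTree.toSub_of_reach hr']
    refine (RTree.sub_parent _ _).2 ⟨fun h1 => ?_, hp⟩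
    have h2 : R.box (R.src g.1) = R.box (R.src e) := h1
    rw [h2, h.parent hR] at hp
    rw [← Option.some.inj hp] at hr
    exact RTree.not_reach_of_child (h.parent hR) hr
  door w x hx hne := by
    have hw : R.tree.Reach (R.box w.1) (R.box (R.src e)) := by
      refine RTree.reach_of_toSub_ne fun hw => hne ?_
      have : (R.tree.sub _).Reach (R.tree.toSub _ (R.box w.1)) x := hx
      rw [hw] at this
      exact RTree.reach_root_iff.1 this
    have hx' : R.tree.Reach (R.box w.1) x.1 := by
      have : (R.tree.sub _).Reach (R.tree.toSub _ (R.box w.1)) x := hx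
      rw [RTree.toSub_of_reach hw] at this
      exact (RTree.sub_reach _ _).1 this
    obtain ⟨g, v, h1, h2, h3⟩ := hR.door w.1 x.1 hx' fun h4 =>
      RTree.not_reach_of_child (h.parent hR) (h4 ▸ x.2)
    have hv : v ≠ R.src o := by
      rintro rfl
      obtain rfl := (h.input_iff hR g).1 h1
      exact hne (Subtype.ext h3.symm)
    refine ⟨⟨g, h.src_ne h1⟩, ⟨v, hv⟩, (Net.restrict_tgt _ _).2 h1, h2, ?_⟩
    change R.tree.toSub _ (R.box (R.src g)) = x
    exact (RTree.toSub_of_reach (h3 ▸ x.2)).trans (Subtype.ext h3)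
  daimon v hv := by
    have hr := h.above v.1 (hR.daimon v.1 hv)
    change R.tree.toSub _ (R.box v.1) ≠ _
    rw [RTree.toSub_of_reach hr]
    exact fun h1 => hd v.1 hv (congrArg Subtype.val h1)

theorem type_unbox (h : R.Boxed C o e) (hR : R.Inv) :
    (h.unbox hR).toNet.type = C.map R.ty ++ [R.ty e] := by
  let R' := h.unbox hR
  have h1 : R'.concl.map (Subtype.val : R'.E → R.E) = C ++ [e] := Net.restrict_concl
  have h2 : R'.toNet.type = (R'.concl.map (Subtype.val : R'.E → R.E)).map R.ty :=
    (List.map_map (f := (Subtype.val : R'.E → R.E)) (g := R.ty)).symm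
  exact h2.trans ((congrArg (List.map R.ty) h1).trans List.map_append)

theorem form_unbox (h : R.Boxed C o e) (hR : R.Inv) {N : Net}
    (hN : DaimonForm (C.map R.flag ++ [(R.ty e, False)]) N) :
    DaimonForm ((h.unbox hR).concl.map (h.unbox hR).flag) N := by
  let R' := h.unbox hR
  let u : R'.E → R.E := Subtype.val
  have h1 : R'.concl.map u = C ++ [e] := Net.restrict_concl
  let g : R.E → Formula × Prop := fun f => (R.ty f, f ∈ C ∧ (R.flag f).2)
  have h2 : DaimonForm ((C ++ [e]).map g) N := by
    refine hN.mono ?_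
    rw [List.map_append]
    refine List.rel_append ?_ (.cons ⟨rfl, False.elim⟩ .nil)
    rw [List.forall₂_map_left_iff, List.forall₂_map_right_iff, List.forall₂_same]
    exact fun e he => ⟨rfl, fun h => ⟨he, h⟩⟩
  rw [← h1, List.map_map] at h2
  refine h2.mono ?_
  rw [List.forall₂_map_left_iff, List.forall₂_map_right_iff, List.forall₂_same]
  intro e _
  refine ⟨rfl, fun ⟨_, h3, f, hf⟩ => ⟨h3, ⟨f, h.src_ne hf⟩, ?_⟩⟩
  exact (Net.restrict_tgt _ _).2 hf

end BoxNet.Boxed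

/-- The part of a thick subtree above a node. -/
noncomputable def Thick.sub {T : RTree} (t : Thick T) {b : T.Node} (x : t.tree.Node)
    (hx : t.h x = b) : Thick (T.sub b) where
  tree := t.tree.sub x
  h y := ⟨t.h y.1, hx ▸ t.reach_h y.2⟩
  h_root := Subtype.ext hx
  h_parent y z hyz := by
    obtain ⟨h1, h2⟩ := (RTree.sub_parent _ _).1 hyz
    refine (RTree.sub_parent _ _).2 ⟨fun h3 => h1 ?_, t.h_parent _ _ h2⟩
    exact t.reach_unique (t.tree.reach_refl _) y.2 (Eq.trans h3 hx.symm)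

namespace BoxNet.Boxed

variable {R : BoxNet} {C : List R.E} {o e : R.E} {N : Net}

theorem root_cases_exp (h : R.Boxed C o e) (hR : R.Inv) (E : Exp N R) {D : List N.E} {o' : N.E}
    (hc : N.concl = D ++ [o']) (ho : E.q o' = o) {v : N.V} (hv : R.box (E.p v) = R.tree.root)
    (hne : E.p v ≠ R.src o) : ∃ c ∈ D, N.src c = v := by
  obtain ⟨c, hcC, hcv⟩ := h.root_cases hR hv hne
  have h1 : c ∈ N.concl.map E.q := by
    rw [E.concl_q, h.concl]; exact List.mem_append_left _ hcC
  obtain ⟨d, hd, rfl⟩ := List.mem_map.1 h1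
  have h2 : N.src d = v := by
    rw [E.src_q] at hcv
    exact E.inj_root hcv (hcv ▸ hv)
  rw [hc, List.mem_append, List.mem_singleton] at hd
  rcases hd with hd | rfl
  · exact ⟨d, hd, h2⟩
  · rw [ho] at hcv
    exact absurd hcv.symm hne

theorem b_root_of_mem (E : Exp N R) (hN : N.WF) {D : List N.E} {o' : N.E}
    (hc : N.concl = D ++ [o']) {c : N.E} (hcD : c ∈ D) : E.b (N.src c) = E.t.tree.root :=
  E.root_of_mem ((hN.mem_concl c).1 (hc ▸ List.mem_append_left _ hcD))

theorem p_ne (h : R.Boxed C o e) (E : Exp N R) {D : List N.E} (hD : D.map E.q = C)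
    {x : E.t.tree.Node} (hx : E.t.h x = R.box (R.src e)) (hb : ¬ R.tree.Reach R.tree.root
      (R.box (R.src e))) {v : N.V}
    (hv : E.t.tree.Reach (E.b v) x ∨ ∃ c ∈ D, N.src c = v) : E.p v ≠ R.src o := by
  rcases hv with hv | ⟨c, hc, rfl⟩
  · intro h1
    have h2 := E.t.reach_h hv
    rw [← E.box_p, h1, hx, R.box_tail o h.tgt_last] at h2
    exact hb h2
  · rw [← E.src_q]
    exact h.src_concl_ne (hD ▸ List.mem_map_of_mem hc)

/-- Each copy of the content of the box is an expansion of this content. -/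
noncomputable def expUnbox (h : R.Boxed C o e) (hR : R.Inv) (hN : N.WF) (E : Exp N R)
    {D : List N.E} {o' : N.E} (hc : N.concl = D ++ [o']) (hD : D.map E.q = C) (ho : E.q o' = o)
    (x : E.t.tree.Node) (hx : E.t.h x = R.box (R.src e)) {f : N.E} (hf : E.q f = e)
    (hs : ∀ g ∈ D ++ [f], N.src g ∈ {v | E.t.tree.Reach (E.b v) x ∨ ∃ c ∈ D, N.src c = v}) :
    Exp (N.restrict {v | E.t.tree.Reach (E.b v) x ∨ ∃ c ∈ D, N.src c = v} (D ++ [f]) hs)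
      (h.unbox hR) where
  t := E.t.sub x hx
  p v := ⟨E.p v.1, h.p_ne E hD hx (RTree.not_reach_of_child (h.parent hR)) v.2⟩
  b v := E.t.tree.toSub x (E.b v.1)
  q g := ⟨E.q g.1, by
    rw [E.src_q]
    exact h.p_ne E hD hx (RTree.not_reach_of_child (h.parent hR)) g.2⟩
  box_p v := by
    change R.tree.toSub _ (R.box (E.p v.1)) = (E.t.sub x hx).h (E.t.tree.toSub x (E.b v.1))
    rcases v.2 with hv | ⟨c, hcD, hcv⟩
    · rw [RTree.toSub_of_reach hv, E.box_p]
      exact RTree.toSub_of_reach (hx ▸ E.t.reach_h hv)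
    · have h1 : E.b v.1 = E.t.tree.root := hcv ▸ b_root_of_mem E hN hc hcD
      have h2 : ¬ R.tree.Reach (R.box (E.p v.1)) (R.box (R.src e)) := by
        rw [E.box_p, h1, E.t.h_root]; exact RTree.not_reach_of_child (h.parent hR)
      have h3 : ¬ E.t.tree.Reach (E.b v.1) x := fun h3 => h2 (by
        rw [E.box_p, ← hx]; exact E.t.reach_h h3)
      rw [RTree.toSub_of_not_reach h2, RTree.toSub_of_not_reach h3]
      exact (E.t.sub x hx).h_root.symm
  inj v w h1 h2 := by
    have h1 : E.p v.1 = E.p w.1 := congrArg Subtype.val h1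
    have h2 : E.t.tree.toSub x (E.b v.1) = E.t.tree.toSub x (E.b w.1) := h2
    refine Subtype.ext ?_
    by_cases hr : R.box (E.p v.1) = R.tree.root
    · exact E.inj_root h1 hr
    · have key : ∀ u : {v | E.t.tree.Reach (E.b v) x ∨ ∃ c ∈ D, N.src c = v},
          R.box (E.p u.1) ≠ R.tree.root → E.t.tree.Reach (E.b u.1) x := by
        rintro ⟨u, hu | ⟨c, hcD, rfl⟩⟩ hu'
        · exact hu
        · exact absurd ((E.root_iff _).2 (b_root_of_mem E hN hc hcD)) hu'
      rw [RTree.toSub_of_reach (key v hr), RTree.toSub_of_reach (key w (h1 ▸ hr))] at h2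
      exact E.inj _ _ h1 (congrArg Subtype.val h2)
  surj := by
    rintro ⟨v, hv⟩ y hy
    have hy : R.tree.toSub (R.box (R.src e)) (R.box v) = (E.t.sub x hx).h y := hy
    by_cases hr : R.box v = R.tree.root
    · obtain ⟨w, rfl, hw⟩ := E.surj_root hr
      have hw1 : ¬ E.t.tree.Reach (E.b w) x := fun h3 => by
        have h4 := E.t.reach_h h3
        rw [← E.box_p, hx, hr] at h4
        exact RTree.not_reach_of_child (h.parent hR) h4
      refine ⟨⟨w, Or.inr (h.root_cases_exp hR E hc ho hr hv)⟩, rfl, ?_⟩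
      rw [hr, RTree.toSub_of_not_reach (RTree.not_reach_of_child (h.parent hR))] at hy
      exact (RTree.toSub_of_not_reach hw1).trans ((E.t.sub x hx).h_eq_root.1 hy.symm).symm
    · rw [RTree.toSub_of_reach (h.above v hr)] at hy
      obtain ⟨w, rfl, hw⟩ := E.surj v y.1 (congrArg Subtype.val hy)
      have hwx : E.t.tree.Reach (E.b w) x := hw ▸ y.2
      exact ⟨⟨w, Or.inl hwx⟩, rfl, (RTree.toSub_of_reach hwx).trans (Subtype.ext hw)⟩
  src_q g := Subtype.ext (E.src_q g.1)
  injE g k h1 h2 := Subtype.ext (E.injE _ _ (congrArg Subtype.val h1) (congrArg Subtype.val h2))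
  surjE := by
    rintro ⟨g, hg⟩ w hw
    obtain ⟨f, rfl, hf⟩ := E.surjE g w.1 (congrArg Subtype.val hw)
    exact ⟨⟨f, hf.symm ▸ w.2⟩, rfl, Subtype.ext hf⟩
  tgt_q g v hv := by
    obtain ⟨h1, h2⟩ := E.tgt_q g.1 v.1 ((Net.restrict_tgt _ _).1 hv)
    exact ⟨(Net.restrict_tgt _ _).2 h1, h2.toSub⟩
  tgt_some g u hu := by
    have hu' := (Net.restrict_tgt _ _).1 hu
    obtain ⟨v, hv⟩ := E.tgt_some g.1 _ hu'
    obtain ⟨h1, h2⟩ := E.tgt_q _ _ hv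
    have h3 : u.1 = E.p v := Option.some.inj (hu'.symm.trans h1)
    suffices hvK : E.t.tree.Reach (E.b v) x ∨ ∃ c ∈ D, N.src c = v from
      ⟨⟨v, hvK⟩, (Net.restrict_tgt _ _).2 hv⟩
    by_cases hr : R.box (E.p v) = R.tree.root
    · exact Or.inr (h.root_cases_exp hR E hc ho hr (h3 ▸ u.2))
    · have h4 : E.t.tree.Reach (E.b (N.src g.1)) x := by
        rcases g.2 with h4 | ⟨c, hcD, hcg⟩
        · exact h4
        · have h5 : E.b (N.src g.1) = E.t.tree.root := hcg ▸ b_root_of_mem E hN hc hcD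
          rw [h5] at h2
          exact absurd ((E.root_iff v).2 (RTree.reach_root_iff.1 h2)) hr
      refine Or.inl (h4.of_child ?_ h2 fun h5 => hr ((E.root_iff v).2 h5))
      refine E.t.parent_of_h (E.t.tree.reach_root x) ?_
      rw [hx, h.parent hR, E.t.h_root]
  label_p v := E.label_p v.1
  ty_q g := E.ty_q g.1
  left_q g v hv := E.left_q g.1 v.1 ((Net.restrict_tgt _ _).1 hv)
  concl_q := by
    refine List.map_injective_iff.2 Subtype.val_injective ?_
    refine Eq.trans ?_ (Net.restrict_concl (N := R.toNet)
      (hc := (h.restrictable hR).src_mem)).symm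
    have hcN : (D ++ [f]).map E.q = C ++ [e] := by rw [List.map_append, hD, List.map_singleton, hf]
    refine (List.map_map ..).trans (Eq.trans ?_ hcN)
    refine (List.map_map (f := Subtype.val) (g := E.q)).symm.trans ?_
    exact congrArg _ Net.restrict_concl

end BoxNet.Boxed

/-! ### Opening the box -/

namespace BoxNet.Boxed

variable {R : BoxNet} {C : List R.E} {o e : R.E} {N : Net}

theorem root_of_no_copy (h : R.Boxed C o e) (E : Exp N R)
    (hx : ∀ x, E.t.h x ≠ R.box (R.src e)) (v : N.V) : R.box (E.p v) = R.tree.root := by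
  by_contra hr
  have h1 := h.above _ hr
  rw [E.box_p] at h1
  obtain ⟨y, _, hy⟩ := E.t.exists_reach _ h1
  exact hx y hy

/-- An expansion without copies of the box. -/
theorem isEmptyBox (h : R.Boxed C o e) (hR : R.Inv) (E : Exp N R)
    (hx : ∀ x, E.t.h x ≠ R.box (R.src e)) : N.IsEmptyBox := by
  have hroot := h.root_of_no_copy E hx
  refine ⟨fun v => ?_, fun g => ?_⟩
  · rw [E.label_p]
    by_cases hv : E.p v = R.src o
    · exact Or.inr (hv ▸ h.bang)
    · obtain ⟨c, hc, hcv⟩ := h.root_cases hR (hroot v) hv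
      exact Or.inl (hcv ▸ h.wn c hc)
  · rw [E.tgt_none]
    exact h.saturated _ (by rw [E.src_q]; exact hroot _)

theorem exists_type (h : R.Boxed C o e) : ∃ D A, C.map R.ty = List.map .wn D ∧ R.ty o = .bang A ∧
    R.ty e = A := by
  obtain ⟨o', A, h1, h2, h3⟩ := (R.wf.cell_ok _).bang h.bang
  obtain rfl := (h1 o).1 rfl
  have : C.map R.ty ∈ Set.range (List.map Formula.wn) := by
    rw [Set.range_list_map]
    intro B hB
    obtain ⟨c, hc, rfl⟩ := List.mem_map.1 hB
    obtain ⟨o', A, h1, h2, _⟩ := (R.wf.cell_ok _).wn (h.wn c hc)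
    exact ⟨A, by rw [(h1 c).1 rfl, h2]⟩
  obtain ⟨D, hD⟩ := this
  exact ⟨D, A, hD.symm, h2, h3 e h.input⟩

/-- When all copies are erased, only the border is left and the step replaces it by a daimon. All
the outputs of this daimon are conclusions, so it meets any requirement on flags. -/
theorem exists_empty (h : R.Boxed C o e) (hR : R.Inv) (E : Exp N R)
    (hx : ∀ x, E.t.h x ≠ R.box (R.src e)) (D : List Formula) (A : Formula) :
    ∃ N', LocalAct (.box D A) N {[N']} ∧
      DaimonForm (C.map R.flag ++ [(R.ty e, False)]) N' := by
  let l : List DaimonOut := (C ++ [e]).map fun c => ⟨R.ty c, false⟩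
  have h1 : DaimonForm ((C ++ [e]).map fun c => (R.ty c, False)) (daimonNet l) := by
    refine DaimonForm.of_list l ?_
    rw [List.forall₂_map_left_iff, List.forall₂_map_right_iff, List.forall₂_same]
    exact fun c _ => ⟨rfl, fun h => by cases h⟩
  refine ⟨daimonNet l, .boxEmpty (h.isEmptyBox hR E hx) (h1.isHypothesis fun y hy => ?_),
    h1.mono ?_⟩
  · obtain ⟨c, _, rfl⟩ := List.mem_map.1 hy
    exact id
  · rw [List.map_append]
    refine List.rel_append ?_ (.cons ⟨rfl, id⟩ .nil)
    rw [List.forall₂_map_left_iff, List.forall₂_map_right_iff, List.forall₂_same]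
    exact fun c _ => ⟨rfl, False.elim⟩

/-- By saturation every cell of the root has a conclusion among its outputs, so the condition
`Net.Inner` of the `box` step selects exactly the copies of the content. -/
theorem inner_iff (h : R.Boxed C o e) (hR : R.Inv) (E : Exp N R) (hN : N.WF) (v : N.V) :
    N.Inner v ↔ E.b v ≠ E.t.tree.root := by
  rw [Ne, ← E.root_iff]
  constructor
  · intro hv hr
    obtain ⟨c, hc, hcv⟩ := h.saturated.exists_concl hR hr
    rw [← E.concl_q] at hc
    obtain ⟨d, hd, rfl⟩ := List.mem_map.1 hc
    rw [E.src_q] at hcv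
    exact hv d hd (E.inj_root hcv (hcv ▸ hr))
  · rintro hr c hc rfl
    exact hr ((E.root_iff _).2 (E.root_of_mem ((hN.mem_concl c).1 hc)))

/-- An expansion with copies of the box. -/
theorem exists_copies (h : R.Boxed C o e) (hR : R.Inv) (E : Exp N R) (hN : N.WF)
    (hx : ∃ x, E.t.h x = R.box (R.src e)) (D : List Formula) (A : Formula) :
    ∃ T, LocalAct (.box D A) N T ∧ ∀ c ∈ T, ∃ N', c = [N'] ∧
      (N.DaimonFree → N'.DaimonFree) ∧ Nonempty (Exp N' (h.unbox hR)) := by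
  classical
  -- The copies of the box are the nodes of the thick subtree over it; they number the results of
  -- the step.
  let X := {x // E.t.h x = R.box (R.src e)}
  have hX : Finite X := by have := E.t.tree.finite; exact inferInstanceAs (Finite {x // _})
  obtain ⟨x₀, hx₀⟩ := hx
  obtain ⟨n, ⟨ψ⟩⟩ := Finite.exists_equiv_fin X
  have hn : 0 < n := Fin.pos (ψ ⟨x₀, hx₀⟩)
  obtain ⟨P, P', hPP, hP, hP'⟩ := List.map_eq_append_iff.1 (E.concl_q.trans h.concl)
  obtain ⟨o', P'', rfl, ho', hP''⟩ := List.map_eq_cons_iff.1 hP'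
  obtain rfl := List.map_eq_nil_iff.1 hP''
  have hlabel : ∀ c ∈ P, N.label (N.src c) = .wn := fun c hc => by
    rw [E.label_p, ← E.src_q]; exact h.wn _ (hP ▸ List.mem_map_of_mem hc)
  have hf : ∀ j : Fin n, ∃ g, E.q g = e ∧ E.b (N.src g) = (ψ.symm j).1 := fun j => by
    obtain ⟨w, hw, hwb⟩ := E.surj (R.src e) (ψ.symm j).1 (ψ.symm j).2.symm
    obtain ⟨g, hg, rfl⟩ := E.surjE e w hw.symm
    exact ⟨g, hg, hwb⟩
  choose f hfe hfb using hf
  -- `k v` is the copy that contains `v`. The value on cells in no copy is arbitrary, and exists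
  -- because there is at least one copy.
  let k : N.V → Fin n := fun v =>
    if hv : ∃ x : X, E.t.tree.Reach (E.b v) x.1 then ψ hv.choose else ⟨0, hn⟩
  have hk : ∀ v (x : X), E.t.tree.Reach (E.b v) x.1 → k v = ψ x := fun v x hvx => by
    have hv : ∃ x : X, E.t.tree.Reach (E.b v) x.1 := ⟨x, hvx⟩
    have h1 : k v = ψ hv.choose := dif_pos hv
    rw [h1]
    refine congrArg ψ (Subtype.ext (E.t.reach_unique hv.choose_spec hvx ?_))
    rw [hv.choose.2, x.2]
  have hex : ∀ v, N.Inner v → ∃ x : X, E.t.tree.Reach (E.b v) x.1 := fun v hv => by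
    have hr : R.box (E.p v) ≠ R.tree.root := fun hr =>
      (h.inner_iff hR E hN v).1 hv ((E.root_iff v).1 hr)
    have h1 := h.above _ hr
    rw [E.box_p] at h1
    obtain ⟨y, hy, hyx⟩ := E.t.exists_reach _ h1
    exact ⟨⟨y, hyx⟩, hy⟩
  have hinner : ∀ v (x : X), E.t.tree.Reach (E.b v) x.1 → N.Inner v := fun v x hvx => by
    rw [h.inner_iff hR E hN]
    intro hr
    rw [hr] at hvx
    have h1 := x.2
    rw [RTree.reach_root_iff.1 hvx, E.t.h_root] at h1
    exact RTree.not_reach_of_child (h.parent hR) (h1 ▸ R.tree.reach_refl _)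
  let K : Fin n → Set N.V := fun j =>
    {v | E.t.tree.Reach (E.b v) (ψ.symm j).1 ∨ ∃ c ∈ P, N.src c = v}
  have hK : ∀ j, {v | N.Inner v ∧ k v = j} ∪ {v | ∃ c ∈ P, N.src c = v} = K j := fun j => by
    ext v
    refine or_congr_left ⟨fun ⟨h1, h2⟩ => ?_, fun h1 => ⟨hinner v _ h1, ?_⟩⟩
    · obtain ⟨x, hvx⟩ := hex v h1
      rw [← h2, hk v x hvx, ψ.symm_apply_apply]; exact hvx
    · rw [hk v _ h1, ψ.apply_symm_apply]
  have hKE : ∀ j, {g | N.Inner (N.src g) ∧ k (N.src g) = j} ∪ {g | g ∈ P} =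
      {g | N.src g ∈ K j} := fun j => by
    ext g
    rw [Set.mem_ofPred_eq, ← hK j]
    refine or_congr_right ⟨fun hg => ⟨g, hg, rfl⟩, fun ⟨c, hc, hcg⟩ => ?_⟩
    rwa [(hN.isOut_wn (hlabel c hc) g).1 hcg.symm]
  have hs : ∀ j, ∀ g ∈ P ++ [f j], N.src g ∈ K j := fun j g hg => by
    rcases List.mem_append.1 hg with hg | hg
    · exact Or.inr ⟨g, hg, rfl⟩
    · rw [List.mem_singleton.1 hg]
      refine Or.inl ?_
      rw [hfb]; exact E.t.tree.reach_refl _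
  have hpo : E.p (N.src o') = R.src o := by rw [← E.src_q, ho']
  refine ⟨_, .box hn (fun j => N.restrict (K j) (P ++ [f j]) (hs j)) P o' f k hPP
    (by rw [E.label_p, hpo, h.bang]) hlabel (fun g => ⟨fun hg => ?_, ?_⟩) (fun j => ?_)
    (fun g v hg hv => ?_) (fun j => ?_), ?_⟩
  · have h1 := (E.tgt_q g _ hg).1
    rw [hpo] at h1
    have h2 := (h.input_iff hR _).1 h1
    have h3 : E.t.h (E.b (N.src g)) = R.box (R.src e) := by rw [← E.box_p, ← E.src_q, h2]
    refine ⟨ψ ⟨_, h3⟩, E.injE _ _ (h2.trans (hfe _).symm) (E.inj _ _ ?_ ?_)⟩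
    · rw [← E.src_q, ← E.src_q, h2, hfe]
    · rw [hfb, ψ.symm_apply_apply]
  · rintro ⟨j, rfl⟩
    obtain ⟨v, hv⟩ := E.tgt_some (f j) _ (by rw [hfe]; exact h.input)
    have h1 := (E.tgt_q _ v hv).1
    rw [hfe, h.input] at h1
    rw [hv]
    refine congrArg some (E.inj_root ((Option.some.inj h1).symm.trans hpo.symm) ?_)
    rw [← Option.some.inj h1, R.box_tail o h.tgt_last]
  · rw [hk _ (ψ.symm j) (by rw [hfb]; exact E.t.tree.reach_refl _), ψ.apply_symm_apply]
  · obtain ⟨x, hvx⟩ := hex v hv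
    rw [hk v x hvx, hk _ x ((E.tgt_q g v hg).2.trans hvx)]
  · rw [hK, hKE]
    exact N.sub_restrict
  · rintro _ ⟨j, rfl⟩
    exact ⟨_, rfl, N.sub_restrict.daimonFree,
      ⟨h.expUnbox hR hN E hPP hP ho' _ (ψ.symm j).2 (hfe j) (hs j)⟩⟩

theorem isGood (h : R.Boxed C o e) (hR : R.Inv)
    (ih : ∀ R' : BoxNet, R'.Inv → R'.size < R.size → R'.IsGood) : R.IsGood := by
  obtain ⟨D, A, hC, ho, rfl⟩ := h.exists_type
  have hty : R.toNet.type = D.map .wn ++ [.bang (R.ty e)] := by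
    rw [Net.type, h.concl, List.map_append, hC, List.map_singleton, ho]
  have hform : ∀ N, DaimonForm (R.concl.map R.flag) N → ∃ N', LocalAct (.box D (R.ty e)) N {[N']} ∧
      DaimonForm (C.map R.flag ++ [(R.ty e, False)]) N' := fun N hN => by
    rw [h.concl, List.map_append, List.map_singleton, flag, ho] at hN
    exact hN.box D
  have hform_ty : ∀ N, DaimonForm (C.map R.flag ++ [(R.ty e, False)]) N →
      N.type = D.map .wn ++ [R.ty e] := fun N hN => by
    rw [hN.type, List.map_append, List.map_map, ← hC]; rfl
  unfold IsGood
  rw [hty]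
  -- With a daimon directly in the box, each copy of the box would contain a copy of the daimon. So
  -- a daimon-free member has no copy, all members are filled by a daimon after the step, and the
  -- content of the box need not be followed any further.
  by_cases hd : ∃ v, R.label v = .daimon ∧ R.box v = R.box (R.src e)
  · obtain ⟨v, hv, hvb⟩ := hd
    have hg := goodForm (C.map R.flag ++ [(R.ty e, False)]) [] (by simp) (by simp)
    have hm : (C.map R.flag ++ [(R.ty e, False)]).map Prod.fst = D.map .wn ++ [R.ty e] := by
      rw [List.map_append, List.map_map, ← hC]; rfl
    rw [List.append_nil, GoodForm, hm] at hg
    refine hg.step₁ (.box D (R.ty e)) ?_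
    rintro N hN - (⟨hdf, ⟨E⟩⟩ | hA)
    · have hx : ∀ x, E.t.h x ≠ R.box (R.src e) := fun x hx => by
        obtain ⟨w, hw, _⟩ := E.surj v x (by rw [hvb, hx])
        exact hdf w (by rw [E.label_p, hw, hv])
      obtain ⟨N', h1, h2⟩ := h.exists_empty hR E hx D (R.ty e)
      exact ⟨N', h1, h2.wf, hform_ty N' h2, h2⟩
    · obtain ⟨N', h1, h2⟩ := hform N hA
      exact ⟨N', h1, h2.wf, hform_ty N' h2, h2⟩
  · have hg := ih _ (h.inv_unbox hR fun v h1 h2 => hd ⟨v, h1, h2⟩) (h.size_unbox hR)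
    unfold IsGood at hg
    rw [h.type_unbox hR, hC] at hg
    -- Three sorts of members are opened together: those with copies of the box give several
    -- expansions of its content, those without copies give a daimon, and a daimon stays one.
    refine hg.step_set (.box D (R.ty e)) ?_
    rintro N hN - (⟨hdf, ⟨E⟩⟩ | hA)
    · by_cases hx : ∃ x, E.t.h x = R.box (R.src e)
      · obtain ⟨T, h1, h2⟩ := h.exists_copies hR E hN hx D (R.ty e)
        refine ⟨T, h1, fun c hc => ?_⟩
        obtain ⟨N', rfl, h3, ⟨E'⟩⟩ := h2 c hc
        refine ⟨N', rfl, E'.wf ?_, ?_, Or.inl ⟨h3 hdf, ⟨E'⟩⟩⟩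
        · exact (h.inv_unbox hR fun v h1 h2 => hd ⟨v, h1, h2⟩).exists_root
        · rw [E'.type_eq, h.type_unbox hR, hC]
      · obtain ⟨N', h1, h2⟩ := h.exists_empty hR E (fun x hx' => hx ⟨x, hx'⟩) D (R.ty e)
        refine ⟨_, h1, fun c hc => ⟨N', hc, h2.wf, hform_ty N' h2, Or.inr (h.form_unbox hR h2)⟩⟩
    · obtain ⟨N', h1, h2⟩ := hform N hA
      refine ⟨_, h1, fun c hc => ⟨N', hc, h2.wf, hform_ty N' h2, Or.inr (h.form_unbox hR h2)⟩⟩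

end BoxNet.Boxed

/-! ### The induction on the size, and the conclusion -/

theorem BoxNet.Inv.isGood {R : BoxNet} (hR : R.Inv) : R.IsGood := by
  induction hn : R.size using Nat.strong_induction_on generalizing R with
  | _ n ih =>
    subst hn
    have ih' : ∀ R' : BoxNet, R'.Inv → R'.size < R.size → R'.IsGood := fun R' h1 h2 =>
      ih _ h2 h1 rfl
    -- A box is opened only when nothing is left to do at the root around it; otherwise the
    -- induction hypothesis is reached by removing, contracting or splitting at the root.
    by_cases hs : R.Saturated
    · exact hs.isGood hR ih' fun c hp C o e h => h.isGood (hR.reconcl c hp) ih'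
    · exact BoxNet.isGood_of_not_saturated hR ih' hs

theorem glueable_of_subset_taylor {P : Set Poly} (hne : P.Nonempty)
    (hP : ∀ r ∈ P, IsDiLLProofStructure r) {R : List BoxNet} (hR : IsMELLProofStructure R)
    (h : P ⊆ Taylor R) : Glueable P := by
  obtain ⟨hlen, hmell⟩ := hR
  match R with
  | [] =>
    have h1 : ∀ r ∈ P, r = [] := fun r hr => List.forall₂_nil_right_iff.1 (h hr)
    obtain ⟨r₀, hr₀⟩ := hne
    refine ⟨[], .nil, fun r hr => ?_, ?_⟩
    · rw [h1 r hr]; exact ⟨by simp, rfl⟩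
    · ext r
      exact ⟨fun hr => (hr.trans (h1 r₀ hr₀).symm : r = r₀) ▸ hr₀, h1 r⟩
  | [R₀] =>
    have hR₀ := BoxNet.Inv.of_isMELL (hmell R₀ (by simp))
    refine hR₀.isGood.glueable hne fun r hr => ?_
    obtain ⟨N, l, ⟨t, ht⟩, hl, rfl⟩ := List.forall₂_cons_right_iff.1 (h hr)
    obtain rfl := List.forall₂_nil_right_iff.1 hl
    obtain ⟨E⟩ := Exp.iff_iso.2 ⟨t, ht⟩
    obtain ⟨hwf, hdf⟩ := (hP _ hr).2 N (by simp)
    exact ⟨N, rfl, hwf, E.type_eq, Or.inl ⟨hdf, ⟨E⟩⟩⟩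
  | _ :: _ :: _ => simp at hlen

end Glue

theorem mainTheorem3 (P : Set Glue.Poly) (hne : P.Nonempty)
    (hP : ∀ r ∈ P, Glue.IsDiLLProofStructure r) :
    Glue.Glueable P ↔ ∃ R : List Glue.BoxNet, Glue.IsMELLProofStructure R ∧ P ⊆ Glue.Taylor R :=
  ⟨Glue.Glueable.exists_taylor hne hP,
    fun ⟨_, hR, h⟩ => Glue.glueable_of_subset_taylor hne hP hR h⟩
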